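/- Let $\Omega\subseteq\mathbb R^n$ be open with $0\in\Omega$, and let $f\in C^4(\Omega;\mathbb R^n)$ be such that $\partial_t u+\partial_x f(u)=0$ is strictly hyperbolic, with eigenvalues $\lambda_1(u)<\dots<\lambda_n(u)$ of $Df(u)$, each characteristic field being either genuinely nonlinear or linearly degenerate. Let $r_1,\dots,r_n$ be right eigenvectors of $Df$, continuous near $0$, normalized by $D\lambda_j\cdot r_j\equiv k_j$ (with arbitrary fixed $k_j>0$) in the genuinely nonlinear fields and by $|r_j|\equiv 1$ in the linearly degenerate ones, and let $l_1,\dots,l_n$ be the dual left eigenvectors, $l_i\cdot r_j=\delta_{ij}$. Let $\psi_j(\sigma)(u)$ be the $j$-th Lax curve exiting $u$: the integral curve of $r_j$ for $\sigma\ge0$, or if the $j$-th field is linearly degenerate; and for $\sigma<0$ in a genuinely nonlinear field the $j$-th shock curve, parametrized by $\lambda_j(\psi_j(\sigma)(u))=\lambda_j(u)+k_j\sigma$. For $u^-,u^+$ near $0$ let $E(u^-,u^+)=(\sigma_1,\dots,\sigma_n)$ be the small wave strengths with $u^+=\psi_n(\sigma_n)\circ\dots\circ\psi_1(\sigma_1)(u^-)$;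 precisely, for $\varepsilon>0$, $E(u^-,u^+)$ is defined when such $\sigma$ with all $|\sigma_i|<\varepsilon$ exists, and is this $\sigma$ (which is unique for $\varepsilon$ small and $u^-$ near $0$). For $v\in L^1(\mathbb R;\Omega)$ right continuous and piecewise constant with finite jump set $\mathcal I(v)$, all of whose jumps lie in the domain of $E$, set $(\sigma_{x,1},\dots,\sigma_{x,n})=E(v(x-),v(x+))$, and let $\mathcal A(v)$ be the set of pairs $((x,i),(y,j))\in(\mathcal I(v)\times\{1,\dots,n\})^2$ with $x<y$ and either $i>j$, or $i=j$, the $i$-th field genuinely nonlinear and $\min\{\sigma_{x,i},\sigma_{y,j}\}<0$. Let $$\mathbf V(v)=\sum_{x\in\mathcal I(v)}\sum_{i=1}^n|\sigma_{x,i}|,\qquad \mathbf Q(v)=\sum_{((x,i),(y,j))\in\mathcal A(v)}|\sigma_{x,i}\sigma_{y,j}|,\qquad \mathbf\Upsilon=\mathbf V+C_0\mathbf Q .$$ Let $\mathcal D_\delta^*$ be the set of such $v$ with $\mathbf\Upsilon(v)<\delta$, let $\mathcal D_\delta$ be its closure in $L^1$, and for $u\in\mathcal D_\delta$ put $B_\eta(u)=\{v\in\mathcal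 D_\delta^*:\|v-u\|_{L^1}<\eta\}$ and $$\bar{\mathbf Q}(u)=\lim_{\eta\to0+}\inf_{v\in B_\eta(u)}\mathbf Q(v)=\sup_{\eta>0}\inf_{v\in B_\eta(u)}\mathbf Q(v),\qquad \bar{\mathbf\Upsilon}(u)=\lim_{\eta\to0+}\inf_{v\in B_\eta(u)}\mathbf\Upsilon(v)=\sup_{\eta>0}\inf_{v\in B_\eta(u)}\mathbf\Upsilon(v).$$ For $u\in\mathcal D_\delta$, taken right continuous and of bounded variation, with $\mu_c$ the atomless part of the vector measure $Du$, define the wave measures $$\mu_i(B)=\int_B l_i(u)\,d\mu_c+\sum_{x\in B}E_i(u(x-),u(x+)),\qquad B\subseteq\mathbb R\ \text{Borel},$$ where the sum is over the jump points of $u$ in $B$. Let $\mu_i^\pm$ be the positive and negative parts of $\mu_i$, $|\mu_i|=\mu_i^++\mu_i^-$, and $$\rho=\sum_{1\le j<i\le n}|\mu_i|\otimes|\mu_j|+\sum_{i\ \text{genuinely nonlinear}}\left(\mu_i^-\otimes\mu_i^-+\mu_i^+\otimes\mu_i^-+\mu_i^-\otimes\mu_i^+\right),$$ $$\hat{\mathbf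 Q}(u)=\rho(\{(x,y)\in\mathbb R^2:x<y\}),\qquad \hat{\mathbf\Upsilon}(u)=\sum_{i=1}^n|\mu_i|(\mathbb R)+C_0\,\hat{\mathbf Q}(u).$$ Then for all sufficiently small $\varepsilon>0$, all sufficiently large $C_0$ (larger than a positive constant that depends only on the system, with its normalization, and not on $\varepsilon$), and all sufficiently small $\delta>0$: every $u\in\mathcal D_\delta$ has a right continuous representative of bounded variation, its wave measures are well defined, and $$\bar{\mathbf Q}(u)=\hat{\mathbf Q}(u),\qquad \bar{\mathbf\Upsilon}(u)=\hat{\mathbf\Upsilon}(u)\qquad\text{for all }u\in\mathcal D_\delta .$$ -/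

import Mathlib

open Set Filter Topology MeasureTheory
open scoped ENNReal

noncomputable section

/-- The space of states `ℝⁿ` with its Euclidean norm. -/
abbrev State (n : ℕ) : Type := EuclideanSpace ℝ (Fin n)

/-- The raw data of a system `∂ₜ u + ∂ₓ f(u) = 0` of `n` conservation laws: the set of states `Ω`,
the flux `f`, the numbers `k j` used to parametrize the genuinely nonlinear fields, and a choice
`r j u` of right eigenvectors.  The laws they satisfy are `HypothesisF` and `IsNormalized`. -/
structure ConservationLaw (n : ℕ) where
  Ω : Set (State n)
  f : State n → State n
  k : Fin n → ℝ
  r : Fin n → State n → State n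

namespace ConservationLaw

variable {n : ℕ} (L : ConservationLaw n)

/-- The Jacobian `Df(u)` as an endomorphism of `ℝⁿ`. -/
def jac (u : State n) : Module.End ℝ (State n) := (fderiv ℝ L.f u : State n →ₗ[ℝ] State n)

/-- Strict hyperbolicity at `u`: `Df(u)` has `n` real distinct eigenvalues, here listed in
increasing order. -/
def StrictlyHyperbolicAt (u : State n) : Prop :=
  ∃ lam : Fin n → ℝ, StrictMono lam ∧ ∀ j, (L.jac u).HasEigenvalue (lam j)

open Classical in
/-- The `j`-th characteristic speed `λⱼ(u)`: the `j`-th eigenvalue of `Df(u)` in increasing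
order. -/
def speed (j : Fin n) (u : State n) : ℝ :=
  if h : L.StrictlyHyperbolicAt u then h.choose j else 0

/-- The `j`-th field is genuinely nonlinear: `Dλⱼ(u) · w ≠ 0` for all `j`-eigenvectors `w`. -/
def GenuinelyNonlinear (j : Fin n) : Prop :=
  ∀ u ∈ L.Ω, ∀ w, (L.jac u).HasEigenvector (L.speed j u) w → fderiv ℝ (L.speed j) u w ≠ 0

/-- The `j`-th field is linearly degenerate: `Dλⱼ(u) · w = 0` for all `j`-eigenvectors `w`. -/
def LinearlyDegenerate (j : Fin n) : Prop :=
  ∀ u ∈ L.Ω, ∀ w, (L.jac u).HasEigenvector (L.speed j u) w → fderiv ℝ (L.speed j) u w = 0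

/-- `Ω` is an open neighbourhood of `0`, `f` is `C⁴` on `Ω`, the system is strictly hyperbolic, and
each field is either genuinely nonlinear or linearly degenerate. -/
structure HypothesisF : Prop where
  isOpen : IsOpen L.Ω
  zero_mem : (0 : State n) ∈ L.Ω
  contDiffOn : ContDiffOn ℝ 4 L.f L.Ω
  hyperbolic : ∀ u ∈ L.Ω, L.StrictlyHyperbolicAt u
  fields : ∀ j, L.GenuinelyNonlinear j ∨ L.LinearlyDegenerate j

/-- The normalization of the right eigenvectors `rⱼ`: in a genuinely nonlinear field `Dλⱼ · rⱼ = kⱼ`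
with `kⱼ > 0` (so that `λⱼ` grows at the rate `kⱼ` along the integral curves of `rⱼ`), in a linearly
degenerate one `|rⱼ| = 1` (so that integral curves are parametrized by arc-length); the orientation
is chosen continuously near `0`. -/
structure IsNormalized : Prop where
  k_pos : ∀ j, 0 < L.k j
  eigenvector : ∀ j, ∀ u ∈ L.Ω, (L.jac u).HasEigenvector (L.speed j u) (L.r j u)
  nonlinear : ∀ j, L.GenuinelyNonlinear j → ∀ u ∈ L.Ω, fderiv ℝ (L.speed j) u (L.r j u) = L.k j
  degenerate : ∀ j, L.LinearlyDegenerate j → ∀ u ∈ L.Ω, ‖L.r j u‖ = 1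
  continuous_near_zero : ∀ j, ∀ᶠ u in 𝓝 (0 : State n), ContinuousAt (L.r j) u

/-- The left eigenvectors `lᵢ(u)`, as the dual basis of the `rⱼ(u)`: `lᵢ(u) · rⱼ(u) = δᵢⱼ`.
The coordinates of `lᵢ(u)` are the `i`-th row of the inverse of the matrix with columns `rⱼ(u)`. -/
def l (i : Fin n) (u : State n) : State n →L[ℝ] ℝ :=
  ∑ m, ((Matrix.of fun a j => L.r j u a)⁻¹ : Matrix (Fin n) (Fin n) ℝ) i m •
    (EuclideanSpace.proj m : State n →L[ℝ] ℝ)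

/-- `v = Rⱼ(σ)(u)`: the integral curve of `rⱼ` through `u` (in `Ω`) reaches `v` at parameter `σ`. -/
def Rarefaction (j : Fin n) (σ : ℝ) (u v : State n) : Prop :=
  ∃ γ : ℝ → State n, γ 0 = u ∧ γ σ = v ∧
    ∀ τ ∈ uIcc 0 σ, γ τ ∈ L.Ω ∧ HasDerivWithinAt γ (L.r j (γ τ)) (uIcc 0 σ) τ

/-- `v = Sⱼ(σ)(u)` for a genuinely nonlinear field: `v` is reached at parameter `σ` along the
`j`-th shock curve exiting `u`, that is, the continuous curve in `Ω` of states joined to `u` by a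
discontinuity satisfying the Rankine-Hugoniot relation, with speed `s` tending to `λⱼ(u)` at `u`,
and parametrized by `λⱼ(Sⱼ(τ)(u)) = λⱼ(u) + kⱼ τ`. -/
def Shock (j : Fin n) (σ : ℝ) (u v : State n) : Prop :=
  ∃ (γ : ℝ → State n) (s : ℝ → ℝ), ContinuousOn γ (uIcc 0 σ) ∧ ContinuousOn s (uIcc 0 σ) ∧
    γ 0 = u ∧ s 0 = L.speed j u ∧ γ σ = v ∧
    ∀ τ ∈ uIcc 0 σ, γ τ ∈ L.Ω ∧ L.f (γ τ) - L.f u = s τ • (γ τ - u) ∧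
      L.speed j (γ τ) = L.speed j u + L.k j * τ

/-- `v = ψⱼ(σ)(u)`, the `j`-th Lax curve: the rarefaction curve for `σ ≥ 0`, the shock curve for
`σ < 0`.  In a linearly degenerate field the two curves coincide and are the integral curve of `rⱼ`,
with arc-length as parameter. -/
def LaxCurve (j : Fin n) (σ : ℝ) (u v : State n) : Prop :=
  (L.GenuinelyNonlinear j ∧ σ < 0 ∧ L.Shock j σ u v) ∨
    (¬ (L.GenuinelyNonlinear j ∧ σ < 0) ∧ L.Rarefaction j σ u v)

/-- `v = Ψ(σ)(u) = ψₙ(σₙ) ∘ ⋯ ∘ ψ₁(σ₁) (u)`; `w` lists the intermediate states. -/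
def WaveFan (σ : Fin n → ℝ) (u v : State n) : Prop :=
  ∃ w : Fin (n + 1) → State n, w 0 = u ∧ w (Fin.last n) = v ∧
    ∀ j : Fin n, L.LaxCurve j (σ j) (w j.castSucc) (w j.succ)

/-- The states `u`, `v` are joined by waves of strengths smaller than `ε`: the domain of `E`. -/
def Solvable (ε : ℝ) (u v : State n) : Prop :=
  ∃ σ : Fin n → ℝ, (∀ i, |σ i| < ε) ∧ L.WaveFan σ u v

open Classical in
/-- The map `E(u, v) = (σ₁, …, σₙ)` of wave strengths in the Riemann problem with data `u`, `v`:
the strengths smaller than `ε` with `v = Ψ(σ)(u)`.  They are unique if `ε` is small and `u` is near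
`0`. -/
def E (ε : ℝ) (u v : State n) : Fin n → ℝ :=
  if h : L.Solvable ε u v then h.choose else 0

end ConservationLaw

/-- The set of jump points of a right continuous function. -/
def jumpSet {n : ℕ} (v : ℝ → State n) : Set ℝ := {x | Function.leftLim v x ≠ v x}

/-- `v` is piecewise constant with finitely many jumps and right continuous: there is a finite set
`J` such that `v x = v y` whenever `]x, y]` contains no point of `J`. -/
def IsPiecewiseConstant {n : ℕ} (v : ℝ → State n) : Prop :=
  ∃ J : Finset ℝ, ∀ x y, x ≤ y → Disjoint (Ioc x y) (J : Set ℝ) → v x = v y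

namespace ConservationLaw

variable {n : ℕ} (L : ConservationLaw n) (ε C₀ δ : ℝ)

/-- `σ_{x,i}`: the strength of the `i`-th wave in the Riemann problem with data `v(x-)`, `v(x+)`,
for right continuous `v`. -/
def strength (v : ℝ → State n) (x : ℝ) (i : Fin n) : ℝ :=
  L.E ε (Function.leftLim v x) (v x) i

/-- The pairs `((x,i),(y,j))` of approaching waves. -/
def approaching (v : ℝ → State n) : Set ((ℝ × Fin n) × (ℝ × Fin n)) :=
  {p | p.1.1 ∈ jumpSet v ∧ p.2.1 ∈ jumpSet v ∧ p.1.1 < p.2.1 ∧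
    (p.2.2 < p.1.2 ∨ (p.1.2 = p.2.2 ∧ L.GenuinelyNonlinear p.1.2 ∧
      min (L.strength ε v p.1.1 p.1.2) (L.strength ε v p.2.1 p.2.2) < 0))}

/-- The linear potential `V` of a piecewise constant function. -/
def V (v : ℝ → State n) : ℝ := ∑ᶠ x ∈ jumpSet v, ∑ i, |L.strength ε v x i|

/-- The interaction potential `Q` of a piecewise constant function. -/
def Q (v : ℝ → State n) : ℝ :=
  ∑ᶠ p ∈ L.approaching ε v, |L.strength ε v p.1.1 p.1.2 * L.strength ε v p.2.1 p.2.2|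

/-- The functional `Υ = V + C₀ Q` of a piecewise constant function. -/
def Upsilon (v : ℝ → State n) : ℝ := L.V ε v + C₀ * L.Q ε v

/-- `D_δ^*`: the (right continuous) piecewise constant functions `v ∈ L¹(ℝ; Ω)` with `Υ(v) < δ`,
where `E(v(x-), v(x+))` has to be defined at every `x`. -/
def DStar : Set (ℝ → State n) :=
  {v | IsPiecewiseConstant v ∧ Integrable v volume ∧ (∀ x, v x ∈ L.Ω) ∧
    (∀ x, L.Solvable ε (Function.leftLim v x) (v x)) ∧ L.Upsilon ε C₀ v < δ}

/-- `D_δ`: the closure of `D_δ^*` in `L¹`. -/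
def D : Set (Lp (State n) 1 (volume : Measure ℝ)) :=
  closure {U | ∃ v ∈ L.DStar ε C₀ δ, U =ᵐ[volume] v}

/-- `B_η(U)`: the elements of `D_δ^*` at `L¹`-distance less than `η` from `U`. -/
def nbhd (η : ℝ) (U : Lp (State n) 1 (volume : Measure ℝ)) : Set (ℝ → State n) :=
  {v | v ∈ L.DStar ε C₀ δ ∧
    eLpNorm (fun x => v x - U x) 1 volume < ENNReal.ofReal η}

/-- The relaxation `lim_{η → 0+} inf_{v ∈ B_η(U)} F(v) = sup_{η > 0} inf_{v ∈ B_η(U)} F(v)` of a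
nonnegative functional `F` on `D_δ^*`, with values in `[0, ∞]`. -/
def relaxation (F : (ℝ → State n) → ℝ) (U : Lp (State n) 1 (volume : Measure ℝ)) : ℝ≥0∞ :=
  ⨆ (η : ℝ) (_ : 0 < η), ⨅ v ∈ L.nbhd ε C₀ δ η U, ENNReal.ofReal (F v)

/-- `Q̄`. -/
def QBar : Lp (State n) 1 (volume : Measure ℝ) → ℝ≥0∞ :=
  L.relaxation ε C₀ δ (L.Q ε)

/-- `Ῡ`. -/
def UpsilonBar : Lp (State n) 1 (volume : Measure ℝ) → ℝ≥0∞ :=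
  L.relaxation ε C₀ δ (L.Upsilon ε C₀)

/-- The continuous (atomless) part `μ_c` of the derivative `μ = Du` of a right continuous function
of bounded variation: the atoms of `Du` are the jump points of `u`. -/
def continuousPart {u : ℝ → State n} (hu : BoundedVariationOn u univ) :
    VectorMeasure ℝ (State n) :=
  hu.vectorMeasure.restrict (jumpSet u)ᶜ

/-- `m 1, …, m n` are the wave measures of the class `U`: for the right continuous representative
`u` of `U`, which is to have bounded variation, and all Borel sets `B`,
`mᵢ(B) = ∫_B lᵢ(u) dμ_c + ∑_{x ∈ B} Eᵢ(u(x-), u(x+))`,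
the sum being over the jump points and the integral and the sum being absolutely convergent. -/
def IsWaveMeasures (U : Lp (State n) 1 (volume : Measure ℝ))
    (m : Fin n → SignedMeasure ℝ) : Prop :=
  ∃ u : ℝ → State n, U =ᵐ[volume] u ∧ (∀ x, ContinuousWithinAt u (Ici x) x) ∧
    ∃ hu : BoundedVariationOn u univ,
      (∀ x ∈ jumpSet u, L.Solvable ε (Function.leftLim u x) (u x)) ∧
      ∀ i, (continuousPart hu).Integrable (fun x => L.l i (u x)) ∧
        Summable (fun x : jumpSet u => L.strength ε u x i) ∧
        ∀ B : Set ℝ, MeasurableSet B →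
          m i B =
            (∫ᵛ x in B, L.l i (u x) ∂[ContinuousLinearMap.id ℝ (State n →L[ℝ] ℝ);
              continuousPart hu]) +
            ∑' x : ↥(B ∩ jumpSet u), L.strength ε u x i

open Classical in
/-- The measure `ρ = ∑_{j < i} |μᵢ| ⊗ |μⱼ| + ∑ᵢ (μᵢ⁻ ⊗ μᵢ⁻ + μᵢ⁺ ⊗ μᵢ⁻ + μᵢ⁻ ⊗ μᵢ⁺)` on `ℝ²`, the
last sum being over the genuinely nonlinear fields. -/
def rho (m : Fin n → SignedMeasure ℝ) : Measure (ℝ × ℝ) :=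
  ∑ p : Fin n × Fin n with p.2 < p.1, (m p.1).totalVariation.prod (m p.2).totalVariation +
  ∑ i : Fin n with L.GenuinelyNonlinear i,
    ((m i).toJordanDecomposition.negPart.prod (m i).toJordanDecomposition.negPart +
      (m i).toJordanDecomposition.posPart.prod (m i).toJordanDecomposition.negPart +
      (m i).toJordanDecomposition.negPart.prod (m i).toJordanDecomposition.posPart)

/-- `Q̂ = ρ({x < y})`. -/
def QHat (m : Fin n → SignedMeasure ℝ) : ℝ≥0∞ := L.rho m {p | p.1 < p.2}

/-- `Υ̂ = ∑ᵢ |μᵢ|(ℝ) + C₀ Q̂`. -/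
def UpsilonHat (m : Fin n → SignedMeasure ℝ) : ℝ≥0∞ :=
  ∑ i, (m i).totalVariation univ + ENNReal.ofReal C₀ * L.QHat m

end ConservationLaw

end

/-! The relaxed functionals are computed by sampling. Replacing a step function by its samples at
fewer points merges adjacent wave fans. By Glimm's interaction estimate, a merge changes the
strengths by at most a constant times the potential of the two merged fans. That potential
disappears from `Q`, while all other interactions are subadditive in the strengths. Hence for small
total strength and large `C₀` sampling decreases both `Q` and `Υ` (`RiemannEstimates.step_mono`).
For a fixed finite set of sample points the potentials depend continuously on the finitely many
sampled values, so they pass to pointwise limits.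

On the other side stands a right continuous function `u` of bounded variation with wave measures
`μᵢ`. The strengths of its samples on a grid are compared with the masses `μᵢ(cell)`. On a cell of
small variation both equal `lᵢ(u) · Δu` up to an error quadratic in the variation. On a cell with a
large atom the atom itself contributes exactly, and the rest of the cell is small. If on every cell
the variation is concentrated near one point, up to a mass `θ`, the total error is `O(θ)`
(`abs_sub_apply_Ioc_le_of_fine`). On fine cells each `μᵢ` also has almost no cancellation. So the
total strength of the samples tends to `∑ |μᵢ|(ℝ)`, their potential tends to `ρ({x < y})`, and the
samples tend to `u` in `L¹` (`IsProfile.exists_stepFun_approx`).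

Both inequalities come from one construction (`RiemannEstimates.exists_recovery`). Given any
sequence `w k` in `D_δ^*` converging to `U`, a subsequence converges almost everywhere to `u`, and
its terms are sampled on a fine grid of points of convergence. The result lies again in `D_δ^*`, is
`L¹`-close to `U`, has potentials close to the claimed values, and has potentials not exceeding
those of `w k`. Closeness to the claimed values bounds the relaxation from above; comparison with `w
k` bounds it from below.

The analytic input is a Riemann solver near `0` with uniform `C^{1,1}` bounds, collected in
`RiemannEstimates`. Shock and rarefaction curves are only shown to agree to first order with a
quadratic remainder, so the glued Lax curves are `C^{1,1}`. This regularity is expressed by second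
differences over parallelograms (`QuadAt`). It is stable under composition, local inversion, flows
and gluing, and it is exactly what Glimm's estimate and the near additivity of strengths need. -/

/-! ### Calculus of maps of class `C^{1,1}`, by second differences. -/

section QuadCalculus

variable {X Y Z : Type*} [NormedAddCommGroup X] [NormedAddCommGroup Y] [NormedAddCommGroup Z]

/-- Near `x` the map `F` is Lipschitz, and its second differences over parallelograms are bounded
by the product of the sides: a form of `C^{1,1}` regularity that needs no derivatives. -/
def QuadAt (F : X → Y) (x : X) : Prop :=
  ∃ K : ℝ, 0 ≤ K ∧ ∃ s ∈ 𝓝 x, ∀ a ∈ s, ∀ b ∈ s, ∀ c ∈ s, ∀ d ∈ s,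
    ‖F a - F b - F c + F d‖ ≤ K * (‖a - b - c + d‖ + ‖b - d‖ * ‖c - d‖)

namespace QuadAt

variable {F : X → Y} {x : X}

theorem exists_lipschitz (hF : QuadAt F x) :
    ∃ K : ℝ, 0 ≤ K ∧ ∃ s ∈ 𝓝 x, ∀ a ∈ s, ∀ b ∈ s, ‖F a - F b‖ ≤ K * ‖a - b‖ := by
  obtain ⟨K, hK, s, hs, h⟩ := hF
  refine ⟨K, hK, s, hs, fun a ha b hb => ?_⟩
  simpa using h a ha b hb b hb b hb

theorem continuousAt_of_mem {K : ℝ} {s : Set X} (hs : s ∈ 𝓝 x)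
    (h : ∀ a ∈ s, ∀ b ∈ s, ‖F a - F b‖ ≤ K * ‖a - b‖) : ContinuousAt F x := by
  rw [ContinuousAt, tendsto_iff_norm_sub_tendsto_zero]
  refine squeeze_zero' (Eventually.of_forall fun _ => norm_nonneg _)
    (g := fun a => K * ‖a - x‖) ?_ ?_
  · filter_upwards [hs] with a ha using h a ha x (mem_of_mem_nhds hs)
  · have : Tendsto (fun a => K * ‖a - x‖) (𝓝 x) (𝓝 (K * ‖x - x‖)) := by
      apply Continuous.tendsto; fun_prop
    simpa using this

theorem continuousAt (hF : QuadAt F x) : ContinuousAt F x := by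
  obtain ⟨K, -, s, hs, h⟩ := hF.exists_lipschitz
  exact continuousAt_of_mem hs h

theorem eventually_continuousAt (hF : QuadAt F x) : ∀ᶠ y in 𝓝 x, ContinuousAt F y := by
  obtain ⟨K, -, s, hs, h⟩ := hF.exists_lipschitz
  filter_upwards [eventually_mem_nhds_iff.2 hs] with y hy using continuousAt_of_mem hy h

theorem comp {G : Y → Z} (hG : QuadAt G (F x)) (hF : QuadAt F x) :
    QuadAt (fun y => G (F y)) x := by
  obtain ⟨K, hK, s, hs, h⟩ := hF
  obtain ⟨M, hM, t, ht, h'⟩ := hG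
  have hc : ContinuousAt F x := QuadAt.continuousAt ⟨K, hK, s, hs, h⟩
  refine ⟨M * (K + K * K), by positivity, s ∩ F ⁻¹' t, inter_mem hs (hc ht), ?_⟩
  rintro a ⟨ha, ha'⟩ b ⟨hb, hb'⟩ c ⟨hc, hc'⟩ d ⟨hd, hd'⟩
  have h1 := h' _ ha' _ hb' _ hc' _ hd'
  have h2 := h _ ha _ hb _ hc _ hd
  have h3 : ‖F b - F d‖ ≤ K * ‖b - d‖ := by simpa using h b hb d hd d hd d hd
  have h4 : ‖F c - F d‖ ≤ K * ‖c - d‖ := by simpa using h c hc d hd d hd d hd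
  have h5 : ‖F b - F d‖ * ‖F c - F d‖ ≤ (K * ‖b - d‖) * (K * ‖c - d‖) := by gcongr
  have h6 : 0 ≤ ‖a - b - c + d‖ := norm_nonneg _
  have h7 : 0 ≤ ‖b - d‖ * ‖c - d‖ := by positivity
  calc _ ≤ M * (‖F a - F b - F c + F d‖ + ‖F b - F d‖ * ‖F c - F d‖) := h1
    _ ≤ M * (K * (‖a - b - c + d‖ + ‖b - d‖ * ‖c - d‖) + (K * ‖b - d‖) * (K * ‖c - d‖)) := by
        gcongr
    _ ≤ _ := by
        have : 0 ≤ M * (K * K) * ‖a - b - c + d‖ := by positivity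
        nlinarith

theorem prodMk {G : X → Z} (hF : QuadAt F x) (hG : QuadAt G x) :
    QuadAt (fun y => (F y, G y)) x := by
  obtain ⟨K, hK, s, hs, h⟩ := hF
  obtain ⟨M, hM, t, ht, h'⟩ := hG
  refine ⟨max K M, by positivity, s ∩ t, inter_mem hs ht, ?_⟩
  rintro a ⟨ha, ha'⟩ b ⟨hb, hb'⟩ c ⟨hc, hc'⟩ d ⟨hd, hd'⟩
  simp only [Prod.mk_sub_mk, Prod.mk_add_mk, Prod.norm_def]
  refine max_le ((h a ha b hb c hc d hd).trans ?_) ((h' a ha' b hb' c hc' d hd').trans ?_)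
  · gcongr; exact le_max_left _ _
  · gcongr; exact le_max_right _ _

section

variable [NormedSpace ℝ X] [NormedSpace ℝ Y]

/-- The second difference is split at the exact fourth vertex `b + c - d` of the parallelogram. The
defect of `a` costs a Lipschitz constant of `F`. The rest is the increment over the segment from `d`
to `b` of `y ↦ F (y + (c - d)) - F y`, whose derivative is `O(‖c - d‖)` because `fderiv ℝ F` is
Lipschitz. The radius `ρ / 3` keeps `b + c - d` in the ball of radius `ρ`. -/
theorem of_contDiffAt (hF : ContDiffAt ℝ 2 F x) : QuadAt F x := by
  obtain ⟨L, s, hs, hL⟩ := (hF.of_le (by norm_num : (1 : WithTop ℕ∞) ≤ 2)).exists_lipschitzOnWith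
  have h1 : ContDiffAt ℝ 1 (fderiv ℝ F) x := hF.fderiv_right (by norm_num)
  obtain ⟨M, t, ht, hM⟩ := h1.exists_lipschitzOnWith
  have h2 : ∀ᶠ y in 𝓝 x, DifferentiableAt ℝ F y := by
    filter_upwards [hF.eventually (by simp)] with y hy using hy.differentiableAt (by simp)
  obtain ⟨ρ, hρ, hsub⟩ := Metric.mem_nhds_iff.1 (inter_mem (inter_mem hs ht) h2)
  refine ⟨max L M, by positivity, Metric.ball x (ρ / 3), Metric.ball_mem_nhds _ (by positivity), ?_⟩
  intro a ha b hb c hc d hd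
  rw [mem_ball_iff_norm] at ha hb hc hd
  have hbig : ∀ y, ‖y - x‖ < ρ → (y ∈ s ∧ y ∈ t) ∧ DifferentiableAt ℝ F y := fun y hy =>
    hsub (mem_ball_iff_norm.2 hy)
  have ha' : ‖b + c - d - x‖ < ρ := by
    have : b + c - d - x = (b - x) + (c - x) - (d - x) := by abel
    rw [this]
    linarith [norm_sub_le ((b - x) + (c - x)) (d - x), norm_add_le (b - x) (c - x)]
  have e1 : ‖F a - F (b + c - d)‖ ≤ L * ‖a - b - c + d‖ := by
    have := hL.norm_sub_le (hbig a (by linarith)).1.1 (hbig _ ha').1.1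
    convert! this using 3
    abel
  have e2 : ‖(F (b + (c - d)) - F b) - (F (d + (c - d)) - F d)‖ ≤ M * ‖c - d‖ * ‖b - d‖ := by
    have hseg : ∀ y ∈ segment ℝ d b, ‖y - x‖ < ρ / 3 := fun y hy => by
      have := (convex_ball x (ρ / 3)).segment_subset (mem_ball_iff_norm.2 hd)
        (mem_ball_iff_norm.2 hb) hy
      exact mem_ball_iff_norm.1 this
    have hseg' : ∀ y ∈ segment ℝ d b, ‖y + (c - d) - x‖ < ρ := fun y hy => by
      have : y + (c - d) - x = (y - x) + (c - x) - (d - x) := by abel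
      rw [this]
      linarith [norm_sub_le ((y - x) + (c - x)) (d - x), norm_add_le (y - x) (c - x), hseg y hy]
    refine Convex.norm_image_sub_le_of_norm_hasFDerivWithin_le
      (f := fun y => F (y + (c - d)) - F y)
      (f' := fun y => fderiv ℝ F (y + (c - d)) - fderiv ℝ F y) (𝕜 := ℝ)
      (s := segment ℝ d b) (fun y hy => ?_) (fun y hy => ?_) (convex_segment _ _)
      (left_mem_segment _ _ _) (right_mem_segment _ _ _)
    · have k1 := (hbig _ (hseg' y hy)).2.hasFDerivAt
      have k2 := (hbig y (by linarith [hseg y hy])).2.hasFDerivAt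
      have k3 : HasFDerivAt (fun y => F (y + (c - d))) (fderiv ℝ F (y + (c - d))) y :=
        (hasFDerivAt_comp_add_right (c - d)).2 k1
      exact (k3.sub k2).hasFDerivWithinAt
    · have := hM.norm_sub_le (hbig _ (hseg' y hy)).1.2 (hbig y (by linarith [hseg y hy])).1.2
      simpa using this
  have e3 : F a - F b - F c + F d = (F a - F (b + c - d)) +
      ((F (b + (c - d)) - F b) - (F (d + (c - d)) - F d)) := by
    rw [show b + (c - d) = b + c - d by abel, show d + (c - d) = c by abel]; abel
  rw [e3]
  have m1 : (L : ℝ) ≤ max (L : ℝ) M := le_max_left _ _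
  have m2 : (M : ℝ) ≤ max (L : ℝ) M := le_max_right _ _
  calc _ ≤ L * ‖a - b - c + d‖ + M * ‖c - d‖ * ‖b - d‖ := (norm_add_le _ _).trans (by linarith)
    _ ≤ max (L : ℝ) M * ‖a - b - c + d‖ + max (L : ℝ) M * ‖c - d‖ * ‖b - d‖ := by gcongr
    _ = _ := by ring

theorem of_contDiff (hF : ContDiff ℝ 2 F) : QuadAt F x := of_contDiffAt hF.contDiffAt

end

section

variable [NormedSpace ℝ Y]

theorem add {G : X → Y} (hF : QuadAt F x) (hG : QuadAt G x) : QuadAt (fun y => F y + G y) x :=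
  comp (G := fun p : Y × Y => p.1 + p.2) (of_contDiff (by fun_prop)) (hF.prodMk hG)

theorem sub {G : X → Y} (hF : QuadAt F x) (hG : QuadAt G x) : QuadAt (fun y => F y - G y) x :=
  comp (G := fun p : Y × Y => p.1 - p.2) (of_contDiff (by fun_prop)) (hF.prodMk hG)

theorem smul {c : X → ℝ} (hc : QuadAt c x) (hF : QuadAt F x) : QuadAt (fun y => c y • F y) x :=
  comp (G := fun p : ℝ × Y => p.1 • p.2) (of_contDiff (by fun_prop)) (hc.prodMk hF)

end

/-- A local inverse inherits the regularity. -/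
theorem localInverse [NormedSpace ℝ X] [NormedSpace ℝ Y] [CompleteSpace X] {f' : X ≃L[ℝ] Y}
    (hf : HasStrictFDerivAt F (f' : X →L[ℝ] Y) x) (hF : QuadAt F x) :
    QuadAt (hf.localInverse F f' x) (F x) := by
  set g := hf.localInverse F f' x with hg
  obtain ⟨K, hK, s, hs, h⟩ := hF
  obtain ⟨L, t, ht, hL⟩ := hf.to_localInverse.exists_lipschitzOnWith
  have hgc : Tendsto g (𝓝 (F x)) (𝓝 x) := hf.localInverse_tendsto
  have hl : ∀ᶠ y in 𝓝 x, g (F y) = y := hf.eventually_left_inverse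
  have hr : ∀ᶠ y in 𝓝 (F x), F (g y) = y := hf.eventually_right_inverse
  have hFc : ContinuousAt F x := hf.continuousAt
  have hw : {y | y ∈ s ∧ g (F y) = y ∧ F y ∈ t} ∈ 𝓝 x := by
    filter_upwards [hs, hl, hFc ht] with y h1 h2 h3 using ⟨h1, h2, h3⟩
  obtain ⟨ρ, hρ, hsub⟩ := Metric.mem_nhds_iff.1 hw
  have hball : ∀ᶠ y in 𝓝 (F x), g y ∈ Metric.ball x (ρ / 3) :=
    hgc (Metric.ball_mem_nhds _ (by positivity))
  refine ⟨L + L * (K * (L * L)), by positivity, _, inter_mem (inter_mem ht hr) hball, ?_⟩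
  rintro a ⟨⟨ha, ha'⟩, ha2⟩ b ⟨⟨hb, hb'⟩, hb2⟩ c ⟨⟨hc, hc'⟩, hc2⟩ d ⟨⟨hd, hd'⟩, hd2⟩
  simp only [mem_ofPred_eq, mem_ball_iff_norm] at ha2 hb2 hc2 hd2 ha' hb' hc' hd'
  have hy : ‖g b + g c - g d - x‖ < ρ := by
    have : g b + g c - g d - x = (g b - x) + (g c - x) - (g d - x) := by abel
    rw [this]
    linarith [norm_sub_le ((g b - x) + (g c - x)) (g d - x), norm_add_le (g b - x) (g c - x)]
  have hin : ∀ y, ‖y - x‖ < ρ → y ∈ s ∧ g (F y) = y ∧ F y ∈ t := fun y hy =>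
    hsub (mem_ball_iff_norm.2 hy)
  -- The parallelogram is completed on the side of the source. Its image `F y` misses `b + c - d` by
  -- a product of sides, and `g` turns `a - F y` back into `g a - y`.
  set y := g b + g c - g d with hydef
  have e1 : ‖g a - y‖ ≤ L * ‖a - F y‖ := by
    have := hL.norm_sub_le ha (hin y hy).2.2
    rwa [← hg, (hin y hy).2.1] at this
  have e2 : ‖F y - b - c + d‖ ≤ K * (‖g b - g d‖ * ‖g c - g d‖) := by
    have := h y (hin y hy).1 (g b) (hin _ (by linarith)).1 (g c) (hin _ (by linarith)).1
      (g d) (hin _ (by linarith)).1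
    rw [hb', hc', hd', show y - g b - g c + g d = 0 by rw [hydef]; abel] at this
    simpa using this
  have e3 : ‖g b - g d‖ ≤ L * ‖b - d‖ := hL.norm_sub_le hb hd
  have e4 : ‖g c - g d‖ ≤ L * ‖c - d‖ := hL.norm_sub_le hc hd
  have e5 : ‖a - F y‖ ≤ ‖a - b - c + d‖ + ‖F y - b - c + d‖ := by
    have : a - F y = (a - b - c + d) - (F y - b - c + d) := by abel
    rw [this]; exact norm_sub_le _ _
  have e6 : g a - g b - g c + g d = g a - y := by rw [hydef]; abel
  rw [e6]
  calc _ ≤ L * ‖a - F y‖ := e1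
    _ ≤ L * (‖a - b - c + d‖ + K * ((L * ‖b - d‖) * (L * ‖c - d‖))) := by
        gcongr
        exact e5.trans (by gcongr; exact e2.trans (by gcongr))
    _ ≤ _ := by
        have : 0 ≤ L * (K * (L * L)) * ‖a - b - c + d‖ := by positivity
        have : 0 ≤ L * (‖b - d‖ * ‖c - d‖) := by positivity
        nlinarith

end QuadAt

/-- A product is strictly differentiable where one factor vanishes and the other is Lipschitz. -/
theorem HasStrictFDerivAt.smul_quadAt [NormedSpace ℝ X] [NormedSpace ℝ Y] {c : X → ℝ} {F : X → Y}
    {x : X} {c' : X →L[ℝ] ℝ} (hc : HasStrictFDerivAt c c' x) (h0 : c x = 0) (hF : QuadAt F x) :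
    HasStrictFDerivAt (fun y => c y • F y) (c'.smulRight (F x)) x := by
  have h1 : HasStrictFDerivAt (fun y => c y • F x) (c'.smulRight (F x)) x := hc.smul_const (F x)
  obtain ⟨K, hK, s, hs, h⟩ := hF.exists_lipschitz
  obtain ⟨M, t, ht, hM⟩ := hc.exists_lipschitzOnWith
  have h2 : HasStrictFDerivAt (fun y => c y • (F y - F x)) (0 : X →L[ℝ] Y) x := by
    rw [hasStrictFDerivAt_iff_isLittleO, Asymptotics.isLittleO_iff]
    intro ε hε
    have e1 : ∀ᶠ p : X × X in 𝓝 (x, x), |c p.1| * K < ε / 2 := by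
      have : ContinuousAt (fun p : X × X => |c p.1| * K) (x, x) := by
        have : ContinuousAt (fun p : X × X => c p.1) (x, x) :=
          ContinuousAt.comp (f := Prod.fst) hc.continuousAt continuousAt_fst
        exact this.abs.mul_const K
      refine this.eventually_lt_const ?_
      simp [h0, hε]
    have e2 : ∀ᶠ p : X × X in 𝓝 (x, x), M * ‖F p.2 - F x‖ < ε / 2 := by
      have : ContinuousAt (fun p : X × X => M * ‖F p.2 - F x‖) (x, x) := by
        have : ContinuousAt (fun p : X × X => F p.2) (x, x) :=
          ContinuousAt.comp (f := Prod.snd) hF.continuousAt continuousAt_snd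
        exact (this.sub continuousAt_const).norm.const_mul _
      refine this.eventually_lt_const ?_
      simp [hε]
    have e3 : ∀ᶠ p : X × X in 𝓝 (x, x), p.1 ∈ s ∩ t ∧ p.2 ∈ s ∩ t := by
      rw [nhds_prod_eq]
      exact prod_mem_prod (inter_mem hs ht) (inter_mem hs ht)
    filter_upwards [e1, e2, e3] with p p1 p2 p3
    have k1 := h _ p3.1.1 _ p3.2.1
    have k2 := hM.norm_sub_le p3.1.2 p3.2.2
    have : c p.1 • (F p.1 - F x) - c p.2 • (F p.2 - F x) - (0 : X →L[ℝ] Y) (p.1 - p.2) =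
        c p.1 • (F p.1 - F p.2) + (c p.1 - c p.2) • (F p.2 - F x) := by
      simp only [smul_sub, sub_smul, zero_apply]; abel
    rw [this]
    calc _ ≤ |c p.1| * ‖F p.1 - F p.2‖ + ‖c p.1 - c p.2‖ * ‖F p.2 - F x‖ := by
          refine (norm_add_le _ _).trans ?_
          rw [norm_smul, norm_smul, Real.norm_eq_abs (c p.1)]
      _ ≤ |c p.1| * (K * ‖p.1 - p.2‖) + M * ‖p.1 - p.2‖ * ‖F p.2 - F x‖ := by gcongr
      _ = (|c p.1| * K + M * ‖F p.2 - F x‖) * ‖p.1 - p.2‖ := by ring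
      _ ≤ ε * ‖p.1 - p.2‖ := by gcongr; linarith
  have := h1.add h2
  rw [add_zero] at this
  refine this.congr_of_eventuallyEq (Eventually.of_forall fun y => ?_)
  simp [smul_sub]

section Glue

variable {D : ℝ × X → Y} {x : X}

/-- Since `D` vanishes on `{0} × X`, a change of `y` at fixed `t` is a second difference over the
rectangle with corners at `0` and `t`, of size `|t| ‖y - y'‖`. A change of `t` at fixed `y'` is
compared with `D (t - t', y')`, which is quadratically small. -/
theorem QuadAt.lipschitz_of_quadratic (hD : QuadAt D (0, x)) {C : ℝ}
    (hC : ∀ᶠ p in 𝓝 ((0, x) : ℝ × X), ‖D p‖ ≤ C * p.1 ^ 2) :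
    ∃ M : ℝ, 0 ≤ M ∧ ∃ s ∈ 𝓝 ((0, x) : ℝ × X), ∀ p ∈ s, ∀ q ∈ s,
      ‖D p - D q‖ ≤
        M * (|p.1| + |q.1|) * ‖p - q‖ := by
  obtain ⟨K, hK, s, hs, h⟩ := hD
  obtain ⟨ρ, hρ, hsub⟩ := Metric.mem_nhds_iff.1 (inter_mem hs hC)
  have hin : ∀ t y, |t| < ρ → ‖y - x‖ < ρ → (t, y) ∈ s ∧ ‖D (t, y)‖ ≤ C * t ^ 2 := by
    intro t y ht hy
    refine hsub (mem_ball_iff_norm.2 ?_)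
    simp [Prod.norm_def, ht, hy]
  have hx0 : ‖x - x‖ < ρ := by simpa using hρ
  have hC0 : 0 ≤ C := by
    have h1 := (hin (ρ / 2) x (by rw [abs_of_pos] <;> linarith) hx0).2
    by_contra hneg
    have : C * (ρ / 2) ^ 2 < 0 := by
      apply mul_neg_of_neg_of_pos (not_le.1 hneg); positivity
    linarith [norm_nonneg (D (ρ / 2, x))]
  have hzero : ∀ y, ‖y - x‖ < ρ → D (0, y) = 0 := fun y hy => by
    have := (hin 0 y (by simpa using hρ) hy).2
    simpa using this
  have key : ∀ p ∈ Metric.ball ((0, x) : ℝ × X) (ρ / 2), ∀ q ∈ Metric.ball ((0, x) : ℝ × X) (ρ / 2),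
      ‖D p - D q‖ ≤ (K + C) * (|p.1| + |q.1|) * ‖p - q‖ := by
    rintro ⟨t, y⟩ hp ⟨t', y'⟩ hq
    simp only [mem_ball_iff_norm, Prod.norm_def, Prod.mk_sub_mk, sub_zero, sup_lt_iff,
      Real.norm_eq_abs] at hp hq
    have ht : |t - t'| < ρ := (abs_sub _ _).trans_lt (by linarith)
    have e1 := h _ (hin t y (by linarith) (by linarith)).1 _ (hin t y' (by linarith) (by linarith)).1
      _ (hin 0 y (by simpa) (by linarith)).1 _ (hin 0 y' (by simpa) (by linarith)).1
    have e2 := h _ (hin t y' (by linarith) (by linarith)).1 _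
      (hin t' y' (by linarith) (by linarith)).1
      _ (hin (t - t') y' ht (by linarith)).1 _ (hin 0 y' (by simpa) (by linarith)).1
    have e3 := (hin (t - t') y' ht (by linarith)).2
    rw [hzero y' (by linarith), hzero y (by linarith)] at e1
    rw [hzero y' (by linarith)] at e2
    simp [Prod.norm_def] at e1 e2
    have n1 : |t - t'| ≤ ‖((t, y) : ℝ × X) - (t', y')‖ := by simp [Prod.norm_def]
    have n2 : ‖y - y'‖ ≤ ‖((t, y) : ℝ × X) - (t', y')‖ := by simp [Prod.norm_def]
    set N := ‖((t, y) : ℝ × X) - (t', y')‖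
    have hN : 0 ≤ N := norm_nonneg _
    have e4 : D (t, y) - D (t', y') = (D (t, y) - D (t, y')) +
      ((D (t, y') - D (t', y') - D (t - t', y')) + D (t - t', y')) := by abel
    have e5 : (t - t') ^ 2 ≤ (|t| + |t'|) * N := by
      rw [← sq_abs, pow_two]; gcongr; exact abs_sub _ _
    calc _ ≤ K * (|t| * ‖y - y'‖) + (K * (|t'| * |t - t'|) + C * (t - t') ^ 2) := by
          rw [e4]
          exact (norm_add_le _ _).trans (add_le_add e1 ((norm_add_le _ _).trans (add_le_add e2 e3)))
      _ ≤ K * (|t| * N) + (K * (|t'| * N) + C * ((|t| + |t'|) * N)) := by gcongr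
      _ = _ := by ring
  exact ⟨K + C, by positivity, _, Metric.ball_mem_nhds _ (half_pos hρ), key⟩

/-- When the signs of `p.1` and `q.1` differ, `|p.1| ≤ ‖p - q‖`, so the quadratic bound on `D p`
alone gives the estimate. -/
theorem QuadAt.lipschitz_cutoff_of_quadratic (hD : QuadAt D (0, x)) {C : ℝ}
    (hC : ∀ᶠ p in 𝓝 ((0, x) : ℝ × X), ‖D p‖ ≤ C * p.1 ^ 2) :
    ∃ M : ℝ, 0 ≤ M ∧ ∃ s ∈ 𝓝 ((0, x) : ℝ × X), ∀ p ∈ s, ∀ q ∈ s,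
      ‖(if p.1 < 0 then D p else 0)  - (if q.1 < 0 then D q else 0)‖ ≤
        M * (|p.1| + |q.1|) * ‖p - q‖ := by
  obtain ⟨K, hK, s, hs, key⟩ := hD.lipschitz_of_quadratic hC
  have hb : ∀ p ∈ s ∩ {p | ‖D p‖ ≤ C * p.1 ^ 2}, ‖D p‖ ≤ |C| * p.1 ^ 2 := fun p hp =>
    hp.2.trans (by gcongr; exact le_abs_self C)
  have hmix : ∀ p ∈ s ∩ {p | ‖D p‖ ≤ C * p.1 ^ 2}, ∀ q : ℝ × X, p.1 < 0 → ¬ q.1 < 0 →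
      ‖D p‖ ≤ (K + |C|) * (|p.1| + |q.1|) * ‖p - q‖ := by
    intro p hp q h1 h2
    have h3 : |p.1| ≤ ‖p - q‖ := by
      have : |p.1 - q.1| ≤ ‖p - q‖ := norm_fst_le (p - q)
      refine le_trans ?_ this
      rw [abs_of_neg h1, abs_of_nonpos (by linarith)]; linarith
    calc ‖D p‖ ≤ |C| * p.1 ^ 2 := hb p hp
      _ = |C| * |p.1| * |p.1| := by rw [← sq_abs p.1]; ring
      _ ≤ (K + |C|) * (|p.1| + |q.1|) * ‖p - q‖ := by
        gcongr
        · linarith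
        · linarith [abs_nonneg q.1]
  refine ⟨K + |C|, by positivity, _, inter_mem hs hC, fun p hp q hq => ?_⟩
  by_cases h1 : p.1 < 0 <;> by_cases h2 : q.1 < 0
  · simp only [h1, h2, if_true]
    refine (key p hp.1 q hq.1).trans ?_
    gcongr
    linarith [abs_nonneg C]
  · simpa [h1, h2] using hmix p hp q h1 h2
  · have := hmix q hq p h2 h1
    rw [add_comm |q.1|, norm_sub_rev] at this
    simpa [h1, h2] using this
  · simp only [h1, h2, if_false, sub_self, norm_zero]; positivity

/-- A `C^{1,1}` map vanishing to second order on `{0} × X` may be cut off along it. -/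
theorem QuadAt.cutoff (hD : QuadAt D (0, x)) {C : ℝ}
    (hC : ∀ᶠ p in 𝓝 ((0, x) : ℝ × X), ‖D p‖ ≤ C * p.1 ^ 2) :
    QuadAt (fun p => if p.1 < 0 then D p else 0) (0, x) := by
  obtain ⟨M, hM, s, hs, h⟩ := hD.lipschitz_cutoff_of_quadratic hC
  obtain ⟨K, hK, t, ht, hq⟩ := hD
  obtain ⟨ρ, hρ, hsub⟩ := Metric.mem_nhds_iff.1 (inter_mem hs ht)
  set r := min ρ (1 / 8) with hr
  have hr0 : 0 < r := by positivity
  refine ⟨K + 64 * M, by positivity, Metric.ball (0, x) r, Metric.ball_mem_nhds _ hr0, ?_⟩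
  intro a ha b hb c hc d hd
  have hin : ∀ p ∈ Metric.ball ((0, x) : ℝ × X) r, p ∈ s ∩ t := fun p hp =>
    hsub (Metric.ball_subset_ball (min_le_left _ _) hp)
  have hdist : ∀ p ∈ Metric.ball ((0, x) : ℝ × X) r, ∀ q ∈ Metric.ball ((0, x) : ℝ × X) r,
      ‖p - q‖ ≤ 1 / 4 := by
    intro p hp q hq
    have := dist_triangle_right p q (0, x)
    rw [mem_ball_iff_norm, ← dist_eq_norm] at hp hq
    rw [← dist_eq_norm]
    have : r ≤ 1 / 8 := min_le_right _ _
    linarith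
  set E : ℝ × X → Y := fun p => if p.1 < 0 then D p else 0 with hE
  set e := ‖a - b - c + d‖
  set d1 := ‖b - d‖
  set d2 := ‖c - d‖
  have he : 0 ≤ e := norm_nonneg _
  have hd1 : 0 ≤ d1 := norm_nonneg _
  have hd2 : 0 ≤ d2 := norm_nonneg _
  have f1 : |b.1 - d.1| ≤ d1 := norm_fst_le (b - d)
  have f2 : |c.1 - d.1| ≤ d2 := norm_fst_le (c - d)
  have f3 : |a.1 - b.1 - c.1 + d.1| ≤ e := norm_fst_le (a - b - c + d)
  have hab : ‖a - b‖ ≤ d2 + e := by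
    have : a - b = (c - d) + (a - b - c + d) := by abel
    rw [this]; exact norm_add_le _ _
  have hac : ‖a - c‖ ≤ d1 + e := by
    have : a - c = (b - d) + (a - b - c + d) := by abel
    rw [this]; exact norm_add_le _ _
  have hd1' : d1 ≤ 1 / 4 := hdist b hb d hd
  have hd2' : d2 ≤ 1 / 4 := hdist c hc d hd
  have he' : e ≤ 1 / 2 := by
    have : a - b - c + d = (a - b) - (c - d) := by abel
    have h2 : e ≤ ‖a - b‖ + ‖c - d‖ := by
      change ‖a - b - c + d‖ ≤ _
      rw [this]; exact norm_sub_le _ _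
    linarith [hdist a ha b hb]
  by_cases hneg : a.1 < 0 ∧ b.1 < 0 ∧ c.1 < 0 ∧ d.1 < 0
  · have := hq a (hin a ha).2 b (hin b hb).2 c (hin c hc).2 d (hin d hd).2
    simp only [hE, hneg, if_true]
    refine this.trans ?_
    gcongr
    linarith
  by_cases hpos : ¬ a.1 < 0 ∧ ¬ b.1 < 0 ∧ ¬ c.1 < 0 ∧ ¬ d.1 < 0
  · simp only [hE, hpos, if_false, sub_self, add_zero, norm_zero]; positivity
  -- If the four points are not all on one side of `{0} × X`, each of them is within the size of the
  -- figure from it, so the Lipschitz constant available below is itself small.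
  have T : |a.1| ≤ d1 + d2 + e ∧ |b.1| ≤ d1 + d2 + e ∧ |c.1| ≤ d1 + d2 + e ∧
      |d.1| ≤ d1 + d2 + e := by
    rw [abs_le] at f1 f2 f3
    simp only [abs_le]
    by_cases h1 : a.1 < 0 <;> by_cases h2 : b.1 < 0 <;> by_cases h3 : c.1 < 0 <;>
      by_cases h4 : d.1 < 0 <;> simp only [h1, h2, h3, h4, and_true, not_true, not_false_iff,
        and_false] at hneg hpos <;> refine ⟨⟨?_, ?_⟩, ⟨?_, ?_⟩, ⟨?_, ?_⟩, ⟨?_, ?_⟩⟩ <;> linarith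
  obtain ⟨T1, T2, T3, T4⟩ := T
  have hl : ∀ p ∈ Metric.ball ((0, x) : ℝ × X) r, ∀ q ∈ Metric.ball ((0, x) : ℝ × X) r,
      |p.1| ≤ d1 + d2 + e → |q.1| ≤ d1 + d2 + e → ∀ N, ‖p - q‖ ≤ N →
      ‖E p - E q‖ ≤ M * (2 * (d1 + d2 + e)) * N := by
    intro p hp q hq h1 h2 N hN
    refine (h p (hin p hp).1 q (hin q hq).1).trans ?_
    gcongr
    linarith
  have hMd : 0 ≤ M * (d1 * d2) := by positivity
  have hMe : 0 ≤ M * e := by positivity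
  -- The differences are taken along the shorter side: every term of the resulting product then
  -- contains `e` or is at most a multiple of `d1 * d2`.
  have hfin : ‖E a - E b - E c + E d‖ ≤ 64 * M * (e + d1 * d2) := by
    rcases le_total d1 d2 with h12 | h12
    · have g1 := hl a ha c hc T1 T3 _ hac
      have g2 := hl b hb d hd T2 T4 d1 le_rfl
      have : E a - E b - E c + E d = (E a - E c) - (E b - E d) := by abel
      rw [this]
      calc _ ≤ M * (2 * (d1 + d2 + e)) * (d1 + e) + M * (2 * (d1 + d2 + e)) * d1 :=
            (norm_sub_le _ _).trans (add_le_add g1 g2)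
        _ = M * (2 * (d1 + d2 + e) * (2 * d1 + e)) := by ring
        _ ≤ M * (64 * (e + d1 * d2)) := by
            refine mul_le_mul_of_nonneg_left ?_ hM
            nlinarith [mul_nonneg hd1 hd2, mul_le_mul_of_nonneg_left h12 hd1,
              mul_le_mul_of_nonneg_left he' he, mul_le_mul_of_nonneg_left hd1' he,
              mul_le_mul_of_nonneg_left hd2' he]
        _ = _ := by ring
    · have g1 := hl a ha b hb T1 T2 _ hab
      have g2 := hl c hc d hd T3 T4 d2 le_rfl
      have : E a - E b - E c + E d = (E a - E b) - (E c - E d) := by abel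
      rw [this]
      calc _ ≤ M * (2 * (d1 + d2 + e)) * (d2 + e) + M * (2 * (d1 + d2 + e)) * d2 :=
            (norm_sub_le _ _).trans (add_le_add g1 g2)
        _ = M * (2 * (d1 + d2 + e) * (2 * d2 + e)) := by ring
        _ ≤ M * (64 * (e + d1 * d2)) := by
            refine mul_le_mul_of_nonneg_left ?_ hM
            nlinarith [mul_nonneg hd1 hd2, mul_le_mul_of_nonneg_left h12 hd2,
              mul_le_mul_of_nonneg_left he' he, mul_le_mul_of_nonneg_left hd1' he,
              mul_le_mul_of_nonneg_left hd2' he]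
        _ = _ := by ring
  refine hfin.trans ?_
  gcongr
  linarith

theorem hasStrictFDerivAt_zero_of_lipschitz [NormedSpace ℝ X] [NormedSpace ℝ Y]
    (h : ∃ M : ℝ, 0 ≤ M ∧ ∃ s ∈ 𝓝 ((0, x) : ℝ × X), ∀ p ∈ s, ∀ q ∈ s,
      ‖D p - D q‖ ≤ M * (|p.1| + |q.1|) * ‖p - q‖) :
    HasStrictFDerivAt D (0 : ℝ × X →L[ℝ] Y) (0, x) := by
  obtain ⟨M, hM, s, hs, h⟩ := h
  rw [hasStrictFDerivAt_iff_isLittleO, Asymptotics.isLittleO_iff]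
  intro ε hε
  have e1 : ∀ᶠ p : (ℝ × X) × (ℝ × X) in 𝓝 ((0, x), (0, x)), M * (|p.1.1| + |p.2.1|) < ε := by
    have : ContinuousAt (fun p : (ℝ × X) × (ℝ × X) => M * (|p.1.1| + |p.2.1|))
      ((0, x), (0, x)) := by fun_prop
    refine this.eventually_lt_const ?_
    simpa using hε
  have e2 : ∀ᶠ p : (ℝ × X) × (ℝ × X) in 𝓝 ((0, x), (0, x)), p.1 ∈ s ∧ p.2 ∈ s := by
    rw [nhds_prod_eq]
    exact prod_mem_prod hs hs
  filter_upwards [e1, e2] with p h1 h2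
  rw [zero_apply, sub_zero]
  refine (h _ h2.1 _ h2.2).trans ?_
  gcongr

end Glue

end QuadCalculus

/-! ### Smooth dependence of simple eigenvalues and eigenvectors. -/

section Eigen

variable {n : ℕ} {X : Type*} [NormedAddCommGroup X] [NormedSpace ℝ X]

theorem Module.Basis.repr_apply_of_eigenbasis {ι : Type*} (b : Module.Basis ι ℝ X)
    (A : X →ₗ[ℝ] X) {lam : ι → ℝ} (hA : ∀ i, A (b i) = lam i • b i) (v : X) (i : ι) :
    b.repr (A v) i = lam i * b.repr v i := by
  classical
  have h : b.coord i ∘ₗ A = lam i • b.coord i := by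
    refine b.ext fun j => ?_
    by_cases hij : j = i
    · subst hij; simp [hA]
    · simp [hA, hij]
  simpa using LinearMap.congr_fun h v

theorem Module.Basis.sub_mul_repr_eq_zero {ι : Type*} (b : Module.Basis ι ℝ X)
    (A : X →ₗ[ℝ] X) {lam : ι → ℝ} (hA : ∀ i, A (b i) = lam i • b i) {s : ℝ} {v : X}
    (hv : A v = s • v) (i : ι) : (lam i - s) * b.repr v i = 0 := by
  have h := b.repr_apply_of_eigenbasis A hA v i
  rw [hv, map_smul, Finsupp.smul_apply, smul_eq_mul] at h
  linarith

/-- An eigenvalue and an eigenvector of an operator with simple spectrum depend smoothly on it. -/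
theorem exists_contDiffAt_eigen [FiniteDimensional ℝ X] {ι : Type*} (b : Module.Basis ι ℝ X)
    (A₀ : X →L[ℝ] X) {lam : ι → ℝ}
    (hlam : Function.Injective lam) (hA : ∀ i, A₀ (b i) = lam i • b i) (j : ι) :
    ∃ (Λ : (X →L[ℝ] X) → ℝ) (R : (X →L[ℝ] X) → X), ContDiffAt ℝ 4 Λ A₀ ∧ ContDiffAt ℝ 4 R A₀ ∧
      Λ A₀ = lam j ∧ R A₀ = b j ∧ ∀ᶠ A in 𝓝 A₀, A (R A) = Λ A • R A := by
  set ℓ : X →L[ℝ] ℝ := LinearMap.toContinuousLinearMap (b.coord j) with hℓ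
  -- Eigenpairs near `(lam j, b j)` are the solutions of `A w = t w` normalized by `ℓ w = 1`. The
  -- linearization in `(t, w)` is injective because the eigenvalue is simple, so the implicit
  -- function theorem applies.
  set G : (X →L[ℝ] X) × (ℝ × X) → ℝ × X := fun p => (ℓ p.2.2, p.1 p.2.2 - p.2.1 • p.2.2) with hG
  set u : (X →L[ℝ] X) × (ℝ × X) := (A₀, (lam j, b j)) with hu
  have hGc : ContDiff ℝ 4 G := by
    apply ContDiff.prodMk
    · fun_prop
    · exact (contDiff_fst.clm_apply (by fun_prop)).sub (by fun_prop)
  set T : ℝ × X →L[ℝ] ℝ × X :=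
    (ℓ.comp (ContinuousLinearMap.snd ℝ ℝ X)).prod
      ((A₀ - lam j • ContinuousLinearMap.id ℝ X).comp (ContinuousLinearMap.snd ℝ ℝ X) -
        (ContinuousLinearMap.fst ℝ ℝ X).smulRight (b j)) with hT
  have hder : fderiv ℝ G u ∘L .inr ℝ (X →L[ℝ] X) (ℝ × X) = T := by
    have h1 : HasFDerivAt (fun q : ℝ × X => G (A₀, q)) T (lam j, b j) := by
      apply HasFDerivAt.prodMk
      · exact (ℓ.comp (ContinuousLinearMap.snd ℝ ℝ X)).hasFDerivAt
      · have e1 : HasFDerivAt (fun q : ℝ × X => A₀ q.2)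
            (A₀.comp (ContinuousLinearMap.snd ℝ ℝ X)) (lam j, b j) :=
          (A₀.comp (ContinuousLinearMap.snd ℝ ℝ X)).hasFDerivAt
        have e2 := (hasFDerivAt_fst (𝕜 := ℝ) (p := (lam j, b j))).smul
          (hasFDerivAt_snd (𝕜 := ℝ) (p := (lam j, b j)))
        refine (e1.sub e2).congr_fderiv ?_
        ext q <;> simp [sub_eq_add_neg]
    have h2 : HasFDerivAt (fun q : ℝ × X => G (A₀, q))
        (fderiv ℝ G u ∘L .inr ℝ (X →L[ℝ] X) (ℝ × X)) (lam j, b j) := by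
      have := (hGc.differentiable (by simp) u).hasFDerivAt
      exact HasFDerivAt.comp (lam j, b j) this (hasFDerivAt_prodMk_right A₀ (lam j, b j))
    exact h2.unique h1
  have hinj : Function.Injective (T : ℝ × X →ₗ[ℝ] ℝ × X) := by
    rw [← LinearMap.ker_eq_bot, LinearMap.ker_eq_bot']
    rintro ⟨t, w⟩ hw
    have hw' : ℓ w = 0 ∧ A₀ w - lam j • w - t • b j = 0 := by
      simpa [hT, Prod.ext_iff] using hw
    obtain ⟨h1, h2⟩ := hw'
    have h1' : b.repr w j = 0 := by simpa [hℓ] using h1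
    have hco : ∀ i, b.repr (A₀ w) i = lam i * b.repr w i :=
      b.repr_apply_of_eigenbasis (A₀ : X →ₗ[ℝ] X) hA w
    have h3 : ∀ i, (lam i - lam j) * b.repr w i - t * b.repr (b j) i = 0 := by
      intro i
      have := congrArg (fun y => b.repr y i) h2
      simp only [map_sub, map_smul, Finsupp.sub_apply, Finsupp.smul_apply, smul_eq_mul, hco,
        map_zero, Finsupp.zero_apply] at this
      linarith
    have ht : t = 0 := by simpa using h3 j
    subst ht
    have hw0 : w = 0 := by
      apply b.repr.injective
      ext i
      by_cases hij : i = j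
      · subst hij; simpa using h1'
      · have := h3 i
        simp only [zero_mul, sub_zero, mul_eq_zero, sub_eq_zero] at this
        rcases this with h | h
        · exact absurd (hlam h) hij
        · simpa using h
    simp [hw0]
  have hinv : (fderiv ℝ G u ∘L .inr ℝ (X →L[ℝ] X) (ℝ × X)).IsInvertible := by
    rw [hder]
    exact ⟨(LinearEquiv.ofInjectiveEndo _ hinj).toContinuousLinearEquiv, by ext q <;> rfl⟩
  have hGu : G u = (1, 0) := by simp [hG, hu, hℓ, hA]
  have cdf : ContDiffAt ℝ 4 G u := hGc.contDiffAt
  set ψ := cdf.implicitFunction (by simp) hinv with hψ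
  have hψc : ContDiffAt ℝ 4 ψ A₀ := cdf.contDiffAt_implicitFunction (by simp) hinv
  have hψ0 : ψ A₀ = (lam j, b j) := cdf.implicitFunction_apply_self (by simp) hinv
  refine ⟨fun A => (ψ A).1, fun A => (ψ A).2, hψc.fst, hψc.snd, by simp [hψ0], by simp [hψ0], ?_⟩
  filter_upwards [cdf.eventually_apply_implicitFunction (by simp) hinv] with A hAe
  have := congrArg Prod.snd (hAe.trans hGu)
  simpa [hG, sub_eq_zero] using this

/-- The increasing list of the eigenvalues is determined by the operator. -/
theorem eq_of_strictMono_eigenvalue {A : Module.End ℝ (State n)} {lam mu : Fin n → ℝ}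
    (h1 : StrictMono lam) (h2 : StrictMono mu) (e1 : ∀ j, A.HasEigenvalue (lam j))
    (e2 : ∀ j, A.HasEigenvalue (mu j)) : lam = mu := by
  choose v hv using fun j => (e1 j).exists_hasEigenvector
  have hli := Module.End.eigenvectors_linearIndependent' A lam h1.injective v hv
  let b := basisOfLinearIndependentOfCardEqFinrank' v hli (by simp)
  have hb : ∀ i, A (b i) = lam i • b i := fun i => by
    simp only [b, coe_basisOfLinearIndependentOfCardEqFinrank']
    exact (hv i).apply_eq_smul
  have key : range mu ⊆ range lam := by
    rintro _ ⟨j, rfl⟩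
    obtain ⟨w, hw⟩ := (e2 j).exists_hasEigenvector
    by_contra hno
    apply hw.2
    apply b.repr.injective
    ext i
    have := b.sub_mul_repr_eq_zero A hb hw.apply_eq_smul i
    rw [mul_eq_zero, sub_eq_zero] at this
    rcases this with h | h
    · exact absurd ⟨i, h⟩ hno
    · simpa using h
  have hcard : range mu = range lam := by
    refine Set.eq_of_subset_of_ncard_le key ?_ (finite_range _)
    rw [← image_univ, ← image_univ, ncard_image_of_injective _ h1.injective,
      ncard_image_of_injective _ h2.injective]
  exact (StrictMono.range_inj h1 h2).1 hcard.symm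

end Eigen

/-! ### Regularity of the characteristic speeds and of the normalized eigenvectors. -/

namespace ConservationLaw

variable {n : ℕ} (L : ConservationLaw n)

theorem speed_spec {u : State n} (h : L.StrictlyHyperbolicAt u) :
    StrictMono (fun j => L.speed j u) ∧ ∀ j, (L.jac u).HasEigenvalue (L.speed j u) := by
  have : (fun j => L.speed j u) = h.choose := by
    funext j; simp [speed, h]
  rw [this]
  refine ⟨h.choose_spec.1, fun j => ?_⟩
  rw [congrFun this j]
  exact h.choose_spec.2 j

theorem speed_eq {u : State n} {lam : Fin n → ℝ} (h1 : StrictMono lam)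
    (h2 : ∀ j, (L.jac u).HasEigenvalue (lam j)) (j : Fin n) : L.speed j u = lam j := by
  have h := L.speed_spec ⟨lam, h1, h2⟩
  exact congrFun (eq_of_strictMono_eigenvalue h.1 h1 h.2 h2) j

end ConservationLaw

noncomputable section

namespace ConservationLaw

variable {n : ℕ} (L : ConservationLaw n)

/-- Smooth branches of eigenvalues and eigenvectors of matrices near `Df(0)`. -/
structure EigenBranches (Λ : Fin n → (State n →L[ℝ] State n) → ℝ)
    (R : Fin n → (State n →L[ℝ] State n) → State n) : Prop where
  contDiffAt_val : ∀ j, ContDiffAt ℝ 4 (Λ j) (fderiv ℝ L.f 0)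
  contDiffAt_vec : ∀ j, ContDiffAt ℝ 4 (R j) (fderiv ℝ L.f 0)
  val_zero : ∀ j, Λ j (fderiv ℝ L.f 0) = L.speed j 0
  vec_zero : ∀ j, R j (fderiv ℝ L.f 0) = L.r j 0
  eventually_eigen : ∀ᶠ A in 𝓝 (fderiv ℝ L.f 0), StrictMono (fun j => Λ j A) ∧
    (∀ j, A (R j A) = Λ j A • R j A) ∧ ∀ j, R j A ≠ 0

variable {L}

theorem HypothesisF.contDiffAt (hF : L.HypothesisF) : ContDiffAt ℝ 4 L.f 0 :=
  hF.contDiffOn.contDiffAt (hF.isOpen.mem_nhds hF.zero_mem)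

theorem HypothesisF.contDiffAt_fderiv (hF : L.HypothesisF) : ContDiffAt ℝ 3 (fderiv ℝ L.f) 0 :=
  hF.contDiffAt.fderiv_right (by norm_num)

theorem exists_eigenBranches (hF : L.HypothesisF) (hr : L.IsNormalized) :
    ∃ Λ R, L.EigenBranches Λ R := by
  have h0 := L.speed_spec (hF.hyperbolic 0 hF.zero_mem)
  have hv := fun j => hr.eigenvector j 0 hF.zero_mem
  have hli := Module.End.eigenvectors_linearIndependent' (L.jac 0) (fun j => L.speed j 0)
    h0.1.injective (fun j => L.r j 0) hv
  let b := basisOfLinearIndependentOfCardEqFinrank' _ hli (by simp)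
  have hb : ∀ i, b i = L.r i 0 := fun i => by
    simp [b, coe_basisOfLinearIndependentOfCardEqFinrank']
  have hA : ∀ i, fderiv ℝ L.f 0 (b i) = L.speed i 0 • b i := fun i => by
    rw [hb]; exact (hv i).apply_eq_smul
  choose Λ R h1 h2 h3 h4 h5 using exists_contDiffAt_eigen b _ h0.1.injective hA
  refine ⟨Λ, R, h1, h2, h3, fun j => (h4 j).trans (hb j), ?_⟩
  have hmono : ∀ᶠ A in 𝓝 (fderiv ℝ L.f 0), ∀ i j, i < j → Λ i A < Λ j A := by
    rw [eventually_all]; intro i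
    rw [eventually_all]; intro j
    by_cases hij : i < j
    · have : Λ i (fderiv ℝ L.f 0) < Λ j (fderiv ℝ L.f 0) := by rw [h3, h3]; exact h0.1 hij
      filter_upwards [(h1 i).continuousAt.eventually_lt (h1 j).continuousAt this] with A hA _
      exact hA
    · exact Eventually.of_forall fun A h => absurd h hij
  have hne : ∀ᶠ A in 𝓝 (fderiv ℝ L.f 0), ∀ j, R j A ≠ 0 := by
    rw [eventually_all]; intro j
    exact (h2 j).continuousAt.eventually_ne (by rw [h4, hb]; exact (hv j).2)
  filter_upwards [hmono, hne, eventually_all.2 h5] with A e1 e2 e3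
  exact ⟨fun i j hij => e1 i j hij, e3, e2⟩

variable {Λ : Fin n → (State n →L[ℝ] State n) → ℝ}
  {R : Fin n → (State n →L[ℝ] State n) → State n}

/-- Eigenvectors with eigenvalue near `λⱼ(0)` are multiples of the `j`-th branch. -/
theorem EigenBranches.exists_eq_smul (hE : L.EigenBranches Λ R) (hF : L.HypothesisF) (j : Fin n) :
    ∃ d > 0, ∀ᶠ A in 𝓝 (fderiv ℝ L.f 0), |Λ j A - L.speed j 0| < d ∧
      ∀ s w, |s - L.speed j 0| < d → A w = s • w →
      ∃ c : ℝ, w = c • R j A := by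
  have h0 := L.speed_spec (hF.hyperbolic 0 hF.zero_mem)
  -- With `d` at most half the spectral gap, an eigenvalue within `d` of the `j`-th one cannot equal
  -- another branch, which stays within `d` of its own value at `0`.
  obtain ⟨d, hd, hsep⟩ : ∃ d > 0, ∀ i, i ≠ j → 2 * d ≤ |L.speed i 0 - L.speed j 0| := by
    have : ∀ i, ∃ d > 0, i ≠ j → 2 * d ≤ |L.speed i 0 - L.speed j 0| := by
      intro i
      by_cases hij : i = j
      · exact ⟨1, one_pos, fun h => absurd hij h⟩
      · have : 0 < |L.speed i 0 - L.speed j 0| :=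
          abs_pos.2 (sub_ne_zero.2 (h0.1.injective.ne hij))
        exact ⟨_, half_pos this, fun _ => by linarith⟩
    choose d hd h using this
    refine ⟨Finset.univ.inf' ⟨j, Finset.mem_univ j⟩ d, ?_, fun i hi => le_trans ?_ (h i hi)⟩
    · exact (Finset.lt_inf'_iff _).2 fun i _ => hd i
    · gcongr
      exact Finset.inf'_le d (Finset.mem_univ i)
  refine ⟨d, hd, ?_⟩
  have hclose : ∀ᶠ A in 𝓝 (fderiv ℝ L.f 0), ∀ i, |Λ i A - L.speed i 0| < d := by
    rw [eventually_all]; intro i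
    filter_upwards [(hE.contDiffAt_val i).continuousAt.eventually (Metric.ball_mem_nhds _ hd)]
      with A hA
    rwa [← hE.val_zero, ← Real.dist_eq]
  filter_upwards [hE.eventually_eigen, hclose] with A hA hc
  refine ⟨hc j, fun s w hs hw => ?_⟩
  have hli := Module.End.eigenvectors_linearIndependent' (A : Module.End ℝ (State n))
    (fun j => Λ j A) hA.1.injective (fun j => R j A)
    (fun j => ⟨Module.End.mem_eigenspace_iff.2 (hA.2.1 j), hA.2.2 j⟩)
  let b := basisOfLinearIndependentOfCardEqFinrank' _ hli (by simp)
  have hb : ∀ i, b i = R i A := fun i => by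
    simp [b, coe_basisOfLinearIndependentOfCardEqFinrank']
  refine ⟨b.repr w j, ?_⟩
  have hz : ∀ i, i ≠ j → b.repr w i = 0 := by
    intro i hi
    have := b.sub_mul_repr_eq_zero (A : State n →ₗ[ℝ] State n) (lam := fun i => Λ i A)
      (fun i => by rw [hb]; exact hA.2.1 i) hw i
    rcases mul_eq_zero.1 this with h | h
    · exfalso
      have e1 := hsep i hi
      have e2 := hc i
      have e3 : s = Λ i A := by linarith
      rw [e3] at hs
      have : |L.speed i 0 - L.speed j 0| < 2 * d := by
        rw [abs_lt] at *; constructor <;> linarith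
      linarith
    · exact h
  conv_lhs => rw [← b.sum_repr w]
  rw [Finset.sum_eq_single j (fun i _ hi => by rw [hz i hi, zero_smul]) (by simp), hb]

theorem eventually_mem_Ω (hF : L.HypothesisF) : ∀ᶠ u in 𝓝 (0 : State n), u ∈ L.Ω :=
  hF.isOpen.mem_nhds hF.zero_mem

/-- The speeds are defined by a choice at each state. The smooth branches form an increasing list of
eigenvalues, and such a list is unique. -/
theorem EigenBranches.eventually_speed_eq (hE : L.EigenBranches Λ R) (hF : L.HypothesisF)
    (j : Fin n) : (fun u => Λ j (fderiv ℝ L.f u)) =ᶠ[𝓝 0] L.speed j := by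
  filter_upwards [hF.contDiffAt_fderiv.continuousAt.eventually hE.eventually_eigen] with u hu
  refine (L.speed_eq hu.1 (fun i => ?_) j).symm
  exact Module.End.hasEigenvalue_of_hasEigenvector (x := R i (fderiv ℝ L.f u))
    ⟨Module.End.mem_eigenspace_iff.2 (hu.2.1 i), hu.2.2 i⟩

theorem EigenBranches.contDiffAt_speed (hE : L.EigenBranches Λ R) (hF : L.HypothesisF)
    (j : Fin n) : ContDiffAt ℝ 3 (L.speed j) 0 :=
  ((((hE.contDiffAt_val j).of_le (by norm_num)).comp (0 : State n)
    hF.contDiffAt_fderiv)).congr_of_eventuallyEq (hE.eventually_speed_eq hF j).symm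

theorem EigenBranches.contDiffAt_vec_fderiv (hE : L.EigenBranches Λ R) (hF : L.HypothesisF)
    (j : Fin n) : ContDiffAt ℝ 3 (fun u => R j (fderiv ℝ L.f u)) 0 :=
  ((hE.contDiffAt_vec j).of_le (by norm_num)).comp (0 : State n) hF.contDiffAt_fderiv

theorem EigenBranches.eventually_r_eq (hE : L.EigenBranches Λ R) (hF : L.HypothesisF)
    (hr : L.IsNormalized) (j : Fin n) :
    ∀ᶠ u in 𝓝 0, ∃ c : ℝ, L.r j u = c • R j (fderiv ℝ L.f u) := by
  obtain ⟨d, hd, h⟩ := hE.exists_eq_smul hF j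
  filter_upwards [hF.contDiffAt_fderiv.continuousAt.eventually h, hE.eventually_speed_eq hF j,
    eventually_mem_Ω hF] with u h1 h2 h3
  refine h1.2 (L.speed j u) _ ?_ (hr.eigenvector j u h3).apply_eq_smul
  rw [← h2]; exact h1.1

theorem EigenBranches.r_eq_of_genuinelyNonlinear (hE : L.EigenBranches Λ R) (hF : L.HypothesisF)
    (hr : L.IsNormalized) {j : Fin n} (hj : L.GenuinelyNonlinear j) :
    L.r j =ᶠ[𝓝 0] fun u => (L.k j / fderiv ℝ (L.speed j) u (R j (fderiv ℝ L.f u))) •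
      R j (fderiv ℝ L.f u) := by
  filter_upwards [hE.eventually_r_eq hF hr j, eventually_mem_Ω hF] with u ⟨c, hc⟩ hu
  have h1 := hr.nonlinear j hj u hu
  rw [hc, map_smul, smul_eq_mul] at h1
  have hk := hr.k_pos j
  have hne : fderiv ℝ (L.speed j) u (R j (fderiv ℝ L.f u)) ≠ 0 := by
    intro h; rw [h] at h1; simp at h1; linarith
  rw [hc, ← h1]
  field_simp

/-- In a genuinely nonlinear field the normalization fixes the multiple of the smooth branch, at the
cost of one derivative of the speed. In a linearly degenerate field `|r| = 1` fixes it up to sign,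
and continuity at `0` fixes the sign. -/
theorem EigenBranches.contDiffAt_r (hE : L.EigenBranches Λ R) (hF : L.HypothesisF)
    (hr : L.IsNormalized) (j : Fin n) : ContDiffAt ℝ 2 (L.r j) 0 := by
  have hR : ContDiffAt ℝ 2 (fun u => R j (fderiv ℝ L.f u)) 0 :=
    (hE.contDiffAt_vec_fderiv hF j).of_le (by norm_num)
  by_cases hj : L.GenuinelyNonlinear j
  · refine ContDiffAt.congr_of_eventuallyEq ?_ (hE.r_eq_of_genuinelyNonlinear hF hr hj)
    have h1 : ContDiffAt ℝ 2 (fderiv ℝ (L.speed j)) 0 :=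
      (hE.contDiffAt_speed hF j).fderiv_right (by norm_num)
    refine ContDiffAt.smul (contDiffAt_const.div (h1.clm_apply hR) ?_) hR
    rw [hE.vec_zero, hr.nonlinear j hj 0 hF.zero_mem]
    exact (hr.k_pos j).ne'
  · have hld := (hF.fields j).resolve_left hj
    have hR0 : R j (fderiv ℝ L.f 0) ≠ 0 := by
      rw [hE.vec_zero]; exact (hr.eigenvector j 0 hF.zero_mem).2
    have hpos : ∀ᶠ u in 𝓝 (0 : State n), 0 < inner ℝ (L.r j u) (R j (fderiv ℝ L.f u)) := by
      have hc : ContinuousAt (fun u => inner ℝ (L.r j u) (R j (fderiv ℝ L.f u))) 0 :=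
        (hr.continuous_near_zero j).self_of_nhds.inner hR.continuousAt
      refine hc.eventually_const_lt ?_
      change 0 < inner ℝ (L.r j 0) (R j (fderiv ℝ L.f 0))
      rw [hE.vec_zero, real_inner_self_eq_norm_sq, hr.degenerate j hld 0 hF.zero_mem]
      norm_num
    have heq : L.r j =ᶠ[𝓝 0] fun u => ‖R j (fderiv ℝ L.f u)‖⁻¹ • R j (fderiv ℝ L.f u) := by
      filter_upwards [hE.eventually_r_eq hF hr j, eventually_mem_Ω hF, hpos] with u ⟨c, hc⟩ hu hp
      have h1 := hr.degenerate j hld u hu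
      rw [hc, real_inner_smul_left, real_inner_self_eq_norm_sq] at hp
      have hc0 : 0 < c := pos_of_mul_pos_left hp (by positivity)
      rw [hc, norm_smul, Real.norm_of_nonneg hc0.le] at h1
      rw [hc, eq_inv_of_mul_eq_one_left h1]
    refine ContDiffAt.congr_of_eventuallyEq ?_ heq
    exact ((hR.norm ℝ hR0).inv (norm_ne_zero_iff.2 hR0)).smul hR

end ConservationLaw

end

/-! ### The local flow of a vector field of class `C^{1,1}`. -/

section Flow

variable {X : Type*} [NormedAddCommGroup X] [NormedSpace ℝ X]

/-- `x` solves `x' = s g(x)` on the unit interval. -/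
def IsUnitCurve (g : X → X) (s : ℝ) (x : ℝ → X) : Prop :=
  ∀ τ ∈ Icc (0 : ℝ) 1, HasDerivWithinAt x (s • g (x τ)) (Icc 0 1) τ

theorem gronwallBound_le_of_mem_Icc {δ K ε t : ℝ} (hδ : 0 ≤ δ) (hK : 1 ≤ K) (hε : 0 ≤ ε)
    (ht : t ∈ Icc (0 : ℝ) 1) : gronwallBound δ K ε t ≤ (δ + ε) * Real.exp K := by
  rw [gronwallBound_of_K_ne_0 (by positivity)]
  have h1 : Real.exp (K * t) ≤ Real.exp K :=
    Real.exp_le_exp.2 (by nlinarith [ht.1, ht.2])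
  have h2 : 1 ≤ Real.exp (K * t) := Real.one_le_exp (mul_nonneg (by linarith) ht.1)
  have h3 : ε / K ≤ ε := div_le_self hε hK
  have h4 : ε / K * (Real.exp (K * t) - 1) ≤ ε * Real.exp K := by
    refine mul_le_mul h3 (by linarith) (by linarith) hε
  nlinarith [mul_le_mul_of_nonneg_left h1 hδ]

namespace IsUnitCurve

variable {g : X → X} {s : ℝ} {x : ℝ → X}

theorem continuousOn (h : IsUnitCurve g s x) : ContinuousOn x (Icc 0 1) :=
  fun τ hτ => (h τ hτ).continuousWithinAt

theorem hasDerivWithinAt_Ici (h : IsUnitCurve g s x) {τ : ℝ} (hτ : τ ∈ Ico (0 : ℝ) 1) :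
    HasDerivWithinAt x (s • g (x τ)) (Ici τ) τ :=
  (h τ (Ico_subset_Icc_self hτ)).mono_of_mem_nhdsWithin (Icc_mem_nhdsGE_of_mem hτ)

theorem norm_lt (h : IsUnitCurve g s x) {ρ M : ℝ} (hM : ∀ y, ‖y‖ < ρ → ‖g y‖ ≤ M)
    (hx : ‖x 0‖ < ρ / 2) (hs : |s| * M < ρ / 3) {τ : ℝ} (hτ : τ ∈ Icc (0 : ℝ) 1) :
    ‖x τ‖ < ρ := by
  have hρ : 0 < ρ := by linarith [norm_nonneg (x 0)]
  have := image_norm_le_of_norm_deriv_right_lt_deriv_boundary (f := x)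
    (f' := fun τ => s • g (x τ)) (a := 0) (b := 1) (B := fun t => ρ / 2 + ρ / 3 * t)
    (B' := fun _ => ρ / 3) h.continuousOn (fun t ht => h.hasDerivWithinAt_Ici ht)
    (by simpa using hx.le) (fun t => by
      simpa using ((hasDerivAt_id t).const_mul (ρ / 3)).const_add (ρ / 2)) (fun t ht hb => by
      rw [norm_smul, Real.norm_eq_abs]
      refine lt_of_le_of_lt ?_ hs
      gcongr
      apply hM
      rw [hb]
      nlinarith [ht.1, ht.2]) hτ
  nlinarith [hτ.1, hτ.2]

theorem norm_sub_le (h : IsUnitCurve g s x) {M : ℝ} (hM : ∀ τ ∈ Icc (0 : ℝ) 1, ‖g (x τ)‖ ≤ M)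
    {τ : ℝ} (hτ : τ ∈ Icc (0 : ℝ) 1) : ‖x τ - x 0‖ ≤ |s| * M := by
  have hM0 : 0 ≤ M := (norm_nonneg _).trans (hM τ hτ)
  have := norm_image_sub_le_of_norm_deriv_le_segment' (f := x) (f' := fun τ => s • g (x τ))
    (a := 0) (b := 1) (C := |s| * M) h (fun t ht => by
      rw [norm_smul, Real.norm_eq_abs]
      gcongr
      exact hM t (Ico_subset_Icc_self ht)) τ hτ
  refine this.trans ?_
  have : 0 ≤ |s| * M := by positivity
  nlinarith [hτ.1, hτ.2]

/-- Lipschitz dependence on the parameter and the initial value. -/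
theorem norm_sub_le_of (h : IsUnitCurve g s x) {s' : ℝ} {x' : ℝ → X} (h' : IsUnitCurve g s' x')
    {K M : ℝ} {S : Set X} (hK1 : 1 ≤ K) (hM0 : 0 ≤ M) (hK : ∀ a ∈ S, ∀ b ∈ S, ‖g a - g b‖ ≤ K * ‖a - b‖)
    (hM : ∀ a ∈ S, ‖g a‖ ≤ M) (hx : ∀ τ ∈ Icc (0 : ℝ) 1, x τ ∈ S)
    (hx' : ∀ τ ∈ Icc (0 : ℝ) 1, x' τ ∈ S) (hs : |s| ≤ 1) {τ : ℝ} (hτ : τ ∈ Icc (0 : ℝ) 1) :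
    ‖x τ - x' τ‖ ≤ (‖x 0 - x' 0‖ + M * |s - s'|) * Real.exp K := by
  have := norm_le_gronwallBound_of_norm_deriv_right_le (f := fun t => x t - x' t)
    (f' := fun t => s • g (x t) - s' • g (x' t)) (δ := ‖x 0 - x' 0‖) (K := K)
    (ε := M * |s - s'|) (a := 0) (b := 1) (h.continuousOn.sub h'.continuousOn)
    (fun t ht => (h.hasDerivWithinAt_Ici ht).sub (h'.hasDerivWithinAt_Ici ht)) le_rfl
    (fun t ht => by
      have ht' := Ico_subset_Icc_self ht
      have : s • g (x t) - s' • g (x' t) = s • (g (x t) - g (x' t)) + (s - s') • g (x' t) := by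
        module
      rw [this]
      refine (norm_add_le _ _).trans ?_
      rw [norm_smul, norm_smul, Real.norm_eq_abs, Real.norm_eq_abs]
      have e1 := hK _ (hx t ht') _ (hx' t ht')
      have e2 := hM _ (hx' t ht')
      have e3 : |s| * ‖g (x t) - g (x' t)‖ ≤ 1 * (K * ‖x t - x' t‖) := by gcongr
      have e4 : |s - s'| * ‖g (x' t)‖ ≤ |s - s'| * M := by gcongr
      linarith) τ hτ
  refine this.trans ?_
  rw [sub_zero]
  exact gronwallBound_le_of_mem_Icc (norm_nonneg _) hK1 (by positivity) hτ

end IsUnitCurve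

/-- The local flow of a vector field of class `C^{1,1}` near `0`. -/
structure IsLocalFlow (g : X → X) (U : Set X) (φ : ℝ × X → X) : Prop where
  quadAt : QuadAt φ (0, 0)
  quadratic : ∃ C : ℝ, ∀ᶠ p in 𝓝 ((0, 0) : ℝ × X), ‖φ p - p.2 - p.1 • g p.2‖ ≤ C * p.1 ^ 2
  curve : ∀ᶠ p in 𝓝 ((0, 0) : ℝ × X), ∃ γ : ℝ → X, γ 0 = p.2 ∧ γ p.1 = φ p ∧
    ∀ τ ∈ uIcc 0 p.1, γ τ ∈ U ∧ HasDerivWithinAt γ (g (γ τ)) (uIcc 0 p.1) τ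
  unique : ∀ᶠ p in 𝓝 ((0, 0) : ℝ × X), ∀ γ : ℝ → X, γ 0 = p.2 →
    (∀ τ ∈ uIcc 0 p.1, HasDerivWithinAt γ (g (γ τ)) (uIcc 0 p.1) τ) → γ p.1 = φ p
  add : ∀ᶠ p in 𝓝 ((0, 0, 0) : ℝ × ℝ × X), φ (p.1, φ (p.2.1, p.2.2)) = φ (p.1 + p.2.1, p.2.2)

theorem isUnitCurve_comp_mul {g : X → X} {γ : ℝ → X} {s t : ℝ} {I : Set ℝ}
    (hI : ∀ τ ∈ Icc (0 : ℝ) 1, t + s * τ ∈ I)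
    (h : ∀ τ ∈ I, HasDerivWithinAt γ (g (γ τ)) I τ) :
    IsUnitCurve g s (fun τ => γ (t + s * τ)) := by
  intro τ hτ
  have h1 : HasDerivWithinAt (fun τ : ℝ => t + s * τ) s (Icc 0 1) τ := by
    simpa using (((hasDerivAt_id τ).const_mul s).const_add t).hasDerivWithinAt
  exact (h _ (hI τ hτ)).scomp τ h1 hI

theorem mul_mem_uIcc {s τ : ℝ} (hτ : τ ∈ Icc (0 : ℝ) 1) : 0 + s * τ ∈ uIcc 0 s := by
  rw [mem_uIcc]
  rcases le_total 0 s with h | h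
  · left; constructor <;> nlinarith [hτ.1, hτ.2]
  · right; constructor <;> nlinarith [hτ.1, hτ.2]

-- Picard–Lindelöf provides the curves. Rescaling time to `[0, 1]` turns the parameter `s` into a
-- factor of the field. The second difference of four unit curves then satisfies a linear
-- differential inequality, by the second-difference bound for `(s, y) ↦ s • g y`, and Gronwall's
-- inequality gives the regularity of the flow.
set_option maxHeartbeats 1000000 in
theorem exists_isLocalFlow [CompleteSpace X] {g : X → X} (hg : QuadAt g 0) {U : Set X}
    (hU : U ∈ 𝓝 0) : ∃ φ, IsLocalFlow g U φ := by
  obtain ⟨K₀, hK₀, S₀, hS₀, hL₀⟩ := hg.exists_lipschitz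
  have hH : QuadAt (fun p : ℝ × X => p.1 • g p.2) (0, 0) := by
    refine QuadAt.smul (QuadAt.of_contDiff contDiff_fst) ?_
    exact QuadAt.comp (F := Prod.snd) (x := ((0, 0) : ℝ × X)) hg (QuadAt.of_contDiff contDiff_snd)
  obtain ⟨Q, hQ, S₁, hS₁, hq⟩ := hH
  obtain ⟨ρ₁, hρ₁, hsub₁⟩ := Metric.mem_nhds_iff.1 hS₁
  obtain ⟨ρ₀, hρ₀, hsub₀⟩ := Metric.mem_nhds_iff.1 (inter_mem hS₀ hU)
  set K := K₀ + 1 with hKdef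
  set ρ := min ρ₀ ρ₁ with hρdef
  have hρ : 0 < ρ := by positivity
  set S : Set X := Metric.ball 0 ρ with hS
  have hSmem : ∀ y, y ∈ S ↔ ‖y‖ < ρ := fun y => by rw [hS, mem_ball_zero_iff]
  have hSsub : ∀ y ∈ S, y ∈ S₀ ∩ U := fun y hy =>
    hsub₀ (Metric.ball_subset_ball (min_le_left _ _) hy)
  have hL : ∀ a ∈ S, ∀ b ∈ S, ‖g a - g b‖ ≤ K * ‖a - b‖ := fun a ha b hb =>
    (hL₀ a (hSsub a ha).1 b (hSsub b hb).1).trans (by gcongr; linarith)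
  set M := ‖g 0‖ + K * ρ with hMdef
  have hM0 : 0 ≤ M := by positivity
  have hM : ∀ a ∈ S, ‖g a‖ ≤ M := by
    intro a ha
    have h1 := hL a ha 0 (by rw [hSmem]; simpa)
    have h2 : ‖g a‖ ≤ ‖g 0‖ + ‖g a - g 0‖ := by
      simpa using norm_add_le (g 0) (g a - g 0)
    rw [sub_zero] at h1
    have h3 : K * ‖a‖ ≤ K * ρ := by gcongr; exact ((hSmem a).1 ha).le
    linarith
  have hK1 : 1 ≤ K := by linarith
  have hqS : ∀ s, |s| < ρ → ∀ a ∈ S, (s, a) ∈ S₁ := by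
    intro s hs a ha
    apply hsub₁
    rw [hSmem] at ha
    simp only [mem_ball_iff_norm, Prod.norm_def, Prod.mk_sub_mk, sub_zero, sup_lt_iff]
    exact ⟨hs.trans_le (min_le_right _ _), ha.trans_le (min_le_right _ _)⟩
  -- the radius of the parameter domain
  obtain ⟨η, hη, hη1, hηM, hηρ⟩ : ∃ η > 0, η ≤ 1 ∧ η * M < ρ / 12 ∧ η < ρ / 4 := by
    refine ⟨min (min 1 (ρ / (24 * (M + 1)))) (ρ / 8), by positivity,
      (min_le_left _ _).trans (min_le_left _ _), ?_, ?_⟩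
    · have h1 : min (min 1 (ρ / (24 * (M + 1)))) (ρ / 8) ≤ ρ / (24 * (M + 1)) :=
        (min_le_left _ _).trans (min_le_right _ _)
      calc _ ≤ ρ / (24 * (M + 1)) * M := by gcongr
        _ ≤ ρ / (24 * (M + 1)) * (M + 1) := by gcongr; linarith
        _ = ρ / 24 := by field_simp
        _ < ρ / 12 := by linarith
    · exact lt_of_le_of_lt (min_le_right _ _) (by linarith)
  have hstay : ∀ {s : ℝ} {x : ℝ → X}, IsUnitCurve g s x → |s| ≤ η → ‖x 0‖ < ρ / 2 →
      ∀ τ ∈ Icc (0 : ℝ) 1, x τ ∈ S := by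
    intro s x h hs hx τ hτ
    rw [hSmem]
    refine h.norm_lt (fun y hy => hM y ((hSmem y).2 hy)) hx ?_ hτ
    have : |s| * M ≤ η * M := by gcongr
    linarith
  have hdiff : ∀ {s s' : ℝ} {x x' : ℝ → X}, IsUnitCurve g s x → IsUnitCurve g s' x' → |s| ≤ η →
      |s'| ≤ η → ‖x 0‖ < ρ / 2 → ‖x' 0‖ < ρ / 2 → ∀ τ ∈ Icc (0 : ℝ) 1,
      ‖x τ - x' τ‖ ≤ (‖x 0 - x' 0‖ + M * |s - s'|) * Real.exp K := by
    intro s s' x x' h h' hs hs' hx hx' τ hτ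
    exact h.norm_sub_le_of h' hK1 hM0 hL hM (hstay h hs hx) (hstay h' hs' hx') (hs.trans hη1) hτ
  -- the flow
  have hPL : IsPicardLindelof (fun _ => g) (tmin := -(2 * η)) (tmax := 2 * η)
      ⟨0, by constructor <;> linarith⟩ 0 ⟨ρ / 2, by positivity⟩ ⟨ρ / 4, by positivity⟩
      ⟨M, hM0⟩ ⟨K, by positivity⟩ := by
    apply IsPicardLindelof.of_time_independent
    · intro y hy
      refine hM y ?_
      rw [mem_closedBall_zero_iff] at hy
      have : ‖y‖ ≤ ρ / 2 := hy
      rw [hSmem]; linarith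
    · refine LipschitzOnWith.of_dist_le_mul fun y hy z hz => ?_
      rw [mem_closedBall_zero_iff] at hy hz
      have h1 : ‖y‖ ≤ ρ / 2 := hy
      have h2 : ‖z‖ ≤ ρ / 2 := hz
      rw [dist_eq_norm, dist_eq_norm]
      refine hL y ?_ z ?_ <;> rw [hSmem] <;> linarith
    · change M * max (2 * η - 0) (0 - -(2 * η)) ≤ ρ / 2 - ρ / 4
      rw [sub_zero, zero_sub, neg_neg, max_self]
      nlinarith
  obtain ⟨α, hα⟩ := hPL.exists_forall_mem_closedBall_eq_forall_mem_Icc_hasDerivWithinAt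
  have hα0 : ∀ z, ‖z‖ < ρ / 4 → α z 0 = z := fun z hz =>
    (hα z (mem_closedBall_zero_iff.2 hz.le)).1
  have hα1 : ∀ z, ‖z‖ < ρ / 4 → ∀ t ∈ Icc (-(2 * η)) (2 * η),
      HasDerivWithinAt (α z) (g (α z t)) (Icc (-(2 * η)) (2 * η)) t := fun z hz =>
    (hα z (mem_closedBall_zero_iff.2 hz.le)).2
  -- The time window is twice the parameter range so that a curve may be entered at a time `t` and
  -- followed for a further time `s`, as the group law requires.
  have hunit : ∀ z s t, ‖z‖ < ρ / 4 → |s| ≤ η → |t| ≤ η →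
      IsUnitCurve g s (fun τ => α z (t + s * τ)) := by
    intro z s t hz hs ht
    refine isUnitCurve_comp_mul (fun τ hτ => ?_) (hα1 z hz)
    rw [abs_le] at hs ht
    constructor <;> nlinarith [hτ.1, hτ.2]
  set φ : ℝ × X → X := fun p => α p.2 p.1 with hφ
  have hball : ∀ᶠ p in 𝓝 ((0, 0) : ℝ × X), |p.1| ≤ η ∧ ‖p.2‖ < ρ / 4 := by
    have h1 : ∀ᶠ p in 𝓝 ((0, 0) : ℝ × X), |p.1| < η :=
      (continuous_fst.abs.continuousAt).eventually_lt_const (by simpa using hη)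
    have h2 : ∀ᶠ p in 𝓝 ((0, 0) : ℝ × X), ‖p.2‖ < ρ / 4 :=
      (continuous_snd.norm.continuousAt).eventually_lt_const (by simpa using hρ)
    filter_upwards [h1, h2] with p p1 p2 using ⟨p1.le, p2⟩
  -- unit curves through points of the parameter domain
  have hcurve : ∀ p : ℝ × X, |p.1| ≤ η → ‖p.2‖ < ρ / 4 →
      IsUnitCurve g p.1 (fun τ => α p.2 (0 + p.1 * τ)) := fun p h1 h2 =>
    hunit p.2 p.1 0 h2 h1 (by simpa using hη.le)
  have hstart : ∀ p : ℝ × X, ‖p.2‖ < ρ / 4 → ‖α p.2 (0 + p.1 * 0)‖ < ρ / 2 := fun p hp => by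
    rw [mul_zero, add_zero, hα0 _ hp]; linarith
  have huniq : ∀ p : ℝ × X, |p.1| ≤ η → ‖p.2‖ < ρ / 4 → ∀ x, IsUnitCurve g p.1 x → x 0 = p.2 →
      x 1 = φ p := by
    intro p h1 h2 x hx hx0
    have := hdiff hx (hcurve p h1 h2) h1 h1 (by rw [hx0]; linarith) (hstart p h2) 1
      (by simp)
    simp only [mul_zero, add_zero, hα0 _ h2, hx0, sub_self, norm_zero, abs_zero,
      zero_mul, mul_one, zero_add] at this
    exact sub_eq_zero.1 (norm_le_zero_iff.1 this)
  have hC : ∃ C : ℝ, ∀ᶠ p in 𝓝 ((0, 0) : ℝ × X), ‖φ p - p.2 - p.1 • g p.2‖ ≤ C * p.1 ^ 2 := by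
    refine ⟨K * M, ?_⟩
    filter_upwards [hball] with p hp
    obtain ⟨h1, h2⟩ := hp
    have hx := hcurve p h1 h2
    have hin := hstay hx h1 (hstart p h2)
    set x : ℝ → X := fun τ => α p.2 (0 + p.1 * τ) with hxdef
    have hx0 : x 0 = p.2 := by simp [hxdef, hα0 _ h2]
    have hp2 : p.2 ∈ S := by rw [hSmem]; linarith
    have := norm_image_sub_le_of_norm_deriv_le_segment_01'
      (f := fun τ => x τ - τ • (p.1 • g p.2))
      (f' := fun τ => p.1 • g (x τ) - p.1 • g p.2) (C := K * M * p.1 ^ 2)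
      (fun t ht => ((hx t ht).sub
        (by simpa using (hasDerivAt_id t).hasDerivWithinAt.smul_const (p.1 • g p.2))))
      (fun t ht => by
        have ht' := Ico_subset_Icc_self ht
        rw [← smul_sub, norm_smul, Real.norm_eq_abs]
        have e1 := hL _ (hin t ht') _ hp2
        have e2 := hx.norm_sub_le (fun τ hτ => hM _ (hin τ hτ)) ht'
        rw [hx0] at e2
        calc |p.1| * ‖g (x t) - g p.2‖ ≤ |p.1| * (K * (|p.1| * M)) := by
              gcongr; exact e1.trans (by gcongr)
          _ = _ := by rw [← sq_abs p.1]; ring)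
    convert! this using 2
    simp only [hxdef, hφ, mul_one, zero_add, mul_zero, one_smul, zero_smul, sub_zero, hα0 _ h2]
    abel
  have hquad : QuadAt φ (0, 0) := by
    set B := (1 + M) * Real.exp K with hB
    have hB0 : 0 ≤ B := by positivity
    refine ⟨(1 + Q * (1 + (1 + B) * (1 + B))) * Real.exp (Q + 1), by positivity, _, hball, ?_⟩
    intro a ha b hb c hc d hd
    set x : ℝ × X → ℝ → X := fun p τ => α p.2 (0 + p.1 * τ) with hxdef
    have hxu : ∀ p : ℝ × X, |p.1| ≤ η ∧ ‖p.2‖ < ρ / 4 → IsUnitCurve g p.1 (x p) ∧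
        (∀ τ ∈ Icc (0 : ℝ) 1, x p τ ∈ S) ∧ x p 0 = p.2 ∧ x p 1 = φ p ∧
        ∀ τ ∈ Icc (0 : ℝ) 1, (p.1, x p τ) ∈ S₁ := by
      intro p hp
      have h1 := hcurve p hp.1 hp.2
      have h2 := hstay h1 hp.1 (hstart p hp.2)
      refine ⟨h1, h2, by simp [hxdef, hα0 _ hp.2], by simp [hxdef, hφ], fun τ hτ =>
        hqS _ (by linarith [hp.1]) _ (h2 τ hτ)⟩
    have hlip : ∀ p q : ℝ × X, |p.1| ≤ η ∧ ‖p.2‖ < ρ / 4 → |q.1| ≤ η ∧ ‖q.2‖ < ρ / 4 →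
        ∀ τ ∈ Icc (0 : ℝ) 1, ‖((p.1, x p τ) : ℝ × X) - (q.1, x q τ)‖ ≤ (1 + B) * ‖p - q‖ := by
      intro p q hp hq τ hτ
      have h1 := hdiff (hcurve p hp.1 hp.2) (hcurve q hq.1 hq.2) hp.1 hq.1 (hstart p hp.2)
        (hstart q hq.2) τ hτ
      rw [mul_zero, mul_zero, add_zero, hα0 _ hp.2, hα0 _ hq.2] at h1
      have h2 : ‖p.2 - q.2‖ ≤ ‖p - q‖ := norm_snd_le (p - q)
      have h3 : |p.1 - q.1| ≤ ‖p - q‖ := norm_fst_le (p - q)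
      have h4 : (‖p.2 - q.2‖ + M * |p.1 - q.1|) * Real.exp K ≤
          (‖p - q‖ + M * ‖p - q‖) * Real.exp K := by gcongr
      rw [Prod.mk_sub_mk, Prod.norm_def]
      refine max_le ?_ ?_
      · change |p.1 - q.1| ≤ _
        nlinarith [norm_nonneg (p - q)]
      · change ‖x p τ - x q τ‖ ≤ _
        have : (‖p - q‖ + M * ‖p - q‖) * Real.exp K = B * ‖p - q‖ := by rw [hB]; ring
        nlinarith [norm_nonneg (p - q)]
    obtain ⟨a1, a2, a3, a4, a5⟩ := hxu a ha
    obtain ⟨b1, b2, b3, b4, b5⟩ := hxu b hb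
    obtain ⟨c1, c2, c3, c4, c5⟩ := hxu c hc
    obtain ⟨d1, d2, d3, d4, d5⟩ := hxu d hd
    set e := ‖a - b - c + d‖ with he
    set m := ‖b - d‖ * ‖c - d‖ with hm
    have hm0 : 0 ≤ m := by positivity
    -- The inhomogeneous term consists of the second difference `e` of the data and the product of
    -- the first differences of the curves, which depend on the data in a Lipschitz way with
    -- constant `1 + B`.
    have := norm_le_gronwallBound_of_norm_deriv_right_le
      (f := fun t => x a t - x b t - x c t + x d t)
      (f' := fun t => a.1 • g (x a t) - b.1 • g (x b t) - c.1 • g (x c t) + d.1 • g (x d t))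
      (δ := e) (K := Q + 1) (ε := Q * (e + (1 + B) * (1 + B) * m)) (a := 0) (b := 1)
      (((a1.continuousOn.sub b1.continuousOn).sub c1.continuousOn).add d1.continuousOn)
      (fun t ht => (((a1.hasDerivWithinAt_Ici ht).sub (b1.hasDerivWithinAt_Ici ht)).sub
        (c1.hasDerivWithinAt_Ici ht)).add (d1.hasDerivWithinAt_Ici ht))
      (by rw [a3, b3, c3, d3]; exact norm_snd_le (a - b - c + d))
      (fun t ht => by
        have ht' := Ico_subset_Icc_self ht
        have h1 := hq _ (a5 t ht') _ (b5 t ht') _ (c5 t ht') _ (d5 t ht')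
        have h2 := hlip b d hb hd t ht'
        have h3 := hlip c d hc hd t ht'
        have h4 : ‖((a.1, x a t) : ℝ × X) - (b.1, x b t) - (c.1, x c t) + (d.1, x d t)‖ ≤
            e + ‖x a t - x b t - x c t + x d t‖ := by
          simp only [Prod.mk_sub_mk, Prod.mk_add_mk, Prod.norm_def]
          refine max_le ?_ ?_
          · have : |a.1 - b.1 - c.1 + d.1| ≤ e := norm_fst_le (a - b - c + d)
            exact this.trans (by linarith [norm_nonneg (x a t - x b t - x c t + x d t)])
          · linarith [norm_nonneg (a - b - c + d)]
        refine h1.trans ?_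
        have h5 : ‖((b.1, x b t) : ℝ × X) - (d.1, x d t)‖ *
            ‖((c.1, x c t) : ℝ × X) - (d.1, x d t)‖ ≤
            ((1 + B) * ‖b - d‖) * ((1 + B) * ‖c - d‖) := by gcongr
        have h6 : ((1 + B) * ‖b - d‖) * ((1 + B) * ‖c - d‖) = (1 + B) * (1 + B) * m := by
          rw [hm]; ring
        have h7 := norm_nonneg (x a t - x b t - x c t + x d t)
        calc _ ≤ Q * (e + ‖x a t - x b t - x c t + x d t‖ + (1 + B) * (1 + B) * m) := by
              refine mul_le_mul_of_nonneg_left ?_ hQ; linarith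
          _ ≤ _ := by nlinarith) 1 (by simp)
    simp only [a4, b4, c4, d4, sub_zero] at this
    refine this.trans ((gronwallBound_le_of_mem_Icc (norm_nonneg _) (by linarith)
      (by positivity) (by simp)).trans ?_)
    have h0 : 0 ≤ e := norm_nonneg _
    have h1 : e + Q * (e + (1 + B) * (1 + B) * m) ≤ (1 + Q * (1 + (1 + B) * (1 + B))) * (e + m) := by
      have e1 : 0 ≤ Q * ((1 + B) * (1 + B)) * e := by positivity
      have e2 : 0 ≤ Q * m := by positivity
      linarith
    calc _ ≤ (1 + Q * (1 + (1 + B) * (1 + B))) * (e + m) * Real.exp (Q + 1) := by gcongr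
      _ = _ := by ring
  refine ⟨φ, hquad, hC, ?_, ?_, ?_⟩
  · filter_upwards [hball] with p hp
    have hsub : uIcc 0 p.1 ⊆ Icc (-(2 * η)) (2 * η) := by
      have := abs_le.1 hp.1
      rw [← uIcc_of_le (by linarith : -(2 * η) ≤ 2 * η)]
      apply uIcc_subset_uIcc <;> rw [uIcc_of_le (by linarith : -(2 * η) ≤ 2 * η)] <;>
        constructor <;> linarith
    refine ⟨α p.2, hα0 _ hp.2, rfl, fun τ hτ => ⟨?_, (hα1 _ hp.2 τ (hsub hτ)).mono hsub⟩⟩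
    have hτ' : |τ| ≤ η := by
      have := abs_sub_left_of_mem_uIcc hτ
      simpa using this.trans (by simpa using hp.1)
    have := hstay (hcurve (τ, p.2) hτ' hp.2) hτ' (hstart (τ, p.2) hp.2) 1 (by simp)
    have := (hSsub _ this).2
    simpa using this
  · filter_upwards [hball] with p hp γ hγ0 hγ
    have := huniq p hp.1 hp.2 _ (isUnitCurve_comp_mul (t := 0) (fun τ hτ => mul_mem_uIcc hτ) hγ)
      (by simpa using hγ0)
    simpa using this
  · have h1 : ∀ᶠ p in 𝓝 ((0, 0, 0) : ℝ × ℝ × X), |p.1| ≤ η := by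
      have : ∀ᶠ p in 𝓝 ((0, 0, 0) : ℝ × ℝ × X), |p.1| < η :=
        (continuous_fst.abs.continuousAt).eventually_lt_const (by simpa using hη)
      exact this.mono fun p hp => hp.le
    have h2 : ∀ᶠ p in 𝓝 ((0, 0, 0) : ℝ × ℝ × X), |p.2.1| ≤ η ∧ ‖p.2.2‖ < ρ / 4 :=
      (continuous_snd.tendsto ((0, 0, 0) : ℝ × ℝ × X)).eventually hball
    have h3 : ∀ᶠ p in 𝓝 ((0, 0, 0) : ℝ × ℝ × X), ‖φ p.2‖ < ρ / 4 := by
      have hφ0 : φ (0, 0) = 0 := hα0 0 (by simpa using hρ)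
      have : ContinuousAt (fun p : ℝ × ℝ × X => ‖φ p.2‖) (0, 0, 0) :=
        (ContinuousAt.comp (f := Prod.snd) (g := φ) hquad.continuousAt continuousAt_snd).norm
      refine this.eventually_lt_const ?_
      simpa [hφ0] using hρ
    filter_upwards [h1, h2, h3] with p p1 p2 p3
    have := huniq (p.1, φ p.2) p1 p3 _ (hunit p.2.2 p.1 p.2.1 p2.2 p1 p2.1) (by simp [hφ])
    rw [add_comm p.1]
    simpa using this.symm

end Flow

/-! ### Averages over segments, for the secant form of the Rankine–Hugoniot relation. -/

section Average

variable {X Y : Type*} [NormedAddCommGroup X] [NormedSpace ℝ X] [NormedAddCommGroup Y]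
  [NormedSpace ℝ Y]

theorem add_smul_sub_mem_ball {p : X × X} {ρ θ : ℝ} (h1 : ‖p.1‖ < ρ) (h2 : ‖p.2‖ < ρ)
    (hθ : θ ∈ Icc (0 : ℝ) 1) : p.1 + θ • (p.2 - p.1) ∈ Metric.ball (0 : X) ρ := by
  have := convex_ball (0 : X) ρ (mem_ball_zero_iff.2 h1) (mem_ball_zero_iff.2 h2)
    (sub_nonneg.2 hθ.2) hθ.1 (by ring)
  convert! this using 1
  module

omit [NormedSpace ℝ Y] in
theorem continuousOn_segment {G : X → Y} {p : X × X} {ρ : ℝ} (hG : ContinuousOn G (Metric.ball 0 ρ))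
    (h1 : ‖p.1‖ < ρ) (h2 : ‖p.2‖ < ρ) :
    ContinuousOn (fun θ : ℝ => G (p.1 + θ • (p.2 - p.1))) (Icc 0 1) :=
  hG.comp (by fun_prop) fun _ hθ => add_smul_sub_mem_ball h1 h2 hθ

/-- Averages over segments inherit the regularity. -/
theorem QuadAt.integral_segment [CompleteSpace Y] {G : X → Y} (hG : QuadAt G 0) :
    QuadAt (fun p : X × X => ∫ θ in (0 : ℝ)..1, G (p.1 + θ • (p.2 - p.1))) (0, 0) := by
  obtain ⟨L, -, s', hs', hL⟩ := hG.exists_lipschitz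
  obtain ⟨K, hK, s, hs, h⟩ := hG
  obtain ⟨ρ, hρ, hsub⟩ := Metric.mem_nhds_iff.1 (inter_mem hs hs')
  have hc : ContinuousOn G (Metric.ball 0 ρ) := fun y hy =>
    (continuousAt_of_mem (K := L) ((Metric.isOpen_ball.mem_nhds hy : Metric.ball 0 ρ ∈ 𝓝 y))
      (fun a ha b hb => hL a (hsub ha).2 b (hsub hb).2)).continuousWithinAt
  refine ⟨K, hK, Metric.ball (0, 0) ρ, Metric.ball_mem_nhds _ hρ, ?_⟩
  have hm : ∀ p ∈ Metric.ball ((0, 0) : X × X) ρ, ‖p.1‖ < ρ ∧ ‖p.2‖ < ρ := by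
    intro p hp
    rw [mem_ball_iff_norm, Prod.mk_zero_zero, sub_zero] at hp
    exact ⟨(norm_fst_le p).trans_lt hp, (norm_snd_le p).trans_lt hp⟩
  have hseg : ∀ (p : X × X) θ, θ ∈ Icc (0 : ℝ) 1 → ‖p.1 + θ • (p.2 - p.1)‖ ≤ ‖p‖ := by
    intro p θ hθ
    have : p.1 + θ • (p.2 - p.1) = (1 - θ) • p.1 + θ • p.2 := by module
    rw [this]
    refine (norm_add_le _ _).trans ?_
    rw [norm_smul, norm_smul, Real.norm_of_nonneg (sub_nonneg.2 hθ.2), Real.norm_of_nonneg hθ.1]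
    have h1 := norm_fst_le p
    have h2 := norm_snd_le p
    nlinarith [hθ.1, hθ.2]
  have hi : ∀ p ∈ Metric.ball ((0, 0) : X × X) ρ,
      IntervalIntegrable (fun θ : ℝ => G (p.1 + θ • (p.2 - p.1))) volume 0 1 := by
    intro p hp
    refine ContinuousOn.intervalIntegrable ?_
    rw [uIcc_of_le zero_le_one]
    exact continuousOn_segment hc (hm p hp).1 (hm p hp).2
  intro a ha b hb c hc d hd
  rw [← intervalIntegral.integral_sub (hi a ha) (hi b hb),
    ← intervalIntegral.integral_sub ((hi a ha).sub (hi b hb)) (hi c hc),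
    ← intervalIntegral.integral_add (((hi a ha).sub (hi b hb)).sub (hi c hc)) (hi d hd)]
  refine (intervalIntegral.norm_integral_le_of_norm_le_const
    (C := K * (‖a - b - c + d‖ + ‖b - d‖ * ‖c - d‖)) ?_).trans (by simp)
  intro θ hθ
  rw [uIoc_of_le zero_le_one] at hθ
  have hθ' := Ioc_subset_Icc_self hθ
  have mem : ∀ p ∈ Metric.ball ((0, 0) : X × X) ρ, p.1 + θ • (p.2 - p.1) ∈ s := fun p hp =>
    (hsub (add_smul_sub_mem_ball (hm p hp).1 (hm p hp).2 hθ')).1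
  refine (h _ (mem a ha) _ (mem b hb) _ (mem c hc) _ (mem d hd)).trans ?_
  have e1 := hseg (a - b - c + d) θ hθ'
  have e2 := hseg (b - d) θ hθ'
  have e3 := hseg (c - d) θ hθ'
  have f1 : a.1 + θ • (a.2 - a.1) - (b.1 + θ • (b.2 - b.1)) - (c.1 + θ • (c.2 - c.1)) +
      (d.1 + θ • (d.2 - d.1)) = (a - b - c + d).1 + θ • ((a - b - c + d).2 - (a - b - c + d).1) := by
    simp only [Prod.fst_add, Prod.fst_sub, Prod.snd_add, Prod.snd_sub]; module
  have f2 : b.1 + θ • (b.2 - b.1) - (d.1 + θ • (d.2 - d.1)) =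
      (b - d).1 + θ • ((b - d).2 - (b - d).1) := by
    simp only [Prod.fst_sub, Prod.snd_sub]; module
  have f3 : c.1 + θ • (c.2 - c.1) - (d.1 + θ • (d.2 - d.1)) =
      (c - d).1 + θ • ((c - d).2 - (c - d).1) := by
    simp only [Prod.fst_sub, Prod.snd_sub]; module
  rw [f1, f2, f3]
  gcongr

/-- The averaged derivative represents increments. -/
theorem integral_fderiv_segment [CompleteSpace Y] {f : X → Y} (hf : ContDiffAt ℝ 1 f 0) :
    ∀ᶠ p in 𝓝 ((0, 0) : X × X),
      (∫ θ in (0 : ℝ)..1, fderiv ℝ f (p.1 + θ • (p.2 - p.1))) (p.2 - p.1) = f p.2 - f p.1 := by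
  have h1 : ∀ᶠ y in 𝓝 (0 : X), ContDiffAt ℝ 1 f y := hf.eventually (by simp)
  obtain ⟨ρ, hρ, hsub'⟩ := Metric.mem_nhds_iff.1 h1
  have hsub : ∀ {y}, y ∈ Metric.ball (0 : X) ρ → ContDiffAt ℝ 1 f y := fun hy => hsub' hy
  have hc : ContinuousOn (fderiv ℝ f) (Metric.ball 0 ρ) := fun y hy =>
    ((hsub hy).fderiv_right (m := 0) (by norm_num)).continuousAt.continuousWithinAt
  filter_upwards [Metric.ball_mem_nhds ((0, 0) : X × X) hρ] with p hp
  rw [mem_ball_iff_norm, Prod.mk_zero_zero, sub_zero] at hp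
  have p1 := (norm_fst_le p).trans_lt hp
  have p2 := (norm_snd_le p).trans_lt hp
  have hcs := continuousOn_segment hc p1 p2
  rw [ContinuousLinearMap.intervalIntegral_apply
    (by refine ContinuousOn.intervalIntegrable ?_; rwa [uIcc_of_le zero_le_one])]
  have := intervalIntegral.integral_eq_sub_of_hasDerivAt (a := 0) (b := 1)
    (f := fun θ : ℝ => f (p.1 + θ • (p.2 - p.1)))
    (f' := fun θ : ℝ => fderiv ℝ f (p.1 + θ • (p.2 - p.1)) (p.2 - p.1)) ?_ ?_
  · simpa using this
  · intro θ hθ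
    rw [uIcc_of_le zero_le_one] at hθ
    have hd := ((hsub (add_smul_sub_mem_ball p1 p2 hθ)).differentiableAt (by simp)).hasFDerivAt
    have hl : HasDerivAt (fun θ : ℝ => p.1 + θ • (p.2 - p.1)) (p.2 - p.1) θ := by
      simpa using ((hasDerivAt_id θ).smul_const (p.2 - p.1)).const_add p.1
    exact hd.comp_hasDerivAt θ hl
  · refine ContinuousOn.intervalIntegrable ?_
    rw [uIcc_of_le zero_le_one]
    exact hcs.clm_apply continuousOn_const

end Average

/-! ### Curves defined by a secant direction and parametrized by a scalar function. -/

section HugoniotCurve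

variable {X : Type*} [NormedAddCommGroup X] [NormedSpace ℝ X] [FiniteDimensional ℝ X]

/-- The solution `γ = S (s, z)`, `p = P (s, z)` of `γ - z = p • R̂ (z, γ)`, `λ γ - λ z = k s`. -/
structure IsHugoniot (lam : X → ℝ) (k : ℝ) (r : X → X) (Rh : X × X → X) (S : ℝ × X → X)
    (P : ℝ × X → ℝ) : Prop where
  quadAt : QuadAt S (0, 0)
  zero : S (0, 0) = 0
  quadratic : ∃ C : ℝ, ∀ᶠ p in 𝓝 ((0, 0) : ℝ × X), ‖S p - p.2 - p.1 • r p.2‖ ≤ C * p.1 ^ 2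
  solves : ∀ᶠ p in 𝓝 ((0, 0) : ℝ × X), S p - p.2 = P p • Rh (p.2, S p) ∧
    lam (S p) - lam p.2 = k * p.1
  unique : ∀ᶠ q in 𝓝 ((0, 0, 0) : X × ℝ × X), q.2.2 - q.1 = q.2.1 • Rh (q.1, q.2.2) →
    q.2.2 = S ((lam q.2.2 - lam q.1) / k, q.1)

/-- `S` and `P` are components of a local inverse of `Φ (z, p, y) = (z, (lam y - lam z) / k, y - z -
p • Rh (z, y))`. Although `Rh` is only `C^{1,1}`, its coefficient `p` vanishes at the origin, so `Φ`
is strictly differentiable there. The derivative is injective since `lam` grows at the rate `k ≠ 0`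
along `r`. -/
theorem exists_isHugoniot {lam : X → ℝ} (hlam : ContDiffAt ℝ 2 lam 0) {k : ℝ} (hk : 0 < k)
    {r : X → X} {Rh : X × X → X} (hR : QuadAt Rh (0, 0)) (hRr : ∀ᶠ z in 𝓝 (0 : X), Rh (z, z) = r z)
    (hr : QuadAt r 0) (hlr : ∀ᶠ z in 𝓝 (0 : X), fderiv ℝ lam z (r z) = k) :
    ∃ S P, IsHugoniot lam k r Rh S P := by
  have : CompleteSpace X := FiniteDimensional.complete ℝ X
  have hR0 : Rh (0, 0) = r 0 := hRr.self_of_nhds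
  have hlr0 : fderiv ℝ lam 0 (r 0) = k := hlr.self_of_nhds
  set Φ : X × ℝ × X → X × ℝ × X := fun q =>
    (q.1, k⁻¹ * (lam q.2.2 - lam q.1), q.2.2 - q.1 - q.2.1 • Rh (q.1, q.2.2)) with hΦ
  have hΦ0 : Φ 0 = 0 := by simp [hΦ]
  have hlq2 : ContDiffAt ℝ 2 (fun q : X × ℝ × X => lam q.2.2) 0 :=
    ContDiffAt.comp (g := lam) (f := fun q : X × ℝ × X => q.2.2) (0 : X × ℝ × X) hlam
      (by fun_prop)
  have hlq1 : ContDiffAt ℝ 2 (fun q : X × ℝ × X => lam q.1) 0 :=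
    ContDiffAt.comp (g := lam) (f := fun q : X × ℝ × X => q.1) (0 : X × ℝ × X) hlam (by fun_prop)
  have hRq : QuadAt (fun q : X × ℝ × X => Rh (q.1, q.2.2)) 0 :=
    QuadAt.comp (G := Rh) (F := fun q : X × ℝ × X => (q.1, q.2.2)) hR
      (QuadAt.of_contDiff (by fun_prop))
  have hΦq : QuadAt Φ 0 := by
    refine QuadAt.prodMk (QuadAt.of_contDiff contDiff_fst) (QuadAt.prodMk ?_ ?_)
    · exact QuadAt.of_contDiffAt (contDiffAt_const.mul (hlq2.sub hlq1))
    · refine QuadAt.sub (QuadAt.of_contDiff (by fun_prop)) (QuadAt.smul ?_ hRq)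
      exact QuadAt.of_contDiff (by fun_prop)
  have hls : HasStrictFDerivAt lam (fderiv ℝ lam 0) 0 := hlam.hasStrictFDerivAt (by norm_num)
  set π₁ : X × ℝ × X →L[ℝ] X := ContinuousLinearMap.fst ℝ X (ℝ × X)
  set π₂ : X × ℝ × X →L[ℝ] ℝ :=
    (ContinuousLinearMap.fst ℝ ℝ X).comp (ContinuousLinearMap.snd ℝ X (ℝ × X))
  set π₃ : X × ℝ × X →L[ℝ] X :=
    (ContinuousLinearMap.snd ℝ ℝ X).comp (ContinuousLinearMap.snd ℝ X (ℝ × X))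
  set T : X × ℝ × X →L[ℝ] X × ℝ × X := π₁.prod
    ((k⁻¹ • ((fderiv ℝ lam 0).comp π₃ - (fderiv ℝ lam 0).comp π₁)).prod
      (π₃ - π₁ - π₂.smulRight (Rh (0, 0)))) with hT
  have hΦd : HasStrictFDerivAt Φ T 0 := by
    have d3 : HasStrictFDerivAt (fun q : X × ℝ × X => lam q.2.2) ((fderiv ℝ lam 0).comp π₃) 0 :=
      HasStrictFDerivAt.comp (g := lam) (f := fun q : X × ℝ × X => q.2.2) (0 : X × ℝ × X) hls
        π₃.hasStrictFDerivAt
    have d1 : HasStrictFDerivAt (fun q : X × ℝ × X => lam q.1) ((fderiv ℝ lam 0).comp π₁) 0 :=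
      HasStrictFDerivAt.comp (g := lam) (f := fun q : X × ℝ × X => q.1) (0 : X × ℝ × X) hls
        π₁.hasStrictFDerivAt
    refine π₁.hasStrictFDerivAt.prodMk (HasStrictFDerivAt.prodMk ?_ ?_)
    · exact (d3.sub d1).const_mul k⁻¹
    · exact (π₃.hasStrictFDerivAt.sub π₁.hasStrictFDerivAt).sub
        (HasStrictFDerivAt.smul_quadAt π₂.hasStrictFDerivAt rfl hRq)
  have hTinj : Function.Injective T := by
    rw [injective_iff_map_eq_zero]
    rintro ⟨z, p, y⟩ h
    simp only [hT, ContinuousLinearMap.prod_apply, Prod.mk_eq_zero, hR0] at h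
    obtain ⟨h1, h2, h3⟩ := h
    have h1 : z = 0 := h1
    subst h1
    have h3 : y - 0 - p • r 0 = 0 := h3
    have h2 : k⁻¹ * (fderiv ℝ lam 0 y - fderiv ℝ lam 0 0) = 0 := h2
    rw [sub_zero, sub_eq_zero] at h3
    rw [h3, map_zero, sub_zero, map_smul, hlr0, smul_eq_mul] at h2
    have hp : p = 0 := by
      have := hk.ne'
      field_simp at h2; simpa using h2
    subst hp
    simp [h3]
  set e : (X × ℝ × X) ≃L[ℝ] X × ℝ × X :=
    (LinearEquiv.ofInjectiveEndo (T : X × ℝ × X →ₗ[ℝ] X × ℝ × X) hTinj).toContinuousLinearEquiv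
    with he
  have heT : (e : X × ℝ × X →L[ℝ] X × ℝ × X) = T := by
    exact ContinuousLinearMap.ext fun _ => rfl
  rw [← heT] at hΦd
  set g := hΦd.localInverse Φ e 0 with hg
  have hgq : QuadAt g 0 := by
    have := QuadAt.localInverse hΦd hΦq
    rwa [hΦ0] at this
  have hleft : ∀ᶠ q in 𝓝 (0 : X × ℝ × X), g (Φ q) = q := hΦd.eventually_left_inverse
  have hright : ∀ᶠ q in 𝓝 (0 : X × ℝ × X), Φ (g q) = q := by
    have := hΦd.eventually_right_inverse
    rwa [hΦ0] at this
  have hg0 : g 0 = 0 := by simpa [hΦ0] using hleft.self_of_nhds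
  have hιc : Tendsto (fun p : ℝ × X => ((p.2, p.1, 0) : X × ℝ × X)) (𝓝 (0, 0)) (𝓝 0) :=
    Continuous.tendsto' (by fun_prop) _ _ rfl
  set S : ℝ × X → X := fun p => (g (p.2, p.1, 0)).2.2 with hS
  set P : ℝ × X → ℝ := fun p => (g (p.2, p.1, 0)).2.1 with hP
  have hgιq : QuadAt (fun p : ℝ × X => g (p.2, p.1, 0)) (0, 0) :=
    QuadAt.comp (G := g) (F := fun p : ℝ × X => ((p.2, p.1, 0) : X × ℝ × X)) hgq
      (QuadAt.of_contDiff (by fun_prop))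
  have hSq : QuadAt S (0, 0) := QuadAt.comp (G := fun q : X × ℝ × X => q.2.2)
    (QuadAt.of_contDiff (by fun_prop)) hgιq
  have hPq : QuadAt P (0, 0) := QuadAt.comp (G := fun q : X × ℝ × X => q.2.1)
    (QuadAt.of_contDiff (by fun_prop)) hgιq
  have hS0 : S (0, 0) = 0 := by change (g 0).2.2 = 0; rw [hg0]; rfl
  have hz : ∀ᶠ z in 𝓝 (0 : X), S (0, z) = z ∧ P (0, z) = 0 := by
    have ht : Tendsto (fun z : X => ((z, 0, z) : X × ℝ × X)) (𝓝 0) (𝓝 0) :=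
      Continuous.tendsto' (by fun_prop) _ _ rfl
    filter_upwards [ht.eventually hleft] with z h
    have : Φ (z, 0, z) = (z, 0, 0) := by simp [hΦ]
    rw [this] at h
    simp [hS, hP, h]
  have hsolve : ∀ᶠ p in 𝓝 ((0, 0) : ℝ × X), S p - p.2 = P p • Rh (p.2, S p) ∧
      lam (S p) - lam p.2 = k * p.1 := by
    filter_upwards [hιc.eventually hright] with p hp
    simp only [hΦ, Prod.mk.injEq] at hp
    obtain ⟨h1, h2, h3⟩ := hp
    rw [h1] at h2 h3
    refine ⟨sub_eq_zero.1 h3, ?_⟩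
    change k⁻¹ * (lam (S p) - lam p.2) = p.1 at h2
    rw [← h2]; field_simp
  refine ⟨S, P, hSq, hS0, ?_, hsolve, ?_⟩
  · obtain ⟨KS, hKS, s1, hs1, hl1⟩ := hSq.exists_lipschitz
    obtain ⟨KP, hKP, s2, hs2, hl2⟩ := hPq.exists_lipschitz
    obtain ⟨KR, hKR, s3, hs3, hl3⟩ := hR.exists_lipschitz
    obtain ⟨s4, Q, hQ, hl4⟩ :=
      (hlam.fderiv_right (m := 1) (by norm_num)).exists_lipschitzOnWith
    have hdiff : ∀ᶠ y in 𝓝 (0 : X), DifferentiableAt ℝ lam y := by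
      filter_upwards [hlam.eventually (by simp)] with y hy using hy.differentiableAt (by simp)
    obtain ⟨ρ, hρ, hsub⟩ := Metric.mem_nhds_iff.1 (inter_mem hQ hdiff)
    have hk0 := hk.ne'
    refine ⟨KP * KR * KS + ‖r 0‖ * (k⁻¹ * (s4 * KS * KS + (‖fderiv ℝ lam 0‖ + 1) * (KP * KR * KS)))
      + (k⁻¹ * (s4 * KS * KS + (‖fderiv ℝ lam 0‖ + 1) * (KP * KR * KS))), ?_⟩
    have t2 : Tendsto (fun p : ℝ × X => p.2) (𝓝 (0, 0)) (𝓝 0) :=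
      Continuous.tendsto' (by fun_prop) _ _ rfl
    have t02 : Tendsto (fun p : ℝ × X => ((0, p.2) : ℝ × X)) (𝓝 (0, 0)) (𝓝 (0, 0)) :=
      Continuous.tendsto' (by fun_prop) _ _ rfl
    have t22 : Tendsto (fun p : ℝ × X => ((p.2, p.2) : X × X)) (𝓝 (0, 0)) (𝓝 (0, 0)) :=
      Continuous.tendsto' (by fun_prop) _ _ rfl
    have tS : Tendsto S (𝓝 (0, 0)) (𝓝 0) := by
      have := hSq.continuousAt.tendsto; rwa [hS0] at this
    have t2S : Tendsto (fun p : ℝ × X => ((p.2, S p) : X × X)) (𝓝 (0, 0)) (𝓝 (0, 0)) :=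
      t2.prodMk_nhds tS
    have hrb : ∀ᶠ z in 𝓝 (0 : X), ‖r z‖ < ‖r 0‖ + 1 :=
      hr.continuousAt.norm.eventually_lt_const (by linarith)
    have hfb : ∀ᶠ z in 𝓝 (0 : X), ‖fderiv ℝ lam z‖ < ‖fderiv ℝ lam 0‖ + 1 :=
      (hlam.fderiv_right (m := 1) (by norm_num)).continuousAt.norm.eventually_lt_const
        (by linarith)
    filter_upwards [hsolve, t2.eventually hz, t2.eventually hRr, t2.eventually hlr, hs1, hs2,
      t02.eventually hs1, t02.eventually hs2, t22.eventually hs3, t2S.eventually hs3,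
      t2.eventually (Metric.ball_mem_nhds 0 hρ), tS.eventually (Metric.ball_mem_nhds 0 hρ),
      t2.eventually hrb, t2.eventually hfb]
      with p h1 h2 h3 h4 m1 m2 m3 m4 m5 m6 m7 m8 m9 m10
    obtain ⟨s, z⟩ := p
    simp only at *
    have n1 : ‖((s, z) : ℝ × X) - (0, z)‖ = |s| := by
      simp [Prod.norm_def]
    have b1 : ‖S (s, z) - z‖ ≤ KS * |s| := by
      have := hl1 _ m1 _ m3; rwa [n1, h2.1] at this
    have b2 : |P (s, z)| ≤ KP * |s| := by
      have := hl2 _ m2 _ m4; rwa [n1, h2.2, sub_zero, Real.norm_eq_abs] at this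
    have b3 : ‖Rh (z, S (s, z)) - r z‖ ≤ KR * (KS * |s|) := by
      have := hl3 _ m6 _ m5
      rw [h3] at this
      refine this.trans ?_
      have : ‖((z, S (s, z)) : X × X) - (z, z)‖ = ‖S (s, z) - z‖ := by
        simp [Prod.norm_def]
      rw [this]; gcongr
    set w := S (s, z) - z with hw
    have b4 : ‖w - P (s, z) • r z‖ ≤ KP * KR * KS * s ^ 2 := by
      rw [h1.1, ← smul_sub, norm_smul, Real.norm_eq_abs]
      calc _ ≤ KP * |s| * (KR * (KS * |s|)) := by gcongr
        _ = _ := by rw [← sq_abs s]; ring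
    have b5 : |lam (S (s, z)) - lam z - fderiv ℝ lam z w| ≤ s4 * KS * KS * s ^ 2 := by
      have hconv := Convex.norm_image_sub_le_of_norm_hasFDerivWithin_le' (𝕜 := ℝ) (f := lam)
        (f' := fderiv ℝ lam) (s := segment ℝ z (S (s, z))) (x := z) (y := S (s, z))
        (φ := fderiv ℝ lam z) (C := s4 * (KS * |s|)) ?_ ?_ (convex_segment _ _)
        (left_mem_segment _ _ _) (right_mem_segment _ _ _)
      · refine hconv.trans ?_
        calc s4 * (KS * |s|) * ‖w‖ ≤ s4 * (KS * |s|) * (KS * |s|) := by gcongr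
          _ = _ := by rw [← sq_abs s]; ring
      · intro y hy
        have := (convex_ball (0 : X) ρ).segment_subset m7 m8 hy
        exact (hsub this).2.hasFDerivAt.hasFDerivWithinAt
      · intro y hy
        have hy' := (convex_ball (0 : X) ρ).segment_subset m7 m8 hy
        have := hl4.dist_le_mul y (hsub hy').1 z (hsub m7).1
        rw [dist_eq_norm, dist_eq_norm] at this
        refine this.trans ?_
        gcongr
        refine le_trans ?_ b1
        obtain ⟨t, ht, rfl⟩ := (segment_eq_image' ℝ z (S (s, z)) ▸ hy :
          y ∈ (fun θ : ℝ => z + θ • (S (s, z) - z)) '' Icc 0 1)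
        simp only [add_sub_cancel_left, norm_smul, Real.norm_of_nonneg ht.1]
        have := norm_nonneg (S (s, z) - z)
        nlinarith [ht.2]
    -- The two parameters agree to second order: the increment of `lam` is `k * s` by construction,
    -- and `k * P (s, z)` up to a quadratic error, by Taylor's formula and the normalization of `r`.
    have b6 : |s - P (s, z)| ≤
        k⁻¹ * (s4 * KS * KS + (‖fderiv ℝ lam 0‖ + 1) * (KP * KR * KS)) * s ^ 2 := by
      have e1 : k * (s - P (s, z)) = (lam (S (s, z)) - lam z - fderiv ℝ lam z w) +
          fderiv ℝ lam z (w - P (s, z) • r z) := by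
        rw [h1.2, map_sub _ w, map_smul, h4, smul_eq_mul]; ring
      have e2 : |fderiv ℝ lam z (w - P (s, z) • r z)| ≤
          (‖fderiv ℝ lam 0‖ + 1) * (KP * KR * KS * s ^ 2) := by
        refine ((fderiv ℝ lam z).le_opNorm _).trans ?_
        gcongr
      have e3 : k * |s - P (s, z)| ≤ s4 * KS * KS * s ^ 2 +
          (‖fderiv ℝ lam 0‖ + 1) * (KP * KR * KS * s ^ 2) := by
        rw [← abs_of_pos hk, ← abs_mul, e1]
        exact (abs_add_le _ _).trans (add_le_add b5 e2)
      rw [mul_assoc, le_inv_mul_iff₀ hk]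
      linarith
    have e4 : w - s • r z = (w - P (s, z) • r z) - (s - P (s, z)) • r z := by module
    rw [e4]
    refine (norm_sub_le _ _).trans ?_
    rw [norm_smul, Real.norm_eq_abs]
    have : |s - P (s, z)| * ‖r z‖ ≤ k⁻¹ * (s4 * KS * KS + (‖fderiv ℝ lam 0‖ + 1) * (KP * KR * KS)) *
      s ^ 2 * (‖r 0‖ + 1) := by gcongr
    linarith
  · have hΦt : ∀ᶠ q in 𝓝 ((0, 0, 0) : X × ℝ × X), g (Φ q) = q := hleft
    filter_upwards [hΦt] with q hq h
    have : Φ q = (q.1, (lam q.2.2 - lam q.1) / k, 0) := by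
      simp only [hΦ, Prod.mk.injEq]
      exact ⟨trivial, by rw [div_eq_inv_mul], by rw [h, sub_self]⟩
    rw [this] at hq
    change q.2.2 = (g (q.1, (lam q.2.2 - lam q.1) / k, 0)).2.2
    rw [hq]

end HugoniotCurve

/-! ### Shock curves and Lax curves. -/

noncomputable section

namespace ConservationLaw

variable {n : ℕ} (L : ConservationLaw n)

/-- The averaged Jacobian `∫₀¹ Df(z + θ(γ - z)) dθ`. -/
def avg (p : State n × State n) : State n →L[ℝ] State n :=
  ∫ θ in (0 : ℝ)..1, fderiv ℝ L.f (p.1 + θ • (p.2 - p.1))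

variable {L}

theorem HypothesisF.quadAt_avg (hF : L.HypothesisF) : QuadAt L.avg (0, 0) :=
  QuadAt.integral_segment (QuadAt.of_contDiffAt (hF.contDiffAt_fderiv.of_le (by norm_num)))

theorem avg_self (z : State n) : L.avg (z, z) = fderiv ℝ L.f z := by
  simp [avg]

/-- It turns the Rankine–Hugoniot relation into an eigenvalue problem: `γ - z` must be an
eigenvector of the averaged Jacobian, with the shock speed as eigenvalue, unless it vanishes. -/
theorem HypothesisF.eventually_avg_apply (hF : L.HypothesisF) :
    ∀ᶠ p in 𝓝 ((0, 0) : State n × State n), L.avg p (p.2 - p.1) = L.f p.2 - L.f p.1 :=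
  integral_fderiv_segment (hF.contDiffAt.of_le (by norm_num))

variable {Λ : Fin n → (State n →L[ℝ] State n) → ℝ}
  {R : Fin n → (State n →L[ℝ] State n) → State n}

/-- The `j`-th eigenvector of the averaged Jacobian, normalized so that it is `rⱼ` on the
diagonal. -/
theorem EigenBranches.exists_secantVector (hE : L.EigenBranches Λ R) (hF : L.HypothesisF)
    (hr : L.IsNormalized) {j : Fin n} (hj : L.GenuinelyNonlinear j) :
    ∃ Rh : State n × State n → State n, QuadAt Rh (0, 0) ∧
      (∀ᶠ z in 𝓝 (0 : State n), Rh (z, z) = L.r j z) ∧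
      ∃ d > 0, ∀ᶠ p in 𝓝 ((0, 0) : State n × State n),
        L.avg p (Rh p) = Λ j (L.avg p) • Rh p ∧ |Λ j (L.avg p) - L.speed j 0| < d ∧
        ∀ s w, |s - L.speed j 0| < d → L.avg p w = s • w → ∃ c : ℝ, w = c • Rh p := by
  have hq := hF.quadAt_avg
  have h0 : L.avg (0, 0) = fderiv ℝ L.f 0 := avg_self 0
  have hk := hr.k_pos j
  have hden0 : fderiv ℝ (L.speed j) 0 (R j (fderiv ℝ L.f 0)) = L.k j := by
    rw [hE.vec_zero, hr.nonlinear j hj 0 hF.zero_mem]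
  have hcd : ContDiffAt ℝ 2 (fun q : State n × (State n →L[ℝ] State n) =>
      (L.k j / fderiv ℝ (L.speed j) q.1 (R j q.2)) • R j q.2) (0, fderiv ℝ L.f 0) := by
    have h1 : ContDiffAt ℝ 2 (fun q : State n × (State n →L[ℝ] State n) => R j q.2)
        (0, fderiv ℝ L.f 0) :=
      ContDiffAt.comp (g := R j) (f := Prod.snd) (0, fderiv ℝ L.f 0)
        ((hE.contDiffAt_vec j).of_le (by norm_num)) contDiffAt_snd
    have h2 : ContDiffAt ℝ 2 (fun q : State n × (State n →L[ℝ] State n) =>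
        fderiv ℝ (L.speed j) q.1) (0, fderiv ℝ L.f 0) :=
      ContDiffAt.comp (g := fderiv ℝ (L.speed j)) (f := Prod.fst) (0, fderiv ℝ L.f 0)
        ((hE.contDiffAt_speed hF j).fderiv_right (by norm_num)) contDiffAt_fst
    refine ContDiffAt.smul (contDiffAt_const.div (h2.clm_apply h1) ?_) h1
    change fderiv ℝ (L.speed j) 0 (R j (fderiv ℝ L.f 0)) ≠ 0
    rw [hden0]; exact hk.ne'
  refine ⟨fun p => (L.k j / fderiv ℝ (L.speed j) p.1 (R j (L.avg p))) • R j (L.avg p), ?_, ?_, ?_⟩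
  · refine QuadAt.comp (F := fun p : State n × State n => (p.1, L.avg p)) (x := (0, 0))
      (G := fun q : State n × (State n →L[ℝ] State n) =>
      (L.k j / fderiv ℝ (L.speed j) q.1 (R j q.2)) • R j q.2) ?_
      ((QuadAt.of_contDiff contDiff_fst).prodMk hq)
    change QuadAt _ ((0 : State n), L.avg (0, 0))
    rw [h0]; exact QuadAt.of_contDiffAt hcd
  · filter_upwards [hE.r_eq_of_genuinelyNonlinear hF hr hj] with z hz
    rw [hz, avg_self]
  · obtain ⟨d, hd, hw⟩ := hE.exists_eq_smul hF j
    have ht : Tendsto L.avg (𝓝 (0, 0)) (𝓝 (fderiv ℝ L.f 0)) := by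
      have := hq.continuousAt.tendsto; rwa [h0] at this
    have hden : ∀ᶠ p in 𝓝 ((0, 0) : State n × State n),
        fderiv ℝ (L.speed j) p.1 (R j (L.avg p)) ≠ 0 := by
      have hc : ContinuousAt (fun p : State n × State n =>
          fderiv ℝ (L.speed j) p.1 (R j (L.avg p))) (0, 0) := by
        refine ContinuousAt.clm_apply ?_ ?_
        · exact ContinuousAt.comp (g := fderiv ℝ (L.speed j)) (f := Prod.fst) (x := (0, 0))
            ((hE.contDiffAt_speed hF j).fderiv_right (m := 2) (by norm_num)).continuousAt
            continuousAt_fst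
        · exact ContinuousAt.comp (g := R j) (f := L.avg)
            (by rw [h0]; exact (hE.contDiffAt_vec j).continuousAt) hq.continuousAt
      refine hc.eventually_ne ?_
      change fderiv ℝ (L.speed j) 0 (R j (L.avg (0, 0))) ≠ 0
      rw [h0, hden0]; exact hk.ne'
    refine ⟨d, hd, ?_⟩
    filter_upwards [ht.eventually hw, ht.eventually hE.eventually_eigen, hden] with p h1 h2 h3
    refine ⟨by rw [map_smul, h2.2.1 j, smul_comm], h1.1, fun s w hs hw => ?_⟩
    obtain ⟨c, rfl⟩ := h1.2 s w hs hw
    refine ⟨c * (fderiv ℝ (L.speed j) p.1 (R j (L.avg p)) / L.k j), ?_⟩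
    rw [smul_smul]
    congr 1
    field_simp

/-- The shock curves are the values of a map of class `C^{1,1}`. -/
theorem EigenBranches.exists_shockMap (hE : L.EigenBranches Λ R) (hF : L.HypothesisF)
    (hr : L.IsNormalized) {j : Fin n} (hj : L.GenuinelyNonlinear j) :
    ∃ S : ℝ × State n → State n, QuadAt S (0, 0) ∧
      (∃ C : ℝ, ∀ᶠ p in 𝓝 ((0, 0) : ℝ × State n), ‖S p - p.2 - p.1 • L.r j p.2‖ ≤ C * p.1 ^ 2) ∧
      ∀ᶠ p in 𝓝 ((0, 0) : ℝ × State n), ∀ v, L.Shock j p.1 p.2 v ↔ v = S p := by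
  obtain ⟨Rh, hRq, hRr, d, hd, hR⟩ := hE.exists_secantVector hF hr hj
  have hk := hr.k_pos j
  obtain ⟨S, P, hS⟩ := exists_isHugoniot (lam := L.speed j) (r := L.r j)
    ((hE.contDiffAt_speed hF j).of_le (by norm_num)) hk hRq hRr
    (QuadAt.of_contDiffAt (hE.contDiffAt_r hF hr j))
    (by filter_upwards [eventually_mem_Ω hF] with z hz using hr.nonlinear j hj z hz)
  refine ⟨S, hS.quadAt, hS.quadratic, ?_⟩
  obtain ⟨C, hC⟩ := hS.quadratic
  have h0 : L.avg (0, 0) = fderiv ℝ L.f 0 := avg_self 0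
  have hR00 : Rh (0, 0) ≠ 0 := by
    rw [hRr.self_of_nhds]; exact (hr.eigenvector j 0 hF.zero_mem).2
  set m := ‖Rh (0, 0)‖ / 2 with hm
  have hm0 : 0 < m := by positivity
  have hRm : ∀ᶠ p in 𝓝 ((0, 0) : State n × State n), m < ‖Rh p‖ :=
    hRq.continuousAt.norm.eventually_const_lt (half_lt_self (norm_pos_iff.2 hR00))
  have hΛc : ∀ᶠ p in 𝓝 ((0, 0) : State n × State n), ContinuousAt (fun p => Λ j (L.avg p)) p := by
    refine QuadAt.eventually_continuousAt (QuadAt.comp (G := Λ j) ?_ hF.quadAt_avg)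
    rw [h0]; exact QuadAt.of_contDiffAt ((hE.contDiffAt_val j).of_le (by norm_num))
  have hΩ2 : ∀ᶠ p in 𝓝 ((0, 0) : State n × State n), p.2 ∈ L.Ω :=
    (continuous_snd.tendsto ((0, 0) : State n × State n)).eventually (eventually_mem_Ω hF)
  obtain ⟨ρ₁, hρ₁, hs₁⟩ := Metric.eventually_nhds_iff_ball.1 hS.unique
  obtain ⟨ρ', hρ', hs'⟩ := Metric.eventually_nhds_iff_ball.1
    (((hR.and hRm).and (hΛc.and hΩ2)).and hF.eventually_avg_apply)
  -- The last entry bounds the coefficient in `γ - z = c • Rh (z, γ)`: since `‖Rh‖ > m`, it yields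
  -- `|c| * m < 2 * ρ₂ ≤ m * ρ₁`.
  set ρ₂ := min (min ρ' ρ₁) (m * ρ₁ / 2) with hρ₂
  have hρ₂0 : 0 < ρ₂ := by positivity
  have hunique : ∀ (z : State n) (c : ℝ) (γ : State n), ‖z‖ < ρ₁ → |c| < ρ₁ → ‖γ‖ < ρ₁ →
      γ - z = c • Rh (z, γ) → γ = S ((L.speed j γ - L.speed j z) / L.k j, z) := by
    intro z c γ h1 h2 h3 h4
    refine hs₁ (z, c, γ) ?_ h4
    simp only [mem_ball_iff_norm, Prod.norm_def, Prod.mk_sub_mk, sub_zero, sup_lt_iff]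
    exact ⟨h1, h2, h3⟩
  have hpair : ∀ z γ : State n, ‖z‖ < ρ₂ → ‖γ‖ < ρ₂ → (z, γ) ∈ Metric.ball ((0, 0) : _ × State n) ρ' := by
    intro z γ h1 h2
    simp only [mem_ball_iff_norm, Prod.norm_def, Prod.mk_sub_mk, sub_zero, sup_lt_iff]
    exact ⟨h1.trans_le ((min_le_left _ _).trans (min_le_left _ _)),
      h2.trans_le ((min_le_left _ _).trans (min_le_left _ _))⟩
  have hSn : ∀ᶠ p in 𝓝 ((0, 0) : ℝ × State n), ‖S p‖ < ρ₂ :=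
    hS.quadAt.continuousAt.norm.eventually_lt_const (by change ‖S (0, 0)‖ < ρ₂; rw [hS.zero]; simpa using hρ₂0)
  have hsp : ∀ᶠ p in 𝓝 ((0, 0) : ℝ × State n), Λ j (fderiv ℝ L.f p.2) = L.speed j p.2 :=
    (continuous_snd.tendsto ((0, 0) : ℝ × State n)).eventually (hE.eventually_speed_eq hF j)
  obtain ⟨ρ'', hρ'', hs''⟩ := Metric.eventually_nhds_iff_ball.1
    (((hSn.and hsp).and (hC.and hS.solves)).and hS.quadAt.eventually_continuousAt)
  set ρ₃ := min ρ'' ρ₂ with hρ₃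
  have hρ₃0 : 0 < ρ₃ := by positivity
  filter_upwards [Metric.ball_mem_nhds ((0, 0) : ℝ × State n) hρ₃0]
  rintro ⟨σ, z⟩ hp
  simp only [mem_ball_iff_norm, Prod.norm_def, Prod.mk_sub_mk, sub_zero, sup_lt_iff] at hp
  obtain ⟨hσ, hz⟩ := hp
  rw [Real.norm_eq_abs] at hσ
  have hz2 : ‖z‖ < ρ₂ := hz.trans_le (min_le_right _ _)
  have hmem : ∀ τ ∈ uIcc 0 σ, (τ, z) ∈ Metric.ball ((0, 0) : ℝ × State n) ρ'' := by
    intro τ hτ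
    have : |τ| ≤ |σ| := by simpa using abs_sub_left_of_mem_uIcc hτ
    simp only [mem_ball_iff_norm, Prod.norm_def, Prod.mk_sub_mk, sub_zero, sup_lt_iff]
    exact ⟨(this.trans_lt hσ).trans_le (min_le_left _ _), hz.trans_le (min_le_left _ _)⟩
  have hS0 : S (0, z) = z := by
    have := (hs'' _ (hmem 0 left_mem_uIcc)).1.2.1
    simp only [zero_smul, sub_zero, ne_eq, OfNat.ofNat_ne_zero, not_false_eq_true, zero_pow,
      mul_zero] at this
    exact sub_eq_zero.1 (norm_le_zero_iff.1 this)
  have hSn' : ∀ τ ∈ uIcc 0 σ, ‖S (τ, z)‖ < ρ₂ := fun τ hτ => (hs'' _ (hmem τ hτ)).1.1.1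
  have hzz : Λ j (L.avg (z, z)) = L.speed j z := by
    rw [avg_self]; exact (hs'' _ (hmem 0 left_mem_uIcc)).1.1.2
  have hScont : ContinuousOn (fun τ => S (τ, z)) (uIcc 0 σ) := fun τ hτ =>
    (ContinuousAt.comp (g := S) (f := fun τ => (τ, z)) (hs'' _ (hmem τ hτ)).2
      (by fun_prop)).continuousWithinAt
  have hsolve : ∀ τ ∈ uIcc 0 σ, S (τ, z) - z = P (τ, z) • Rh (z, S (τ, z)) ∧
      L.speed j (S (τ, z)) - L.speed j z = L.k j * τ := fun τ hτ => (hs'' _ (hmem τ hτ)).1.2.2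
  have hRH : ∀ τ ∈ uIcc 0 σ, L.avg (z, S (τ, z)) (S (τ, z) - z) =
      Λ j (L.avg (z, S (τ, z))) • (S (τ, z) - z) := by
    intro τ hτ
    have := (hs' _ (hpair z _ hz2 (hSn' τ hτ))).1.1.1.1
    conv_lhs => rw [(hsolve τ hτ).1]
    rw [map_smul, this, smul_comm, ← (hsolve τ hτ).1]
  intro v
  constructor
  · rintro ⟨γ, s, hγc, hsc, hγ0, hs0, rfl, h⟩
    change γ σ = S (σ, z)
    -- An arbitrary shock curve is compared with `S` by connectedness: the parameters of agreement
    -- form a closed and open set that contains `0`.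
    set A : Set (uIcc 0 σ) := {τ | γ τ = S (τ, z)} with hA
    have hγr : Continuous (fun τ : uIcc 0 σ => γ τ) := continuousOn_iff_continuous_domRestrict.1 hγc
    have hsr : Continuous (fun τ : uIcc 0 σ => s τ) := continuousOn_iff_continuous_domRestrict.1 hsc
    have hSr : Continuous (fun τ : uIcc 0 σ => S (τ, z)) :=
      continuousOn_iff_continuous_domRestrict.1 hScont
    have hclosed : IsClosed A := isClosed_eq hγr hSr
    have hopen : IsOpen A := by
      rw [isOpen_iff_mem_nhds]
      intro τ hτ
      have hτA : γ τ = S (τ, z) := hτ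
      -- At a point of agreement the speed is the `j`-th eigenvalue of the averaged Jacobian, by the
      -- initial condition if `τ = 0` and because `γ τ ≠ z` otherwise. By continuity nearby speeds
      -- remain in the window where only the `j`-th eigendirection is possible.
      have hsτ : |s τ - L.speed j 0| < d := by
        have hwin := (hs' _ (hpair z _ hz2 (hSn' τ τ.2))).1.1.1.2.1
        by_cases h0 : (τ : ℝ) = 0
        · rw [h0, hs0, ← hzz]
          exact (hs' _ (hpair z _ hz2 hz2)).1.1.1.2.1
        · have hne : γ τ - z ≠ 0 := by
            intro hz0
            have e1 := (h τ τ.2).2.2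
            simp only at e1
            rw [sub_eq_zero.1 hz0] at e1
            have : L.k j * τ = 0 := by linarith
            exact h0 ((mul_eq_zero.1 this).resolve_left hk.ne')
          have e2 := (h τ τ.2).2.1
          have e3 := (hs' _ (hpair z _ hz2 (hSn' τ τ.2))).2
          have e4 := hRH τ τ.2
          simp only at e2 e3
          rw [← hτA] at e3 e4 hwin
          rw [← e3, e4] at e2
          have e5 : (Λ j (L.avg (z, γ τ)) - s τ) • (γ τ - z) = 0 := by
            rw [sub_smul, e2, sub_self]
          have e6 := (smul_eq_zero.1 e5).resolve_right hne
          rw [← sub_eq_zero.1 e6]; exact hwin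
      have ev1 : ∀ᶠ τ' : uIcc 0 σ in 𝓝 τ, |s τ' - L.speed j 0| < d :=
        ((hsr.sub continuous_const).abs.tendsto τ).eventually_lt_const hsτ
      have ev2 : ∀ᶠ τ' : uIcc 0 σ in 𝓝 τ, ‖γ τ'‖ < ρ₂ :=
        (hγr.norm.tendsto τ).eventually_lt_const (by rw [hτA]; exact hSn' τ τ.2)
      filter_upwards [ev1, ev2] with τ' e1 e2
      have f1 := hs' _ (hpair z _ hz2 e2)
      have f2 := (h τ' τ'.2).2.1
      have f3 := f1.2
      simp only at f2 f3
      rw [f2] at f3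
      obtain ⟨c, hc⟩ := f1.1.1.1.2.2 _ _ e1 f3
      have hcb : |c| < ρ₁ := by
        have g1 : ‖γ τ' - z‖ < 2 * ρ₂ := (norm_sub_le _ _).trans_lt (by linarith)
        rw [hc, norm_smul, Real.norm_eq_abs] at g1
        have g2 : |c| * m ≤ |c| * ‖Rh (z, γ τ')‖ := by gcongr; exact f1.1.1.2.le
        have g3 : 2 * ρ₂ ≤ m * ρ₁ := by
          have : ρ₂ ≤ m * ρ₁ / 2 := min_le_right _ _
          linarith
        have g4 : |c| * m < ρ₁ * m := by linarith
        exact lt_of_mul_lt_mul_right g4 hm0.le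
      have h12 : ρ₂ ≤ ρ₁ := (min_le_left _ _).trans (min_le_right _ _)
      have key := hunique z c (γ τ') (hz2.trans_le h12) hcb (e2.trans_le h12) hc
      have hsp := (h τ' τ'.2).2.2
      simp only at hsp
      have : (L.speed j (γ τ') - L.speed j z) / L.k j = τ' := by
        rw [hsp]; field_simp; ring
      rw [this] at key
      exact key
    have : PreconnectedSpace (uIcc (0 : ℝ) σ) :=
      Subtype.preconnectedSpace isPreconnected_uIcc
    have huniv := IsClopen.eq_univ ⟨hclosed, hopen⟩
      ⟨⟨0, left_mem_uIcc⟩, by change γ 0 = S (0, z); rw [hγ0, hS0]⟩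
    exact (huniv ▸ mem_univ (⟨σ, right_mem_uIcc⟩ : uIcc 0 σ) : (⟨σ, right_mem_uIcc⟩ : uIcc 0 σ) ∈ A)
  · rintro rfl
    refine ⟨fun τ => S (τ, z), fun τ => Λ j (L.avg (z, S (τ, z))), hScont, ?_, hS0, ?_, rfl, ?_⟩
    · intro τ hτ
      have h1 : ContinuousAt (fun p => Λ j (L.avg p)) (z, S (τ, z)) :=
        (hs' _ (hpair z _ hz2 (hSn' τ hτ))).1.2.1
      exact ContinuousAt.comp_continuousWithinAt (g := fun p => Λ j (L.avg p))
        (f := fun τ => (z, S (τ, z))) h1 (continuousWithinAt_const.prodMk (hScont τ hτ))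
    · simp only [hS0]; exact hzz
    · intro τ hτ
      have f1 := hs' _ (hpair z _ hz2 (hSn' τ hτ))
      refine ⟨f1.1.2.2, ?_, ?_⟩
      · rw [← f1.2]; exact hRH τ hτ
      · have := (hsolve τ hτ).2
        change L.speed j (S (τ, z)) = L.speed j z + L.k j * τ
        linarith

/-- A parametrization of the `j`-th Lax curves near `0`. -/
structure IsLaxMap (L : ConservationLaw n) (j : Fin n) (ψ : ℝ × State n → State n) : Prop where
  quadAt : QuadAt ψ (0, 0)
  quadratic : ∃ C : ℝ, ∀ᶠ p in 𝓝 ((0, 0) : ℝ × State n),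
    ‖ψ p - p.2 - p.1 • L.r j p.2‖ ≤ C * p.1 ^ 2
  lax : ∀ᶠ p in 𝓝 ((0, 0) : ℝ × State n), ∀ v, L.LaxCurve j p.1 p.2 v ↔ v = ψ p
  add : ∀ᶠ p in 𝓝 ((0, 0, 0) : ℝ × ℝ × State n),
    (L.GenuinelyNonlinear j → 0 ≤ p.1 ∧ 0 ≤ p.2.1) →
      ψ (p.1, ψ (p.2.1, p.2.2)) = ψ (p.1 + p.2.1, p.2.2)

theorem eventually_rarefaction_iff {j : Fin n} {φ : ℝ × State n → State n}
    (hφ : IsLocalFlow (L.r j) L.Ω φ) :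
    ∀ᶠ p in 𝓝 ((0, 0) : ℝ × State n), ∀ v, L.Rarefaction j p.1 p.2 v ↔ v = φ p := by
  filter_upwards [hφ.curve, hφ.unique] with p h1 h2 v
  constructor
  · rintro ⟨γ, hγ0, rfl, hγ⟩
    exact h2 γ hγ0 fun τ hτ => (hγ τ hτ).2
  · rintro rfl
    exact h1

/-- In a genuinely nonlinear field shock and rarefaction curves have the same first-order expansion,
so their difference is quadratically small and may be cut off to negative parameters without losing
`C^{1,1}` regularity. In a linearly degenerate field the flow serves for both signs. -/
theorem exists_isLaxMap (hF : L.HypothesisF) (hr : L.IsNormalized) (j : Fin n) :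
    ∃ ψ, IsLaxMap L j ψ := by
  obtain ⟨Λ, R, hE⟩ := exists_eigenBranches hF hr
  obtain ⟨φ, hφ⟩ := exists_isLocalFlow (QuadAt.of_contDiffAt (hE.contDiffAt_r hF hr j))
    (eventually_mem_Ω hF)
  obtain ⟨C, hC⟩ := hφ.quadratic
  have hrar := eventually_rarefaction_iff hφ
  by_cases hj : L.GenuinelyNonlinear j
  · obtain ⟨S, hSq, ⟨C', hC'⟩, hS⟩ := hE.exists_shockMap hF hr hj
    have hψ : (fun p : ℝ × State n => if p.1 < 0 then S p else φ p) =
        fun p => φ p + if p.1 < 0 then S p - φ p else 0 := by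
      funext p; split_ifs <;> simp
    have hD : ∀ᶠ p in 𝓝 ((0, 0) : ℝ × State n), ‖S p - φ p‖ ≤ (C + C') * p.1 ^ 2 := by
      filter_upwards [hC, hC'] with p h1 h2
      have : S p - φ p = (S p - p.2 - p.1 • L.r j p.2) - (φ p - p.2 - p.1 • L.r j p.2) := by abel
      rw [this]
      refine (norm_sub_le _ _).trans ?_
      linarith
    refine ⟨fun p => if p.1 < 0 then S p else φ p, ?_, ?_, ?_, ?_⟩
    · rw [hψ]
      exact hφ.quadAt.add ((hSq.sub hφ.quadAt).cutoff hD)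
    · refine ⟨max C C', ?_⟩
      filter_upwards [hC, hC'] with p h1 h2
      split_ifs
      · exact h2.trans (by gcongr; exact le_max_right _ _)
      · exact h1.trans (by gcongr; exact le_max_left _ _)
    · filter_upwards [hrar, hS] with p h1 h2 v
      simp only [LaxCurve, hj, true_and]
      split_ifs with h
      · simp [h, h2]
      · simp [h, h1]
    · filter_upwards [hφ.add] with p h1 h2
      obtain ⟨h3, h4⟩ := h2 hj
      simp only [not_lt.2 h3, not_lt.2 h4, not_lt.2 (add_nonneg h3 h4), if_false]
      exact h1
  · refine ⟨φ, hφ.quadAt, hφ.quadratic, ?_, ?_⟩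
    · filter_upwards [hrar] with p h1 v
      simp only [LaxCurve, hj, false_and, not_false_eq_true, true_and, false_or]
      exact h1 v
    · filter_upwards [hφ.add] with p h1 _ using h1

end ConservationLaw

end

/-! ### Composition of Lax curves and the local Riemann solver. -/

noncomputable section

namespace ConservationLaw

variable {n : ℕ} {L : ConservationLaw n}

namespace IsLaxMap

variable {j : Fin n} {ψ : ℝ × State n → State n}

theorem eventually_zero (hψ : IsLaxMap L j ψ) : ∀ᶠ z in 𝓝 (0 : State n), ψ (0, z) = z := by
  obtain ⟨C, hC⟩ := hψ.quadratic
  have ht : Tendsto (fun z : State n => ((0, z) : ℝ × State n)) (𝓝 0) (𝓝 (0, 0)) :=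
    Continuous.tendsto' (by fun_prop) _ _ rfl
  filter_upwards [ht.eventually hC] with z hz
  simp only [zero_smul, sub_zero, ne_eq, OfNat.ofNat_ne_zero, not_false_eq_true, zero_pow,
    mul_zero] at hz
  exact sub_eq_zero.1 (norm_le_zero_iff.1 hz)

theorem zero (hψ : IsLaxMap L j ψ) : ψ (0, 0) = 0 := hψ.eventually_zero.self_of_nhds

/-- Apart from its explicit linear part the map is `C^{1,1}` and quadratically small in the
parameter, so that the remainder has small Lipschitz constants near `(0, 0)`. -/
theorem hasStrictFDerivAt (hψ : IsLaxMap L j ψ) (hr : QuadAt (L.r j) 0) :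
    HasStrictFDerivAt ψ (ContinuousLinearMap.snd ℝ ℝ (State n) +
      (ContinuousLinearMap.fst ℝ ℝ (State n)).smulRight (L.r j 0)) (0, 0) := by
  have hrq : QuadAt (fun p : ℝ × State n => L.r j p.2) (0, 0) :=
    QuadAt.comp (G := L.r j) (F := Prod.snd) (x := ((0, 0) : ℝ × State n)) hr
      (QuadAt.of_contDiff contDiff_snd)
  have hD : QuadAt (fun p : ℝ × State n => ψ p - p.2 - p.1 • L.r j p.2) (0, 0) :=
    (hψ.quadAt.sub (QuadAt.of_contDiff contDiff_snd)).sub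
      ((QuadAt.of_contDiff contDiff_fst).smul hrq)
  obtain ⟨C, hC⟩ := hψ.quadratic
  have h0 := hasStrictFDerivAt_zero_of_lipschitz (hD.lipschitz_of_quadratic hC)
  have h1 : HasStrictFDerivAt (fun p : ℝ × State n => p.2) (ContinuousLinearMap.snd ℝ ℝ (State n))
      (0, 0) := (ContinuousLinearMap.snd ℝ ℝ (State n)).hasStrictFDerivAt
  have h2 : HasStrictFDerivAt (fun p : ℝ × State n => p.1 • L.r j p.2)
      ((ContinuousLinearMap.fst ℝ ℝ (State n)).smulRight (L.r j 0)) (0, 0) :=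
    HasStrictFDerivAt.smul_quadAt (x := ((0, 0) : ℝ × State n))
      (ContinuousLinearMap.fst ℝ ℝ (State n)).hasStrictFDerivAt rfl hrq
  have h3 := (h0.add h1).add h2
  rw [zero_add] at h3
  refine h3.congr_of_eventuallyEq (Eventually.of_forall fun p => ?_)
  simp only [Pi.add_apply]
  abel

end IsLaxMap

/-- The intermediate states of the composition of Lax curves with strengths `σ` starting at `u`. -/
def fanState (ψ : Fin n → ℝ × State n → State n) (p : (Fin n → ℝ) × State n) :
    Fin (n + 1) → State n :=
  Fin.induction (motive := fun _ => State n) p.2 fun j w => ψ j (p.1 j, w)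

@[simp] theorem fanState_zero (ψ : Fin n → ℝ × State n → State n) (p : (Fin n → ℝ) × State n) :
    fanState ψ p 0 = p.2 := rfl

@[simp] theorem fanState_succ (ψ : Fin n → ℝ × State n → State n) (p : (Fin n → ℝ) × State n)
    (j : Fin n) : fanState ψ p j.succ = ψ j (p.1 j, fanState ψ p j.castSucc) := by
  simp [fanState]

theorem filter_castSucc_lt_succ (i : Fin n) : (Finset.univ.filter fun j : Fin n => j.castSucc < i.succ) =
    insert i (Finset.univ.filter fun j : Fin n => j.castSucc < i.castSucc) := by
  ext j
  simp [Fin.castSucc_lt_succ_iff, le_iff_eq_or_lt]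

section Fan

variable {ψ : Fin n → ℝ × State n → State n} (hψ : ∀ j, IsLaxMap L j (ψ j))

include hψ

theorem fanState_zero_zero (i : Fin (n + 1)) : fanState ψ 0 i = 0 := by
  induction i using Fin.induction with
  | zero => rfl
  | succ i ih => rw [fanState_succ, ih]; exact (hψ i).zero

theorem quadAt_fanState (i : Fin (n + 1)) : QuadAt (fun p => fanState ψ p i) 0 := by
  induction i using Fin.induction with
  | zero => exact QuadAt.of_contDiff contDiff_snd
  | succ i ih =>
    simp only [fanState_succ]
    refine QuadAt.comp (G := ψ i)
      (F := fun p : (Fin n → ℝ) × State n => (p.1 i, fanState ψ p i.castSucc)) ?_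
      (QuadAt.prodMk (QuadAt.of_contDiff (by fun_prop)) ih)
    rw [fanState_zero_zero hψ]; exact (hψ i).quadAt

theorem tendsto_fanState (i : Fin (n + 1)) : Tendsto (fun p => fanState ψ p i) (𝓝 0) (𝓝 0) := by
  have := (quadAt_fanState hψ i).continuousAt.tendsto
  rwa [fanState_zero_zero hψ] at this

theorem eventually_fanState_zero (i : Fin (n + 1)) :
    ∀ᶠ u in 𝓝 (0 : State n), fanState ψ (0, u) i = u := by
  induction i using Fin.induction with
  | zero => exact Eventually.of_forall fun u => rfl
  | succ i ih =>
    filter_upwards [ih, (hψ i).eventually_zero] with u h1 h2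
    rw [fanState_succ, h1]; exact h2

theorem hasStrictFDerivAt_fanState (hr : ∀ j, QuadAt (L.r j) 0) (i : Fin (n + 1)) :
    ∃ D : (Fin n → ℝ) × State n →L[ℝ] State n, HasStrictFDerivAt (fun p => fanState ψ p i) D 0 ∧
      ∀ p, D p = p.2 + ∑ j : Fin n with j.castSucc < i, p.1 j • L.r j 0 := by
  induction i using Fin.induction with
  | zero =>
    refine ⟨ContinuousLinearMap.snd ℝ _ _, ?_, by simp⟩
    simp only [fanState_zero]
    exact hasStrictFDerivAt_snd
  | succ i ih =>
    obtain ⟨D, hD, hDp⟩ := ih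
    have h1 := (hψ i).hasStrictFDerivAt (hr i)
    set π : (Fin n → ℝ) × State n →L[ℝ] ℝ :=
      (ContinuousLinearMap.proj i).comp (ContinuousLinearMap.fst ℝ (Fin n → ℝ) (State n))
    have h2 : HasStrictFDerivAt
        (fun p : (Fin n → ℝ) × State n => (p.1 i, fanState ψ p i.castSucc)) (π.prod D) 0 :=
      π.hasStrictFDerivAt.prodMk hD
    have h3 := HasStrictFDerivAt.comp (g := ψ i) (0 : (Fin n → ℝ) × State n)
      (by rw [fanState_zero_zero hψ]; exact h1) h2
    refine ⟨_, by simp only [fanState_succ]; exact h3, fun p => ?_⟩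
    rw [filter_castSucc_lt_succ, Finset.sum_insert (by simp)]
    simp [hDp, π]
    abel

/-- All eigenvectors are evaluated at the initial state, so that the dual basis `lᵢ` at that state
will recover the strengths to first order. -/
theorem quadratic_fanState (hr : ∀ j, QuadAt (L.r j) 0) (i : Fin (n + 1)) :
    ∃ C : ℝ, 0 ≤ C ∧ ∀ᶠ p in 𝓝 (0 : (Fin n → ℝ) × State n),
      ‖fanState ψ p i - p.2 - ∑ j : Fin n with j.castSucc < i, p.1 j • L.r j p.2‖ ≤
        C * ‖p.1‖ ^ 2 := by
  induction i using Fin.induction with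
  | zero => exact ⟨0, le_rfl, by simp⟩
  | succ i ih =>
    obtain ⟨C, hC0, hC⟩ := ih
    obtain ⟨C', hC'⟩ := (hψ i).quadratic
    obtain ⟨K, hK, s, hs, hl⟩ := (hr i).exists_lipschitz
    obtain ⟨M, hM, t, ht, hlt⟩ := (quadAt_fanState hψ i.castSucc).exists_lipschitz
    have tf := tendsto_fanState hψ i.castSucc
    have t2 : Tendsto (fun p : (Fin n → ℝ) × State n => p.2) (𝓝 0) (𝓝 0) :=
      Continuous.tendsto' (by fun_prop) _ _ rfl
    have t02 : Tendsto (fun p : (Fin n → ℝ) × State n => ((0, p.2) : (Fin n → ℝ) × State n))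
      (𝓝 0) (𝓝 0) := Continuous.tendsto' (by fun_prop) _ _ rfl
    have tψ : Tendsto (fun p : (Fin n → ℝ) × State n => (p.1 i, fanState ψ p i.castSucc)) (𝓝 0)
        (𝓝 (0, 0)) := by
      refine Tendsto.prodMk_nhds ?_ tf
      exact Continuous.tendsto' (by fun_prop) _ _ rfl
    refine ⟨C + |C'| + K * M, by positivity, ?_⟩
    filter_upwards [hC, tψ.eventually hC', tf.eventually hs, t2.eventually hs, ht,
      t02.eventually ht, t2.eventually (eventually_fanState_zero hψ i.castSucc)]
      with p h1 h2 h3 h4 h5 h6 h7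
    set w := fanState ψ p i.castSucc with hw
    rw [fanState_succ, filter_castSucc_lt_succ, Finset.sum_insert (by simp)]
    have hpi : |p.1 i| ≤ ‖p.1‖ := norm_le_pi_norm p.1 i
    have e1 : ‖w - p.2‖ ≤ M * ‖p.1‖ := by
      have := hlt _ h5 _ h6
      rw [h7] at this
      refine this.trans ?_
      gcongr
      simp [Prod.norm_def]
    have e2 : ‖p.1 i • (L.r i w - L.r i p.2)‖ ≤ K * M * ‖p.1‖ ^ 2 := by
      rw [norm_smul, Real.norm_eq_abs]
      calc _ ≤ ‖p.1‖ * (K * (M * ‖p.1‖)) := by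
            gcongr
            exact (hl _ h3 _ h4).trans (by gcongr)
        _ = _ := by ring
    have e3 : C' * p.1 i ^ 2 ≤ |C'| * ‖p.1‖ ^ 2 := by
      rw [← sq_abs (p.1 i)]
      gcongr
      exact le_abs_self C'
    have e4 : ψ i (p.1 i, w) - p.2 - (p.1 i • L.r i p.2 +
        ∑ j : Fin n with j.castSucc < i.castSucc, p.1 j • L.r j p.2) =
        (ψ i (p.1 i, w) - w - p.1 i • L.r i w) + p.1 i • (L.r i w - L.r i p.2) +
        (w - p.2 - ∑ j : Fin n with j.castSucc < i.castSucc, p.1 j • L.r j p.2) := by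
      rw [smul_sub]; abel
    rw [e4]
    refine (norm_add₃_le).trans ?_
    linarith

theorem eventually_waveFan_iff : ∀ᶠ p in 𝓝 (0 : (Fin n → ℝ) × State n), ∀ v,
    L.WaveFan p.1 p.2 v ↔ v = fanState ψ p (Fin.last n) := by
  have tψ : ∀ i : Fin n, Tendsto (fun p : (Fin n → ℝ) × State n =>
      (p.1 i, fanState ψ p i.castSucc)) (𝓝 0) (𝓝 (0, 0)) := fun i => by
    refine Tendsto.prodMk_nhds ?_ (tendsto_fanState hψ i.castSucc)
    exact Continuous.tendsto' (by fun_prop) _ _ rfl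
  filter_upwards [eventually_all.2 fun i => (tψ i).eventually (hψ i).lax] with p hp v
  constructor
  · rintro ⟨w, hw0, rfl, hw⟩
    have : ∀ i, w i = fanState ψ p i := by
      intro i
      induction i using Fin.induction with
      | zero => exact hw0
      | succ i ih =>
        have := hw i
        rw [ih] at this
        rw [fanState_succ]
        exact (hp i _).1 this
    exact this _
  · rintro rfl
    exact ⟨fanState ψ p, rfl, rfl, fun j => (hp j _).2 (fanState_succ ψ p j)⟩

end Fan

/-- The solution of Riemann problems near `0`: `Eh (u, v)` are the strengths joining `u` to `v`. -/
structure IsSolver (L : ConservationLaw n) (ψ : Fin n → ℝ × State n → State n)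
    (Eh : State n × State n → Fin n → ℝ) : Prop where
  quadAt : QuadAt Eh 0
  zero : Eh 0 = 0
  left : ∀ᶠ p in 𝓝 (0 : (Fin n → ℝ) × State n), Eh (p.2, fanState ψ p (Fin.last n)) = p.1
  right : ∀ᶠ q in 𝓝 (0 : State n × State n), fanState ψ (Eh q, q.1) (Fin.last n) = q.2

theorem linearIndependent_r (hF : L.HypothesisF) (hr : L.IsNormalized) {u : State n}
    (hu : u ∈ L.Ω) : LinearIndependent ℝ (fun j => L.r j u) :=
  Module.End.eigenvectors_linearIndependent' (L.jac u) (fun j => L.speed j u)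
    (L.speed_spec (hF.hyperbolic u hu)).1.injective _ (fun j => hr.eigenvector j u hu)

/-- The map `(σ, u) ↦ (u, Ψ(σ)(u))` has at the origin the derivative `(σ, u) ↦ (u, u + ∑ σⱼ rⱼ(0))`,
which is invertible because the eigenvectors form a basis. The strengths are the first component of
its local inverse. -/
theorem exists_isSolver (hF : L.HypothesisF) (hr : L.IsNormalized)
    {ψ : Fin n → ℝ × State n → State n} (hψ : ∀ j, IsLaxMap L j (ψ j))
    (hrq : ∀ j, QuadAt (L.r j) 0) : ∃ Eh, IsSolver L ψ Eh := by
  obtain ⟨D, hD, hDp⟩ := hasStrictFDerivAt_fanState hψ hrq (Fin.last n)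
  simp only [Fin.castSucc_lt_last, Finset.filter_true] at hDp
  set Φ : (Fin n → ℝ) × State n → State n × State n :=
    fun p => (p.2, fanState ψ p (Fin.last n)) with hΦ
  have hΦ0 : Φ 0 = 0 := by
    simp only [hΦ, fanState_zero_zero hψ]; rfl
  have hΦq : QuadAt Φ 0 := (QuadAt.of_contDiff contDiff_snd).prodMk (quadAt_fanState hψ _)
  set T : (Fin n → ℝ) × State n →L[ℝ] State n × State n :=
    (ContinuousLinearMap.snd ℝ (Fin n → ℝ) (State n)).prod D with hT
  have hΦd : HasStrictFDerivAt Φ T 0 :=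
    (ContinuousLinearMap.snd ℝ (Fin n → ℝ) (State n)).hasStrictFDerivAt.prodMk hD
  have hinj : Function.Injective (T : (Fin n → ℝ) × State n →ₗ[ℝ] State n × State n) := by
    rw [injective_iff_map_eq_zero]
    rintro ⟨σ, u⟩ h
    have h1 : u = 0 := congrArg Prod.fst h
    have h2 : D (σ, u) = 0 := congrArg Prod.snd h
    rw [hDp, h1, zero_add] at h2
    have := Fintype.linearIndependent_iff.1 (linearIndependent_r hF hr hF.zero_mem) σ h2
    rw [Prod.mk_eq_zero]
    exact ⟨funext this, h1⟩
  set e : ((Fin n → ℝ) × State n) ≃L[ℝ] State n × State n :=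
    (LinearMap.linearEquivOfInjective _ hinj (by simp)).toContinuousLinearEquiv with he
  have heT : (e : (Fin n → ℝ) × State n →L[ℝ] State n × State n) = T :=
    ContinuousLinearMap.ext fun _ => rfl
  rw [← heT] at hΦd
  set g := hΦd.localInverse Φ e 0 with hg
  have hgq : QuadAt g 0 := by
    have := QuadAt.localInverse hΦd hΦq
    rwa [hΦ0] at this
  have hleft : ∀ᶠ q in 𝓝 (0 : (Fin n → ℝ) × State n), g (Φ q) = q := hΦd.eventually_left_inverse
  have hright : ∀ᶠ q in 𝓝 (0 : State n × State n), Φ (g q) = q := by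
    have := hΦd.eventually_right_inverse
    rwa [hΦ0] at this
  have hg0 : g 0 = 0 := by simpa [hΦ0] using hleft.self_of_nhds
  refine ⟨fun q => (g q).1, ?_, ?_, ?_, ?_⟩
  · exact QuadAt.comp (G := Prod.fst) (QuadAt.of_contDiff contDiff_fst) hgq
  · simp only [hg0]; rfl
  · filter_upwards [hleft] with p hp
    exact congrArg Prod.fst hp
  · filter_upwards [hright] with q hq
    have h1 : (g q).2 = q.1 := congrArg Prod.fst hq
    have h2 : fanState ψ (g q) (Fin.last n) = q.2 := congrArg Prod.snd hq
    rw [← h1]; exact h2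

section Solver

variable {ψ : Fin n → ℝ × State n → State n} {Eh : State n × State n → Fin n → ℝ}

theorem IsSolver.tendsto (h : IsSolver L ψ Eh) : Tendsto Eh (𝓝 0) (𝓝 0) := by
  have := h.quadAt.continuousAt.tendsto
  rwa [h.zero] at this

theorem IsSolver.eventually_self (h : IsSolver L ψ Eh) (hψ : ∀ j, IsLaxMap L j (ψ j)) :
    ∀ᶠ u in 𝓝 (0 : State n), Eh (u, u) = 0 := by
  have ht : Tendsto (fun u : State n => ((0, u) : (Fin n → ℝ) × State n)) (𝓝 0) (𝓝 0) :=
    Continuous.tendsto' (by fun_prop) _ _ rfl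
  filter_upwards [ht.eventually h.left, eventually_fanState_zero hψ (Fin.last n)] with u h1 h2
  rwa [h2] at h1

theorem IsSolver.eventually_solvable (h : IsSolver L ψ Eh) (hψ : ∀ j, IsLaxMap L j (ψ j))
    {ε : ℝ} (hε : 0 < ε) : ∀ᶠ q in 𝓝 (0 : State n × State n), L.Solvable ε q.1 q.2 := by
  have ht : Tendsto (fun q : State n × State n => ((Eh q, q.1) : (Fin n → ℝ) × State n)) (𝓝 0)
      (𝓝 0) := h.tendsto.prodMk_nhds (Continuous.tendsto' (by fun_prop) _ _ rfl)
  filter_upwards [h.right, ht.eventually (eventually_waveFan_iff hψ),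
    h.tendsto.norm.eventually_lt_const (u := ε) (by simpa using hε)] with q h1 h2 h3
  exact ⟨Eh q, fun i => (norm_le_pi_norm (Eh q) i).trans_lt h3, (h2 _).2 h1.symm⟩

/-- It identifies the chosen strengths `E` with the smooth solver: strengths below `ε₀` lie where
the local inverse is a left inverse, whatever was chosen. The end state `v` is not assumed to be
near `0`; its distance from `u` is a conclusion. -/
theorem IsSolver.exists_forall_solvable (h : IsSolver L ψ Eh) (hψ : ∀ j, IsLaxMap L j (ψ j)) :
    ∃ ε₀ > 0, ∃ K : ℝ, 0 ≤ K ∧ ∀ᶠ u in 𝓝 (0 : State n), ∀ ε < ε₀, ∀ v, L.Solvable ε u v →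
      L.E ε u v = Eh (u, v) ∧ ‖v - u‖ ≤ K * ‖Eh (u, v)‖ := by
  obtain ⟨K, hK, s, hs, hl⟩ := (quadAt_fanState hψ (Fin.last n)).exists_lipschitz
  obtain ⟨ρ, hρ, hsub⟩ := Metric.eventually_nhds_iff_ball.1
    ((eventually_waveFan_iff hψ).and (h.left.and (eventually_mem_set.2 hs)))
  have hmem : ∀ (σ : Fin n → ℝ) (u : State n), ‖σ‖ < ρ → ‖u‖ < ρ → (σ, u) ∈
      Metric.ball (0 : (Fin n → ℝ) × State n) ρ := fun σ u h1 h2 => by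
    rw [mem_ball_zero_iff, Prod.norm_def]; exact max_lt h1 h2
  refine ⟨ρ, hρ, K, hK, ?_⟩
  filter_upwards [Metric.ball_mem_nhds (0 : State n) hρ, eventually_fanState_zero hψ (Fin.last n)]
    with u hu hu0 ε hε v hv
  rw [mem_ball_zero_iff] at hu
  have hspec := hv.choose_spec
  have hE : L.E ε u v = hv.choose := by simp [E, hv]
  set σ := hv.choose with hσ
  have hσn : ‖σ‖ < ρ := (pi_norm_lt_iff hρ).2 fun i => (hspec.1 i).trans hε
  have key := hsub _ (hmem σ u hσn hu)
  have hv' := (key.1 v).1 hspec.2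
  have hEh : Eh (u, v) = σ := by rw [hv']; exact key.2.1
  rw [hE, hEh]
  refine ⟨rfl, ?_⟩
  have := hl _ key.2.2 _ (hsub _ (hmem 0 u (by simpa using hρ) hu)).2.2
  rw [hu0, ← hv'] at this
  refine this.trans ?_
  simp [Prod.norm_def]

end Solver

end ConservationLaw

end

/-! ### Interaction potentials and Glimm's interaction estimate. -/

noncomputable section

namespace ConservationLaw

variable {n : ℕ} (L : ConservationLaw n)

open Classical in
/-- The interaction potential of an `i`-wave of strength `s` on the left of a `j`-wave of
strength `t`. -/
def wavePotential (i j : Fin n) (s t : ℝ) : ℝ :=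
  if j < i ∨ (i = j ∧ L.GenuinelyNonlinear i ∧ min s t < 0) then |s * t| else 0

/-- The interaction potential of two adjacent wave fans. -/
def fanPotential (σ τ : Fin n → ℝ) : ℝ := ∑ i, ∑ j, L.wavePotential i j (σ i) (τ j)

variable {L}

theorem wavePotential_nonneg (i j : Fin n) (s t : ℝ) : 0 ≤ L.wavePotential i j s t := by
  unfold wavePotential; split_ifs <;> positivity

theorem wavePotential_le (i j : Fin n) (s t : ℝ) : L.wavePotential i j s t ≤ |s| * |t| := by
  unfold wavePotential
  split_ifs
  · rw [abs_mul]
  · positivity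

@[simp] theorem wavePotential_zero_left (i j : Fin n) (t : ℝ) : L.wavePotential i j 0 t = 0 := by
  simp [wavePotential]

@[simp] theorem wavePotential_zero_right (i j : Fin n) (s : ℝ) :
    L.wavePotential i j s 0 = 0 := by
  simp [wavePotential]

theorem wavePotential_of_lt {i j : Fin n} (h : j < i) (s t : ℝ) :
    L.wavePotential i j s t = |s * t| := if_pos (Or.inl h)

/-- This form without case distinction, where only two rarefactions do not interact, makes the
continuity of the potential visible. -/
theorem wavePotential_self {i : Fin n} (h : L.GenuinelyNonlinear i) (s t : ℝ) :
    L.wavePotential i i s t = |s * t| - max s 0 * max t 0 := by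
  unfold wavePotential
  by_cases hst : min s t < 0
  · rw [if_pos (Or.inr ⟨rfl, h, hst⟩)]
    rcases min_lt_iff.1 hst with h | h <;> simp [h.le]
  · rw [if_neg (by simp only [lt_irrefl, false_or, not_and]; exact fun _ _ => hst)]
    have := le_min_iff.1 (not_lt.1 hst)
    rw [max_eq_left this.1, max_eq_left this.2, abs_of_nonneg (mul_nonneg this.1 this.2), sub_self]

theorem wavePotential_eq_zero {i j : Fin n} (h : ¬ j < i)
    (h' : ¬ (i = j ∧ L.GenuinelyNonlinear i)) (s t : ℝ) : L.wavePotential i j s t = 0 :=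
  if_neg (by tauto)

theorem wavePotential_self_comm (i : Fin n) (s t : ℝ) :
    L.wavePotential i i s t = L.wavePotential i i t s := by
  by_cases h : L.GenuinelyNonlinear i
  · rw [wavePotential_self h, wavePotential_self h, mul_comm, mul_comm (max s 0)]
  · rw [wavePotential_eq_zero (lt_irrefl i) (by tauto), wavePotential_eq_zero (lt_irrefl i) (by tauto)]

/-- For a genuinely nonlinear field the potential is `|s| * |t|` if `t < 0` and `t` times the
negative part of `s` if `t ≥ 0`; both are subadditive in `s`. -/
theorem wavePotential_add_left (i j : Fin n) (s s' t : ℝ) :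
    L.wavePotential i j (s + s') t ≤ L.wavePotential i j s t + L.wavePotential i j s' t := by
  by_cases h1 : j < i
  · simp only [wavePotential_of_lt h1, add_mul]
    exact abs_add_le _ _
  by_cases h2 : i = j ∧ L.GenuinelyNonlinear i
  · obtain ⟨rfl, h⟩ := h2
    simp only [wavePotential_self h, abs_mul]
    rcases lt_or_ge t 0 with ht | ht
    · simp only [max_eq_right ht.le, mul_zero, sub_zero]
      rw [← add_mul]
      gcongr
      exact abs_add_le s s'
    · rw [max_eq_left ht, abs_of_nonneg ht]
      have key : ∀ x : ℝ, |x| - max x 0 = max (-x) 0 := fun x => by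
        rcases le_total 0 x with h | h <;> simp [h, abs_of_nonneg, abs_of_nonpos]
      have : max (-(s + s')) 0 ≤ max (-s) 0 + max (-s') 0 :=
        max_le (by linarith [le_max_left (-s) 0, le_max_left (-s') 0])
          (by linarith [le_max_right (-s) 0, le_max_right (-s') 0])
      rw [← key, ← key, ← key] at this
      nlinarith
  · simp only [wavePotential_eq_zero h1 h2, add_zero, le_refl]

theorem wavePotential_add_right (i j : Fin n) (s t t' : ℝ) :
    L.wavePotential i j s (t + t') ≤ L.wavePotential i j s t + L.wavePotential i j s t' := by
  by_cases h1 : j < i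
  · simp only [wavePotential_of_lt h1, mul_add]
    exact abs_add_le _ _
  by_cases h2 : i = j ∧ L.GenuinelyNonlinear i
  · obtain ⟨rfl, -⟩ := h2
    rw [wavePotential_self_comm, wavePotential_self_comm i s t, wavePotential_self_comm i s t']
    exact wavePotential_add_left i i t t' s
  · simp only [wavePotential_eq_zero h1 h2, add_zero, le_refl]

theorem fanPotential_nonneg (σ τ : Fin n → ℝ) : 0 ≤ L.fanPotential σ τ :=
  Finset.sum_nonneg fun _ _ => Finset.sum_nonneg fun _ _ => wavePotential_nonneg _ _ _ _

theorem fanPotential_le (σ τ : Fin n → ℝ) :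
    L.fanPotential σ τ ≤ (∑ i, |σ i|) * ∑ i, |τ i| := by
  rw [Finset.sum_mul_sum]
  exact Finset.sum_le_sum fun i _ => Finset.sum_le_sum fun j _ => wavePotential_le _ _ _ _

theorem fanPotential_add_left (σ σ' τ : Fin n → ℝ) :
    L.fanPotential (σ + σ') τ ≤ L.fanPotential σ τ + L.fanPotential σ' τ := by
  simp only [fanPotential, ← Finset.sum_add_distrib]
  exact Finset.sum_le_sum fun i _ => Finset.sum_le_sum fun j _ => wavePotential_add_left _ _ _ _ _

theorem fanPotential_add_right (σ τ τ' : Fin n → ℝ) :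
    L.fanPotential σ (τ + τ') ≤ L.fanPotential σ τ + L.fanPotential σ τ' := by
  simp only [fanPotential, ← Finset.sum_add_distrib]
  exact Finset.sum_le_sum fun i _ => Finset.sum_le_sum fun j _ => wavePotential_add_right _ _ _ _ _

theorem fanPotential_single (σ : Fin n → ℝ) (j : Fin n) (t : ℝ) :
    L.fanPotential σ (Pi.single j t) = ∑ i, L.wavePotential i j (σ i) t := by
  refine Finset.sum_congr rfl fun i _ => ?_
  rw [Finset.sum_eq_single j _ (by simp)]
  · simp
  · intro k _ hk; simp [hk]

theorem fanPotential_single_le (σ τ : Fin n → ℝ) (j : Fin n) :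
    L.fanPotential σ (Pi.single j (τ j)) ≤ L.fanPotential σ τ := by
  rw [fanPotential_single]
  exact Finset.sum_le_sum fun i _ => Finset.single_le_sum
    (f := fun j => L.wavePotential i j (σ i) (τ j)) (fun j _ => wavePotential_nonneg _ _ _ _)
    (Finset.mem_univ j)

theorem sum_abs_le (σ : Fin n → ℝ) : ∑ i, |σ i| ≤ n * ‖σ‖ := by
  refine (Finset.sum_le_card_nsmul _ _ ‖σ‖ fun i _ => norm_le_pi_norm σ i).trans ?_
  simp

section Interaction

variable {ψ : Fin n → ℝ × State n → State n} (hψ : ∀ j, IsLaxMap L j (ψ j))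

include hψ

/-- Adding a wave on the right of a fan with which it does not interact. -/
theorem eventually_fanState_add (j : Fin n) :
    ∀ᶠ x in 𝓝 (0 : ℝ × (Fin n → ℝ) × State n), (∀ i, j < i → x.2.1 i = 0) →
      (x.2.1 j = 0 ∨ (L.GenuinelyNonlinear j → 0 ≤ x.1 ∧ 0 ≤ x.2.1 j)) →
      fanState ψ (x.2.1 + Pi.single j x.1, x.2.2) (Fin.last n) =
        ψ j (x.1, fanState ψ x.2 (Fin.last n)) := by
  have t2 : Tendsto (fun x : ℝ × (Fin n → ℝ) × State n => x.2) (𝓝 0) (𝓝 0) :=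
    Continuous.tendsto' (by fun_prop) _ _ rfl
  have tf : ∀ i, Tendsto (fun x : ℝ × (Fin n → ℝ) × State n => fanState ψ x.2 i) (𝓝 0) (𝓝 0) :=
    fun i => (tendsto_fanState hψ i).comp t2
  have tψ : ∀ i, Tendsto (fun x : ℝ × (Fin n → ℝ) × State n => ψ j (x.1, fanState ψ x.2 i))
      (𝓝 0) (𝓝 0) := fun i => by
    have h1 : Tendsto (fun x : ℝ × (Fin n → ℝ) × State n => (x.1, fanState ψ x.2 i)) (𝓝 0)
        (𝓝 (0, 0)) := Tendsto.prodMk_nhds (Continuous.tendsto' (by fun_prop) _ _ rfl) (tf i)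
    have h2 := (hψ j).quadAt.continuousAt.tendsto
    rw [(hψ j).zero] at h2
    exact h2.comp h1
  have ta : Tendsto (fun x : ℝ × (Fin n → ℝ) × State n =>
      (x.1, x.2.1 j, fanState ψ x.2 j.castSucc)) (𝓝 0) (𝓝 (0, 0, 0)) :=
    Tendsto.prodMk_nhds (Continuous.tendsto' (by fun_prop) _ _ rfl)
      (Tendsto.prodMk_nhds (Continuous.tendsto' (by fun_prop) _ _ rfl) (tf _))
  filter_upwards [eventually_all.2 fun i : Fin n => (tf i.castSucc).eventually
      (hψ i).eventually_zero, eventually_all.2 fun i : Fin n => (tψ i.castSucc).eventually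
      (hψ i).eventually_zero, (tψ j.castSucc).eventually (hψ j).eventually_zero,
      (tf j.castSucc).eventually (hψ j).eventually_zero, ta.eventually (hψ j).add]
    with x h1 h2 h3 h4 h5 hx hj
  obtain ⟨s, σ, u⟩ := x
  simp only at *
  -- Beyond the index `j` the fan carries no waves, so the state no longer changes; at the index `j`
  -- the new wave either is alone or is joined by the addition law of the Lax curve.
  have key : ∀ i, fanState ψ (σ + Pi.single j s, u) i =
      if i ≤ j.castSucc then fanState ψ (σ, u) i else ψ j (s, fanState ψ (σ, u) i) := by
    intro i
    induction i using Fin.induction with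
    | zero => simp
    | succ i ih =>
      rw [fanState_succ, ih, fanState_succ]
      rcases lt_trichotomy i j with h | h | h
      · have e1 : i.castSucc ≤ j.castSucc := h.le
        have e2 : i.succ ≤ j.castSucc := by rwa [Fin.succ_le_castSucc_iff]
        simp [e1, e2, h.ne]
      · subst h
        have e2 : ¬ i.succ ≤ i.castSucc := by simp
        simp only [le_refl, if_true, e2, if_false, Pi.add_apply, Pi.single_eq_same]
        rcases hj with hj | hj
        · rw [hj, zero_add, h4]
        · rw [h5 hj, add_comm]
      · have e1 : ¬ i.castSucc ≤ j.castSucc := by simpa using h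
        have e2 : ¬ i.succ ≤ j.castSucc := by
          rw [Fin.succ_le_castSucc_iff]; exact not_lt.2 h.le
        simp only [e1, e2, if_false, Pi.add_apply, hx i h, zero_add,
          Pi.single_eq_of_ne h.ne', h1, h2]
  rw [key, if_neg (by simp)]

variable {Eh : State n × State n → Fin n → ℝ} (hE : IsSolver L ψ Eh)

include hE

/-- Interaction of a fan with a single wave on its right. -/
theorem exists_norm_interaction_single (j : Fin n) :
    ∃ K : ℝ, 0 ≤ K ∧ ∀ᶠ x in 𝓝 (0 : ℝ × (Fin n → ℝ) × State n),
      ‖Eh (x.2.2, ψ j (x.1, fanState ψ x.2 (Fin.last n))) - x.2.1 - Pi.single j x.1‖ ≤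
        K * L.fanPotential x.2.1 (Pi.single j x.1) := by
  classical
  set G : ℝ × (Fin n → ℝ) × State n → Fin n → ℝ := fun x =>
    Eh (x.2.2, ψ j (x.1, fanState ψ x.2 (Fin.last n))) - x.2.1 - Pi.single j x.1 with hG
  have hf : QuadAt (fun x : ℝ × (Fin n → ℝ) × State n => fanState ψ x.2 (Fin.last n)) 0 :=
    QuadAt.comp (G := fun p => fanState ψ p (Fin.last n)) (F := Prod.snd)
      (x := (0 : ℝ × (Fin n → ℝ) × State n)) (quadAt_fanState hψ _)
      (QuadAt.of_contDiff contDiff_snd)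
  have hψf : QuadAt (fun x : ℝ × (Fin n → ℝ) × State n =>
      ψ j (x.1, fanState ψ x.2 (Fin.last n))) 0 := by
    refine QuadAt.comp (G := ψ j) (F := fun x : ℝ × (Fin n → ℝ) × State n =>
      (x.1, fanState ψ x.2 (Fin.last n))) ?_ ((QuadAt.of_contDiff contDiff_fst).prodMk hf)
    simp only [Prod.fst_zero, Prod.snd_zero, fanState_zero_zero hψ]
    exact (hψ j).quadAt
  have hGq : QuadAt G 0 := by
    refine QuadAt.sub (QuadAt.sub ?_ (QuadAt.of_contDiff (by fun_prop))) ?_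
    · refine QuadAt.comp (G := Eh) (F := fun x : ℝ × (Fin n → ℝ) × State n =>
        (x.2.2, ψ j (x.1, fanState ψ x.2 (Fin.last n)))) ?_
        (QuadAt.prodMk (QuadAt.of_contDiff (by fun_prop)) hψf)
      simp only [Prod.fst_zero, Prod.snd_zero, fanState_zero_zero hψ]
      have : ψ j (0, 0) = 0 := (hψ j).zero
      rw [this]; exact hE.quadAt
    · exact QuadAt.of_contDiff (((ContinuousLinearMap.single ℝ (fun _ : Fin n => ℝ) j).comp
        (ContinuousLinearMap.fst ℝ ℝ ((Fin n → ℝ) × State n))).contDiff)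
  have tadd : Tendsto (fun x : ℝ × (Fin n → ℝ) × State n =>
      ((x.2.1 + Pi.single j x.1, x.2.2) : (Fin n → ℝ) × State n)) (𝓝 0) (𝓝 0) := by
    refine Continuous.tendsto' ?_ _ _ (by simp)
    have h1 : Continuous (fun x : ℝ × (Fin n → ℝ) × State n => (Pi.single j x.1 : Fin n → ℝ)) :=
      (continuous_single (A := fun _ : Fin n => ℝ) j).comp continuous_fst
    fun_prop
  have t2 : Tendsto (fun x : ℝ × (Fin n → ℝ) × State n => x.2) (𝓝 0) (𝓝 0) :=
    Continuous.tendsto' (by fun_prop) _ _ rfl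
  have hvan : ∀ᶠ x in 𝓝 (0 : ℝ × (Fin n → ℝ) × State n), (∀ i, j < i → x.2.1 i = 0) →
      (x.2.1 j = 0 ∨ (L.GenuinelyNonlinear j → 0 ≤ x.1 ∧ 0 ≤ x.2.1 j)) → G x = 0 := by
    filter_upwards [eventually_fanState_add hψ j, tadd.eventually hE.left] with x h1 h2 a b
    simp only [hG]
    rw [← h1 a b, h2]
    abel
  have hvan0 : ∀ᶠ x in 𝓝 (0 : ℝ × (Fin n → ℝ) × State n), x.1 = 0 → G x = 0 := by
    filter_upwards [t2.eventually hE.left,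
      ((tendsto_fanState hψ (Fin.last n)).comp t2).eventually (hψ j).eventually_zero] with x h1 h2 h
    simp only [hG, h]
    simp only [Function.comp_apply] at h2
    rw [h2, h1]
    simp
  obtain ⟨K, hK, s, hs, hq⟩ := hGq
  obtain ⟨ρ, hρ, hsub⟩ := Metric.mem_nhds_iff.1 (inter_mem (inter_mem hs hvan) hvan0)
  refine ⟨K, hK, ?_⟩
  filter_upwards [Metric.ball_mem_nhds 0 hρ]
  rintro ⟨t, σ, u⟩ hx
  simp only [mem_ball_zero_iff, Prod.norm_def, sup_lt_iff] at hx
  obtain ⟨ht, hσ, hu⟩ := hx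
  have hmem : ∀ (t' : ℝ) (σ' : Fin n → ℝ), ‖t'‖ < ρ → ‖σ'‖ < ρ →
      (t', σ', u) ∈ Metric.ball (0 : ℝ × (Fin n → ℝ) × State n) ρ := by
    intro t' σ' h1 h2
    simp only [mem_ball_zero_iff, Prod.norm_def, sup_lt_iff]
    exact ⟨h1, h2, hu⟩
  -- `P` selects the waves of the fan that do not interact with the added one, and `σ'` is the fan
  -- truncated to them.
  set P : Fin n → Prop := fun i => i < j ∨ (i = j ∧ (L.GenuinelyNonlinear j → 0 ≤ t ∧ 0 ≤ σ j))
    with hP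
  set σ' : Fin n → ℝ := fun i => if P i then σ i else 0 with hσ'
  have hσ'n : ‖σ'‖ < ρ := by
    refine lt_of_le_of_lt ((pi_norm_le_iff_of_nonneg (norm_nonneg _)).2 fun i => ?_) hσ
    simp only [hσ']
    split_ifs
    · exact norm_le_pi_norm σ i
    · simp
  have h0ρ : ‖(0 : ℝ)‖ < ρ := by simpa using hρ
  have mb := hsub (hmem t σ' ht hσ'n)
  have mc := hsub (hmem 0 σ h0ρ hσ)
  have md := hsub (hmem 0 σ' h0ρ hσ'n)
  have gb : G (t, σ', u) = 0 := by
    refine mb.1.2 (fun i hi => ?_) ?_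
    · have : ¬ P i := by simp only [hP]; rintro (h | ⟨h, -⟩) <;> omega
      simp only [hσ', this, if_false]
    · by_cases hj : P j
      · right
        simp only [hσ', hj, if_true]
        simpa [hP] using hj
      · left; simp only [hσ', hj, if_false]
  -- The error `G` vanishes at `(t, σ')`, `(0, σ)` and `(0, σ')`, so the parallelogram estimate
  -- leaves only the product `|t| * ‖σ - σ'‖` of the added wave with the waves it meets.
  have := hq _ (hsub (hmem t σ ht hσ)).1.1 _ mb.1.1 _ mc.1.1 _ md.1.1
  rw [gb, mc.2 rfl, md.2 rfl] at this
  simp only [sub_zero, add_zero, Prod.mk_sub_mk, Prod.mk_add_mk, sub_self] at this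
  refine this.trans ?_
  gcongr
  have e1 : σ - σ' - σ + σ' = 0 := by abel
  rw [e1, zero_sub, neg_add_cancel]
  have e2 : ‖((0, 0, 0) : ℝ × (Fin n → ℝ) × State n)‖ = 0 := norm_zero
  have e3 : ‖((t, 0) : ℝ × (Fin n → ℝ) × State n)‖ = |t| := by
    simp [Prod.norm_def]
  have e4 : ‖((0, σ - σ', 0) : ℝ × (Fin n → ℝ) × State n)‖ = ‖σ - σ'‖ := by
    simp [Prod.norm_def]
  rw [e2, e3, e4, zero_add, ← Real.norm_eq_abs, ← norm_smul]
  refine (pi_norm_le_iff_of_nonneg (fanPotential_nonneg _ _)).2 fun i => ?_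
  rw [fanPotential_single]
  refine le_trans ?_ (Finset.single_le_sum (f := fun i => L.wavePotential i j (σ i) t)
    (fun i _ => wavePotential_nonneg _ _ _ _) (Finset.mem_univ i))
  simp only [Pi.smul_apply, Pi.sub_apply, hσ', smul_eq_mul]
  by_cases h : P i
  · simp only [h, if_true, sub_self, mul_zero, norm_zero]
    exact wavePotential_nonneg _ _ _ _
  · simp only [h, if_false, sub_zero, Real.norm_eq_abs]
    have hc : j < i ∨ (i = j ∧ L.GenuinelyNonlinear i ∧ min (σ i) t < 0) := by
      simp only [hP, not_or, not_and, not_lt] at h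
      rcases h.1.lt_or_eq with h1 | h1
      · exact Or.inl h1
      · right
        subst h1
        have := h.2 rfl
        simp only [not_forall, not_and, not_le] at this
        obtain ⟨g, hg⟩ := this
        refine ⟨rfl, g, ?_⟩
        rcases lt_or_ge t 0 with h2 | h2
        · exact (min_le_right _ _).trans_lt h2
        · exact (min_le_left _ _).trans_lt (hg h2)
    simp only [wavePotential, hc, if_true]
    rw [mul_comm]

/-- Interaction of two fans, the waves of the second one being added one at a time. -/
theorem exists_norm_interaction_fan (i : Fin (n + 1)) :
    ∃ C : ℝ, 0 ≤ C ∧ ∀ᶠ x in 𝓝 (0 : (Fin n → ℝ) × (Fin n → ℝ) × State n),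
      ‖Eh (x.2.2, fanState ψ (x.2.1, fanState ψ (x.1, x.2.2) (Fin.last n)) i) - x.1 -
        (fun j : Fin n => if j.castSucc < i then x.2.1 j else 0)‖ ≤
        C * L.fanPotential x.1 x.2.1 := by
  have t1 : Tendsto (fun x : (Fin n → ℝ) × (Fin n → ℝ) × State n => (x.1, x.2.2)) (𝓝 0) (𝓝 0) :=
    Continuous.tendsto' (by fun_prop) _ _ rfl
  have tb : Tendsto (fun x : (Fin n → ℝ) × (Fin n → ℝ) × State n =>
      ((x.2.1, fanState ψ (x.1, x.2.2) (Fin.last n)) : (Fin n → ℝ) × State n)) (𝓝 0) (𝓝 0) :=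
    Tendsto.prodMk_nhds (Continuous.tendsto' (by fun_prop) _ _ rfl)
      ((tendsto_fanState hψ _).comp t1)
  induction i using Fin.induction with
  | zero =>
    refine ⟨0, le_rfl, ?_⟩
    filter_upwards [t1.eventually hE.left] with x hx
    rw [fanState_zero, hx]
    simp only [Fin.not_lt_zero, if_false, sub_self, zero_mul]
    exact (norm_zero (E := Fin n → ℝ)).le.trans' (by simp [← Pi.zero_def])
  | succ i ih =>
    obtain ⟨C, hC0, hC⟩ := ih
    obtain ⟨K, hK0, hK⟩ := exists_norm_interaction_single hψ hE i
    have tw : Tendsto (fun x : (Fin n → ℝ) × (Fin n → ℝ) × State n =>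
        ((x.2.2, fanState ψ (x.2.1, fanState ψ (x.1, x.2.2) (Fin.last n)) i.castSucc) :
          State n × State n)) (𝓝 0) (𝓝 0) :=
      Tendsto.prodMk_nhds (Continuous.tendsto' (by fun_prop) _ _ rfl)
        ((tendsto_fanState hψ _).comp tb)
    have tK : Tendsto (fun x : (Fin n → ℝ) × (Fin n → ℝ) × State n =>
        ((x.2.1 i, Eh (x.2.2, fanState ψ (x.2.1, fanState ψ (x.1, x.2.2) (Fin.last n)) i.castSucc),
          x.2.2) : ℝ × (Fin n → ℝ) × State n)) (𝓝 0) (𝓝 0) :=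
      Tendsto.prodMk_nhds (Continuous.tendsto' (by fun_prop) _ _ rfl)
        (Tendsto.prodMk_nhds (hE.tendsto.comp tw) (Continuous.tendsto' (by fun_prop) _ _ rfl))
    have tτ : ∀ᶠ x in 𝓝 (0 : (Fin n → ℝ) × (Fin n → ℝ) × State n), |x.2.1 i| < 1 := by
      have : Tendsto (fun x : (Fin n → ℝ) × (Fin n → ℝ) × State n => |x.2.1 i|) (𝓝 0) (𝓝 0) :=
        Continuous.tendsto' (by fun_prop) _ _ (by simp)
      exact this.eventually_lt_const one_pos
    refine ⟨C + K * (1 + n * C), by positivity, ?_⟩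
    filter_upwards [hC, tw.eventually hE.right, tK.eventually hK, tτ] with x h1 h2 h3 h4
    obtain ⟨σ, τ, u⟩ := x
    set w := fanState ψ (τ, fanState ψ (σ, u) (Fin.last n)) i.castSucc with hw
    rw [fanState_succ, ← hw]
    rw [h2] at h3
    set σk := Eh (u, w) with hσk
    set T : Fin n → ℝ := fun j => if j.castSucc < i.castSucc then τ j else 0 with hT
    have hT' : (fun j : Fin n => if j.castSucc < i.succ then τ j else 0) =
        T + Pi.single i (τ i) := by
      funext j
      simp only [hT, Pi.add_apply, Fin.castSucc_lt_succ_iff, Fin.castSucc_lt_castSucc_iff]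
      rcases lt_trichotomy j i with h | h | h
      · simp [h, h.le, h.ne]
      · subst h; simp
      · simp [not_lt.2 h.le, not_le.2 h, h.ne']
    set q := L.fanPotential σ τ with hq
    have hq0 : 0 ≤ q := fanPotential_nonneg _ _
    set e := σk - σ - T with he
    -- The solved fan `σk` consists of `σ`, of the waves `T` already added and of an error `e`.
    -- Waves in `T` have indices below `i` and do not meet the new one, and `e` is of order `q`.
    have p1 : L.fanPotential σk (Pi.single i (τ i)) ≤ q + n * C * q := by
      have d1 : σk = σ + (T + e) := by rw [he]; abel
      have d2 : L.fanPotential T (Pi.single i (τ i)) = 0 := by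
        rw [fanPotential_single]
        refine Finset.sum_eq_zero fun j _ => ?_
        by_cases hj : j < i
        · simp [wavePotential, not_lt.2 hj.le, hj.ne]
        · simp [hT, hj]
      have d3 : L.fanPotential e (Pi.single i (τ i)) ≤ n * C * q := by
        refine (fanPotential_le _ _).trans ?_
        have s1 : ∑ k, |(Pi.single i (τ i) : Fin n → ℝ) k| = |τ i| := by
          rw [Finset.sum_eq_single i (fun k _ hk => by simp [hk]) (by simp)]
          simp
        rw [s1]
        have s2 := sum_abs_le e
        have s3 : (n : ℝ) * ‖e‖ ≤ n * (C * q) := by gcongr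
        calc (∑ k, |e k|) * |τ i| ≤ (n * (C * q)) * 1 := by
              gcongr
              exact s2.trans s3
          _ = _ := by ring
      rw [d1]
      have := fanPotential_add_left (L := L) σ (T + e) (Pi.single i (τ i))
      have := fanPotential_add_left (L := L) T e (Pi.single i (τ i))
      have := fanPotential_single_le (L := L) σ τ i
      linarith
    rw [hT']
    have d4 : Eh (u, ψ i (τ i, w)) - σ - (T + Pi.single i (τ i)) =
        (Eh (u, ψ i (τ i, w)) - σk - Pi.single i (τ i)) + e := by rw [he]; abel
    rw [d4]
    refine (norm_add_le _ _).trans ?_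
    have : K * L.fanPotential σk (Pi.single i (τ i)) ≤ K * (q + n * C * q) := by gcongr
    linarith

/-- Glimm's interaction estimate. -/
theorem exists_norm_interaction : ∃ K : ℝ, 0 ≤ K ∧
    ∀ᶠ x in 𝓝 (0 : State n × State n × State n),
      ‖Eh (x.1, x.2.2) - Eh (x.1, x.2.1) - Eh (x.2.1, x.2.2)‖ ≤
        K * L.fanPotential (Eh (x.1, x.2.1)) (Eh (x.2.1, x.2.2)) := by
  obtain ⟨C, hC0, hC⟩ := exists_norm_interaction_fan hψ hE (Fin.last n)
  have t1 : Tendsto (fun x : State n × State n × State n => (x.1, x.2.1)) (𝓝 0) (𝓝 0) :=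
    Continuous.tendsto' (by fun_prop) _ _ rfl
  have t2 : Tendsto (fun x : State n × State n × State n => (x.2.1, x.2.2)) (𝓝 0) (𝓝 0) :=
    Continuous.tendsto' (by fun_prop) _ _ rfl
  have t3 : Tendsto (fun x : State n × State n × State n =>
      ((Eh (x.1, x.2.1), Eh (x.2.1, x.2.2), x.1) : (Fin n → ℝ) × (Fin n → ℝ) × State n))
      (𝓝 0) (𝓝 0) :=
    Tendsto.prodMk_nhds (hE.tendsto.comp t1) (Tendsto.prodMk_nhds (hE.tendsto.comp t2)
      (Continuous.tendsto' (by fun_prop) _ _ rfl))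
  refine ⟨C, hC0, ?_⟩
  filter_upwards [t3.eventually hC, t1.eventually hE.right, t2.eventually hE.right] with x h1 h2 h3
  simp only [Fin.castSucc_lt_last, if_true] at h1
  rw [h2, h3] at h1
  exact h1

end Interaction

end ConservationLaw

end

/-! ### Dual eigenvectors and uniform estimates for the Riemann problem. -/

noncomputable section

namespace ConservationLaw

variable {n : ℕ} {L : ConservationLaw n}

theorem l_apply_r (hF : L.HypothesisF) (hr : L.IsNormalized) {u : State n} (hu : u ∈ L.Ω)
    (i j : Fin n) : L.l i u (L.r j u) = if i = j then 1 else 0 := by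
  set M : Matrix (Fin n) (Fin n) ℝ := Matrix.of fun a j => L.r j u a with hM
  have hli : LinearIndependent ℝ M.col := by
    have := (linearIndependent_r hF hr hu).map' (WithLp.linearEquiv 2 ℝ (Fin n → ℝ)).toLinearMap
      (LinearEquiv.ker _)
    exact this
  have hunit : IsUnit M := Matrix.linearIndependent_cols_iff_isUnit.1 hli
  have hmul : M⁻¹ * M = 1 := Matrix.nonsing_inv_mul M ((Matrix.isUnit_iff_isUnit_det M).1 hunit)
  have := congrFun (congrFun hmul i) j
  rw [Matrix.mul_apply, Matrix.one_apply] at this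
  rw [← this]
  simp [l, hM]

variable (L) in
/-- The matrix with columns `rⱼ(u)` as a continuous linear map. -/
def frame (u : State n) : (Fin n → ℝ) →L[ℝ] State n :=
  ∑ j, (ContinuousLinearMap.proj j : (Fin n → ℝ) →L[ℝ] ℝ).smulRight (L.r j u)

theorem frame_apply (u : State n) (c : Fin n → ℝ) : L.frame u c = ∑ j, c j • L.r j u := by
  simp [frame]

theorem exists_frameEquiv (hF : L.HypothesisF) (hr : L.IsNormalized) {u : State n} (hu : u ∈ L.Ω) :
    ∃ e : (Fin n → ℝ) ≃L[ℝ] State n, (e : (Fin n → ℝ) →L[ℝ] State n) = L.frame u := by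
  have hinj : Function.Injective (L.frame u : (Fin n → ℝ) →ₗ[ℝ] State n) := by
    rw [injective_iff_map_eq_zero]
    intro c hc
    exact funext (Fintype.linearIndependent_iff.1 (linearIndependent_r hF hr hu) c
      ((frame_apply u c).symm.trans hc))
  exact ⟨(LinearMap.linearEquivOfInjective _ hinj (by simp)).toContinuousLinearEquiv,
    ContinuousLinearMap.ext fun _ => rfl⟩

/-- Written through the inverse of the frame, `lᵢ` inherits the regularity of the right
eigenvectors. -/
theorem l_eq (hF : L.HypothesisF) (hr : L.IsNormalized) {u : State n} (hu : u ∈ L.Ω) (i : Fin n) :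
    L.l i u = (ContinuousLinearMap.proj i : (Fin n → ℝ) →L[ℝ] ℝ).comp
      (ContinuousLinearMap.inverse (L.frame u)) := by
  obtain ⟨e, he⟩ := exists_frameEquiv hF hr hu
  rw [← he, ContinuousLinearMap.inverse_equiv]
  ext v
  have hv : v = ∑ j, (e.symm v) j • L.r j u := by
    rw [← frame_apply, ← he]; simp
  conv_lhs => rw [hv]
  simp [map_sum, l_apply_r hF hr hu]

theorem contDiffAt_l (hF : L.HypothesisF) (hr : L.IsNormalized)
    (hrc : ∀ j, ContDiffAt ℝ 2 (L.r j) 0) (i : Fin n) : ContDiffAt ℝ 2 (L.l i) 0 := by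
  have h1 : ContDiffAt ℝ 2 L.frame 0 := by
    unfold frame
    refine ContDiffAt.sum fun j _ => ?_
    exact ((ContinuousLinearMap.smulRightL ℝ (Fin n → ℝ) (State n)
      (ContinuousLinearMap.proj j)).contDiff.contDiffAt).comp (0 : State n) (hrc j)
  obtain ⟨e, he⟩ := exists_frameEquiv hF hr hF.zero_mem
  have h2 : ContDiffAt ℝ 2 (fun u => ContinuousLinearMap.inverse (L.frame u)) 0 :=
    ContDiffAt.comp (g := ContinuousLinearMap.inverse) (f := L.frame) (0 : State n)
      (by rw [← he]; exact contDiffAt_map_inverse e) h1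
  have h3 : ContDiffAt ℝ 2 (fun u => (ContinuousLinearMap.proj i : (Fin n → ℝ) →L[ℝ] ℝ).comp
      (ContinuousLinearMap.inverse (L.frame u))) 0 := contDiffAt_const.clm_comp h2
  refine h3.congr_of_eventuallyEq ?_
  filter_upwards [eventually_mem_Ω hF] with u hu using l_eq hF hr hu i

variable (L) in
/-- Estimates for the Riemann problem with data in the ball of radius `ρ` around `0`. -/
structure RiemannEstimates (ε : ℝ) (Eh : State n × State n → Fin n → ℝ) (K ρ : ℝ) : Prop where
  K_nonneg : 0 ≤ K
  ρ_pos : 0 < ρ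
  mem_Ω : ∀ u, ‖u‖ < ρ → u ∈ L.Ω
  solvable : ∀ u v, ‖u‖ < ρ → ‖v‖ < ρ → L.Solvable ε u v
  E_eq : ∀ u v, ‖u‖ < ρ → L.Solvable ε u v → L.E ε u v = Eh (u, v)
  norm_sub_le : ∀ u v, ‖u‖ < ρ → L.Solvable ε u v → ‖v - u‖ ≤ K * ‖Eh (u, v)‖
  self : ∀ u, ‖u‖ < ρ → Eh (u, u) = 0
  quad : ∀ a b c d : State n × State n, ‖a‖ < ρ → ‖b‖ < ρ → ‖c‖ < ρ → ‖d‖ < ρ →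
    ‖Eh a - Eh b - Eh c + Eh d‖ ≤ K * (‖a - b - c + d‖ + ‖b - d‖ * ‖c - d‖)
  interaction : ∀ a b c, ‖a‖ < ρ → ‖b‖ < ρ → ‖c‖ < ρ →
    ‖Eh (a, c) - Eh (a, b) - Eh (b, c)‖ ≤ K * L.fanPotential (Eh (a, b)) (Eh (b, c))
  linear : ∀ u v, ‖u‖ < ρ → ‖v‖ < ρ → ∀ i, |Eh (u, v) i - L.l i u (v - u)| ≤ K * ‖v - u‖ ^ 2
  l_bound : ∀ u, ‖u‖ < ρ → ∀ i, ‖L.l i u‖ ≤ K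
  l_lipschitz : ∀ u v, ‖u‖ < ρ → ‖v‖ < ρ → ∀ i, ‖L.l i u - L.l i v‖ ≤ K * ‖u - v‖

/-- Applying `lᵢ(u)` to the expansion `v - u = ∑ Eⱼ rⱼ(u) + O(‖E‖²)` isolates the `i`-th strength,
and `‖E‖ = O(‖v - u‖)`. -/
theorem IsSolver.exists_linear {ψ : Fin n → ℝ × State n → State n}
    {Eh : State n × State n → Fin n → ℝ} (h : IsSolver L ψ Eh) (hψ : ∀ j, IsLaxMap L j (ψ j))
    (hF : L.HypothesisF) (hr : L.IsNormalized) (hrc : ∀ j, ContDiffAt ℝ 2 (L.r j) 0) :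
    ∃ K : ℝ, 0 ≤ K ∧ ∀ᶠ q in 𝓝 (0 : State n × State n), ∀ i,
      |Eh q i - L.l i q.1 (q.2 - q.1)| ≤ K * ‖q.2 - q.1‖ ^ 2 := by
  obtain ⟨C, hC0, hC⟩ := quadratic_fanState hψ (fun j => QuadAt.of_contDiffAt (hrc j)) (Fin.last n)
  simp only [Fin.castSucc_lt_last, Finset.filter_true] at hC
  obtain ⟨M, hM, s, hs, hl⟩ := h.quadAt.exists_lipschitz
  have ht : Tendsto (fun q : State n × State n => ((Eh q, q.1) : (Fin n → ℝ) × State n)) (𝓝 0)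
      (𝓝 0) := h.tendsto.prodMk_nhds (Continuous.tendsto' (by fun_prop) _ _ rfl)
  have t1 : Tendsto (fun q : State n × State n => q.1) (𝓝 0) (𝓝 0) :=
    Continuous.tendsto' (by fun_prop) _ _ rfl
  have t11 : Tendsto (fun q : State n × State n => (q.1, q.1)) (𝓝 0) (𝓝 0) :=
    Continuous.tendsto' (by fun_prop) _ _ rfl
  set B : ℝ := ∑ i, (‖L.l i 0‖ + 1) with hB
  have hB0 : 0 ≤ B := Finset.sum_nonneg fun i _ => by positivity
  have hlb : ∀ᶠ u in 𝓝 (0 : State n), ∀ i, ‖L.l i u‖ ≤ B := by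
    rw [eventually_all]; intro i
    have : ∀ᶠ u in 𝓝 (0 : State n), ‖L.l i u‖ < ‖L.l i 0‖ + 1 :=
      (contDiffAt_l hF hr hrc i).continuousAt.norm.eventually_lt_const (by linarith)
    filter_upwards [this] with u hu
    exact hu.le.trans (Finset.single_le_sum (f := fun i => ‖L.l i 0‖ + 1)
      (fun i _ => by positivity) (Finset.mem_univ i))
  refine ⟨B * (C * M ^ 2), by positivity, ?_⟩
  filter_upwards [ht.eventually hC, h.right, hs, t11.eventually hs,
    t1.eventually (h.eventually_self hψ), t1.eventually hlb, t1.eventually (eventually_mem_Ω hF)]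
    with q h1 h2 h3 h4 h5 h6 h7 i
  rw [h2] at h1
  have e1 : ‖Eh q‖ ≤ M * ‖q.2 - q.1‖ := by
    have := hl _ h3 _ h4
    rw [h5, sub_zero] at this
    refine this.trans ?_
    gcongr
    simp [Prod.norm_def]
  have e2 : L.l i q.1 (∑ j, Eh q j • L.r j q.1) = Eh q i := by
    simp [map_sum, l_apply_r hF hr h7]
  have e3 : Eh q i - L.l i q.1 (q.2 - q.1) =
      -(L.l i q.1 (q.2 - q.1 - ∑ j, Eh q j • L.r j q.1)) := by
    rw [map_sub (L.l i q.1) (q.2 - q.1), e2]; ring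
  rw [e3, abs_neg]
  refine ((L.l i q.1).le_opNorm _).trans ?_
  calc ‖L.l i q.1‖ * ‖q.2 - q.1 - ∑ j, Eh q j • L.r j q.1‖ ≤ B * (C * (M * ‖q.2 - q.1‖) ^ 2) := by
        gcongr
        · exact h6 i
        · exact h1.trans (by gcongr)
    _ = _ := by ring

/-- Solvability of the Riemann problem near `0`, with uniform estimates. -/
theorem exists_riemannEstimates (hF : L.HypothesisF) (hr : L.IsNormalized) :
    ∃ (Eh : State n × State n → Fin n → ℝ) (K : ℝ), ∃ ε₀ > 0, ∀ ε, 0 < ε → ε < ε₀ →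
      ∃ ρ, L.RiemannEstimates ε Eh K ρ := by
  obtain ⟨Λ, R, hER⟩ := exists_eigenBranches hF hr
  have hrc := hER.contDiffAt_r hF hr
  choose ψ hψ using exists_isLaxMap hF hr
  obtain ⟨Eh, hE⟩ := exists_isSolver hF hr hψ fun j => QuadAt.of_contDiffAt (hrc j)
  obtain ⟨ε₀, hε₀, K₁, hK₁, h₁⟩ := hE.exists_forall_solvable hψ
  obtain ⟨K₂, hK₂, s₂, hs₂, h₂⟩ := hE.quadAt
  obtain ⟨K₃, hK₃, h₃⟩ := exists_norm_interaction hψ hE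
  obtain ⟨K₄, hK₄, h₄⟩ := hE.exists_linear hψ hF hr hrc
  choose K₅ s₅ hs₅ h₅ using fun i =>
    ((contDiffAt_l hF hr hrc i).of_le (by norm_num : (1 : WithTop ℕ∞) ≤ 2)).exists_lipschitzOnWith
  set B : ℝ := ∑ i, (‖L.l i 0‖ + 1 + K₅ i) with hB
  have hBi : ∀ i, ‖L.l i 0‖ + 1 + K₅ i ≤ B := fun i =>
    Finset.single_le_sum (f := fun i => ‖L.l i 0‖ + 1 + (K₅ i : ℝ))
      (fun i _ => by positivity) (Finset.mem_univ i)
  have hB0 : 0 ≤ B := Finset.sum_nonneg fun i _ => by positivity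
  have hlb : ∀ᶠ u in 𝓝 (0 : State n), ∀ i, ‖L.l i u‖ < ‖L.l i 0‖ + 1 ∧ u ∈ s₅ i := by
    rw [eventually_all]; intro i
    exact ((contDiffAt_l hF hr hrc i).continuousAt.norm.eventually_lt_const (by linarith)).and
      (hs₅ i)
  set K := K₁ + K₂ + K₃ + K₄ + B with hK
  -- `Eh` and `K` are fixed before `ε`; only the radius depends on `ε`, through solvability with
  -- strengths below `ε`. This makes the bound on `C₀` independent of `ε`.
  refine ⟨Eh, K, ε₀, hε₀, fun ε hε hεε₀ => ?_⟩
  obtain ⟨ρ₁, hρ₁, g₁⟩ := Metric.eventually_nhds_iff_ball.1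
    (((eventually_mem_Ω hF).and (hE.eventually_self hψ)).and (h₁.and hlb))
  obtain ⟨ρ₂, hρ₂, g₂⟩ := Metric.eventually_nhds_iff_ball.1
    (((hE.eventually_solvable hψ hε).and h₄).and hs₂)
  obtain ⟨ρ₃, hρ₃, g₃⟩ := Metric.eventually_nhds_iff_ball.1 h₃
  set ρ := min ρ₁ (min ρ₂ ρ₃) with hρ
  have m1 : ∀ u : State n, ‖u‖ < ρ → u ∈ Metric.ball (0 : State n) ρ₁ := fun u hu => by
    rw [mem_ball_zero_iff]; exact hu.trans_le (min_le_left _ _)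
  have m2 : ∀ q : State n × State n, ‖q‖ < ρ → q ∈ Metric.ball 0 ρ₂ := fun u hu => by
    rw [mem_ball_zero_iff]; exact hu.trans_le ((min_le_right _ _).trans (min_le_left _ _))
  have m2' : ∀ u v : State n, ‖u‖ < ρ → ‖v‖ < ρ → (u, v) ∈ Metric.ball (0 : State n × State n) ρ₂ :=
    fun u v hu hv => m2 _ (by rw [Prod.norm_def]; exact max_lt hu hv)
  refine ⟨ρ, by positivity, by positivity, fun u hu => (g₁ u (m1 u hu)).1.1, fun u v hu hv =>
    (g₂ _ (m2' u v hu hv)).1.1, fun u v hu hs => ((g₁ u (m1 u hu)).2.1 ε hεε₀ v hs).1, ?_,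
    fun u hu => (g₁ u (m1 u hu)).1.2, ?_, ?_, ?_, ?_, ?_⟩
  · intro u v hu hs
    refine ((g₁ u (m1 u hu)).2.1 ε hεε₀ v hs).2.trans ?_
    gcongr; linarith
  · intro a b c d ha hb hc hd
    refine (h₂ a (g₂ _ (m2 a ha)).2 b (g₂ _ (m2 b hb)).2 c (g₂ _ (m2 c hc)).2 d
      (g₂ _ (m2 d hd)).2).trans ?_
    gcongr; linarith
  · intro a b c ha hb hc
    refine (g₃ (a, b, c) ?_).trans ?_
    · simp only [mem_ball_zero_iff, Prod.norm_def]
      have : ρ ≤ ρ₃ := (min_le_right _ _).trans (min_le_right _ _)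
      exact max_lt (ha.trans_le this) (max_lt (hb.trans_le this) (hc.trans_le this))
    · have := fanPotential_nonneg (L := L) (Eh (a, b)) (Eh (b, c))
      simp only
      gcongr; linarith
  · intro u v hu hv i
    refine ((g₂ _ (m2' u v hu hv)).1.2 i).trans ?_
    simp only
    gcongr; linarith
  · intro u hu i
    have := ((g₁ u (m1 u hu)).2.2 i).1
    have := hBi i
    have := (K₅ i).coe_nonneg
    linarith
  · intro u v hu hv i
    have := (h₅ i).dist_le_mul u ((g₁ u (m1 u hu)).2.2 i).2 v ((g₁ v (m1 v hv)).2.2 i).2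
    rw [dist_eq_norm, dist_eq_norm] at this
    refine this.trans ?_
    gcongr
    have := hBi i
    have := norm_nonneg (L.l i 0)
    linarith

end ConservationLaw

end

/-! ### Step functions and their potentials. -/

noncomputable section

/-- The value of `g` at the last point of `S`; it is `0` if there is none. -/
def lastVal {n : ℕ} (S : Finset ℝ) (g : ℝ → State n) : State n :=
  if h : S.Nonempty then g (S.max' h) else 0

/-- The right continuous step function that takes the values of `g` at the points of `F`, and
vanishes on the left of `F`. -/
def stepFun {n : ℕ} (F : Finset ℝ) (g : ℝ → State n) (x : ℝ) : State n :=
  lastVal (F.filter (· ≤ x)) g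

/-- The value of `stepFun F g` on the left of `x`. -/
def leftState {n : ℕ} (F : Finset ℝ) (g : ℝ → State n) (x : ℝ) : State n :=
  lastVal (F.filter (· < x)) g

section StepFun

variable {n : ℕ} {F S : Finset ℝ} {g h : ℝ → State n}

theorem lastVal_eq {m : ℝ} (hm : m ∈ S) (hS : ∀ y ∈ S, y ≤ m) : lastVal S g = g m := by
  rw [lastVal, dif_pos ⟨m, hm⟩]
  congr 1
  exact le_antisymm (Finset.max'_le _ _ _ hS) (Finset.le_max' _ _ hm)

@[simp] theorem lastVal_empty : lastVal ∅ g = 0 := by simp [lastVal]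

theorem lastVal_insert {M : ℝ} (hM : ∀ y ∈ F, y < M) : lastVal (insert M F) g = g M :=
  lastVal_eq (Finset.mem_insert_self _ _) fun y hy => by
    rcases Finset.mem_insert.1 hy with rfl | hy
    · exact le_rfl
    · exact (hM y hy).le

theorem exists_isLast (hS : S.Nonempty) : ∃ m ∈ S, ∀ y ∈ S, y ≤ m :=
  ⟨S.max' hS, S.max'_mem hS, fun y hy => S.le_max' y hy⟩

theorem lastVal_congr (hgh : ∀ x ∈ S, g x = h x) : lastVal S g = lastVal S h := by
  rcases S.eq_empty_or_nonempty with rfl | hS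
  · simp
  · obtain ⟨m, hm, hm'⟩ := exists_isLast hS
    rw [lastVal_eq hm hm', lastVal_eq hm hm', hgh m hm]

theorem norm_lastVal_sub_le {c : ℝ} (hc : 0 ≤ c) (hgh : ∀ x ∈ S, ‖g x - h x‖ ≤ c) :
    ‖lastVal S g - lastVal S h‖ ≤ c := by
  rcases S.eq_empty_or_nonempty with rfl | hS
  · simpa
  · obtain ⟨m, hm, hm'⟩ := exists_isLast hS
    rw [lastVal_eq hm hm', lastVal_eq hm hm']
    exact hgh m hm

theorem norm_lastVal_lt {c : ℝ} (hc : 0 < c) (hg : ∀ x ∈ S, ‖g x‖ < c) : ‖lastVal S g‖ < c := by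
  rcases S.eq_empty_or_nonempty with rfl | hS
  · simpa
  · obtain ⟨m, hm, hm'⟩ := exists_isLast hS
    rw [lastVal_eq hm hm']
    exact hg m hm

theorem tendsto_lastVal {ι : Type*} {f : Filter ι} {w : ι → ℝ → State n}
    (hw : ∀ x ∈ S, Tendsto (fun k => w k x) f (𝓝 (g x))) :
    Tendsto (fun k => lastVal S (w k)) f (𝓝 (lastVal S g)) := by
  rcases S.eq_empty_or_nonempty with rfl | hS
  · simp [tendsto_const_nhds]
  · obtain ⟨m, hm, hm'⟩ := exists_isLast hS
    simp only [lastVal_eq hm hm']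
    exact hw m hm

theorem stepFun_of_mem {x : ℝ} (hx : x ∈ F) : stepFun F g x = g x :=
  lastVal_eq (by simpa using hx) fun y hy => (Finset.mem_filter.1 hy).2

theorem stepFun_of_notMem {x : ℝ} (hx : x ∉ F) : stepFun F g x = leftState F g x := by
  unfold stepFun leftState
  congr 1
  refine Finset.filter_congr fun y hy => ⟨fun h => lt_of_le_of_ne h ?_, le_of_lt⟩
  rintro rfl
  exact hx hy

theorem leftState_insert {M x : ℝ} (hx : x ≤ M) : leftState (insert M F) g x = leftState F g x := by
  unfold leftState
  rw [Finset.filter_insert, if_neg (not_lt.2 hx)]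

theorem leftState_of_forall_lt {M : ℝ} (hM : ∀ y ∈ F, y < M) : leftState F g M = lastVal F g := by
  unfold leftState
  rw [Finset.filter_true_of_mem hM]

theorem stepFun_insert_of_lt {M x : ℝ} (hx : x < M) : stepFun (insert M F) g x = stepFun F g x := by
  unfold stepFun
  rw [Finset.filter_insert, if_neg (not_le.2 hx)]

theorem stepFun_insert_of_le {M x : ℝ} (hM : ∀ y ∈ F, y < M) (hx : M ≤ x) :
    stepFun (insert M F) g x = g M := by
  unfold stepFun
  rw [Finset.filter_true_of_mem, lastVal_insert hM]
  intro y hy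
  rcases Finset.mem_insert.1 hy with rfl | hy
  · exact hx
  · exact (hM y hy).le.trans hx

theorem stepFun_eq_zero {x : ℝ} (hx : ∀ y ∈ F, x < y) : stepFun F g x = 0 := by
  unfold stepFun
  rw [Finset.filter_false_of_mem fun y hy => not_le.2 (hx y hy), lastVal_empty]

theorem leftLim_stepFun (x : ℝ) : Function.leftLim (stepFun F g) x = leftState F g x := by
  apply leftLim_eq_of_tendsto
  refine tendsto_const_nhds.congr' ?_
  have h1 : ∀ᶠ y in 𝓝[<] x, ∀ z ∈ F, z < x → z < y := by
    rw [Filter.eventually_all_finset]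
    intro z _
    by_cases hz : z < x
    · filter_upwards [Ioo_mem_nhdsLT hz] with y hy _ using hy.1
    · exact Eventually.of_forall fun y h => absurd h hz
  filter_upwards [h1, self_mem_nhdsWithin] with y hy hyx
  unfold stepFun leftState
  congr 1
  exact Finset.filter_congr fun z hz => ⟨fun h => (hy z hz h).le, fun h => h.trans_lt hyx⟩

theorem jumpSet_stepFun_subset : jumpSet (stepFun F g) ⊆ F := by
  intro x hx
  by_contra h
  exact hx (by rw [leftLim_stepFun, stepFun_of_notMem h])

theorem isPiecewiseConstant_stepFun : IsPiecewiseConstant (stepFun F g) := by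
  refine ⟨F, fun x y hxy hd => ?_⟩
  unfold stepFun
  congr 1
  refine Finset.filter_congr fun z hz => ⟨fun h => h.trans hxy, fun h => ?_⟩
  by_contra hzx
  exact Set.disjoint_left.1 hd ⟨not_le.1 hzx, h⟩ hz

theorem measurable_stepFun (F : Finset ℝ) (g : ℝ → State n) : Measurable (stepFun F g) := by
  induction F using Finset.induction_on_max with
  | empty =>
    have : stepFun ∅ g = fun _ => 0 := by ext1 x; exact stepFun_eq_zero (by simp)
    rw [this]; exact measurable_const
  | insert M F hM ih =>
    have : stepFun (insert M F) g = fun x => if x < M then stepFun F g x else g M := by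
      ext1 x
      split_ifs with h
      · exact stepFun_insert_of_lt h
      · exact stepFun_insert_of_le hM (not_lt.1 h)
    rw [this]
    exact Measurable.ite measurableSet_Iio ih measurable_const

theorem norm_stepFun_sub_le {c : ℝ} (hc : 0 ≤ c) (hgh : ∀ x ∈ F, ‖g x - h x‖ ≤ c) (x : ℝ) :
    ‖stepFun F g x - stepFun F h x‖ ≤ c :=
  norm_lastVal_sub_le hc fun y hy => hgh y (Finset.mem_filter.1 hy).1

theorem norm_stepFun_lt {c : ℝ} (hc : 0 < c) (hg : ∀ x ∈ F, ‖g x‖ < c) (x : ℝ) :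
    ‖stepFun F g x‖ < c :=
  norm_lastVal_lt hc fun y hy => hg y (Finset.mem_filter.1 hy).1

theorem norm_leftState_lt {c : ℝ} (hc : 0 < c) (hg : ∀ x ∈ F, ‖g x‖ < c) (x : ℝ) :
    ‖leftState F g x‖ < c :=
  norm_lastVal_lt hc fun y hy => hg y (Finset.mem_filter.1 hy).1

theorem leftState_congr (hgh : ∀ x ∈ F, g x = h x) (x : ℝ) : leftState F g x = leftState F h x :=
  lastVal_congr fun y hy => hgh y (Finset.mem_filter.1 hy).1

theorem stepFun_eq_zero_of_le {M x : ℝ} (hM : M ∈ F) (hF : ∀ y ∈ F, y ≤ M) (hg : g M = 0)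
    (hx : M ≤ x) : stepFun F g x = 0 := by
  unfold stepFun
  rw [Finset.filter_true_of_mem fun y hy => (hF y hy).trans hx, lastVal_eq hM hF, hg]

theorem integrable_stepFun {M : ℝ} (hM : M ∈ F) (hF : ∀ y ∈ F, y ≤ M) (hg : g M = 0) :
    Integrable (stepFun F g) := by
  obtain ⟨B, hB⟩ : ∃ B : ℝ, ∀ x ∈ F, ‖g x‖ < B := by
    obtain ⟨B, hB⟩ := (F.image fun x => ‖g x‖).bddAbove
    exact ⟨B + 1, fun x hx => (hB (Finset.mem_coe.2 (Finset.mem_image_of_mem _ hx))).trans_lt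
      (by linarith)⟩
  have hB0 : 0 < B := (norm_nonneg _).trans_lt (hB M hM)
  obtain ⟨A, hA⟩ := F.bddBelow
  have hs : Function.support (stepFun F g) ⊆ Icc A M := by
    intro x hx
    rw [Function.mem_support] at hx
    constructor
    · by_contra h
      exact hx (stepFun_eq_zero fun y hy => (not_le.1 h).trans_le (hA hy))
    · by_contra h
      exact hx (stepFun_eq_zero_of_le hM hF hg (not_le.1 h).le)
  rw [← integrableOn_iff_integrable_of_support_subset hs]
  exact Measure.integrableOn_of_bounded (M := B) (by simp)
    (measurable_stepFun F g).aestronglyMeasurable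
    (Eventually.of_forall fun x => (norm_stepFun_lt hB0 hB x).le)

/-- On the left of all its jumps `v` is constant on a half-line, and integrability makes this
constant `0`, the default value of `lastVal`. -/
theorem eq_stepFun {v : ℝ → State n} {J G : Finset ℝ}
    (hJ : ∀ x y, x ≤ y → Disjoint (Ioc x y) (J : Set ℝ) → v x = v y) (hv : Integrable v)
    (hG : J ⊆ G) : v = stepFun G v := by
  ext1 x
  rcases (G.filter (· ≤ x)).eq_empty_or_nonempty with h | h
  · have h1 : ∀ y ∈ Iic x, v y = v x := fun y hy => hJ y x hy (Set.disjoint_left.2 fun z hz hzJ => by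
      have := hG hzJ
      have h2 : z ∈ G.filter (· ≤ x) := Finset.mem_filter.2 ⟨this, hz.2⟩
      simp [h] at h2)
    have h2 : IntegrableOn (fun _ : ℝ => v x) (Iic x) :=
      (hv.integrableOn (s := Iic x)).congr_fun h1 measurableSet_Iic
    rw [integrableOn_const_iff] at h2
    rw [stepFun, h, lastVal_empty]
    simpa using h2
  · obtain ⟨m, hm, hm'⟩ := exists_isLast h
    rw [stepFun, lastVal_eq hm hm']
    refine (hJ m x (Finset.mem_filter.1 hm).2 (Set.disjoint_left.2 fun z hz hzJ => ?_)).symm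
    exact absurd (hm' z (Finset.mem_filter.2 ⟨hG hzJ, hz.2⟩)) (not_le.2 hz.1)

theorem eq_zero_of_forall_le {v : ℝ → State n} {J : Finset ℝ}
    (hJ : ∀ x y, x ≤ y → Disjoint (Ioc x y) (J : Set ℝ) → v x = v y) (hv : Integrable v) {M : ℝ}
    (hM : ∀ y ∈ J, y ≤ M) : v M = 0 := by
  have h1 : ∀ y ∈ Ici M, v y = v M := fun y hy => (hJ M y hy (Set.disjoint_left.2 fun z hz hzJ =>
    absurd (hM z hzJ) (not_le.2 hz.1))).symm
  have h2 : IntegrableOn (fun _ : ℝ => v M) (Ici M) :=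
    (hv.integrableOn (s := Ici M)).congr_fun h1 measurableSet_Ici
  rw [integrableOn_const_iff] at h2
  simpa using h2

end StepFun

namespace ConservationLaw

variable {n : ℕ} (L : ConservationLaw n)

/-- The strengths of the waves of `stepFun F g` at `x`. -/
def fanAt (Eh : State n × State n → Fin n → ℝ) (F : Finset ℝ) (g : ℝ → State n) (x : ℝ) :
    Fin n → ℝ := Eh (leftState F g x, g x)

/-- The total strength of the waves of `stepFun F g`. -/
def stepV (Eh : State n × State n → Fin n → ℝ) (F : Finset ℝ) (g : ℝ → State n) : ℝ :=
  ∑ x ∈ F, ∑ i, |fanAt Eh F g x i|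

/-- The interaction potential of fans `σ x` located at the points `x` of `F`. -/
def pairSum (F : Finset ℝ) (σ : ℝ → Fin n → ℝ) : ℝ :=
  ∑ x ∈ F, ∑ y ∈ F, if x < y then L.fanPotential (σ x) (σ y) else 0

/-- The interaction potential of `stepFun F g`. -/
def stepQ (Eh : State n × State n → Fin n → ℝ) (F : Finset ℝ) (g : ℝ → State n) : ℝ :=
  L.pairSum F (fanAt Eh F g)

variable {L}

theorem pairSum_congr {F : Finset ℝ} {σ τ : ℝ → Fin n → ℝ} (h : ∀ x ∈ F, σ x = τ x) :
    L.pairSum F σ = L.pairSum F τ :=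
  Finset.sum_congr rfl fun x hx => Finset.sum_congr rfl fun y hy => by rw [h x hx, h y hy]

theorem pairSum_nonneg (F : Finset ℝ) (σ : ℝ → Fin n → ℝ) : 0 ≤ L.pairSum F σ :=
  Finset.sum_nonneg fun x _ => Finset.sum_nonneg fun y _ => by
    split_ifs
    exacts [fanPotential_nonneg _ _, le_rfl]

theorem pairSum_insert {F : Finset ℝ} {z : ℝ} (hz : z ∉ F) (σ : ℝ → Fin n → ℝ) :
    L.pairSum (insert z F) σ = L.pairSum F σ +
      ∑ x ∈ F, ((if x < z then L.fanPotential (σ x) (σ z) else 0) +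
        if z < x then L.fanPotential (σ z) (σ x) else 0) := by
  simp only [pairSum, Finset.sum_insert hz, lt_irrefl, if_false, zero_add, Finset.sum_add_distrib]
  ring

theorem fanAt_congr {Eh : State n × State n → Fin n → ℝ} {F : Finset ℝ} {g h : ℝ → State n}
    (hgh : ∀ x ∈ F, g x = h x) {x : ℝ} (hx : x ∈ F) : fanAt Eh F g x = fanAt Eh F h x := by
  rw [fanAt, fanAt, leftState_congr hgh, hgh x hx]

theorem stepV_congr {Eh : State n × State n → Fin n → ℝ} {F : Finset ℝ} {g h : ℝ → State n}
    (hgh : ∀ x ∈ F, g x = h x) : stepV Eh F g = stepV Eh F h :=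
  Finset.sum_congr rfl fun x hx => by rw [fanAt_congr hgh hx]

theorem stepQ_congr {Eh : State n × State n → Fin n → ℝ} {F : Finset ℝ} {g h : ℝ → State n}
    (hgh : ∀ x ∈ F, g x = h x) : L.stepQ Eh F g = L.stepQ Eh F h :=
  pairSum_congr fun x hx => by rw [fanAt_congr hgh hx]

end ConservationLaw

end

/-! ### Sampling decreases the potentials. -/

namespace ConservationLaw

variable {n : ℕ} {L : ConservationLaw n} {ε K ρ : ℝ} {Eh : State n × State n → Fin n → ℝ}

/-- When two neighbouring fans are merged, their interactions with any other fan are subadditive and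
their mutual potential is lost. The correction `ρ` meets each remaining fan with potential at most
the product of the total strengths. -/
theorem pairSum_merge {H : Finset ℝ} {z x₀ : ℝ} {σ σ' : ℝ → Fin n → ℝ} (hz : z ∉ H) (hx : x₀ ∉ H)
    (hzx : z < x₀) (hH : ∀ y ∈ H, y < z ∨ x₀ < y) (hσ : ∀ y ∈ H, σ' y = σ y) {ρ : Fin n → ℝ}
    (hσ' : σ' x₀ = σ z + σ x₀ + ρ) :
    L.pairSum (insert x₀ H) σ' ≤ L.pairSum (insert z (insert x₀ H)) σ -
      L.fanPotential (σ z) (σ x₀) + (∑ i, |ρ i|) * ∑ y ∈ H, ∑ i, |σ y i| := by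
  have hz' : z ∉ insert x₀ H := by simp [hz, hzx.ne]
  rw [pairSum_insert hz', pairSum_insert hx, pairSum_insert hx, Finset.sum_insert hx,
    if_neg (not_lt.2 hzx.le), if_pos hzx, pairSum_congr hσ]
  have key : ∀ y ∈ H,
      ((if y < x₀ then L.fanPotential (σ' y) (σ' x₀) else 0) +
        if x₀ < y then L.fanPotential (σ' x₀) (σ' y) else 0) ≤
      ((if y < x₀ then L.fanPotential (σ y) (σ x₀) else 0) +
        if x₀ < y then L.fanPotential (σ x₀) (σ y) else 0) +
      ((if y < z then L.fanPotential (σ y) (σ z) else 0) +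
        if z < y then L.fanPotential (σ z) (σ y) else 0) + (∑ i, |ρ i|) * ∑ i, |σ y i| := by
    intro y hy
    rw [hσ y hy, hσ']
    rcases hH y hy with h | h
    · have h1 := fanPotential_add_right (L := L) (σ y) (σ z + σ x₀) ρ
      have h2 := fanPotential_add_right (L := L) (σ y) (σ z) (σ x₀)
      have h3 := fanPotential_le (L := L) (σ y) ρ
      rw [if_pos (h.trans hzx), if_pos (h.trans hzx), if_neg (not_lt.2 (h.trans hzx).le), if_pos h,
        if_neg (not_lt.2 h.le), if_neg (not_lt.2 (h.trans hzx).le)]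
      linarith
    · have h1 := fanPotential_add_left (L := L) (σ z + σ x₀) ρ (σ y)
      have h2 := fanPotential_add_left (L := L) (σ z) (σ x₀) (σ y)
      have h3 := fanPotential_le (L := L) ρ (σ y)
      rw [if_pos h, if_pos (hzx.trans h), if_neg (not_lt.2 h.le), if_neg (not_lt.2 h.le),
        if_neg (not_lt.2 (hzx.trans h).le), if_pos h]
      linarith
  have := Finset.sum_le_sum key
  simp only [Finset.sum_add_distrib, ← Finset.mul_sum] at this ⊢
  linarith

/-- The point `z` does not enter the state on the left of `x ≤ z`, and for `x > x₀` it is hidden by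
the later point `x₀`. -/
theorem fanAt_erase {F : Finset ℝ} {g : ℝ → State n} {z x₀ x : ℝ} (hx₀ : x₀ ∈ F) (hzx : z < x₀)
    (hx : x ≤ z ∨ x₀ < x) : fanAt Eh (F.erase z) g x = fanAt Eh F g x := by
  have : leftState (F.erase z) g x = leftState F g x := by
    rcases hx with hx | hx
    · unfold leftState
      congr 1
      ext y
      simp only [Finset.mem_filter, Finset.mem_erase]
      exact ⟨fun h => ⟨h.1.2, h.2⟩, fun h => ⟨⟨(h.2.trans_le hx).ne, h.1⟩, h.2⟩⟩
    · obtain ⟨m, hm, hm'⟩ := exists_isLast (S := F.filter (· < x))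
        ⟨x₀, Finset.mem_filter.2 ⟨hx₀, hx⟩⟩
      have hxm : x₀ ≤ m := hm' x₀ (Finset.mem_filter.2 ⟨hx₀, hx⟩)
      rw [leftState, leftState, lastVal_eq hm hm', lastVal_eq (m := m)]
      · exact Finset.mem_filter.2 ⟨Finset.mem_erase.2 ⟨(hzx.trans_le hxm).ne',
          (Finset.mem_filter.1 hm).1⟩, (Finset.mem_filter.1 hm).2⟩
      · intro y hy
        exact hm' y (Finset.mem_filter.2 ⟨(Finset.mem_erase.1 (Finset.mem_filter.1 hy).1).2,
          (Finset.mem_filter.1 hy).2⟩)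
  rw [fanAt, fanAt, this]

/-- The effect of removing a point from a step function. -/
theorem RiemannEstimates.erase (R : L.RiemannEstimates ε Eh K ρ) {F : Finset ℝ} {g : ℝ → State n}
    {z x₀ : ℝ} (hz : z ∈ F) (hx : x₀ ∈ F) (hzx : z < x₀) (hF : ∀ y ∈ F, y ≤ z ∨ x₀ ≤ y)
    (hg : ∀ x ∈ F, ‖g x‖ < ρ) :
    ∃ q : ℝ, 0 ≤ q ∧ stepV Eh (F.erase z) g ≤ stepV Eh F g + n * K * q ∧
      L.stepQ Eh (F.erase z) g ≤ L.stepQ Eh F g - q + n * K * q * stepV Eh F g := by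
  set H := (F.erase z).erase x₀ with hH
  have hxe : x₀ ∈ F.erase z := Finset.mem_erase.2 ⟨hzx.ne', hx⟩
  have e1 : F.erase z = insert x₀ H := (Finset.insert_erase hxe).symm
  have e2 : F = insert z (insert x₀ H) := by rw [← e1, Finset.insert_erase hz]
  have hHz : z ∉ H := by simp [hH]
  have hHx : x₀ ∉ H := by simp [hH]
  have hz' : z ∉ insert x₀ H := by simp [hHz, hzx.ne]
  have hHF : ∀ y ∈ H, y < z ∨ x₀ < y := fun y hy => by
    rcases hF y (Finset.mem_of_mem_erase (Finset.mem_of_mem_erase hy)) with h | h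
    · exact Or.inl (lt_of_le_of_ne h fun h => hHz (h ▸ hy))
    · exact Or.inr (lt_of_le_of_ne h fun h => hHx (h ▸ hy))
  set σ := fanAt Eh F g with hσ
  set σ' := fanAt Eh (F.erase z) g with hσ'
  have hs : ∀ y ∈ H, σ' y = σ y := fun y hy => fanAt_erase hx hzx ((hHF y hy).imp_left le_of_lt)
  have l1 : leftState F g x₀ = g z := lastVal_eq (Finset.mem_filter.2 ⟨hz, hzx⟩) fun y hy =>
    (hF y (Finset.mem_filter.1 hy).1).resolve_right (not_le.2 (Finset.mem_filter.1 hy).2)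
  have l2 : leftState (F.erase z) g x₀ = leftState F g z := by
    unfold leftState
    congr 1
    ext y
    simp only [Finset.mem_filter, Finset.mem_erase]
    constructor
    · rintro ⟨⟨h1, h2⟩, h3⟩
      exact ⟨h2, lt_of_le_of_ne ((hF y h2).resolve_right (not_le.2 h3)) h1⟩
    · rintro ⟨h1, h2⟩
      exact ⟨⟨h2.ne, h1⟩, h2.trans hzx⟩
  have hint := R.interaction (leftState F g z) (g z) (g x₀) (norm_leftState_lt R.ρ_pos hg z) (hg z hz)
    (hg x₀ hx)
  -- The fan at the erased point joins the one at its successor `x₀`; by Glimm's estimate the new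
  -- fan at `x₀` is their sum up to an error `r` of norm at most `K * q`.
  set q := L.fanPotential (σ z) (σ x₀) with hq
  have hq' : L.fanPotential (Eh (leftState F g z, g z)) (Eh (g z, g x₀)) = q := by
    rw [hq, hσ, fanAt, fanAt, l1]
  rw [hq'] at hint
  set r := Eh (leftState F g z, g x₀) - Eh (leftState F g z, g z) - Eh (g z, g x₀) with hr
  have hr' : σ' x₀ = σ z + σ x₀ + r := by
    rw [hσ', hσ, fanAt, fanAt, fanAt, l1, l2, hr]; abel
  have hrn : ∑ i, |r i| ≤ n * K * q := (sum_abs_le r).trans (by rw [mul_assoc]; gcongr)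
  have hV : stepV Eh F g = (∑ i, |σ z i|) + ((∑ i, |σ x₀ i|) + ∑ y ∈ H, ∑ i, |σ y i|) := by
    conv_lhs => rw [stepV, e2, Finset.sum_insert hz', Finset.sum_insert hHx, ← e2]
  have hV' : stepV Eh (F.erase z) g = (∑ i, |σ' x₀ i|) + ∑ y ∈ H, ∑ i, |σ y i| := by
    conv_lhs => rw [stepV, e1, Finset.sum_insert hHx, ← e1]
    congr 1
    exact Finset.sum_congr rfl fun y hy => by rw [← hσ', hs y hy]
  have h0 : ∀ y, 0 ≤ ∑ i, |σ y i| := fun y => Finset.sum_nonneg fun i _ => abs_nonneg _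
  refine ⟨q, fanPotential_nonneg _ _, ?_, ?_⟩
  · rw [hV, hV', hr']
    have : ∑ i, |(σ z + σ x₀ + r) i| ≤ ∑ i, (|σ z i| + |σ x₀ i| + |r i|) :=
      Finset.sum_le_sum fun i _ => abs_add_three _ _ _
    rw [Finset.sum_add_distrib, Finset.sum_add_distrib] at this
    linarith
  · have := pairSum_merge (L := L) hHz hHx hzx hHF hs hr'
    rw [← e1, Finset.insert_erase hz] at this
    refine this.trans ?_
    have h2 : ∑ y ∈ H, ∑ i, |σ y i| ≤ stepV Eh F g := by rw [hV]; linarith [h0 z, h0 x₀]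
    have h3 : 0 ≤ ∑ y ∈ H, ∑ i, |σ y i| := Finset.sum_nonneg fun y _ => h0 y
    have h4 : 0 ≤ ∑ i, |r i| := Finset.sum_nonneg fun i _ => abs_nonneg _
    have := mul_le_mul hrn h2 h3 (h4.trans hrn)
    simp only [stepQ]
    linarith

/-- Sampling a step function decreases the interaction potential and `Υ`. -/
theorem RiemannEstimates.step_mono (R : L.RiemannEstimates ε Eh K ρ) {C₀ δ : ℝ}
    (hC : 2 * (n * K) ≤ C₀) (hδ : n * K * δ ≤ 1 / 2) {F : Finset ℝ} {g : ℝ → State n} {M : ℝ}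
    (hM : M ∈ F) (G : Finset ℝ) (hFG : F ⊆ G) (hG : ∀ y ∈ G, y ≤ M) (hg : ∀ x ∈ G, ‖g x‖ < ρ)
    (hΥ : stepV Eh G g + C₀ * L.stepQ Eh G g < δ) :
    L.stepQ Eh F g ≤ L.stepQ Eh G g ∧
      stepV Eh F g + C₀ * L.stepQ Eh F g ≤ stepV Eh G g + C₀ * L.stepQ Eh G g := by
  have hnK : 0 ≤ n * K := mul_nonneg n.cast_nonneg R.K_nonneg
  have hC0 : 0 ≤ C₀ := by linarith
  induction G using Finset.strongInduction with
  | H G ih =>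
    rcases hFG.eq_or_ssubset with rfl | hss
    · exact ⟨le_rfl, le_rfl⟩
    obtain ⟨z, hz, hzF⟩ := Finset.exists_of_ssubset hss
    -- The largest point `M` is kept, so every erased point has a successor that receives its waves.
    have hzM : z < M := lt_of_le_of_ne (hG z hz) fun h => hzF (h ▸ hM)
    have hne : (G.filter (z < ·)).Nonempty := ⟨M, Finset.mem_filter.2 ⟨hFG hM, hzM⟩⟩
    obtain ⟨q, hq, hV, hQ⟩ := R.erase (x₀ := (G.filter (z < ·)).min' hne) hz
      (Finset.mem_filter.1 (Finset.min'_mem _ hne)).1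
      (Finset.mem_filter.1 (Finset.min'_mem _ hne)).2
      (fun y hy => (le_or_gt y z).imp_right fun h => Finset.min'_le _ _
        (Finset.mem_filter.2 ⟨hy, h⟩)) hg
    have hQ0 : 0 ≤ L.stepQ Eh G g := pairSum_nonneg _ _
    have hVδ : stepV Eh G g ≤ δ := by nlinarith
    -- The smallness of the total strength leaves a net decrease of `q / 2` in the potential, and
    -- `C₀ ≥ 2 n K` makes this pay for the growth `n K q` of the linear part.
    have h1 : n * K * q * stepV Eh G g ≤ q / 2 := by
      have : n * K * stepV Eh G g ≤ 1 / 2 := (mul_le_mul_of_nonneg_left hVδ hnK).trans hδ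
      nlinarith
    have h2 : L.stepQ Eh (G.erase z) g ≤ L.stepQ Eh G g - q / 2 := by linarith
    have h3 : stepV Eh (G.erase z) g + C₀ * L.stepQ Eh (G.erase z) g ≤
        stepV Eh G g + C₀ * L.stepQ Eh G g := by
      nlinarith [mul_le_mul_of_nonneg_left h2 hC0, mul_le_mul_of_nonneg_right hC hq]
    obtain ⟨i1, i2⟩ := ih (G.erase z) (Finset.erase_ssubset hz)
      (fun y hy => Finset.mem_erase.2 ⟨fun h => hzF (h ▸ hy), hFG hy⟩)
      (fun y hy => hG y (Finset.mem_of_mem_erase hy)) (fun y hy => hg y (Finset.mem_of_mem_erase hy))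
      (h3.trans_lt hΥ)
    exact ⟨by linarith, by linarith⟩

end ConservationLaw

/-! ### Elements of `D_δ^*` as step functions, and their samples. -/

/-- A continuation argument from the left: a jump is controlled only if its left state lies in the
ball of radius `ρ`, and the sum of the previous jumps, starting from the value `0`, keeps it there.
-/
theorem norm_lastVal_le_of_chain {n : ℕ} {g : ℝ → State n} {K ρ : ℝ} {c : ℝ → ℝ} (hK : 0 ≤ K)
    (hc : ∀ x, 0 ≤ c x) (F : Finset ℝ)
    (hF : ∀ x ∈ F, ‖leftState F g x‖ < ρ → ‖g x - leftState F g x‖ ≤ K * c x)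
    (hsum : K * ∑ x ∈ F, c x < ρ) :
    ‖lastVal F g‖ ≤ K * ∑ x ∈ F, c x ∧ ∀ x ∈ F, ‖g x‖ ≤ K * ∑ x ∈ F, c x := by
  induction F using Finset.induction_on_max with
  | empty => simp
  | insert M F hM ih =>
    have hMF : M ∉ F := fun h => lt_irrefl _ (hM M h)
    rw [Finset.sum_insert hMF] at hsum ⊢
    have h0 : 0 ≤ K * c M := mul_nonneg hK (hc M)
    rw [mul_add] at hsum ⊢
    obtain ⟨i1, i2⟩ := ih (fun x hx => by
      have := hF x (Finset.mem_insert_of_mem hx)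
      rwa [leftState_insert (hM x hx).le] at this) (by linarith)
    have h1 := hF M (Finset.mem_insert_self _ _)
    rw [leftState_insert le_rfl, leftState_of_forall_lt hM] at h1
    have h2 := h1 (by linarith)
    have h3 : ‖g M‖ ≤ K * c M + K * ∑ x ∈ F, c x := by
      have := norm_le_norm_sub_add (g M) (lastVal F g)
      linarith
    refine ⟨by rwa [lastVal_insert hM], fun x hx => ?_⟩
    rcases Finset.mem_insert.1 hx with rfl | hx
    · exact h3
    · linarith [i2 x hx]

namespace ConservationLaw

variable {n : ℕ} {L : ConservationLaw n} {ε K ρ : ℝ} {Eh : State n × State n → Fin n → ℝ}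

theorem Q_nonneg (v : ℝ → State n) : 0 ≤ L.Q ε v :=
  finsum_nonneg fun _ => finsum_nonneg fun _ => abs_nonneg _

theorem strength_stepFun {F : Finset ℝ} {g : ℝ → State n} {x : ℝ} (hx : x ∈ F) :
    L.strength ε (stepFun F g) x = L.E ε (leftState F g x) (g x) := by
  ext i
  rw [strength, leftLim_stepFun, stepFun_of_mem hx]

theorem RiemannEstimates.strength_stepFun (R : L.RiemannEstimates ε Eh K ρ) {F : Finset ℝ}
    {g : ℝ → State n} (hg : ∀ x ∈ F, ‖g x‖ < ρ) {x : ℝ} (hx : x ∈ F) :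
    L.strength ε (stepFun F g) x = fanAt Eh F g x := by
  have h1 := norm_leftState_lt R.ρ_pos hg x
  rw [ConservationLaw.strength_stepFun hx, R.E_eq _ _ h1 (R.solvable _ _ h1 (hg x hx)), fanAt]

theorem RiemannEstimates.fanAt_eq_zero (R : L.RiemannEstimates ε Eh K ρ) {F : Finset ℝ}
    {g : ℝ → State n} (hg : ∀ x ∈ F, ‖g x‖ < ρ) {x : ℝ} (hx : x ∈ F)
    (hj : x ∉ jumpSet (stepFun F g)) : fanAt Eh F g x = 0 := by
  have : leftState F g x = g x := by
    rw [← leftLim_stepFun, ← stepFun_of_mem (g := g) hx]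
    by_contra h
    exact hj h
  rw [fanAt, this, R.self _ (hg x hx)]

/-- Points of `F` at which the step function does not jump carry no waves, so they may be included
in the sum. -/
theorem RiemannEstimates.V_stepFun (R : L.RiemannEstimates ε Eh K ρ) {F : Finset ℝ}
    {g : ℝ → State n} (hg : ∀ x ∈ F, ‖g x‖ < ρ) : L.V ε (stepFun F g) = stepV Eh F g := by
  classical
  rw [V, finsum_mem_def, finsum_eq_sum_of_support_subset (s := F)]
  · refine Finset.sum_congr rfl fun x hx => ?_
    by_cases hj : x ∈ jumpSet (stepFun F g)
    · rw [indicator_of_mem hj, R.strength_stepFun hg hx]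
    · rw [indicator_of_notMem hj, R.fanAt_eq_zero hg hx hj]; simp
  · intro x hx
    exact jumpSet_stepFun_subset (mem_of_indicator_ne_zero hx)

theorem RiemannEstimates.Q_stepFun (R : L.RiemannEstimates ε Eh K ρ) {F : Finset ℝ}
    {g : ℝ → State n} (hg : ∀ x ∈ F, ‖g x‖ < ρ) : L.Q ε (stepFun F g) = L.stepQ Eh F g := by
  classical
  set v := stepFun F g with hv
  rw [Q, finsum_mem_def, finsum_eq_sum_of_support_subset
    (s := (F ×ˢ (Finset.univ : Finset (Fin n))) ×ˢ (F ×ˢ (Finset.univ : Finset (Fin n))))]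
  · rw [Finset.sum_product, Finset.sum_product, stepQ, pairSum]
    simp only [Finset.sum_product]
    refine Finset.sum_congr rfl fun x hx => ?_
    rw [Finset.sum_comm]
    refine Finset.sum_congr rfl fun y hy => ?_
    have hsx : L.strength ε v x = _ := R.strength_stepFun hg hx
    have hsy : L.strength ε v y = _ := R.strength_stepFun hg hy
    by_cases hxy : x < y
    · rw [if_pos hxy, fanPotential]
      refine Finset.sum_congr rfl fun i _ => Finset.sum_congr rfl fun j _ => ?_
      by_cases hjx : x ∈ jumpSet v
      · by_cases hjy : y ∈ jumpSet v
        · have e : ((x, i), (y, j)) ∈ L.approaching ε v ↔ (j < i ∨ (i = j ∧ L.GenuinelyNonlinear i ∧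
              min (fanAt Eh F g x i) (fanAt Eh F g y j) < 0)) := by
            simp only [approaching, mem_ofPred_eq, hjx, hjy, hxy, true_and, hsx, hsy]
          rw [indicator_apply, wavePotential]
          simp only [hsx, hsy] at e ⊢
          exact if_congr e rfl rfl
        · rw [R.fanAt_eq_zero hg hy hjy, indicator_of_notMem fun h => hjy h.2.1]
          simp
      · rw [R.fanAt_eq_zero hg hx hjx, indicator_of_notMem fun h => hjx h.1]
        simp
    · rw [if_neg hxy]
      exact Finset.sum_eq_zero fun i _ => Finset.sum_eq_zero fun j _ =>
        indicator_of_notMem (fun h => hxy h.2.2.1) _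
  · intro p hp
    have := mem_of_indicator_ne_zero hp
    simp only [Finset.coe_product, Finset.coe_univ, mem_prod, mem_univ, and_true, Finset.mem_coe]
    exact ⟨jumpSet_stepFun_subset this.1, jumpSet_stepFun_subset this.2.1⟩

theorem RiemannEstimates.stepFun_mem_DStar (R : L.RiemannEstimates ε Eh K ρ) {C₀ δ M : ℝ}
    {F : Finset ℝ} {g : ℝ → State n} (hg : ∀ x ∈ F, ‖g x‖ < ρ) (hM : M ∈ F) (hF : ∀ y ∈ F, y ≤ M)
    (hgM : g M = 0) (hΥ : stepV Eh F g + C₀ * L.stepQ Eh F g < δ) :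
    stepFun F g ∈ L.DStar ε C₀ δ := by
  have hlt := norm_stepFun_lt R.ρ_pos hg
  refine ⟨isPiecewiseConstant_stepFun, integrable_stepFun hM hF hgM, fun x => R.mem_Ω _ (hlt x),
    fun x => ?_, by rwa [Upsilon, R.V_stepFun hg, R.Q_stepFun hg]⟩
  rw [leftLim_stepFun]
  exact R.solvable _ _ (norm_leftState_lt R.ρ_pos hg x) (hlt x)

/-- The elements of `D_δ^*` as step functions. -/
theorem RiemannEstimates.of_mem_DStar (R : L.RiemannEstimates ε Eh K ρ) {C₀ δ : ℝ} (hC : 0 ≤ C₀)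
    (hδ : K * δ < ρ) {v : ℝ → State n} (hv : v ∈ L.DStar ε C₀ δ) :
    (∀ x, ‖v x‖ ≤ K * δ) ∧ ∃ J : Finset ℝ, (∀ G, J ⊆ G → v = stepFun G v) ∧
      ∀ M, (∀ y ∈ J, y ≤ M) → v M = 0 := by
  classical
  obtain ⟨⟨J, hJ⟩, hint, -, hsol, hΥ⟩ := hv
  have hG : ∀ G, J ⊆ G → v = stepFun G v := fun G hG => eq_stepFun hJ hint hG
  refine ⟨?_, J, hG, fun M hM => eq_zero_of_forall_le hJ hint hM⟩
  have hVδ : L.V ε v < δ := by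
    have := mul_nonneg hC (Q_nonneg (L := L) (ε := ε) v)
    rw [Upsilon] at hΥ
    linarith
  intro x
  set G := insert x J with hGdef
  have hvG := hG G (Finset.subset_insert _ _)
  have hl : ∀ y, Function.leftLim v y = leftState G v y := fun y => by
    conv_lhs => rw [hvG]
    exact leftLim_stepFun y
  have hsub : jumpSet v ⊆ G := by
    conv_lhs => rw [hvG]
    exact jumpSet_stepFun_subset
  have hV : L.V ε v = ∑ y ∈ G, (jumpSet v).indicator (fun y => ∑ i, |L.strength ε v y i|) y := by
    rw [V, finsum_mem_def, finsum_eq_sum_of_support_subset (s := G)]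
    intro y hy
    exact hsub (mem_of_indicator_ne_zero hy)
  have hlt : K * L.V ε v < ρ := (mul_le_mul_of_nonneg_left hVδ.le R.K_nonneg).trans_lt hδ
  have key := norm_lastVal_le_of_chain (g := v) (K := K) (ρ := ρ)
    (c := (jumpSet v).indicator (fun y => ∑ i, |L.strength ε v y i|)) R.K_nonneg
    (fun y => indicator_nonneg (fun _ _ => Finset.sum_nonneg fun _ _ => abs_nonneg _) y) G
    (fun y hy hρ => by
      by_cases hj : y ∈ jumpSet v
      · rw [indicator_of_mem hj]
        have hs := hsol y
        rw [hl] at hs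
        have h1 := R.norm_sub_le _ _ hρ hs
        have h2 : L.strength ε v y = Eh (leftState G v y, v y) := by
          ext i; rw [strength, hl, R.E_eq _ _ hρ hs]
        rw [h2]
        refine h1.trans (mul_le_mul_of_nonneg_left ?_ R.K_nonneg)
        rw [pi_norm_le_iff_of_nonneg (Finset.sum_nonneg fun _ _ => abs_nonneg _)]
        intro i
        exact Finset.single_le_sum (f := fun i => |Eh (leftState G v y, v y) i|)
          (fun _ _ => abs_nonneg _) (Finset.mem_univ i)
      · have : leftState G v y = v y := by
          rw [← hl]; by_contra h; exact hj h
        rw [this, indicator_of_notMem hj]; simp)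
    (by rwa [← hV])
  refine (key.2 x (Finset.mem_insert_self _ _)).trans ?_
  rw [← hV]
  exact mul_le_mul_of_nonneg_left hVδ.le R.K_nonneg

section Closed

variable {F : Finset ℝ} {g : ℝ → State n} {M : ℝ}

theorem fanAt_insert_of_lt {x : ℝ} (hx : x < M) : fanAt Eh (insert M F) g x = fanAt Eh F g x := by
  rw [fanAt, fanAt, leftState_insert hx.le]

theorem fanAt_insert_self (hM : ∀ y ∈ F, y < M) :
    fanAt Eh (insert M F) g M = Eh (lastVal F g, g M) := by
  rw [fanAt, leftState_insert le_rfl, leftState_of_forall_lt hM]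

theorem stepV_insert (hM : ∀ y ∈ F, y < M) :
    stepV Eh (insert M F) g = stepV Eh F g + ∑ i, |Eh (lastVal F g, g M) i| := by
  rw [stepV, Finset.sum_insert fun h => lt_irrefl _ (hM M h), fanAt_insert_self hM, add_comm, stepV]
  congr 1
  exact Finset.sum_congr rfl fun x hx => by rw [fanAt_insert_of_lt (hM x hx)]

theorem stepQ_insert (hM : ∀ y ∈ F, y < M) :
    L.stepQ Eh (insert M F) g = L.stepQ Eh F g +
      ∑ x ∈ F, L.fanPotential (fanAt Eh F g x) (Eh (lastVal F g, g M)) := by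
  rw [stepQ, pairSum_insert fun h => lt_irrefl _ (hM M h), fanAt_insert_self hM, stepQ,
    pairSum_congr fun x hx => fanAt_insert_of_lt (hM x hx)]
  congr 1
  refine Finset.sum_congr rfl fun x hx => ?_
  rw [if_pos (hM x hx), if_neg (not_lt.2 (hM x hx).le), add_zero, fanAt_insert_of_lt (hM x hx)]

end Closed

/-- `g` sampled at the points of `F` and continued by `0` from `M` on. -/
theorem RiemannEstimates.sample (R : L.RiemannEstimates ε Eh K ρ) {C₀ δ : ℝ}
    (hC : 2 * (n * K) ≤ C₀) (hδ : n * K * δ ≤ 1 / 2) (hδ' : K * δ < ρ) {v : ℝ → State n}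
    (hv : v ∈ L.DStar ε C₀ δ) {F : Finset ℝ} {M : ℝ} (hM : ∀ y ∈ F, y < M) :
    stepFun (insert M F) (Function.update v M 0) ∈ L.DStar ε C₀ δ ∧
    L.V ε (stepFun (insert M F) (Function.update v M 0)) =
      stepV Eh (insert M F) (Function.update v M 0) ∧
    L.Q ε (stepFun (insert M F) (Function.update v M 0)) =
      L.stepQ Eh (insert M F) (Function.update v M 0) ∧
    L.stepQ Eh (insert M F) (Function.update v M 0) ≤ L.Q ε v ∧
    stepV Eh (insert M F) (Function.update v M 0) +
      C₀ * L.stepQ Eh (insert M F) (Function.update v M 0) ≤ L.Upsilon ε C₀ v := by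
  have hC0 : 0 ≤ C₀ := le_trans (by have := R.K_nonneg; positivity) hC
  obtain ⟨hb, J, hJ, hJ0⟩ := R.of_mem_DStar hC0 hδ' hv
  have hb' : ∀ x, ‖v x‖ < ρ := fun x => (hb x).trans_lt hδ'
  -- Beyond all jumps `v` vanishes, so `M'` is a common last point for `v` and for its sample, as
  -- `step_mono` demands.
  obtain ⟨M', hM'⟩ : ∃ M' : ℝ, ∀ y ∈ insert M (F ∪ J), y < M' := by
    obtain ⟨B, hB⟩ := (insert M (F ∪ J)).bddAbove
    exact ⟨B + 1, fun y hy => (hB hy).trans_lt (by linarith)⟩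
  have hMF : M ∉ F := fun h => lt_irrefl _ (hM M h)
  have hM'F : ∀ y ∈ F, y < M' := fun y hy => hM' y (by simp [hy])
  have hvM' : v M' = 0 := hJ0 M' fun y hy => (hM' y (by simp [hy])).le
  set G := insert M' (F ∪ J) with hG
  have hvG := hJ G (Finset.subset_union_right.trans (Finset.subset_insert _ _))
  have hVv : L.V ε v = stepV Eh G v := by
    conv_lhs => rw [hvG]
    exact R.V_stepFun fun x _ => hb' x
  have hQv : L.Q ε v = L.stepQ Eh G v := by
    conv_lhs => rw [hvG]
    exact R.Q_stepFun fun x _ => hb' x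
  have hΥ := hv.2.2.2.2
  rw [Upsilon, hVv, hQv] at hΥ
  obtain ⟨m1, m2⟩ := R.step_mono hC hδ (F := insert M' F) (M := M') (Finset.mem_insert_self _ _) G
    (Finset.insert_subset_insert _ Finset.subset_union_left)
    (fun y hy => by
      rcases Finset.mem_insert.1 hy with rfl | hy
      · exact le_rfl
      · exact (hM' y (Finset.mem_insert_of_mem hy)).le) (fun x _ => hb' x) hΥ
  have hcongr : ∀ x ∈ F, Function.update v M 0 x = v x := fun x hx =>
    Function.update_of_ne (hM x hx).ne _ _
  -- The potentials depend only on the successive values and not on the positions of the points, so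
  -- the final value `0` may be taken at `M` instead of `M'`.
  have eV : stepV Eh (insert M F) (Function.update v M 0) = stepV Eh (insert M' F) v := by
    rw [stepV_insert hM, stepV_insert hM'F, stepV_congr hcongr, lastVal_congr hcongr, hvM',
      Function.update_self]
  have eQ : L.stepQ Eh (insert M F) (Function.update v M 0) = L.stepQ Eh (insert M' F) v := by
    rw [stepQ_insert hM, stepQ_insert hM'F, stepQ_congr hcongr, lastVal_congr hcongr, hvM',
      Function.update_self]
    congr 1
    exact Finset.sum_congr rfl fun x hx => by rw [fanAt_congr hcongr hx]
  have hgb : ∀ x ∈ insert M F, ‖Function.update v M 0 x‖ < ρ := fun x _ => by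
    by_cases h : x = M
    · subst h; simpa using R.ρ_pos
    · rw [Function.update_of_ne h]; exact hb' x
  rw [R.V_stepFun hgb, R.Q_stepFun hgb, Upsilon, hVv, hQv, eV, eQ]
  refine ⟨R.stepFun_mem_DStar hgb (Finset.mem_insert_self _ _) (fun y hy => ?_) (by simp) ?_,
    rfl, rfl, m1, m2⟩
  · rcases Finset.mem_insert.1 hy with rfl | hy
    · exact le_rfl
    · exact (hM y hy).le
  · rw [eV, eQ]; exact m2.trans_lt hΥ

end ConservationLaw

/-! ### Continuity of the potentials under convergence of the sampled values. -/

namespace ConservationLaw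

variable {n : ℕ} {L : ConservationLaw n} {ε K ρ : ℝ} {Eh : State n × State n → Fin n → ℝ}

theorem continuous_wavePotential (i j : Fin n) :
    Continuous fun p : ℝ × ℝ => L.wavePotential i j p.1 p.2 := by
  by_cases h1 : j < i
  · simp only [wavePotential_of_lt h1]; fun_prop
  by_cases h2 : i = j ∧ L.GenuinelyNonlinear i
  · obtain ⟨rfl, h⟩ := h2
    simp only [wavePotential_self h]; fun_prop
  · simp only [wavePotential_eq_zero h1 h2]; fun_prop

theorem tendsto_wavePotential (i j : Fin n) {ι : Type*} {f : Filter ι} {σ τ : ι → ℝ} {a b : ℝ}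
    (hσ : Tendsto σ f (𝓝 a)) (hτ : Tendsto τ f (𝓝 b)) :
    Tendsto (fun k => L.wavePotential i j (σ k) (τ k)) f (𝓝 (L.wavePotential i j a b)) := by
  have h := (continuous_wavePotential (L := L) i j).tendsto (a, b)
  exact Tendsto.comp h (hσ.prodMk_nhds hτ)

theorem tendsto_fanPotential {ι : Type*} {f : Filter ι} {σ τ : ι → Fin n → ℝ} {a b : Fin n → ℝ}
    (hσ : Tendsto σ f (𝓝 a)) (hτ : Tendsto τ f (𝓝 b)) :
    Tendsto (fun k => L.fanPotential (σ k) (τ k)) f (𝓝 (L.fanPotential a b)) :=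
  tendsto_finsetSum _ fun i _ => tendsto_finsetSum _ fun j _ =>
    tendsto_wavePotential i j (tendsto_pi_nhds.1 hσ i) (tendsto_pi_nhds.1 hτ j)

theorem RiemannEstimates.lipschitz (R : L.RiemannEstimates ε Eh K ρ) {a b : State n × State n}
    (ha : ‖a‖ < ρ) (hb : ‖b‖ < ρ) : ‖Eh a - Eh b‖ ≤ K * ‖a - b‖ := by
  have := R.quad a b b b ha hb hb hb
  simpa using this

theorem RiemannEstimates.tendsto (R : L.RiemannEstimates ε Eh K ρ) {ι : Type*} {f : Filter ι}
    {p : ι → State n × State n} {a : State n × State n} (ha : ‖a‖ < ρ) (hp : Tendsto p f (𝓝 a)) :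
    Tendsto (fun k => Eh (p k)) f (𝓝 (Eh a)) := by
  have h1 : Tendsto (fun k => K * ‖p k - a‖) f (𝓝 0) := by
    have : Tendsto (fun k => K * ‖p k - a‖) f (𝓝 (K * ‖a - a‖)) :=
      ((hp.sub_const a).norm).const_mul K
    simpa using this
  rw [tendsto_iff_norm_sub_tendsto_zero]
  refine squeeze_zero' (Eventually.of_forall fun k => norm_nonneg _) ?_ h1
  filter_upwards [hp.norm.eventually_lt_const ha] with k hk using R.lipschitz hk ha

theorem RiemannEstimates.tendsto_fanAt (R : L.RiemannEstimates ε Eh K ρ) {ι : Type*} {f : Filter ι}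
    {F : Finset ℝ} {w : ι → ℝ → State n} {g : ℝ → State n} (hg : ∀ x ∈ F, ‖g x‖ < ρ)
    (hw : ∀ x ∈ F, Tendsto (fun k => w k x) f (𝓝 (g x))) {x : ℝ} (hx : x ∈ F) :
    Tendsto (fun k => fanAt Eh F (w k) x) f (𝓝 (fanAt Eh F g x)) := by
  refine R.tendsto ?_ (Tendsto.prodMk_nhds (tendsto_lastVal fun y hy => ?_) (hw x hx))
  · rw [Prod.norm_def]
    exact max_lt (norm_leftState_lt R.ρ_pos hg x) (hg x hx)
  · exact hw y (Finset.mem_filter.1 hy).1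

theorem RiemannEstimates.tendsto_stepV (R : L.RiemannEstimates ε Eh K ρ) {ι : Type*} {f : Filter ι}
    {F : Finset ℝ} {w : ι → ℝ → State n} {g : ℝ → State n} (hg : ∀ x ∈ F, ‖g x‖ < ρ)
    (hw : ∀ x ∈ F, Tendsto (fun k => w k x) f (𝓝 (g x))) :
    Tendsto (fun k => stepV Eh F (w k)) f (𝓝 (stepV Eh F g)) :=
  tendsto_finsetSum _ fun _ hx => tendsto_finsetSum _ fun i _ =>
    (((continuous_apply i).tendsto _).comp (R.tendsto_fanAt hg hw hx)).abs

/-- Only finitely many values enter, and both the solver and the wave potentials are continuous.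
With `step_mono` this carries the lower semicontinuity. -/
theorem RiemannEstimates.tendsto_stepQ (R : L.RiemannEstimates ε Eh K ρ) {ι : Type*} {f : Filter ι}
    {F : Finset ℝ} {w : ι → ℝ → State n} {g : ℝ → State n} (hg : ∀ x ∈ F, ‖g x‖ < ρ)
    (hw : ∀ x ∈ F, Tendsto (fun k => w k x) f (𝓝 (g x))) :
    Tendsto (fun k => L.stepQ Eh F (w k)) f (𝓝 (L.stepQ Eh F g)) :=
  tendsto_finsetSum _ fun x hx => tendsto_finsetSum _ fun y hy => by
    split_ifs
    · exact tendsto_fanPotential (R.tendsto_fanAt hg hw hx) (R.tendsto_fanAt hg hw hy)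
    · exact tendsto_const_nhds

end ConservationLaw

/-! ### Grids, their cells, and product measures above the diagonal. -/

noncomputable section

/-- The first point of `F` that is not smaller than `y`; it is `M` if there is none. -/
def label (F : Finset ℝ) (M : ℝ) (y : ℝ) : ℝ :=
  if h : (F.filter (y ≤ ·)).Nonempty then (F.filter (y ≤ ·)).min' h else M

section Label

variable {F : Finset ℝ} {M : ℝ}

theorem label_mem (y : ℝ) : label F M y ∈ insert M F := by
  unfold label
  split_ifs with h
  · exact Finset.mem_insert_of_mem (Finset.mem_filter.1 (Finset.min'_mem _ h)).1
  · exact Finset.mem_insert_self _ _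

/-- The cell of `x` is the interval that is open at the preceding point of `F` and closed at `x`,
matching the increments of right continuous functions. -/
theorem label_eq_iff (hM : ∀ x ∈ F, x < M) {x y : ℝ} (hx : x ∈ F) :
    label F M y = x ↔ y ≤ x ∧ ∀ z ∈ F, z < x → z < y := by
  unfold label
  split_ifs with h
  · constructor
    · rintro rfl
      refine ⟨(Finset.mem_filter.1 (Finset.min'_mem _ h)).2, fun z hz hlt => ?_⟩
      by_contra hzy
      exact absurd (Finset.min'_le _ _ (Finset.mem_filter.2 ⟨hz, not_lt.1 hzy⟩)) (not_le.2 hlt)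
    · rintro ⟨h1, h2⟩
      refine le_antisymm (Finset.min'_le _ _ (Finset.mem_filter.2 ⟨hx, h1⟩)) ?_
      refine Finset.le_min' _ _ _ fun z hz => ?_
      obtain ⟨hz, hyz⟩ := Finset.mem_filter.1 hz
      by_contra hzx
      exact absurd (h2 z hz (not_le.1 hzx)) (not_lt.2 hyz)
  · refine ⟨fun h' => absurd (hM x hx) (by rw [h']; exact lt_irrefl _), fun h' => ?_⟩
    exact absurd ⟨x, Finset.mem_filter.2 ⟨hx, h'.1⟩⟩ h

theorem label_eq_self_iff (hM : ∀ x ∈ F, x < M) {y : ℝ} :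
    label F M y = M ↔ ∀ z ∈ F, z < y := by
  unfold label
  split_ifs with h
  · have := Finset.mem_filter.1 (Finset.min'_mem _ h)
    refine ⟨fun h' => absurd (hM _ this.1) (by rw [h']; exact lt_irrefl _), fun h' => ?_⟩
    exact absurd (h' _ this.1) (not_lt.2 this.2)
  · refine ⟨fun _ z hz => ?_, fun _ => rfl⟩
    by_contra hzy
    exact h ⟨z, Finset.mem_filter.2 ⟨hz, not_lt.1 hzy⟩⟩

theorem label_mono (hM : ∀ x ∈ F, x < M) : Monotone (label F M) := by
  intro y y' hy
  rcases Finset.mem_insert.1 (label_mem (F := F) (M := M) y') with h | h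
  · rw [h]
    rcases Finset.mem_insert.1 (label_mem (F := F) (M := M) y) with h | h
    · exact h.le
    · exact (hM _ h).le
  · have h1 := ((label_eq_iff hM h).1 rfl).1
    unfold label
    rw [dif_pos ⟨_, Finset.mem_filter.2 ⟨h, hy.trans h1⟩⟩]
    exact Finset.min'_le _ _ (Finset.mem_filter.2 ⟨h, hy.trans h1⟩)

theorem measurable_label (hM : ∀ x ∈ F, x < M) : Measurable (label F M) := (label_mono hM).measurable

end Label

/-- The points come from a prescribed dense set, which will be a set of points of convergence of the
approximating sequence. -/
theorem exists_grid {D : Set ℝ} (hD : Dense D) {η : ℝ} (hη : 0 < η) (T : ℝ) :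
    ∃ F : Finset ℝ, (F : Set ℝ) ⊆ D ∧ (∀ y ∈ F, -T - η < y ∧ y < T) ∧
      ∀ x ∈ Icc (-T) T, ∃ y ∈ F, x - η < y ∧ y < x := by
  have h : ∀ x : ℝ, ∃ y ∈ D, x - η < y ∧ y < x := fun x => by
    obtain ⟨y, hy, hyD⟩ := hD.exists_between (show x - η < x by linarith)
    exact ⟨y, hy, hyD⟩
  choose d hdD hd1 hd2 using h
  obtain ⟨t, ht, hcov⟩ := (isCompact_Icc (a := -T) (b := T)).elim_nhds_subcover
    (fun x => Ioo (d x) (d x + η)) fun x _ => Ioo_mem_nhds (hd2 x) (by linarith [hd1 x])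
  classical
  refine ⟨t.image d, ?_, ?_, fun x hx => ?_⟩
  · intro y hy
    obtain ⟨x, -, rfl⟩ := Finset.mem_image.1 (Finset.mem_coe.1 hy)
    exact hdD x
  · intro y hy
    obtain ⟨x, hx, rfl⟩ := Finset.mem_image.1 hy
    have := ht x hx
    exact ⟨by linarith [hd1 x, this.1], by linarith [hd2 x, this.2]⟩
  · obtain ⟨z, hz, hxz⟩ := mem_iUnion₂.1 (hcov hx)
    exact ⟨d z, Finset.mem_image_of_mem _ hz, by linarith [hxz.2], hxz.1⟩

/-- The cells of a fine grid inherit properties that hold locally, also near `±∞`. -/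
theorem exists_forall_cell {Good : Set ℝ → Prop} (hanti : ∀ s t, s ⊆ t → Good t → Good s)
    (hloc : ∀ x, ∃ U ∈ 𝓝 x, Good U) (hbot : ∃ T, Good (Iic T)) (htop : ∃ T, Good (Ici T)) :
    ∃ T₀ : ℝ, ∀ T, T₀ ≤ T → ∃ η₀ > 0, ∀ η, 0 < η → η ≤ η₀ → ∀ F : Finset ℝ,
      (∀ y ∈ F, -T - η < y ∧ y < T) → (∀ x ∈ Icc (-T) T, ∃ y ∈ F, x - η < y ∧ y < x) →
      ∀ M, T ≤ M → ∀ x ∈ insert M F, Good (label F M ⁻¹' {x}) := by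
  obtain ⟨T₁, hT₁⟩ := hbot
  obtain ⟨T₂, hT₂⟩ := htop
  choose U hU hG using hloc
  refine ⟨max 0 (max (-T₁) (T₂ + 1)), fun T hT => ?_⟩
  have hT0 : 0 ≤ T := (le_max_left _ _).trans hT
  have hT1 : -T₁ ≤ T := ((le_max_left _ _).trans (le_max_right _ _)).trans hT
  have hT2 : T₂ + 1 ≤ T := ((le_max_right _ _).trans (le_max_right _ _)).trans hT
  -- Cells meeting the compact part are handled by a Lebesgue number of the cover; the cell of `M`
  -- and that of a possible point on the left of `-T` lie in the two half-lines.
  obtain ⟨r, hr, hball⟩ := lebesgue_number_lemma_of_metric (isCompact_Icc (a := -T) (b := T))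
    (c := fun x => interior (U x)) (fun x => isOpen_interior)
    fun x _ => mem_iUnion.2 ⟨x, mem_interior_iff_mem_nhds.2 (hU x)⟩
  refine ⟨min (r / 2) 1, by positivity, fun η hη hηle F hF hmesh M hM x hx => ?_⟩
  have hη1 : η ≤ r / 2 := hηle.trans (min_le_left _ _)
  have hη2 : η ≤ 1 := hηle.trans (min_le_right _ _)
  have hFM : ∀ y ∈ F, y < M := fun y hy => (hF y hy).2.trans_le hM
  rcases Finset.mem_insert.1 hx with rfl | hxF
  · obtain ⟨y, hy, hy1, -⟩ := hmesh T ⟨by linarith, le_rfl⟩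
    refine hanti _ _ (fun z hz => ?_) hT₂
    have := (label_eq_self_iff hFM).1 hz y hy
    simp only [mem_Ici]
    linarith
  · rcases lt_or_ge x (-T) with h | h
    · refine hanti _ _ (fun z hz => ?_) hT₁
      have := ((label_eq_iff hFM hxF).1 hz).1
      simp only [mem_Iic]
      linarith
    · obtain ⟨y, hy, hy1, hy2⟩ := hmesh x ⟨h, (hF x hxF).2.le⟩
      obtain ⟨i, hi⟩ := hball x ⟨h, (hF x hxF).2.le⟩
      refine hanti _ _ (fun z hz => interior_subset (hi ?_)) (hG i)
      obtain ⟨h1, h2⟩ := (label_eq_iff hFM hxF).1 hz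
      have := h2 y hy hy2
      rw [Metric.mem_ball, Real.dist_eq, abs_lt]
      constructor <;> linarith

section Partition

variable {F : Finset ℝ} {c : ℝ → ℝ} (hc : Measurable c) (hcF : ∀ x, c x ∈ F)
  {α β : Measure ℝ} [IsFiniteMeasure α] [IsFiniteMeasure β]

include hc hcF

theorem sum_measureReal_fiber (s : Set ℝ) :
    ∑ x ∈ F, α.real (c ⁻¹' {x} ∩ s) = α.real s := by
  have := measureReal_biUnion_finset (μ := α.restrict s) (s := F) (f := fun x => c ⁻¹' {x})
    (fun x _ y _ hxy => Set.disjoint_left.2 fun z hz hz' => hxy (hz.symm.trans hz'))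
    fun x _ => hc (measurableSet_singleton x)
  have h2 : (⋃ x ∈ F, c ⁻¹' {x}) = univ := eq_univ_of_forall fun z =>
    mem_iUnion₂.2 ⟨c z, hcF z, rfl⟩
  rw [h2, measureReal_restrict_apply MeasurableSet.univ, univ_inter] at this
  rw [this]
  exact Finset.sum_congr rfl fun x _ =>
    (measureReal_restrict_apply (hc (measurableSet_singleton x))).symm

/-- The mass of `α ⊗ β` above the diagonal is close to that of the pairs of distinct cells of a
fine partition. -/
theorem abs_measureReal_prod_lt_sub_le (hmono : Monotone c) {θ : ℝ}
    (hθ : ∀ x ∈ F, ∃ y, α.real (c ⁻¹' {x} ∩ Iio y) ≤ θ ∧ β.real (c ⁻¹' {x} ∩ Ioi y) ≤ θ) :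
    |(α.prod β).real {p | p.1 < p.2} -
      ∑ x ∈ F, ∑ y ∈ F, if x < y then α.real (c ⁻¹' {x}) * β.real (c ⁻¹' {y}) else 0| ≤
      θ * (α.real univ + β.real univ) := by
  have hcell : ∀ x, MeasurableSet (c ⁻¹' {x}) := fun x => hc (measurableSet_singleton x)
  set A : Set (ℝ × ℝ) := ⋃ q ∈ (F ×ˢ F).filter (fun q => q.1 < q.2), (c ⁻¹' {q.1}) ×ˢ (c ⁻¹' {q.2})
    with hA
  have hAm : (α.prod β).real A =
      ∑ x ∈ F, ∑ y ∈ F, if x < y then α.real (c ⁻¹' {x}) * β.real (c ⁻¹' {y}) else 0 := by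
    rw [hA, measureReal_biUnion_finset]
    · rw [Finset.sum_filter, Finset.sum_product]
      simp only [measureReal_prod_prod]
    · intro p _ q _ hpq
      refine Set.disjoint_left.2 fun z hz hz' => hpq (Prod.ext ?_ ?_)
      · exact hz.1.symm.trans hz'.1
      · exact hz.2.symm.trans hz'.2
    · exact fun q _ => (hcell _).prod (hcell _)
  have hAs : MeasurableSet A := Finset.measurableSet_biUnion _ fun q _ => (hcell _).prod (hcell _)
  have hsub : A ⊆ {p | p.1 < p.2} := by
    intro p hp
    obtain ⟨q, hq, hpq⟩ := mem_iUnion₂.1 hp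
    have hlt := (Finset.mem_filter.1 hq).2
    by_contra h
    have := hmono (not_lt.1 h)
    rw [show c p.1 = q.1 from hpq.1, show c p.2 = q.2 from hpq.2] at this
    exact absurd hlt (not_lt.2 this)
  choose! y hy1 hy2 using hθ
  -- The remaining pairs lie in a common cell. If `p.1 < p.2`, either `p.1` is on the left of the
  -- splitting point or `p.2` is on its right, and each case has a factor of mass at most `θ`.
  have hsub2 : {p : ℝ × ℝ | p.1 < p.2} ⊆ A ∪ ⋃ x ∈ F, ((c ⁻¹' {x} ∩ Iio (y x)) ×ˢ (c ⁻¹' {x}) ∪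
      (c ⁻¹' {x}) ×ˢ (c ⁻¹' {x} ∩ Ioi (y x))) := by
    rintro p (hp : p.1 < p.2)
    rcases (hmono hp.le).lt_or_eq with h | h
    · exact Or.inl (mem_iUnion₂.2 ⟨(c p.1, c p.2), Finset.mem_filter.2
        ⟨Finset.mem_product.2 ⟨hcF _, hcF _⟩, h⟩, rfl, rfl⟩)
    · refine Or.inr (mem_iUnion₂.2 ⟨c p.1, hcF _, ?_⟩)
      rcases lt_or_ge p.1 (y (c p.1)) with h1 | h1
      · exact Or.inl ⟨⟨rfl, h1⟩, h.symm⟩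
      · exact Or.inr ⟨rfl, h.symm, h1.trans_lt hp⟩
  have hle1 : (α.prod β).real A ≤ (α.prod β).real {p | p.1 < p.2} := measureReal_mono hsub
  have hle2 : (α.prod β).real {p | p.1 < p.2} ≤ (α.prod β).real A +
      θ * (α.real univ + β.real univ) := by
    refine (measureReal_mono hsub2).trans ((measureReal_union_le _ _).trans ?_)
    gcongr
    refine (measureReal_biUnion_finset_le _ _).trans ?_
    have hs1 := sum_measureReal_fiber hc hcF (α := α) univ
    have hs2 := sum_measureReal_fiber hc hcF (α := β) univ
    simp only [inter_univ] at hs1 hs2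
    rw [← hs1, ← hs2, ← Finset.sum_add_distrib, Finset.mul_sum]
    refine Finset.sum_le_sum fun x hx => (measureReal_union_le _ _).trans ?_
    rw [measureReal_prod_prod, measureReal_prod_prod]
    have h1 := mul_le_mul_of_nonneg_right (hy1 x hx) (measureReal_nonneg (μ := β) (s := c ⁻¹' {x}))
    have h2 := mul_le_mul_of_nonneg_left (hy2 x hx) (measureReal_nonneg (μ := α) (s := c ⁻¹' {x}))
    linarith
  rw [← hAm, abs_le]
  constructor <;> linarith

/-- On the cells of a fine partition one of two mutually singular measures is small. -/
theorem sum_min_measureReal_le {K₁ K₂ : Set ℝ}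
    (hK : ∀ x ∈ F, Disjoint (c ⁻¹' {x}) K₁ ∨ Disjoint (c ⁻¹' {x}) K₂) :
    ∑ x ∈ F, min (α.real (c ⁻¹' {x})) (β.real (c ⁻¹' {x})) ≤ α.real K₁ᶜ + β.real K₂ᶜ := by
  rw [← sum_measureReal_fiber hc hcF K₁ᶜ, ← sum_measureReal_fiber hc hcF K₂ᶜ,
    ← Finset.sum_add_distrib]
  refine Finset.sum_le_sum fun x hx => ?_
  have h1 := measureReal_nonneg (μ := α) (s := c ⁻¹' {x} ∩ K₁ᶜ)
  have h2 := measureReal_nonneg (μ := β) (s := c ⁻¹' {x} ∩ K₂ᶜ)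
  rcases hK x hx with h | h
  · rw [inter_eq_left.2 h.subset_compl_right]
    exact (min_le_left _ _).trans (by linarith)
  · rw [inter_eq_left.2 h.subset_compl_right]
    exact (min_le_right _ _).trans (by linarith)

end Partition

end

/-! ### Right continuous functions of bounded variation and finite measures. -/

/-- Such a function is the pointwise limit of its values at the next point of the lattice of step `1
/ (k + 1)`, approached from the right. -/
theorem stronglyMeasurable_of_continuousWithinAt_Ici {E : Type*} [TopologicalSpace E]
    [TopologicalSpace.PseudoMetrizableSpace E] {f : ℝ → E}
    (hf : ∀ x, ContinuousWithinAt f (Ici x) x) : StronglyMeasurable f := by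
  refine stronglyMeasurable_of_tendsto (u := atTop)
    (f := fun (k : ℕ) (x : ℝ) => f ((⌊x * (k + 1)⌋ + 1 : ℤ) / (k + 1))) (fun k => ?_) ?_
  · have h1 : StronglyMeasurable fun z : ℤ => f ((z + 1 : ℤ) / ((k : ℝ) + 1)) :=
      StronglyMeasurable.of_discrete
    exact h1.comp_measurable (Int.measurable_floor.comp (measurable_id.mul_const _))
  · rw [tendsto_pi_nhds]
    intro x
    refine (hf x).tendsto.comp (tendsto_nhdsWithin_iff.2 ⟨?_, Eventually.of_forall fun k => ?_⟩)
    · have h1 : Tendsto (fun k : ℕ => x + 1 / ((k : ℝ) + 1)) atTop (𝓝 x) := by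
        simpa using tendsto_const_nhds.add (tendsto_one_div_add_atTop_nhds_zero_nat (𝕜 := ℝ))
      refine tendsto_of_tendsto_of_tendsto_of_le_of_le tendsto_const_nhds h1 (fun k => ?_)
        fun k => ?_
      · have : (0 : ℝ) < k + 1 := by positivity
        rw [le_div_iff₀ this]
        push_cast
        exact (Int.lt_floor_add_one _).le
      · have : (0 : ℝ) < k + 1 := by positivity
        simp only [Int.cast_add, Int.cast_one]
        rw [div_le_iff₀ this, add_mul, one_div, inv_mul_cancel₀ this.ne']
        linarith [Int.floor_le (x * (k + 1))]
    · have : (0 : ℝ) < k + 1 := by positivity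
      rw [mem_Ici, le_div_iff₀ this]
      push_cast
      exact (Int.lt_floor_add_one _).le

theorem exists_measureReal_lt {α : Type*} [MeasurableSpace α] (κ : Measure α) [IsFiniteMeasure κ]
    {s : ℕ → Set α} (hs : ∀ k, MeasurableSet (s k)) (hanti : Antitone s) (hempty : ⋂ k, s k = ∅)
    {e : ℝ} (he : 0 < e) : ∃ k, κ.real (s k) < e := by
  have h := tendsto_measure_iInter_atTop (μ := κ) (fun k => (hs k).nullMeasurableSet) hanti
    ⟨0, measure_ne_top _ _⟩
  rw [hempty, measure_empty] at h
  have h2 := (ENNReal.tendsto_toReal ENNReal.zero_ne_top).comp h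
  simp only [ENNReal.toReal_zero] at h2
  exact (h2.eventually_lt_const he).exists

section Small

variable (κ : Measure ℝ) [IsFiniteMeasure κ] {e : ℝ} (he : 0 < e)

include he

theorem exists_measureReal_Ioo_left_lt (x : ℝ) : ∃ y < x, κ.real (Ioo y x) < e := by
  obtain ⟨k, hk⟩ := exists_measureReal_lt κ (s := fun k : ℕ => Ioo (x - 1 / ((k : ℝ) + 1)) x)
    (fun k => measurableSet_Ioo) (fun k l hkl => Ioo_subset_Ioo_left (by
      have : (1 : ℝ) / (l + 1) ≤ 1 / (k + 1) := one_div_le_one_div_of_le (by positivity)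
        (by gcongr)
      linarith)) (by
      ext z
      simp only [mem_iInter, mem_Ioo, mem_empty_iff_false, iff_false, not_forall]
      by_cases hz : z < x
      · obtain ⟨k, hk⟩ := exists_nat_one_div_lt (sub_pos.2 hz)
        exact ⟨k, fun h => by linarith [h.1]⟩
      · exact ⟨0, fun h => hz h.2⟩) he
  exact ⟨_, sub_lt_self _ (by positivity), hk⟩

theorem exists_measureReal_Ioo_right_lt (x : ℝ) : ∃ y > x, κ.real (Ioo x y) < e := by
  obtain ⟨k, hk⟩ := exists_measureReal_lt κ (s := fun k : ℕ => Ioo x (x + 1 / ((k : ℝ) + 1)))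
    (fun k => measurableSet_Ioo) (fun k l hkl => Ioo_subset_Ioo_right (by
      have : (1 : ℝ) / (l + 1) ≤ 1 / (k + 1) := one_div_le_one_div_of_le (by positivity)
        (by gcongr)
      linarith)) (by
      ext z
      simp only [mem_iInter, mem_Ioo, mem_empty_iff_false, iff_false, not_forall]
      by_cases hz : x < z
      · obtain ⟨k, hk⟩ := exists_nat_one_div_lt (sub_pos.2 hz)
        exact ⟨k, fun h => by linarith [h.2]⟩
      · exact ⟨0, fun h => hz h.1⟩) he
  exact ⟨_, lt_add_of_pos_right _ (by positivity), hk⟩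

theorem exists_measureReal_Iic_lt : ∃ T : ℝ, κ.real (Iic T) < e := by
  obtain ⟨k, hk⟩ := exists_measureReal_lt κ (s := fun k : ℕ => Iic (-(k : ℝ)))
    (fun k => measurableSet_Iic) (fun k l hkl => Iic_subset_Iic.2 (by
      have : (k : ℝ) ≤ l := by exact_mod_cast hkl
      linarith)) (by
      ext z
      simp only [mem_iInter, mem_Iic, mem_empty_iff_false, iff_false, not_forall]
      obtain ⟨k, hk⟩ := exists_nat_gt (-z)
      exact ⟨k, fun h => by linarith⟩) he
  exact ⟨_, hk⟩

theorem exists_measureReal_Ici_lt : ∃ T : ℝ, κ.real (Ici T) < e := by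
  obtain ⟨k, hk⟩ := exists_measureReal_lt κ (s := fun k : ℕ => Ici (k : ℝ))
    (fun k => measurableSet_Ici) (fun k l hkl => Ici_subset_Ici.2 (by exact_mod_cast hkl)) (by
      ext z
      simp only [mem_iInter, mem_Ici, mem_empty_iff_false, iff_false, not_forall]
      obtain ⟨k, hk⟩ := exists_nat_gt z
      exact ⟨k, fun h => by linarith⟩) he
  exact ⟨_, hk⟩

end Small

section BoundedVariation

variable {n : ℕ}

/-- A measure with values in a finite-dimensional space has finite variation. -/
instance isFiniteMeasure_variation {X : Type*} [MeasurableSpace X] (μ : VectorMeasure X (State n)) :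
    IsFiniteMeasure μ.variation := by
  set ν : Fin n → SignedMeasure X := fun i =>
    μ.mapRange (EuclideanSpace.proj (𝕜 := ℝ) i).toLinearMap.toAddMonoidHom
      (EuclideanSpace.proj (𝕜 := ℝ) i).continuous with hν
  have hle : μ.variation ≤ ∑ i, (ν i).totalVariation := by
    refine VectorMeasure.variation_le_of_forall_enorm_le fun s hs => ?_
    rw [Measure.coe_finsetSum, Finset.sum_apply]
    have h1 : ‖μ s‖ₑ ≤ ∑ i, ‖ν i s‖ₑ := by
      have h2 : ‖μ s‖ ≤ ∑ i, ‖μ s i‖ := by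
        have := norm_sum_le (Finset.univ : Finset (Fin n))
          fun i => (EuclideanSpace.single i (μ s i) : State n)
        simp only [PiLp.norm_single] at this
        have h3 : ∑ i, (EuclideanSpace.single i (μ s i) : State n) = μ s := by
          ext j
          simp [WithLp.ofLp_sum, Finset.sum_apply, Pi.single_apply]
        rwa [h3] at this
      have := ENNReal.ofReal_le_ofReal h2
      rw [ofReal_norm, ENNReal.ofReal_sum_of_nonneg fun i _ => norm_nonneg _] at this
      simp only [ofReal_norm] at this
      exact this
    exact h1.trans (Finset.sum_le_sum fun i _ => (ν i).enorm_le_totalVariation s)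
  exact isFiniteMeasure_of_le _ hle

variable {u : ℝ → State n} (hu : BoundedVariationOn u univ)

theorem norm_le_variation {X : Type*} [MeasurableSpace X] (μ : VectorMeasure X (State n))
    (s : Set X) : ‖μ s‖ ≤ μ.variation.real s :=
  VectorMeasure.norm_measure_le_variation (measure_ne_top _ _)

variable (hrc : ∀ x, ContinuousWithinAt u (Ici x) x)

include hrc

theorem rightLim_eq_self (x : ℝ) : Function.rightLim u x = u x := (hrc x).rightLim_eq

theorem vectorMeasure_Ioc_eq {a b : ℝ} (hab : a ≤ b) : hu.vectorMeasure (Ioc a b) = u b - u a := by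
  rw [hu.vectorMeasure_Ioc hab, rightLim_eq_self hrc, rightLim_eq_self hrc]

theorem vectorMeasure_singleton_eq (a : ℝ) :
    hu.vectorMeasure {a} = u a - Function.leftLim u a := by
  rw [hu.vectorMeasure_singleton, rightLim_eq_self hrc]

theorem vectorMeasure_Ioo_eq {a b : ℝ} (hab : a < b) :
    hu.vectorMeasure (Ioo a b) = Function.leftLim u b - u a := by
  rw [hu.vectorMeasure_Ioo hab, rightLim_eq_self hrc]

theorem vectorMeasure_Icc_eq {a b : ℝ} (hab : a ≤ b) :
    hu.vectorMeasure (Icc a b) = u b - Function.leftLim u a := by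
  rw [hu.vectorMeasure_Icc hab, rightLim_eq_self hrc]

-- Jump points are atoms of the variation of `Du`, and a finite measure has at most countably many
-- atoms.
include hu in
theorem countable_jumpSet : (jumpSet u).Countable := by
  refine (Measure.countable_meas_level_set_pos (μ := hu.vectorMeasure.variation) (g := id)
    measurable_id).mono fun x hx => ?_
  have h1 := norm_le_variation hu.vectorMeasure {x}
  rw [vectorMeasure_singleton_eq hu hrc] at h1
  have h2 : 0 < ‖u x - Function.leftLim u x‖ := norm_pos_iff.2 (sub_ne_zero.2 (Ne.symm hx))
  have h3 : 0 < hu.vectorMeasure.variation.real {x} := h2.trans_le h1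
  have h4 : {a : ℝ | id a = x} = {x} := by ext; simp
  show 0 < hu.vectorMeasure.variation {a | id a = x}
  rw [h4]
  exact (ENNReal.toReal_pos_iff.1 h3).1

end BoundedVariation

/-! ### Strengths of increments against wave measures: quadratic estimate. -/

namespace ConservationLaw

variable {n : ℕ} {L : ConservationLaw n} {ε K ρ : ℝ} {Eh : State n × State n → Fin n → ℝ}

variable (L) in
/-- `u` is a right continuous function of bounded variation with values in the ball of radius `ρ`,
`m` are its wave measures, and the finite measure `κ` bounds its variation and those of `m`. -/
structure IsProfile (ε ρ : ℝ) (u : ℝ → State n) (m : Fin n → SignedMeasure ℝ) (κ : Measure ℝ)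
    (hu : BoundedVariationOn u univ) : Prop where
  right_cont : ∀ x, ContinuousWithinAt u (Ici x) x
  bound : ∃ r < ρ, ∀ x, ‖u x‖ ≤ r
  integrable : ∀ i, (continuousPart hu).Integrable (fun x => L.l i (u x))
  summable : ∀ i, Summable (fun x : jumpSet u => L.strength ε u x i)
  apply_eq : ∀ i, ∀ B : Set ℝ, MeasurableSet B → m i B =
    (∫ᵛ x in B, L.l i (u x) ∂[ContinuousLinearMap.id ℝ (State n →L[ℝ] ℝ); continuousPart hu]) +
      ∑' x : ↥(B ∩ jumpSet u), L.strength ε u x i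
  finite : IsFiniteMeasure κ
  variation_le : hu.vectorMeasure.variation ≤ κ
  totalVariation_le : ∀ i, (m i).totalVariation ≤ κ

namespace IsProfile

variable {u : ℝ → State n} {m : Fin n → SignedMeasure ℝ} {κ : Measure ℝ}
  {hu : BoundedVariationOn u univ} (P : L.IsProfile ε ρ u m κ hu)

include P

theorem norm_lt (x : ℝ) : ‖u x‖ < ρ := by
  obtain ⟨r, hr, h⟩ := P.bound
  exact (h x).trans_lt hr

theorem norm_leftLim_lt (x : ℝ) : ‖Function.leftLim u x‖ < ρ := by
  obtain ⟨r, hr, h⟩ := P.bound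
  exact (le_of_tendsto (hu.tendsto_leftLim x).norm (Eventually.of_forall h)).trans_lt hr

theorem norm_vectorMeasure_le (s : Set ℝ) : ‖hu.vectorMeasure s‖ ≤ κ.real s := by
  have := P.finite
  exact (norm_le_variation _ s).trans
    (ENNReal.toReal_mono (measure_ne_top _ _) (P.variation_le s))

theorem abs_apply_le (i : Fin n) (s : Set ℝ) : |m i s| ≤ κ.real s := by
  have := P.finite
  exact ((m i).norm_le_totalVariation s).trans
    (ENNReal.toReal_mono (measure_ne_top _ _) (P.totalVariation_le i s))

theorem norm_sub_le {a b : ℝ} (hab : a ≤ b) : ‖u b - u a‖ ≤ κ.real (Ioc a b) := by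
  rw [← vectorMeasure_Ioc_eq hu P.right_cont hab]
  exact P.norm_vectorMeasure_le _

theorem norm_leftLim_sub_le {a b : ℝ} (hab : a < b) :
    ‖Function.leftLim u b - u a‖ ≤ κ.real (Ioo a b) := by
  rw [← vectorMeasure_Ioo_eq hu P.right_cont hab]
  exact P.norm_vectorMeasure_le _

theorem norm_sub_leftLim_le {a b : ℝ} (hab : a ≤ b) :
    ‖u b - Function.leftLim u a‖ ≤ κ.real (Icc a b) := by
  rw [← vectorMeasure_Icc_eq hu P.right_cont hab]
  exact P.norm_vectorMeasure_le _

variable (R : L.RiemannEstimates ε Eh K ρ)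

include R

theorem strength_eq (x : ℝ) (i : Fin n) :
    L.strength ε u x i = Eh (Function.leftLim u x, u x) i := by
  rw [strength, R.E_eq _ _ (P.norm_leftLim_lt x)
    (R.solvable _ _ (P.norm_leftLim_lt x) (P.norm_lt x))]

/-- A jump at `x` is linearized by `lᵢ(u(x-))`, with an error quadratic in the jump, and `lᵢ` is
then frozen at `u a`, with an error bounded by the variation over the interval times the jump. The
jumps are summable with total at most the variation. -/
theorem jump_sum_le (a b : ℝ) (i : Fin n) :
    |∑' x : ↥(Ioc a b ∩ jumpSet u), L.strength ε u x i -
      L.l i (u a) (hu.vectorMeasure (Ioc a b ∩ jumpSet u))| ≤ 2 * K * κ.real (Ioc a b) ^ 2 := by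
  have := P.finite
  have hK := R.K_nonneg
  set A := Ioc a b with hA
  have hcount : (A ∩ jumpSet u).Countable := (countable_jumpSet hu P.right_cont).mono inter_subset_right
  have : Countable ↥(A ∩ jumpSet u) := hcount.to_subtype
  have hU : (⋃ x : ↥(A ∩ jumpSet u), {(x : ℝ)}) = A ∩ jumpSet u := by
    ext z; simp
  have hdisj : Pairwise (Function.onFun Disjoint fun x : ↥(A ∩ jumpSet u) => ({(x : ℝ)} : Set ℝ)) :=
    fun x y hxy => by
      simp only [Function.onFun, Set.disjoint_singleton]
      exact fun h => hxy (Subtype.ext h)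
  have h1 : HasSum (fun x : ↥(A ∩ jumpSet u) => L.l i (u a) (hu.vectorMeasure {(x : ℝ)}))
      (L.l i (u a) (hu.vectorMeasure (A ∩ jumpSet u))) := by
    have := VectorMeasure.hasSum_of_disjoint_iUnion (v := hu.vectorMeasure)
      (f := fun x : ↥(A ∩ jumpSet u) => ({(x : ℝ)} : Set ℝ)) (fun x => measurableSet_singleton _) hdisj
    rw [hU] at this
    exact (L.l i (u a)).hasSum this
  have h2 : HasSum (fun x : ↥(A ∩ jumpSet u) => κ.real {(x : ℝ)}) (κ.real (A ∩ jumpSet u)) := by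
    have := VectorMeasure.hasSum_of_disjoint_iUnion (v := κ.toSignedMeasure)
      (f := fun x : ↥(A ∩ jumpSet u) => ({(x : ℝ)} : Set ℝ)) (fun x => measurableSet_singleton _) hdisj
    rw [hU, Measure.toSignedMeasure_apply_measurable hcount.measurableSet] at this
    simpa only [Measure.toSignedMeasure_apply_measurable (measurableSet_singleton _)] using this
  have h3 : Summable fun x : ↥(A ∩ jumpSet u) => L.strength ε u x i :=
    (P.summable i).comp_injective (i := fun x : ↥(A ∩ jumpSet u) => (⟨x, x.2.2⟩ : jumpSet u))
      fun x y hxy => Subtype.ext (congrArg (fun z : jumpSet u => (z : ℝ)) hxy)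
  rw [← h1.tsum_eq, ← h3.tsum_sub h1.summable]
  have hb : ∀ x : ↥(A ∩ jumpSet u), ‖L.strength ε u x i - L.l i (u a) (hu.vectorMeasure {(x : ℝ)})‖ ≤
      2 * K * κ.real A * κ.real {(x : ℝ)} := by
    rintro ⟨x, hxA, hxJ⟩
    simp only
    have hx1 : κ.real {x} ≤ κ.real A := measureReal_mono (by simpa using hxA)
    have hx2 : ‖Function.leftLim u x - u a‖ ≤ κ.real A :=
      (P.norm_leftLim_sub_le hxA.1).trans (measureReal_mono fun z hz => ⟨hz.1, hz.2.le.trans hxA.2⟩)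
    have hx3 : ‖u x - Function.leftLim u x‖ ≤ κ.real {x} := by
      rw [← vectorMeasure_singleton_eq hu P.right_cont]
      exact P.norm_vectorMeasure_le _
    rw [P.strength_eq R, vectorMeasure_singleton_eq hu P.right_cont, Real.norm_eq_abs]
    have e1 := R.linear _ _ (P.norm_leftLim_lt x) (P.norm_lt x) i
    have e2 : |L.l i (Function.leftLim u x) (u x - Function.leftLim u x) -
        L.l i (u a) (u x - Function.leftLim u x)| ≤ K * κ.real A * κ.real {x} := by
      rw [← sub_apply, ← Real.norm_eq_abs]
      refine (ContinuousLinearMap.le_opNorm _ _).trans ?_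
      gcongr
      exact (R.l_lipschitz _ _ (P.norm_leftLim_lt x) (P.norm_lt a) i).trans (by gcongr)
    have e3 : K * ‖u x - Function.leftLim u x‖ ^ 2 ≤ K * κ.real A * κ.real {x} := by
      rw [sq, mul_assoc]
      gcongr
      exact hx3.trans hx1
    rw [abs_le] at e1 e2 ⊢
    constructor <;> linarith [e1.1, e1.2, e2.1, e2.2]
  have := tsum_of_norm_bounded (h2.mul_left (2 * K * κ.real A)) hb
  rw [Real.norm_eq_abs] at this
  refine this.trans ?_
  rw [sq, ← mul_assoc]
  gcongr
  · exact measure_ne_top κ A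
  · exact inter_subset_left

/-- Both quantities equal `lᵢ(u a) · (u b - u a)` to first order: the strength by its linear
expansion, the measure by freezing `lᵢ` at `u a`. The constant is `2` for the jumps, `1` for the
continuous part and `1` for the solver. -/
theorem abs_sub_apply_Ioc_le {a b : ℝ} (hab : a ≤ b) (i : Fin n) :
    |Eh (u a, u b) i - m i (Ioc a b)| ≤ 4 * K * κ.real (Ioc a b) ^ 2 := by
  have := P.finite
  have hK := R.K_nonneg
  have hJ : MeasurableSet (jumpSet u) := (countable_jumpSet hu P.right_cont).measurableSet
  set A := Ioc a b with hA
  have hAm : MeasurableSet A := measurableSet_Ioc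
  have h1 := P.jump_sum_le R a b i
  have h2 : (continuousPart hu) A = hu.vectorMeasure (A ∩ (jumpSet u)ᶜ) :=
    VectorMeasure.restrict_apply _ hJ.compl hAm
  have h3 : hu.vectorMeasure A =
      hu.vectorMeasure (A ∩ (jumpSet u)ᶜ) + hu.vectorMeasure (A ∩ jumpSet u) := by
    rw [← VectorMeasure.of_union _ (hAm.inter hJ.compl) (hAm.inter hJ)]
    · congr 1
      ext z; by_cases hz : z ∈ jumpSet u <;> simp [hz]
    · exact Set.disjoint_left.2 fun z hz hz' => hz.2 hz'.2
  rw [vectorMeasure_Ioc_eq hu P.right_cont hab] at h3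
  have h4 : |(∫ᵛ x in A, L.l i (u x) ∂[ContinuousLinearMap.id ℝ (State n →L[ℝ] ℝ);
      continuousPart hu]) - L.l i (u a) (hu.vectorMeasure (A ∩ (jumpSet u)ᶜ))| ≤
      K * κ.real A ^ 2 := by
    have e1 : L.l i (u a) (hu.vectorMeasure (A ∩ (jumpSet u)ᶜ)) =
        ∫ᵛ x in A, L.l i (u a) ∂[ContinuousLinearMap.id ℝ (State n →L[ℝ] ℝ); continuousPart hu] := by
      rw [VectorMeasure.setIntegral_const, h2]; rfl
    have e0 : (continuousPart hu).Integrable (fun _ : ℝ => L.l i (u a)) := by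
      have : IsFiniteMeasure (continuousPart hu).variation := isFiniteMeasure_variation _
      exact integrable_const (μ := (continuousPart hu).variation) (L.l i (u a))
    rw [e1, ← VectorMeasure.integral_fun_sub (P.integrable i).integrableOn e0.integrableOn,
      ← Real.norm_eq_abs]
    refine (VectorMeasure.norm_setIntegral_le_of_norm_le_const (C := K * κ.real A)
      fun x hx => ?_).trans ?_
    · refine (R.l_lipschitz _ _ (P.norm_lt x) (P.norm_lt a) i).trans ?_
      gcongr
      exact (P.norm_sub_le hx.1.le).trans (measureReal_mono (Ioc_subset_Ioc_right hx.2))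
    · have e2 : (continuousPart hu).variation.real A ≤ κ.real A := by
        refine ENNReal.toReal_mono (measure_ne_top _ _) ?_
        rw [continuousPart, VectorMeasure.variation_restrict hJ.compl]
        exact (Measure.restrict_apply_le _ _).trans (P.variation_le A)
      have e3 : ‖ContinuousLinearMap.id ℝ (State n →L[ℝ] ℝ)‖ ≤ 1 :=
        ContinuousLinearMap.norm_id_le
      have e4 : K * κ.real A * ‖ContinuousLinearMap.id ℝ (State n →L[ℝ] ℝ)‖ ≤ K * κ.real A * 1 := by
        gcongr
      calc _ ≤ K * κ.real A * 1 * κ.real A := by gcongr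
        _ = _ := by ring
  have h5 := R.linear _ _ (P.norm_lt a) (P.norm_lt b) i
  have h6 : K * ‖u b - u a‖ ^ 2 ≤ K * κ.real A ^ 2 := by
    gcongr
    exact P.norm_sub_le hab
  rw [h3, map_add, ← h3] at h5
  rw [P.apply_eq i A hAm]
  rw [abs_le] at h1 h4 h5 ⊢
  constructor <;> linarith [h1.1, h1.2, h4.1, h4.2, h5.1, h5.2]

end IsProfile

end ConservationLaw

/-! ### Strengths of increments against wave measures: cells with one large atom. -/

namespace ConservationLaw

variable {n : ℕ} {L : ConservationLaw n} {ε K ρ : ℝ} {Eh : State n × State n → Fin n → ℝ}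

/-- The pairs `(a, c)`, `(a, b)`, `(b, c)`, `(b, b)` form an exact parallelogram and the solver
vanishes at the last one, so the second difference is the defect of additivity. -/
theorem RiemannEstimates.near_additive (R : L.RiemannEstimates ε Eh K ρ) {a b c : State n}
    (ha : ‖a‖ < ρ) (hb : ‖b‖ < ρ) (hc : ‖c‖ < ρ) (i : Fin n) :
    |Eh (a, c) i - Eh (a, b) i - Eh (b, c) i| ≤ K * (‖b - a‖ * ‖c - b‖) := by
  have h2 : ∀ x y : State n, ‖x‖ < ρ → ‖y‖ < ρ → ‖(x, y)‖ < ρ := fun x y hx hy => by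
    rw [Prod.norm_def]; exact max_lt hx hy
  have h := R.quad (a, c) (a, b) (b, c) (b, b) (h2 _ _ ha hc) (h2 _ _ ha hb) (h2 _ _ hb hc)
    (h2 _ _ hb hb)
  have e1 : ((a, c) : State n × State n) - (a, b) - (b, c) + (b, b) = 0 := by
    ext <;> simp
  rw [e1, R.self b hb, norm_zero, zero_add, add_zero] at h
  have h3 := (norm_le_pi_norm (Eh (a, c) - Eh (a, b) - Eh (b, c)) i).trans h
  simp only [Pi.sub_apply, Real.norm_eq_abs, Prod.mk_sub_mk, sub_self, Prod.norm_mk, norm_zero,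
    norm_nonneg, sup_of_le_left, sup_of_le_right] at h3
  rwa [norm_sub_rev b a]

theorem RiemannEstimates.abs_sub_le_right (R : L.RiemannEstimates ε Eh K ρ) {a b c : State n}
    (ha : ‖a‖ < ρ) (hb : ‖b‖ < ρ) (hc : ‖c‖ < ρ) (i : Fin n) :
    |Eh (a, b) i - Eh (a, c) i| ≤ K * ‖b - c‖ := by
  have h2 : ∀ x y : State n, ‖x‖ < ρ → ‖y‖ < ρ → ‖(x, y)‖ < ρ := fun x y hx hy => by
    rw [Prod.norm_def]; exact max_lt hx hy
  have h := (norm_le_pi_norm (Eh (a, b) - Eh (a, c)) i).trans (R.lipschitz (h2 _ _ ha hb) (h2 _ _ ha hc))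
  simpa [Prod.norm_mk] using h

theorem RiemannEstimates.abs_sub_le_left (R : L.RiemannEstimates ε Eh K ρ) {a b c : State n}
    (ha : ‖a‖ < ρ) (hb : ‖b‖ < ρ) (hc : ‖c‖ < ρ) (i : Fin n) :
    |Eh (a, c) i - Eh (b, c) i| ≤ K * ‖a - b‖ := by
  have h2 : ∀ x y : State n, ‖x‖ < ρ → ‖y‖ < ρ → ‖(x, y)‖ < ρ := fun x y hx hy => by
    rw [Prod.norm_def]; exact max_lt hx hy
  have h := (norm_le_pi_norm (Eh (a, c) - Eh (b, c)) i).trans (R.lipschitz (h2 _ _ ha hc) (h2 _ _ hb hc))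
  simpa [Prod.norm_mk] using h

namespace IsProfile

variable {u : ℝ → State n} {m : Fin n → SignedMeasure ℝ} {κ : Measure ℝ}
  {hu : BoundedVariationOn u univ} (P : L.IsProfile ε ρ u m κ hu)
  (R : L.RiemannEstimates ε Eh K ρ)

include P R

/-- The estimate for closed right ends passes to the limit from the left, since the mass of `Ioo y
x` vanishes as `y` tends to `x`. -/
theorem abs_sub_apply_Ioo_le {a x : ℝ} (hax : a < x) (i : Fin n) :
    |Eh (u a, Function.leftLim u x) i - m i (Ioo a x)| ≤ 4 * K * κ.real (Ioo a x) ^ 2 := by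
  have := P.finite
  have hK := R.K_nonneg
  refine le_of_forall_pos_le_add fun e he => ?_
  obtain ⟨y', hy', hκ'⟩ := exists_measureReal_Ioo_left_lt κ (e := e / (K + 1)) (by positivity) x
  set y := max y' ((a + x) / 2) with hy
  have hay : a < y := lt_of_lt_of_le (by linarith) (le_max_right _ _)
  have hyx : y < x := max_lt hy' (by linarith)
  have hκ : (K + 1) * κ.real (Ioo y x) ≤ e := by
    have h1 : κ.real (Ioo y x) ≤ e / (K + 1) :=
      (measureReal_mono (Ioo_subset_Ioo_left (le_max_left _ _))).trans hκ'.le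
    rw [le_div_iff₀ (by positivity)] at h1
    linarith
  have h1 := P.abs_sub_apply_Ioc_le R hay.le i
  have h2 := R.abs_sub_le_right (P.norm_lt a) (P.norm_leftLim_lt x) (P.norm_lt y) i
  have h3 : K * ‖Function.leftLim u x - u y‖ ≤ K * κ.real (Ioo y x) := by
    gcongr
    exact P.norm_leftLim_sub_le hyx
  have h4 : m i (Ioo a x) = m i (Ioc a y) + m i (Ioo y x) := by
    rw [← VectorMeasure.of_union _ measurableSet_Ioc measurableSet_Ioo,
      Ioc_union_Ioo_eq_Ioo hay.le hyx]
    exact Set.disjoint_left.2 fun z hz hz' => absurd hz.2 (not_le.2 hz'.1)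
  have h5 := P.abs_apply_le i (Ioo y x)
  have h6 : 4 * K * κ.real (Ioc a y) ^ 2 ≤ 4 * K * κ.real (Ioo a x) ^ 2 := by
    gcongr
    exact measure_ne_top κ _
  rw [h4]
  rw [abs_le] at h1 h2 h5 ⊢
  constructor <;> linarith [h1.1, h1.2, h2.1, h2.2, h5.1, h5.2]

/-- At an atom the agreement is exact, whatever the size of the jump; this is what the definition of
the wave measures by `E` achieves. -/
theorem apply_singleton (x : ℝ) (i : Fin n) : m i {x} = Eh (Function.leftLim u x, u x) i := by
  have hJ : MeasurableSet (jumpSet u) := (countable_jumpSet hu P.right_cont).measurableSet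
  have h1 : continuousPart hu {x} = 0 := by
    rw [continuousPart, VectorMeasure.restrict_apply _ hJ.compl (measurableSet_singleton x)]
    by_cases hx : x ∈ jumpSet u
    · rw [show ({x} : Set ℝ) ∩ (jumpSet u)ᶜ = ∅ by ext z; simp; rintro rfl; exact hx,
        VectorMeasure.empty]
    · rw [inter_eq_left.2 (by simpa using hx), vectorMeasure_singleton_eq hu P.right_cont, sub_eq_zero]
      by_contra h
      exact hx (Ne.symm h)
  rw [P.apply_eq i {x} (measurableSet_singleton x), VectorMeasure.integral_singleton, h1, map_zero,
    zero_add, tsum_subtype ({x} ∩ jumpSet u) fun y => L.strength ε u y i, tsum_eq_single x]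
  · by_cases hx : x ∈ jumpSet u
    · rw [indicator_of_mem (show x ∈ {x} ∩ jumpSet u from ⟨rfl, hx⟩), P.strength_eq R]
    · rw [indicator_of_notMem fun h => hx h.2]
      have : Function.leftLim u x = u x := by
        by_contra h
        exact hx h
      rw [this, R.self _ (P.norm_lt x)]; rfl
  · intro y hy
    exact indicator_of_notMem (fun h => hy h.1) _

/-- The interval is split at the point that may carry a large atom. The atom contributes no error,
and every other error term is a product with one factor at most `θ`: twice `4` from the two sides
and twice `1` from near additivity. -/
theorem abs_sub_apply_Ioc_le_of_split {a x b θ : ℝ} (hax : a < x) (hxb : x ≤ b)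
    (h1 : κ.real (Ioo a x) ≤ θ) (h2 : κ.real (Ioc x b) ≤ θ) (i : Fin n) :
    |Eh (u a, u b) i - m i (Ioc a b)| ≤ 10 * K * θ * κ.real (Ioc a b) := by
  have := P.finite
  have hK := R.K_nonneg
  set k := κ.real (Ioc a b) with hk
  have hθ : 0 ≤ θ := measureReal_nonneg.trans h1
  have m1 : κ.real (Ioo a x) ≤ k :=
    measureReal_mono (show Ioo a x ⊆ Ioc a b from fun z hz => ⟨hz.1, hz.2.le.trans hxb⟩)
  have m2 : κ.real (Ioc x b) ≤ k := measureReal_mono (Ioc_subset_Ioc_left hax.le)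
  have m3 : κ.real (Icc x b) ≤ k :=
    measureReal_mono (show Icc x b ⊆ Ioc a b from fun z hz => ⟨hax.trans_le hz.1, hz.2⟩)
  have m4 : κ.real {x} ≤ k := measureReal_mono (singleton_subset_iff.2 ⟨hax, hxb⟩)
  have hk0 : 0 ≤ k := measureReal_nonneg
  have e1 := P.abs_sub_apply_Ioo_le R hax i
  have e2 := P.abs_sub_apply_Ioc_le R hxb i
  have e3 := P.apply_singleton R x i
  have e4 := R.near_additive (P.norm_lt a) (P.norm_leftLim_lt x) (P.norm_lt b) i
  have e5 := R.near_additive (P.norm_leftLim_lt x) (P.norm_lt x) (P.norm_lt b) i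
  have e6 : m i (Ioc a b) = m i (Ioo a x) + m i {x} + m i (Ioc x b) := by
    rw [← VectorMeasure.of_union _ measurableSet_Ioo (measurableSet_singleton x),
      ← VectorMeasure.of_union _ (measurableSet_Ioo.union (measurableSet_singleton x))
        measurableSet_Ioc]
    · congr 1
      ext z
      simp only [mem_union, mem_Ioo, mem_singleton_iff, mem_Ioc]
      constructor
      · rintro ⟨h, h'⟩
        rcases lt_trichotomy z x with h3 | h3 | h3 <;> simp [*]
      · rintro ((h | rfl) | h)
        exacts [⟨h.1, h.2.le.trans hxb⟩, ⟨hax, hxb⟩, ⟨hax.trans h.1, h.2⟩]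
    · refine Set.disjoint_left.2 fun z hz hz' => ?_
      rcases hz with hz | hz
      · exact absurd hz.2 (not_lt.2 hz'.1.le)
      · exact absurd hz'.1 (by rw [show z = x from hz]; exact lt_irrefl _)
    · exact Set.disjoint_left.2 fun z hz hz' => absurd hz.2 (by
        rw [show z = x from hz']; exact lt_irrefl _)
  have b1 : 4 * K * κ.real (Ioo a x) ^ 2 ≤ 4 * K * (θ * k) := by
    rw [sq]; gcongr
  have b2 : 4 * K * κ.real (Ioc x b) ^ 2 ≤ 4 * K * (θ * k) := by
    rw [sq]; gcongr
  have b4 : K * (‖Function.leftLim u x - u a‖ * ‖u b - Function.leftLim u x‖) ≤ K * (θ * k) := by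
    gcongr
    · exact (P.norm_leftLim_sub_le hax).trans h1
    · exact (P.norm_sub_leftLim_le hxb).trans m3
  have b5 : K * (‖u x - Function.leftLim u x‖ * ‖u b - u x‖) ≤ K * (θ * k) := by
    rw [mul_comm ‖u x - _‖]
    gcongr
    · exact (P.norm_sub_le hxb).trans h2
    · rw [← vectorMeasure_singleton_eq hu P.right_cont]
      exact (P.norm_vectorMeasure_le _).trans m4
  rw [e6, e3]
  rw [abs_le] at e1 e2 e4 e5 ⊢
  constructor <;> linarith [e1.1, e1.2, e2.1, e2.2, e4.1, e4.2, e5.1, e5.2]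

/-- If the splitting point is outside the interval, the whole interval has mass at most `θ` and the
quadratic estimate suffices. -/
theorem abs_sub_apply_Ioc_le_of_fine {a b θ : ℝ} (hab : a ≤ b)
    (hθ : ∃ y, κ.real (Ioc a b ∩ Iio y) ≤ θ ∧ κ.real (Ioc a b ∩ Ioi y) ≤ θ) (i : Fin n) :
    |Eh (u a, u b) i - m i (Ioc a b)| ≤ 10 * K * θ * κ.real (Ioc a b) := by
  have := P.finite
  have hK := R.K_nonneg
  obtain ⟨y, h1, h2⟩ := hθ
  have key : κ.real (Ioc a b) ≤ θ →
      |Eh (u a, u b) i - m i (Ioc a b)| ≤ 10 * K * θ * κ.real (Ioc a b) := fun h => by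
    refine (P.abs_sub_apply_Ioc_le R hab i).trans ?_
    have h0 : 0 ≤ κ.real (Ioc a b) := measureReal_nonneg
    have : κ.real (Ioc a b) * κ.real (Ioc a b) ≤ θ * κ.real (Ioc a b) := by gcongr
    nlinarith [mul_nonneg hK (mul_nonneg (h0.trans h) h0), mul_le_mul_of_nonneg_left this hK]
  rcases le_or_gt y a with hya | hya
  · have hs : Ioc a b ⊆ Ioc a b ∩ Ioi y := fun z hz => ⟨hz, hya.trans_lt hz.1⟩
    exact key ((measureReal_mono hs).trans h2)
  rcases lt_or_ge b y with hyb | hyb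
  · have hs : Ioc a b ⊆ Ioc a b ∩ Iio y := fun z hz => ⟨hz, hz.2.trans_lt hyb⟩
    exact key ((measureReal_mono hs).trans h1)
  refine P.abs_sub_apply_Ioc_le_of_split R hya hyb ?_ ?_ i
  · have hs : Ioo a y ⊆ Ioc a b ∩ Iio y := fun z hz => ⟨⟨hz.1, hz.2.le.trans hyb⟩, hz.2⟩
    exact (measureReal_mono hs).trans h1
  · have hs : Ioc y b ⊆ Ioc a b ∩ Ioi y := fun z hz => ⟨⟨hya.trans hz.1, hz.2⟩, hz.1⟩
    exact (measureReal_mono hs).trans h2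

/-- The unbounded cell is exhausted by bounded ones: both the state at the left end and the mass
beyond it vanish in the limit. -/
theorem abs_sub_apply_Iic_le_of_fine (hbot : Tendsto u atBot (𝓝 0)) {b θ : ℝ}
    (hθ : ∃ y, κ.real (Iic b ∩ Iio y) ≤ θ ∧ κ.real (Iic b ∩ Ioi y) ≤ θ) (i : Fin n) :
    |Eh (0, u b) i - m i (Iic b)| ≤ 10 * K * θ * κ.real (Iic b) := by
  have := P.finite
  have hK := R.K_nonneg
  have hθ0 : 0 ≤ θ := by
    obtain ⟨y, h, -⟩ := hθ
    exact measureReal_nonneg.trans h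
  refine le_of_forall_pos_le_add fun e he => ?_
  obtain ⟨T, hT⟩ := exists_measureReal_Iic_lt κ (e := e / 2) (by positivity)
  have h1 : ∀ᶠ a in atBot, K * ‖u a‖ < e / 2 := by
    have : Tendsto (fun a => K * ‖u a‖) atBot (𝓝 (K * ‖(0 : State n)‖)) := hbot.norm.const_mul K
    rw [norm_zero, mul_zero] at this
    exact this.eventually_lt_const (by positivity)
  obtain ⟨a, ⟨ha1, ha2⟩, ha3⟩ := ((h1.and (eventually_le_atBot T)).and (eventually_le_atBot b)).exists
  have h2 : κ.real (Iic a) ≤ e / 2 := (measureReal_mono (Iic_subset_Iic.2 ha2)).trans hT.le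
  have h3 := P.abs_sub_apply_Ioc_le_of_fine R ha3 (θ := θ) (by
    obtain ⟨y, h, h'⟩ := hθ
    exact ⟨y, (measureReal_mono (inter_subset_inter_left _ Ioc_subset_Iic_self)).trans h,
      (measureReal_mono (inter_subset_inter_left _ Ioc_subset_Iic_self)).trans h'⟩) i
  have h4 := R.abs_sub_le_left (a := 0) (c := u b) (by simpa using R.ρ_pos) (P.norm_lt a) (P.norm_lt b) i
  rw [zero_sub, norm_neg] at h4
  have h5 := P.abs_apply_le i (Iic a)
  have h6 : m i (Iic b) = m i (Iic a) + m i (Ioc a b) := by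
    rw [← VectorMeasure.of_union _ measurableSet_Iic measurableSet_Ioc, Iic_union_Ioc_eq_Iic ha3]
    exact Set.disjoint_left.2 fun z hz hz' => absurd hz'.1 (not_lt.2 hz)
  have h7 : 10 * K * θ * κ.real (Ioc a b) ≤ 10 * K * θ * κ.real (Iic b) := by
    gcongr
    · exact measure_ne_top κ _
    · exact Ioc_subset_Iic_self
  rw [h6]
  rw [abs_le] at h3 h4 h5 ⊢
  constructor <;> linarith [h3.1, h3.2, h4.1, h4.2, h5.1, h5.2]

theorem abs_sub_apply_Ioi_le_of_fine (htop : Tendsto u atTop (𝓝 0)) {a θ : ℝ}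
    (hθ : ∃ y, κ.real (Ioi a ∩ Iio y) ≤ θ ∧ κ.real (Ioi a ∩ Ioi y) ≤ θ) (i : Fin n) :
    |Eh (u a, 0) i - m i (Ioi a)| ≤ 10 * K * θ * κ.real (Ioi a) := by
  have := P.finite
  have hK := R.K_nonneg
  have hθ0 : 0 ≤ θ := by
    obtain ⟨y, h, -⟩ := hθ
    exact measureReal_nonneg.trans h
  refine le_of_forall_pos_le_add fun e he => ?_
  obtain ⟨T, hT⟩ := exists_measureReal_Ici_lt κ (e := e / 2) (by positivity)
  have h1 : ∀ᶠ b in atTop, K * ‖u b‖ < e / 2 := by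
    have : Tendsto (fun a => K * ‖u a‖) atTop (𝓝 (K * ‖(0 : State n)‖)) := htop.norm.const_mul K
    rw [norm_zero, mul_zero] at this
    exact this.eventually_lt_const (by positivity)
  obtain ⟨b, ⟨hb1, hb2⟩, hb3⟩ := ((h1.and (eventually_ge_atTop T)).and (eventually_ge_atTop a)).exists
  have h2 : κ.real (Ioi b) ≤ e / 2 :=
    (measureReal_mono fun z (hz : b < z) => hb2.trans hz.le).trans hT.le
  have h3 := P.abs_sub_apply_Ioc_le_of_fine R hb3 (θ := θ) (by
    obtain ⟨y, h, h'⟩ := hθ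
    exact ⟨y, (measureReal_mono (inter_subset_inter_left _ Ioc_subset_Ioi_self)).trans h,
      (measureReal_mono (inter_subset_inter_left _ Ioc_subset_Ioi_self)).trans h'⟩) i
  have h4 := R.abs_sub_le_right (a := u a) (P.norm_lt a) (b := 0) (by simpa using R.ρ_pos)
    (P.norm_lt b) i
  rw [zero_sub, norm_neg] at h4
  have h5 := P.abs_apply_le i (Ioi b)
  have h6 : m i (Ioi a) = m i (Ioc a b) + m i (Ioi b) := by
    rw [← VectorMeasure.of_union _ measurableSet_Ioc measurableSet_Ioi, Ioc_union_Ioi_eq_Ioi hb3]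
    exact Set.disjoint_left.2 fun z hz hz' => absurd hz.2 (not_le.2 hz')
  have h7 : 10 * K * θ * κ.real (Ioc a b) ≤ 10 * K * θ * κ.real (Ioi a) := by
    gcongr
    · exact measure_ne_top κ _
    · exact Ioc_subset_Ioi_self
  rw [h6]
  rw [abs_le] at h3 h4 h5 ⊢
  constructor <;> linarith [h3.1, h3.2, h4.1, h4.2, h5.1, h5.2]

end IsProfile

end ConservationLaw

/-! ### Interaction potentials of cells against the measure `ρ`. -/

noncomputable section

namespace ConservationLaw

variable {n : ℕ} {L : ConservationLaw n}

open Classical in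
variable (L) in
/-- The contribution of the `i`-th and `j`-th wave measures to `rho`. -/
def rhoPair (m : Fin n → SignedMeasure ℝ) (i j : Fin n) : Measure (ℝ × ℝ) :=
  (if j < i then (m i).totalVariation.prod (m j).totalVariation else 0) +
  if i = j then if L.GenuinelyNonlinear i then
    ((m i).toJordanDecomposition.negPart.prod (m i).toJordanDecomposition.negPart +
      (m i).toJordanDecomposition.posPart.prod (m i).toJordanDecomposition.negPart +
      (m i).toJordanDecomposition.negPart.prod (m i).toJordanDecomposition.posPart) else 0 else 0

theorem rho_eq_sum (m : Fin n → SignedMeasure ℝ) : L.rho m = ∑ i, ∑ j, L.rhoPair m i j := by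
  unfold rho rhoPair
  rw [Finset.sum_filter, Finset.sum_filter, Fintype.sum_prod_type, ← Finset.sum_add_distrib]
  refine Finset.sum_congr rfl fun i _ => ?_
  rw [Finset.sum_add_distrib, Finset.sum_ite_eq, if_pos (Finset.mem_univ i)]

instance (m : Fin n → SignedMeasure ℝ) (i j : Fin n) : IsFiniteMeasure (L.rhoPair m i j) := by
  unfold rhoPair
  split_ifs <;> infer_instance

theorem rho_real (m : Fin n → SignedMeasure ℝ) (s : Set (ℝ × ℝ)) :
    (L.rho m).real s = ∑ i, ∑ j, (L.rhoPair m i j).real s := by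
  rw [rho_eq_sum, measureReal_def, Measure.coe_finsetSum, Finset.sum_apply, ENNReal.toReal_sum]
  · refine Finset.sum_congr rfl fun i _ => ?_
    rw [Measure.coe_finsetSum, Finset.sum_apply, ENNReal.toReal_sum fun j _ => measure_ne_top _ _]
    rfl
  · intro i _
    rw [Measure.coe_finsetSum, Finset.sum_apply]
    exact ENNReal.sum_ne_top.2 fun j _ => measure_ne_top _ _

theorem totalVariation_real (m : SignedMeasure ℝ) (s : Set ℝ) : m.totalVariation.real s =
    m.toJordanDecomposition.posPart.real s + m.toJordanDecomposition.negPart.real s :=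
  measureReal_add_apply

/-- Here `p` and `q` stand for the positive and negative mass of a cell, and `min p q` measures the
cancellation within it. -/
theorem abs_abs_sub_add_le {s p q : ℝ} (hp : 0 ≤ p) (hq : 0 ≤ q) :
    |(|s| - (p + q))| ≤ 2 * (|s - (p - q)| + min p q) := by
  have h1 : |p - q| = p + q - 2 * min p q := by
    rcases le_total p q with h | h
    · rw [min_eq_left h, abs_of_nonpos (by linarith)]; ring
    · rw [min_eq_right h, abs_of_nonneg (by linarith)]; ring
  have h2 := abs_abs_sub_abs_le s (p - q)
  have h3 : 0 ≤ min p q := le_min hp hq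
  rw [h1] at h2
  have h4 := abs_nonneg (s - (p - q))
  rw [abs_le] at h2 ⊢
  constructor <;> linarith [h2.1, h2.2]

theorem abs_max_sub_le {s p q : ℝ} (hp : 0 ≤ p) (hq : 0 ≤ q) :
    |max s 0 - p| ≤ |s - (p - q)| + min p q := by
  have h1 : max (p - q) 0 = p - min p q := by
    rcases le_total p q with h | h
    · rw [min_eq_left h, max_eq_right (by linarith)]; ring
    · rw [min_eq_right h, max_eq_left (by linarith)]
  have h2 := abs_max_sub_max_le_abs s (p - q) 0
  have h3 : 0 ≤ min p q := le_min hp hq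
  rw [h1] at h2
  rw [abs_le] at h2 ⊢
  constructor <;> linarith [h2.1, h2.2]

/-- Comparison of the interaction potential of two waves with the one of the positive and negative
parts of two cells. -/
theorem wavePotential_self_sub_le {i : Fin n} (h : L.GenuinelyNonlinear i) {s t p q p' q' : ℝ}
    (hp : 0 ≤ p) (hq : 0 ≤ q) (hp' : 0 ≤ p') (hq' : 0 ≤ q') :
    |L.wavePotential i i s t - (q * q' + p * q' + q * p')| ≤
      2 * (|s - (p - q)| + min p q) * |t| + 2 * (p + q) * (|t - (p' - q')| + min p' q') := by
  have e1 := abs_max_sub_le (s := s) hp hq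
  have e2 := abs_max_sub_le (s := -s) hq hp
  have e3 := abs_max_sub_le (s := t) hp' hq'
  have e4 := abs_max_sub_le (s := -t) hq' hp'
  rw [show -s - (q - p) = -(s - (p - q)) by ring, abs_neg, min_comm] at e2
  rw [show -t - (q' - p') = -(t - (p' - q')) by ring, abs_neg, min_comm] at e4
  have hab : ∀ x : ℝ, |x| = max x 0 + max (-x) 0 := fun x => by
    rcases le_total 0 x with h | h <;> simp [h, abs_of_nonneg, abs_of_nonpos]
  set e := |s - (p - q)| + min p q
  set e' := |t - (p' - q')| + min p' q'
  rw [wavePotential_self h, abs_mul, hab s, hab t]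
  set a := max s 0
  set b := max (-s) 0
  set a' := max t 0
  set b' := max (-t) 0
  have ha' : 0 ≤ a' := le_max_right _ _
  have hb' : 0 ≤ b' := le_max_right _ _
  have he : 0 ≤ e := (abs_nonneg _).trans e1
  have he' : 0 ≤ e' := (abs_nonneg _).trans e3
  have key : (a + b) * (a' + b') - a * a' - (q * q' + p * q' + q * p') =
      (a - p) * b' + (b - q) * (a' + b') + (p + q) * (b' - q') + q * (a' - p') := by ring
  rw [key]
  have f1 : |(a - p) * b'| ≤ e * b' := by rw [abs_mul, abs_of_nonneg hb']; gcongr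
  have f2 : |(b - q) * (a' + b')| ≤ e * (a' + b') := by
    rw [abs_mul, abs_of_nonneg (add_nonneg ha' hb')]; gcongr
  have f3 : |(p + q) * (b' - q')| ≤ (p + q) * e' := by
    rw [abs_mul, abs_of_nonneg (add_nonneg hp hq)]; gcongr
  have f4 : |q * (a' - p')| ≤ q * e' := by rw [abs_mul, abs_of_nonneg hq]; gcongr
  have g1 : 0 ≤ e * a' := mul_nonneg he ha'
  have g2 : 0 ≤ p * e' := mul_nonneg hp he'
  refine (abs_add_le _ _).trans ?_
  have := (abs_add_le ((a - p) * b' + (b - q) * (a' + b')) ((p + q) * (b' - q')))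
  have := (abs_add_le ((a - p) * b') ((b - q) * (a' + b')))
  linarith

theorem abs_mul_sub_le {s t p q p' q' : ℝ} (hp : 0 ≤ p) (hq : 0 ≤ q) (hp' : 0 ≤ p') (hq' : 0 ≤ q') :
    |(|s * t| - (p + q) * (p' + q'))| ≤
      2 * (|s - (p - q)| + min p q) * |t| + 2 * (p + q) * (|t - (p' - q')| + min p' q') := by
  have e1 := abs_abs_sub_add_le (s := s) hp hq
  have e2 := abs_abs_sub_add_le (s := t) hp' hq'
  have key : |s * t| - (p + q) * (p' + q') =
      (|s| - (p + q)) * |t| + (p + q) * (|t| - (p' + q')) := by rw [abs_mul]; ring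
  rw [key]
  refine (abs_add_le _ _).trans ?_
  rw [abs_mul, abs_mul, abs_abs, abs_of_nonneg (add_nonneg hp hq)]
  have h1 := mul_le_mul_of_nonneg_right e1 (abs_nonneg t)
  have h2 := mul_le_mul_of_nonneg_left e2 (add_nonneg hp hq)
  linarith

theorem sum_sum_ite_mul_le {F : Finset ℝ} {e t a e' : ℝ → ℝ} (he : ∀ x, 0 ≤ e x) (ht : ∀ x, 0 ≤ t x)
    (ha : ∀ x, 0 ≤ a x) (he' : ∀ x, 0 ≤ e' x) :
    ∑ x ∈ F, ∑ y ∈ F, (if x < y then 2 * e x * t y + 2 * a x * e' y else 0) ≤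
      2 * (∑ x ∈ F, e x) * (∑ x ∈ F, t x) + 2 * (∑ x ∈ F, a x) * ∑ x ∈ F, e' x := by
  have : ∀ x ∈ F, ∀ y ∈ F, (if x < y then 2 * e x * t y + 2 * a x * e' y else 0) ≤
      2 * (e x * t y) + 2 * (a x * e' y) := fun x _ y _ => by
    have h1 := mul_nonneg (he x) (ht y)
    have h2 := mul_nonneg (ha x) (he' y)
    split_ifs <;> linarith
  refine (Finset.sum_le_sum fun x hx => Finset.sum_le_sum (this x hx)).trans (le_of_eq ?_)
  simp only [Finset.sum_add_distrib, ← Finset.mul_sum, mul_assoc, Finset.sum_mul_sum]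

section Partition

variable {F : Finset ℝ} {c : ℝ → ℝ} (hc : Measurable c) (hcF : ∀ x, c x ∈ F) (hmono : Monotone c)
  {m : Fin n → SignedMeasure ℝ} {κ : Measure ℝ} [IsFiniteMeasure κ]
  (hm : ∀ i, (m i).totalVariation ≤ κ) {θ η : ℝ} {σ : ℝ → Fin n → ℝ}
  (hσ : ∀ i, ∑ x ∈ F, (|σ x i - m i (c ⁻¹' {x})| +
    min ((m i).toJordanDecomposition.posPart.real (c ⁻¹' {x}))
      ((m i).toJordanDecomposition.negPart.real (c ⁻¹' {x}))) ≤ η)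

include hc hcF hσ

theorem abs_sum_abs_sub_totalVariation_le (i : Fin n) :
    |∑ x ∈ F, |σ x i| - (m i).totalVariation.real univ| ≤ 2 * η := by
  have h1 := sum_measureReal_fiber hc hcF (α := (m i).totalVariation) univ
  simp only [inter_univ] at h1
  rw [← h1, ← Finset.sum_sub_distrib]
  refine (Finset.abs_sum_le_sum_abs _ _).trans ?_
  refine le_trans ?_ (mul_le_mul_of_nonneg_left (hσ i) zero_le_two)
  rw [Finset.mul_sum]
  refine Finset.sum_le_sum fun x _ => ?_
  rw [totalVariation_real, (m i).apply_eq_posPart_real_sub_negPart_real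
    (hc (measurableSet_singleton x))]
  exact abs_abs_sub_add_le measureReal_nonneg measureReal_nonneg

include hm hmono

/-- The potential of the strengths is compared with products of cell masses, with an error linear in
`η`, and these products over pairs of distinct cells are compared with the product measure above the
diagonal. The constant `6` covers up to three product measures, each with error `2 * θ * κ(ℝ)`. -/
theorem abs_sum_wavePotential_sub_le
    (hθ : ∀ x ∈ F, ∃ y, κ.real (c ⁻¹' {x} ∩ Iio y) ≤ θ ∧ κ.real (c ⁻¹' {x} ∩ Ioi y) ≤ θ)
    (i j : Fin n) :
    |∑ x ∈ F, ∑ y ∈ F, (if x < y then L.wavePotential i j (σ x i) (σ y j) else 0) -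
      (L.rhoPair m i j).real {p | p.1 < p.2}| ≤
      2 * η * (2 * κ.real univ + 2 * η) + 6 * θ * κ.real univ := by
  set k := κ.real univ with hk
  have hη0 : 0 ≤ η := (Finset.sum_nonneg fun x _ => add_nonneg (abs_nonneg _)
    (le_min measureReal_nonneg measureReal_nonneg)).trans (hσ i)
  have hk0 : 0 ≤ k := measureReal_nonneg
  have hcell : ∀ x, MeasurableSet (c ⁻¹' {x}) := fun x => hc (measurableSet_singleton x)
  have hpos : ∀ i, (m i).toJordanDecomposition.posPart ≤ κ := fun i =>
    (Measure.le_add_right le_rfl).trans (hm i)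
  have hneg : ∀ i, (m i).toJordanDecomposition.negPart ≤ κ := fun i =>
    (Measure.le_add_left le_rfl).trans (hm i)
  have hreal : ∀ {α : Measure ℝ}, α ≤ κ → ∀ s, α.real s ≤ κ.real s := fun hα s =>
    ENNReal.toReal_mono (measure_ne_top _ _) (hα s)
  have hθ0 : 0 ≤ θ * k := by
    rcases F.eq_empty_or_nonempty with rfl | ⟨x, hx⟩
    · simpa using hcF 0
    · obtain ⟨y, h, -⟩ := hθ x hx
      exact mul_nonneg (measureReal_nonneg.trans h) hk0
  have hθ' : ∀ {α β : Measure ℝ} [IsFiniteMeasure α] [IsFiniteMeasure β], α ≤ κ → β ≤ κ →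
      |(α.prod β).real {p | p.1 < p.2} -
        ∑ x ∈ F, ∑ y ∈ F, if x < y then α.real (c ⁻¹' {x}) * β.real (c ⁻¹' {y}) else 0| ≤
        2 * (θ * k) := by
    intro α β _ _ hα hβ
    refine (abs_measureReal_prod_lt_sub_le hc hcF hmono (θ := θ) fun x hx => ?_).trans ?_
    · obtain ⟨y, h1, h2⟩ := hθ x hx
      exact ⟨y, (hreal hα _).trans h1, (hreal hβ _).trans h2⟩
    · rcases F.eq_empty_or_nonempty with rfl | ⟨x, hx⟩
      · simpa using hcF 0
      · obtain ⟨y, h, -⟩ := hθ x hx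
        have := mul_le_mul_of_nonneg_left (add_le_add (hreal hα univ) (hreal hβ univ))
          (measureReal_nonneg.trans h)
        linarith
  set p : Fin n → ℝ → ℝ := fun i x => (m i).toJordanDecomposition.posPart.real (c ⁻¹' {x}) with hp
  set q : Fin n → ℝ → ℝ := fun i x => (m i).toJordanDecomposition.negPart.real (c ⁻¹' {x}) with hq
  have hp0 : ∀ i x, 0 ≤ p i x := fun i x => measureReal_nonneg
  have hq0 : ∀ i x, 0 ≤ q i x := fun i x => measureReal_nonneg
  have hσ' : ∀ i, ∑ x ∈ F, (|σ x i - (p i x - q i x)| + min (p i x) (q i x)) ≤ η := fun i => by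
    refine le_trans (le_of_eq (Finset.sum_congr rfl fun x _ => ?_)) (hσ i)
    rw [(m i).apply_eq_posPart_real_sub_negPart_real (hcell x)]
  have hTV : ∀ i, ∑ x ∈ F, (p i x + q i x) ≤ k := fun i => by
    have h1 := sum_measureReal_fiber hc hcF (α := (m i).totalVariation) univ
    simp only [inter_univ, totalVariation_real] at h1
    rw [h1, ← totalVariation_real]
    exact hreal (hm i) univ
  have hT : ∀ i, ∑ x ∈ F, |σ x i| ≤ k + 2 * η := fun i => by
    have h1 := abs_sum_abs_sub_totalVariation_le hc hcF hσ i
    have h2 := hreal (hm i) univ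
    linarith [(abs_le.1 h1).2]
  have hsum : ∑ x ∈ F, ∑ y ∈ F, (if x < y then
      2 * (|σ x i - (p i x - q i x)| + min (p i x) (q i x)) * |σ y j| +
        2 * (p i x + q i x) * (|σ y j - (p j y - q j y)| + min (p j y) (q j y)) else 0) ≤
      2 * η * (2 * k + 2 * η) := by
    refine (sum_sum_ite_mul_le (fun x => add_nonneg (abs_nonneg _) (le_min (hp0 i x) (hq0 i x)))
      (fun x => abs_nonneg _) (fun x => add_nonneg (hp0 i x) (hq0 i x))
      (fun x => add_nonneg (abs_nonneg _) (le_min (hp0 j x) (hq0 j x)))).trans ?_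
    have h1 : 2 * (∑ x ∈ F, (|σ x i - (p i x - q i x)| + min (p i x) (q i x))) *
        ∑ x ∈ F, |σ x j| ≤ 2 * η * (k + 2 * η) := by
      gcongr
      · exact hσ' i
      · exact hT j
    have h2 : 2 * (∑ x ∈ F, (p i x + q i x)) *
        ∑ x ∈ F, (|σ x j - (p j x - q j x)| + min (p j x) (q j x)) ≤ 2 * k * η := by
      gcongr
      · exact hTV i
      · exact hσ' j
    linarith
  have hdiff : ∀ W : ℝ → ℝ → ℝ,
      (∀ x y, |L.wavePotential i j (σ x i) (σ y j) - W x y| ≤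
        2 * (|σ x i - (p i x - q i x)| + min (p i x) (q i x)) * |σ y j| +
        2 * (p i x + q i x) * (|σ y j - (p j y - q j y)| + min (p j y) (q j y))) →
      |∑ x ∈ F, ∑ y ∈ F, (if x < y then L.wavePotential i j (σ x i) (σ y j) else 0) -
        ∑ x ∈ F, ∑ y ∈ F, (if x < y then W x y else 0)| ≤ 2 * η * (2 * k + 2 * η) := by
    intro W hW
    refine le_trans ?_ hsum
    simp only [← Finset.sum_sub_distrib]
    refine (Finset.abs_sum_le_sum_abs _ _).trans (Finset.sum_le_sum fun x _ => ?_)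
    refine (Finset.abs_sum_le_sum_abs _ _).trans (Finset.sum_le_sum fun y _ => ?_)
    split_ifs
    · exact hW x y
    · simp
  by_cases h1 : j < i
  · have hr : L.rhoPair m i j = (m i).totalVariation.prod (m j).totalVariation := by
      rw [rhoPair, if_pos h1, if_neg h1.ne', add_zero]
    have a1 := hdiff (fun x y => (p i x + q i x) * (p j y + q j y)) fun x y => by
      rw [wavePotential_of_lt h1]
      exact abs_mul_sub_le (hp0 i x) (hq0 i x) (hp0 j y) (hq0 j y)
    have a2 := hθ' (hm i) (hm j)
    simp only [totalVariation_real] at a2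
    rw [hr]
    rw [abs_le] at a1 a2 ⊢
    constructor <;> linarith [a1.1, a1.2, a2.1, a2.2]
  by_cases h2 : i = j ∧ L.GenuinelyNonlinear i
  · obtain ⟨rfl, hG⟩ := h2
    have hr : (L.rhoPair m i i).real {p | p.1 < p.2} =
        ((m i).toJordanDecomposition.negPart.prod
          (m i).toJordanDecomposition.negPart).real {p | p.1 < p.2} +
        ((m i).toJordanDecomposition.posPart.prod
          (m i).toJordanDecomposition.negPart).real {p | p.1 < p.2} +
        ((m i).toJordanDecomposition.negPart.prod
          (m i).toJordanDecomposition.posPart).real {p | p.1 < p.2} := by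
      rw [rhoPair, if_neg (lt_irrefl _), if_pos rfl, if_pos hG, zero_add, measureReal_add_apply,
        measureReal_add_apply]
    have a1 := hdiff (fun x y => q i x * q i y + p i x * q i y + q i x * p i y) fun x y =>
      wavePotential_self_sub_le hG (hp0 i x) (hq0 i x) (hp0 i y) (hq0 i y)
    have a2 := hθ' (hneg i) (hneg i)
    have a3 := hθ' (hpos i) (hneg i)
    have a4 := hθ' (hneg i) (hpos i)
    have e : ∑ x ∈ F, ∑ y ∈ F, (if x < y then q i x * q i y + p i x * q i y + q i x * p i y else 0) =
        ∑ x ∈ F, ∑ y ∈ F, (if x < y then q i x * q i y else 0) +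
        ∑ x ∈ F, ∑ y ∈ F, (if x < y then p i x * q i y else 0) +
        ∑ x ∈ F, ∑ y ∈ F, (if x < y then q i x * p i y else 0) := by
      simp only [← Finset.sum_add_distrib]
      refine Finset.sum_congr rfl fun x _ => Finset.sum_congr rfl fun y _ => ?_
      split_ifs <;> ring
    rw [e] at a1
    rw [hr]
    rw [abs_le] at a1 a2 a3 a4 ⊢
    constructor <;> linarith [a1.1, a1.2, a2.1, a2.2, a3.1, a3.2, a4.1, a4.2]
  · have hr : L.rhoPair m i j = 0 := by
      rw [rhoPair, if_neg h1, zero_add]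
      split_ifs with h3 h4
      · exact absurd ⟨h3, h4⟩ h2
      · rfl
      · rfl
    rw [hr]
    simp only [wavePotential_eq_zero h1 h2, ite_self, Finset.sum_const_zero, measureReal_zero_apply,
      sub_zero, abs_zero]
    nlinarith [mul_nonneg hη0 hk0, mul_nonneg hη0 hη0]

theorem abs_pairSum_sub_rho_le
    (hθ : ∀ x ∈ F, ∃ y, κ.real (c ⁻¹' {x} ∩ Iio y) ≤ θ ∧ κ.real (c ⁻¹' {x} ∩ Ioi y) ≤ θ) :
    |L.pairSum F σ - (L.rho m).real {p | p.1 < p.2}| ≤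
      n * (n * (2 * η * (2 * κ.real univ + 2 * η) + 6 * θ * κ.real univ)) := by
  have e : L.pairSum F σ = ∑ i, ∑ j,
      ∑ x ∈ F, ∑ y ∈ F, (if x < y then L.wavePotential i j (σ x i) (σ y j) else 0) := by
    have h1 : ∀ x y, (if x < y then L.fanPotential (σ x) (σ y) else 0) =
        ∑ i, ∑ j, (if x < y then L.wavePotential i j (σ x i) (σ y j) else 0) := fun x y => by
      split_ifs
      · rfl
      · simp
    simp only [pairSum, h1]
    calc _ = ∑ x ∈ F, ∑ i, ∑ y ∈ F, ∑ j,
          (if x < y then L.wavePotential i j (σ x i) (σ y j) else 0) :=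
          Finset.sum_congr rfl fun x _ => Finset.sum_comm
      _ = ∑ i, ∑ x ∈ F, ∑ y ∈ F, ∑ j,
          (if x < y then L.wavePotential i j (σ x i) (σ y j) else 0) := Finset.sum_comm
      _ = ∑ i, ∑ x ∈ F, ∑ j, ∑ y ∈ F,
          (if x < y then L.wavePotential i j (σ x i) (σ y j) else 0) :=
          Finset.sum_congr rfl fun i _ => Finset.sum_congr rfl fun x _ => Finset.sum_comm
      _ = _ := Finset.sum_congr rfl fun i _ => Finset.sum_comm
  rw [e, rho_real, ← Finset.sum_sub_distrib]
  refine (Finset.abs_sum_le_sum_abs _ _).trans ?_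
  have key : ∀ i ∈ (Finset.univ : Finset (Fin n)),
      |∑ j, ∑ x ∈ F, ∑ y ∈ F, (if x < y then L.wavePotential i j (σ x i) (σ y j) else 0) -
        ∑ j, (L.rhoPair m i j).real {p | p.1 < p.2}| ≤
      n * (2 * η * (2 * κ.real univ + 2 * η) + 6 * θ * κ.real univ) := fun i _ => by
    rw [← Finset.sum_sub_distrib]
    refine (Finset.abs_sum_le_sum_abs _ _).trans ?_
    refine (Finset.sum_le_card_nsmul _ _ _ fun j _ =>
      abs_sum_wavePotential_sub_le hc hcF hmono hm hσ hθ i j).trans ?_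
    rw [Finset.card_univ, Fintype.card_fin, nsmul_eq_mul]
  refine (Finset.sum_le_card_nsmul _ _ _ key).trans ?_
  rw [Finset.card_univ, Fintype.card_fin, nsmul_eq_mul]

end Partition

end ConservationLaw

end

/-! ### Approximation of a profile by its samples on fine grids. -/

namespace ConservationLaw

variable {n : ℕ} {L : ConservationLaw n} {ε K ρ : ℝ} {Eh : State n × State n → Fin n → ℝ}

/-- The cells are a left half-line, bounded intervals and a right half-line. The default value `0`
before the first point and the value `0` at `M` match the limits of `u` at infinity. -/
theorem IsProfile.abs_fanAt_sub_le {u : ℝ → State n} {m : Fin n → SignedMeasure ℝ} {κ : Measure ℝ}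
    {hu : BoundedVariationOn u univ} (P : L.IsProfile ε ρ u m κ hu)
    (R : L.RiemannEstimates ε Eh K ρ) (hbot : Tendsto u atBot (𝓝 0)) (htop : Tendsto u atTop (𝓝 0))
    {F : Finset ℝ} (hne : F.Nonempty) {M : ℝ} (hM : ∀ y ∈ F, y < M) {θ : ℝ} {x : ℝ}
    (hx : x ∈ insert M F) (hθ : ∃ y, κ.real (label F M ⁻¹' {x} ∩ Iio y) ≤ θ ∧
      κ.real (label F M ⁻¹' {x} ∩ Ioi y) ≤ θ) (i : Fin n) :
    |fanAt Eh (insert M F) (Function.update u M 0) x i - m i (label F M ⁻¹' {x})| ≤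
      10 * K * θ * κ.real (label F M ⁻¹' {x}) := by
  have hupd : ∀ y ∈ F, Function.update u M 0 y = u y := fun y hy =>
    Function.update_of_ne (hM y hy).ne _ _
  rcases Finset.mem_insert.1 hx with rfl | hxF
  · obtain ⟨p, hp, hp'⟩ := exists_isLast hne
    have e1 : label F x ⁻¹' {x} = Ioi p := by
      ext z
      rw [mem_preimage, mem_singleton_iff, label_eq_self_iff hM]
      exact ⟨fun h => h p hp, fun h y hy => (hp' y hy).trans_lt h⟩
    rw [fanAt_insert_self hM, lastVal_eq hp hp', hupd p hp, Function.update_self, e1]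
    rw [e1] at hθ
    exact P.abs_sub_apply_Ioi_le_of_fine R htop hθ i
  · rw [fanAt, leftState_insert (hM x hxF).le, hupd x hxF]
    rcases (F.filter (· < x)).eq_empty_or_nonempty with h | h
    · have e1 : label F M ⁻¹' {x} = Iic x := by
        ext z
        rw [mem_preimage, mem_singleton_iff, label_eq_iff hM hxF]
        refine ⟨fun h => h.1, fun hz => ⟨hz, fun y hy hyx => ?_⟩⟩
        have : y ∈ F.filter (· < x) := Finset.mem_filter.2 ⟨hy, hyx⟩
        simp [h] at this
      rw [leftState, h, lastVal_empty, e1]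
      rw [e1] at hθ
      exact P.abs_sub_apply_Iic_le_of_fine R hbot hθ i
    · obtain ⟨p, hp, hp'⟩ := exists_isLast h
      obtain ⟨hpF, hpx⟩ := Finset.mem_filter.1 hp
      have e1 : label F M ⁻¹' {x} = Ioc p x := by
        ext z
        rw [mem_preimage, mem_singleton_iff, label_eq_iff hM hxF]
        exact ⟨fun h => ⟨h.2 p hpF hpx, h.1⟩, fun h => ⟨h.2, fun y hy hyx =>
          (hp' y (Finset.mem_filter.2 ⟨hy, hyx⟩)).trans_lt h.1⟩⟩
      rw [leftState, lastVal_eq hp hp', hupd p hpF, e1]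
      rw [e1] at hθ
      exact P.abs_sub_apply_Ioc_le_of_fine R hpx.le hθ i

end ConservationLaw

/-- The two Jordan parts live on complementary sets, and inner regularity provides compact sets
carrying almost all their masses. Being disjoint, these have positive distance, so a small cell
meets at most one of them. -/
theorem MeasureTheory.SignedMeasure.exists_isCompact_separating (m : SignedMeasure ℝ) {η : ℝ}
    (hη : 0 < η) : ∃ K₁ K₂ : Set ℝ, IsCompact K₁ ∧ IsCompact K₂ ∧ Disjoint K₁ K₂ ∧
      m.toJordanDecomposition.posPart.real K₁ᶜ ≤ η ∧
      m.toJordanDecomposition.negPart.real K₂ᶜ ≤ η := by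
  obtain ⟨S, hS, h1, h2⟩ := m.toJordanDecomposition.mutuallySingular
  have key : ∀ (α : Measure ℝ) [IsFiniteMeasure α] (S : Set ℝ), MeasurableSet S → α Sᶜ = 0 →
      ∃ C ⊆ S, IsCompact C ∧ α.real Cᶜ ≤ η := by
    intro α _ S hS h0
    obtain ⟨C, hCS, hC, hlt⟩ := hS.exists_isCompact_sdiff_lt (μ := α) (measure_ne_top _ _)
      (ENNReal.ofReal_pos.2 hη).ne'
    refine ⟨C, hCS, hC, ENNReal.toReal_le_of_le_ofReal hη.le ?_⟩
    have : Cᶜ ⊆ (S \ C) ∪ Sᶜ := fun z hz => by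
      by_cases h : z ∈ S
      exacts [Or.inl ⟨h, hz⟩, Or.inr h]
    refine (measure_mono this).trans ((measure_union_le _ _).trans ?_)
    rw [h0, add_zero]
    exact hlt.le
  obtain ⟨K₁, hs1, hc1, hb1⟩ := key m.toJordanDecomposition.posPart Sᶜ hS.compl (by rwa [compl_compl])
  obtain ⟨K₂, hs2, hc2, hb2⟩ := key m.toJordanDecomposition.negPart S hS h2
  exact ⟨K₁, K₂, hc1, hc2, disjoint_compl_left.mono hs1 hs2, hb1, hb2⟩

/-- On fine cells `κ` is concentrated near one point and the measures `m i` do not change sign. -/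
theorem exists_forall_cell_fine {n : ℕ} (m : Fin n → SignedMeasure ℝ) (κ : Measure ℝ)
    [IsFiniteMeasure κ] {θ : ℝ} (hθ : 0 < θ) :
    ∃ T₀ : ℝ, ∀ T, T₀ ≤ T → ∃ η₀ > 0, ∀ η, 0 < η → η ≤ η₀ → ∀ F : Finset ℝ,
      (∀ y ∈ F, -T - η < y ∧ y < T) → (∀ x ∈ Icc (-T) T, ∃ y ∈ F, x - η < y ∧ y < x) →
      ∀ M, T ≤ M →
      (∀ x ∈ insert M F, ∃ y, κ.real (label F M ⁻¹' {x} ∩ Iio y) ≤ θ ∧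
        κ.real (label F M ⁻¹' {x} ∩ Ioi y) ≤ θ) ∧
      ∀ i, ∑ x ∈ insert M F, min ((m i).toJordanDecomposition.posPart.real (label F M ⁻¹' {x}))
        ((m i).toJordanDecomposition.negPart.real (label F M ⁻¹' {x})) ≤ 2 * θ := by
  choose K₁ K₂ hc1 hc2 hd hb1 hb2 using fun i => (m i).exists_isCompact_separating hθ
  -- Both requirements pass to subsets and hold near every point and near infinity, so all cells of
  -- a fine grid inherit them. Near an atom the splitting point is the atom itself.
  set Good : Set ℝ → Prop := fun s => (∃ y, κ.real (s ∩ Iio y) ≤ θ ∧ κ.real (s ∩ Ioi y) ≤ θ) ∧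
    ∀ i, Disjoint s (K₁ i) ∨ Disjoint s (K₂ i) with hGood
  have g1 : ∀ s t, s ⊆ t → Good t → Good s := by
    rintro s t hst ⟨⟨y, h1, h2⟩, h3⟩
    exact ⟨⟨y, (measureReal_mono (inter_subset_inter_left _ hst)).trans h1,
      (measureReal_mono (inter_subset_inter_left _ hst)).trans h2⟩,
      fun i => (h3 i).imp (fun h => h.mono_left hst) fun h => h.mono_left hst⟩
  have g2 : ∀ x, ∃ U ∈ 𝓝 x, Good U := by
    intro x
    obtain ⟨y₁, hy₁, h1⟩ := exists_measureReal_Ioo_left_lt κ hθ x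
    obtain ⟨y₂, hy₂, h2⟩ := exists_measureReal_Ioo_right_lt κ hθ x
    have h3 : ∀ i, ∃ U ∈ 𝓝 x, Disjoint U (K₁ i) ∨ Disjoint U (K₂ i) := fun i => by
      by_cases hx : x ∈ K₁ i
      · exact ⟨(K₂ i)ᶜ, (hc2 i).isClosed.isOpen_compl.mem_nhds (Set.disjoint_left.1 (hd i) hx),
          Or.inr disjoint_compl_left⟩
      · exact ⟨(K₁ i)ᶜ, (hc1 i).isClosed.isOpen_compl.mem_nhds hx, Or.inl disjoint_compl_left⟩
    choose U hU hdU using h3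
    refine ⟨Ioo y₁ y₂ ∩ ⋂ i, U i, inter_mem (Ioo_mem_nhds hy₁ hy₂) (iInter_mem.2 hU),
      ⟨x, ?_, ?_⟩, fun i => ?_⟩
    · have hs : (Ioo y₁ y₂ ∩ ⋂ i, U i) ∩ Iio x ⊆ Ioo y₁ x := fun z hz => ⟨hz.1.1.1, hz.2⟩
      exact (measureReal_mono hs).trans h1.le
    · have hs : (Ioo y₁ y₂ ∩ ⋂ i, U i) ∩ Ioi x ⊆ Ioo x y₂ := fun z hz => ⟨hz.2, hz.1.1.2⟩
      exact (measureReal_mono hs).trans h2.le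
    · have hs : (Ioo y₁ y₂ ∩ ⋂ i, U i) ⊆ U i := inter_subset_right.trans (iInter_subset _ i)
      exact (hdU i).imp (fun h => h.mono_left hs) fun h => h.mono_left hs
  have g3 : ∃ T, Good (Iic T) := by
    obtain ⟨T, hT⟩ := exists_measureReal_Iic_lt κ hθ
    choose b hb using fun i => (hc1 i).bddBelow
    have h1 : ∀ᶠ S in atBot, S ≤ T ∧ ∀ i, S < b i :=
      (eventually_le_atBot T).and (eventually_all.2 fun i => eventually_lt_atBot (b i))
    obtain ⟨S, hS, hSb⟩ := h1.exists
    have hs : κ.real (Iic S) ≤ θ := (measureReal_mono (Iic_subset_Iic.2 hS)).trans hT.le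
    exact ⟨S, ⟨S, (measureReal_mono inter_subset_left).trans hs,
      (measureReal_mono inter_subset_left).trans hs⟩, fun i => Or.inl (Set.disjoint_left.2
        fun z hz hz' => absurd (hb i hz') (not_le.2 (lt_of_le_of_lt hz (hSb i))))⟩
  have g4 : ∃ T, Good (Ici T) := by
    obtain ⟨T, hT⟩ := exists_measureReal_Ici_lt κ hθ
    choose b hb using fun i => (hc1 i).bddAbove
    have h1 : ∀ᶠ S in atTop, T ≤ S ∧ ∀ i, b i < S :=
      (eventually_ge_atTop T).and (eventually_all.2 fun i => eventually_gt_atTop (b i))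
    obtain ⟨S, hS, hSb⟩ := h1.exists
    have hs : κ.real (Ici S) ≤ θ := (measureReal_mono (Ici_subset_Ici.2 hS)).trans hT.le
    exact ⟨S, ⟨S, (measureReal_mono inter_subset_left).trans hs,
      (measureReal_mono inter_subset_left).trans hs⟩, fun i => Or.inl (Set.disjoint_left.2
        fun z hz hz' => absurd (hb i hz') (not_le.2 (lt_of_lt_of_le (hSb i) hz)))⟩
  obtain ⟨T₀, hT₀⟩ := exists_forall_cell g1 g2 g3 g4
  refine ⟨T₀, fun T hT => ?_⟩
  obtain ⟨η₀, hη₀, h⟩ := hT₀ T hT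
  refine ⟨η₀, hη₀, fun η hη hle F hF hmesh M hM => ⟨fun x hx => (h η hη hle F hF hmesh M hM x hx).1,
    fun i => ?_⟩⟩
  have hFM : ∀ y ∈ F, y < M := fun y hy => (hF y hy).2.trans_le hM
  refine (sum_min_measureReal_le (measurable_label hFM) label_mem (K₁ := K₁ i) (K₂ := K₂ i)
    fun x hx => (h η hη hle F hF hmesh M hM x hx).2 i).trans ?_
  linarith [hb1 i, hb2 i]

/-- By Tonelli's theorem: a point `z` is counted exactly for `y` in `[z, z + η[`. -/
theorem lintegral_measure_Ioc_eq (κ : Measure ℝ) [IsFiniteMeasure κ] (η : ℝ) :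
    ∫⁻ y, κ (Ioc (y - η) y) = ENNReal.ofReal η * κ univ := by
  set A : Set (ℝ × ℝ) := {p | p.1 - η < p.2} ∩ {p | p.2 ≤ p.1} with hA
  have hAm : MeasurableSet A :=
    (measurableSet_lt (by fun_prop) (by fun_prop)).inter (measurableSet_le (by fun_prop) (by fun_prop))
  have h1 : ∀ y, κ (Ioc (y - η) y) = κ (Prod.mk y ⁻¹' A) := fun y => rfl
  simp only [h1]
  rw [← Measure.prod_apply hAm, Measure.prod_apply_symm hAm]
  have h2 : ∀ z : ℝ, (volume : Measure ℝ) ((fun y => (y, z)) ⁻¹' A) = ENNReal.ofReal η := fun z => by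
    have : (fun y => (y, z)) ⁻¹' A = Ico z (z + η) := by
      ext y
      simp only [hA, mem_preimage, mem_inter_iff, mem_ofPred_eq, mem_Ico]
      constructor
      · rintro ⟨h, h'⟩; exact ⟨h', by linarith⟩
      · rintro ⟨h, h'⟩; exact ⟨by linarith, h⟩
    rw [this, Real.volume_Ico]
    congr 1; ring
  simp only [h2, lintegral_const]

/-- The `L¹`-distance of a function of bounded variation to a step function that samples it. -/
theorem lintegral_stepFun_sub_le {n : ℕ} {u : ℝ → State n} (hum : Measurable u) {κ : Measure ℝ} [IsFiniteMeasure κ]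
    (hκ : ∀ a b, a ≤ b → ‖u b - u a‖ ≤ κ.real (Ioc a b)) {r : ℝ} (hr : 0 < r) (hur : ∀ x, ‖u x‖ < r)
    {T η : ℝ} {F : Finset ℝ} (hF : ∀ y ∈ F, -T - η < y ∧ y < T)
    (hmesh : ∀ x ∈ Icc (-T) T, ∃ y ∈ F, x - η < y ∧ y < x) :
    ∫⁻ x, ‖stepFun (insert T F) (Function.update u T 0) x - u x‖ₑ ≤
      ENNReal.ofReal η * κ univ + ENNReal.ofReal r * ENNReal.ofReal η +
        (∫⁻ x in Iic (-T), ‖u x‖ₑ) + ∫⁻ x in Ici T, ‖u x‖ₑ := by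
  have hFT : ∀ y ∈ F, y < T := fun y hy => (hF y hy).2
  set S := stepFun (insert T F) (Function.update u T 0) with hS
  have hupd : ∀ y ∈ F, Function.update u T 0 y = u y := fun y hy =>
    Function.update_of_ne (hFT y hy).ne _ _
  have hlast : ∀ x, x < T → S x = lastVal (F.filter (· ≤ x)) u := fun x hx => by
    rw [hS, stepFun_insert_of_lt hx, stepFun]
    exact lastVal_congr fun y hy => hupd y (Finset.mem_filter.1 hy).1
  -- Inside the grid the sample is taken within distance `η` on the left, and the variation there
  -- bounds the difference. The second term covers the strip before `-T` where a sample may already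
  -- be present, and the last two are the tails of `u`.
  have hpt : ∀ x, ‖S x - u x‖ₑ ≤ κ (Ioc (x - η) x) +
      (Ioc (-T - η) (-T)).indicator (fun _ => ENNReal.ofReal r) x +
      (Iic (-T)).indicator (fun x => ‖u x‖ₑ) x + (Ici T).indicator (fun x => ‖u x‖ₑ) x := by
    intro x
    rcases le_or_gt T x with hx | hx
    · have : S x = 0 := by rw [hS, stepFun_insert_of_le hFT hx, Function.update_self]
      rw [this, zero_sub, enorm_neg, indicator_of_mem (show x ∈ Ici T from hx)]
      exact le_add_self
    rcases le_or_gt x (-T) with hx' | hx'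
    · rw [indicator_of_mem (show x ∈ Iic (-T) from hx')]
      have h1 : ‖S x‖ₑ ≤ (Ioc (-T - η) (-T)).indicator (fun _ => ENNReal.ofReal r) x := by
        by_cases hx2 : x ≤ -T - η
        · have : S x = 0 := by
            rw [hlast x hx, Finset.filter_false_of_mem fun y hy => not_le.2
              (hx2.trans_lt (hF y hy).1), lastVal_empty]
          rw [this]; simp
        · rw [indicator_of_mem (show x ∈ Ioc (-T - η) (-T) from ⟨not_le.1 hx2, hx'⟩), hlast x hx,
            ← ofReal_norm]
          exact ENNReal.ofReal_le_ofReal (norm_lastVal_lt hr fun y _ => hur y).le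
      calc ‖S x - u x‖ₑ ≤ ‖S x‖ₑ + ‖u x‖ₑ := enorm_sub_le
        _ ≤ _ := by
          refine le_trans ?_ le_self_add
          gcongr
          exact h1.trans le_add_self
    · obtain ⟨y, hy, hy1, hy2⟩ := hmesh x ⟨hx'.le, hx.le⟩
      obtain ⟨p, hp, hp'⟩ := exists_isLast (S := F.filter (· ≤ x))
        ⟨y, Finset.mem_filter.2 ⟨hy, hy2.le⟩⟩
      have hyp := hp' y (Finset.mem_filter.2 ⟨hy, hy2.le⟩)
      have hpx := (Finset.mem_filter.1 hp).2
      rw [hlast x hx, lastVal_eq hp hp']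
      have h1 : ‖u p - u x‖ₑ ≤ κ (Ioc (x - η) x) := by
        rw [← ofReal_norm, norm_sub_rev]
        refine (ENNReal.ofReal_le_ofReal (hκ p x hpx)).trans ?_
        rw [ofReal_measureReal]
        exact measure_mono (Ioc_subset_Ioc_left (hy1.le.trans hyp))
      exact h1.trans (le_add_right (le_add_right le_self_add))
  have hmκ : Measurable fun x => κ (Ioc (x - η) x) := by
    have hAm : MeasurableSet ({p | p.1 - η < p.2} ∩ {p | p.2 ≤ p.1} : Set (ℝ × ℝ)) :=
      (measurableSet_lt (by fun_prop) (by fun_prop)).inter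
        (measurableSet_le (by fun_prop) (by fun_prop))
    exact measurable_measure_prodMk_left hAm
  refine (lintegral_mono hpt).trans ?_
  have hm2 : Measurable fun x : ℝ => (Ioc (-T - η) (-T)).indicator (fun _ => ENNReal.ofReal r) x :=
    measurable_const.indicator measurableSet_Ioc
  have hm3 : Measurable fun x : ℝ => (Iic (-T)).indicator (fun x => ‖u x‖ₑ) x :=
    hum.enorm.indicator measurableSet_Iic
  have hm12 : Measurable fun x => κ (Ioc (x - η) x) +
      (Ioc (-T - η) (-T)).indicator (fun _ => ENNReal.ofReal r) x := hmκ.add hm2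
  have hm123 : Measurable fun x => κ (Ioc (x - η) x) +
      (Ioc (-T - η) (-T)).indicator (fun _ => ENNReal.ofReal r) x +
      (Iic (-T)).indicator (fun x => ‖u x‖ₑ) x := hm12.add hm3
  rw [lintegral_add_left hm123, lintegral_add_left hm12,
    lintegral_add_left hmκ, lintegral_measure_Ioc_eq, lintegral_indicator measurableSet_Iic,
    lintegral_indicator measurableSet_Ici, lintegral_indicator measurableSet_Ioc,
    setLIntegral_const, Real.volume_Ioc, show -T - (-T - η) = η by ring]

namespace ConservationLaw

variable {n : ℕ} {L : ConservationLaw n} {ε K ρ : ℝ} {Eh : State n × State n → Fin n → ℝ}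

/-- A function with wave measures `m` is approximated by step functions that sample it, together
with its interaction potential and its total wave strength. -/
theorem IsProfile.exists_stepFun_approx {u : ℝ → State n} {m : Fin n → SignedMeasure ℝ}
    {κ : Measure ℝ} {hu : BoundedVariationOn u univ} (P : L.IsProfile ε ρ u m κ hu)
    (R : L.RiemannEstimates ε Eh K ρ) (hbot : Tendsto u atBot (𝓝 0)) (htop : Tendsto u atTop (𝓝 0))
    (hint : Integrable u) {D : Set ℝ} (hD : Dense D) {e : ℝ} (he : 0 < e) :
    ∃ (F : Finset ℝ) (M : ℝ), (F : Set ℝ) ⊆ D ∧ (∀ y ∈ F, y < M) ∧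
      |L.stepQ Eh (insert M F) (Function.update u M 0) - (L.rho m).real {p | p.1 < p.2}| ≤ e ∧
      |stepV Eh (insert M F) (Function.update u M 0) - ∑ i, (m i).totalVariation.real univ| ≤ e ∧
      ∫⁻ x, ‖stepFun (insert M F) (Function.update u M 0) x - u x‖ₑ ≤ ENNReal.ofReal e := by
  have := P.finite
  have hK := R.K_nonneg
  have hρ := R.ρ_pos
  set k := κ.real univ with hk
  have hk0 : 0 ≤ k := measureReal_nonneg
  -- `t` is the fineness of the cells. The strengths then deviate from the cell masses by `10 * K *
  -- k * t` in total and the cancellation is at most `2 * t`; the displayed expressions are the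
  -- resulting errors of the potential and of the total strength.
  obtain ⟨t, ht0, ht1, ht2⟩ : ∃ t : ℝ, 0 < t ∧
      n * (n * (2 * ((10 * K * k + 2) * t) * (2 * k + 2 * ((10 * K * k + 2) * t)) + 6 * t * k)) < e ∧
      n * (2 * ((10 * K * k + 2) * t)) < e := by
    have h1 : Continuous fun t : ℝ => n * (n * (2 * ((10 * K * k + 2) * t) *
        (2 * k + 2 * ((10 * K * k + 2) * t)) + 6 * t * k)) := by fun_prop
    have h2 : Continuous fun t : ℝ => n * (2 * ((10 * K * k + 2) * t)) := by fun_prop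
    have h3 := (h1.tendsto 0).eventually_lt_const (u := e) (by simpa)
    have h4 := (h2.tendsto 0).eventually_lt_const (u := e) (by simpa)
    have h5 : ∀ᶠ t : ℝ in 𝓝[>] 0, 0 < t := self_mem_nhdsWithin
    obtain ⟨t, h6, h7, h8⟩ := (h5.and ((h3.filter_mono nhdsWithin_le_nhds).and
      (h4.filter_mono nhdsWithin_le_nhds))).exists
    exact ⟨t, h6, h7, h8⟩
  obtain ⟨T₀, hT₀⟩ := exists_forall_cell_fine m κ ht0
  set ν : Measure ℝ := volume.withDensity fun x => ‖u x‖ₑ with hν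
  have : IsFiniteMeasure ν := isFiniteMeasure_withDensity hint.2.ne
  obtain ⟨T₁, hT₁⟩ := exists_measureReal_Iic_lt ν (e := e / 4) (by positivity)
  obtain ⟨T₂, hT₂⟩ := exists_measureReal_Ici_lt ν (e := e / 4) (by positivity)
  set T := max 0 (max T₀ (max (-T₁) T₂)) with hT
  have hT0 : 0 ≤ T := le_max_left _ _
  have hTT0 : T₀ ≤ T := (le_max_left _ _).trans (le_max_right _ _)
  have hTT1 : -T₁ ≤ T := ((le_max_left _ _).trans (le_max_right _ _)).trans (le_max_right _ _)
  have hTT2 : T₂ ≤ T := ((le_max_right _ _).trans (le_max_right _ _)).trans (le_max_right _ _)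
  obtain ⟨η₀, hη₀, hcell⟩ := hT₀ T hTT0
  obtain ⟨η, hη, hηle, hηe⟩ : ∃ η : ℝ, 0 < η ∧ η ≤ η₀ ∧ η * (k + ρ) ≤ e / 2 := by
    refine ⟨min η₀ (e / 2 / (k + ρ)), by positivity, min_le_left _ _, ?_⟩
    exact (mul_le_mul_of_nonneg_right (min_le_right _ _) (by positivity)).trans
      (by rw [div_mul_cancel₀]; positivity)
  obtain ⟨F, hFD, hF, hmesh⟩ := exists_grid hD hη T
  have hFT : ∀ y ∈ F, y < T := fun y hy => (hF y hy).2
  have hne : F.Nonempty := by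
    obtain ⟨y, hy, -⟩ := hmesh T ⟨by linarith, le_rfl⟩
    exact ⟨y, hy⟩
  obtain ⟨c1, c2⟩ := hcell η hη hηle F hF hmesh T le_rfl
  have hc := measurable_label hFT
  have hσ : ∀ i, ∑ x ∈ insert T F,
      (|fanAt Eh (insert T F) (Function.update u T 0) x i - m i (label F T ⁻¹' {x})| +
      min ((m i).toJordanDecomposition.posPart.real (label F T ⁻¹' {x}))
        ((m i).toJordanDecomposition.negPart.real (label F T ⁻¹' {x}))) ≤ (10 * K * k + 2) * t := by
    intro i
    rw [Finset.sum_add_distrib]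
    have h1 := Finset.sum_le_sum fun x hx =>
      P.abs_fanAt_sub_le R hbot htop hne hFT (θ := t) (x := x) hx (c1 x hx) i
    have h2 := sum_measureReal_fiber hc (label_mem (F := F) (M := T)) (α := κ) univ
    simp only [inter_univ] at h2
    rw [← Finset.mul_sum, h2] at h1
    linarith [c2 i]
  refine ⟨F, T, hFD, hFT, ?_, ?_, ?_⟩
  · exact (abs_pairSum_sub_rho_le hc label_mem (label_mono hFT) P.totalVariation_le hσ c1).trans
      ht1.le
  · have e1 : stepV Eh (insert T F) (Function.update u T 0) =
        ∑ i, ∑ x ∈ insert T F, |fanAt Eh (insert T F) (Function.update u T 0) x i| :=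
      Finset.sum_comm
    rw [e1, ← Finset.sum_sub_distrib]
    refine (Finset.abs_sum_le_sum_abs _ _).trans ((Finset.sum_le_card_nsmul _ _ _ fun i _ =>
      abs_sum_abs_sub_totalVariation_le hc label_mem hσ i).trans ?_)
    rw [Finset.card_univ, Fintype.card_fin, nsmul_eq_mul]
    exact ht2.le
  · refine (lintegral_stepFun_sub_le
      (stronglyMeasurable_of_continuousWithinAt_Ici P.right_cont).measurable (κ := κ)
      (fun a b hab => P.norm_sub_le hab) hρ P.norm_lt hF hmesh).trans ?_
    have h1 : (∫⁻ x in Iic (-T), ‖u x‖ₑ) ≤ ENNReal.ofReal (e / 4) := by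
      rw [← withDensity_apply _ measurableSet_Iic, ← ofReal_measureReal]
      exact ENNReal.ofReal_le_ofReal ((measureReal_mono (Iic_subset_Iic.2 (by linarith))).trans hT₁.le)
    have h2 : (∫⁻ x in Ici T, ‖u x‖ₑ) ≤ ENNReal.ofReal (e / 4) := by
      rw [← withDensity_apply _ measurableSet_Ici, ← ofReal_measureReal]
      exact ENNReal.ofReal_le_ofReal ((measureReal_mono (Ici_subset_Ici.2 hTT2)).trans hT₂.le)
    have h3 : ENNReal.ofReal η * κ univ + ENNReal.ofReal ρ * ENNReal.ofReal η ≤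
        ENNReal.ofReal (e / 2) := by
      rw [← ofReal_measureReal (μ := κ) (s := univ), ← ENNReal.ofReal_mul hη.le,
        ← ENNReal.ofReal_mul hρ.le, ← ENNReal.ofReal_add (by positivity) (by positivity)]
      exact ENNReal.ofReal_le_ofReal (by linarith)
    calc _ ≤ ENNReal.ofReal (e / 2) + ENNReal.ofReal (e / 4) + ENNReal.ofReal (e / 4) := by gcongr
      _ = ENNReal.ofReal e := by
        rw [← ENNReal.ofReal_add (by positivity) (by positivity),
          ← ENNReal.ofReal_add (by positivity) (by positivity)]
        congr 1; ring

end ConservationLaw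

/-! ### Existence of the wave measures. -/

noncomputable section

theorem tsum_inter_eq_tsum_indicator (s : ℝ → ℝ) (B J : Set ℝ) :
    ∑' x : ↥(B ∩ J), s x = ∑' x : B, J.indicator s x := by
  rw [tsum_subtype (B ∩ J) s, tsum_subtype B (J.indicator s), Set.indicator_indicator]

/-- The discrete signed measure with mass `s x` at the points `x` of `J`. -/
def discreteSignedMeasure (s : ℝ → ℝ) (J : Set ℝ) (hs : Summable fun x : J => s x) :
    SignedMeasure ℝ where
  measureOf' B := by
    classical exact if MeasurableSet B then ∑' x : ↥(B ∩ J), s x else 0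
  empty' := by
    rw [if_pos MeasurableSet.empty, tsum_inter_eq_tsum_indicator]
    exact tsum_empty
  not_measurable' B hB := if_neg hB
  m_iUnion' f hf hd := by
    have hsum : Summable (J.indicator s) := summable_subtype_iff_indicator.1 hs
    simp only [if_pos (hf _), if_pos (MeasurableSet.iUnion hf), tsum_inter_eq_tsum_indicator]
    have h1 : HasSum (fun x : ↥(⋃ i, f i) => J.indicator s x) _ := (hsum.subtype _).hasSum
    rw [← (Set.unionEqSigmaOfDisjoint hd).symm.hasSum_iff] at h1
    exact h1.sigma fun k => (hsum.subtype (f k)).hasSum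

theorem discreteSignedMeasure_apply (s : ℝ → ℝ) (J : Set ℝ) (hs : Summable fun x : J => s x)
    {B : Set ℝ} (hB : MeasurableSet B) : discreteSignedMeasure s J hs B = ∑' x : ↥(B ∩ J), s x :=
  if_pos hB

/-- The vector measure with density `f` with respect to a vector measure. -/
def setIntegralMeasure {E : Type*} [NormedAddCommGroup E] [NormedSpace ℝ E]
    (μ : VectorMeasure ℝ E) (f : ℝ → E →L[ℝ] ℝ) (hf : μ.Integrable f) : SignedMeasure ℝ where
  measureOf' B := ∫ᵛ x in B, f x ∂[ContinuousLinearMap.id ℝ (E →L[ℝ] ℝ); μ]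
  empty' := VectorMeasure.setIntegral_empty
  not_measurable' _ hB := VectorMeasure.setIntegral_eq_zero_of_not_measurableSet hB
  m_iUnion' _ hB hd := VectorMeasure.hasSum_setIntegral_iUnion hB hd hf.integrableOn

theorem setIntegralMeasure_apply {E : Type*} [NormedAddCommGroup E] [NormedSpace ℝ E]
    (μ : VectorMeasure ℝ E) (f : ℝ → E →L[ℝ] ℝ) (hf : μ.Integrable f) (B : Set ℝ) :
    setIntegralMeasure μ f hf B =
      ∫ᵛ x in B, f x ∂[ContinuousLinearMap.id ℝ (E →L[ℝ] ℝ); μ] := rfl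

namespace ConservationLaw

variable {n : ℕ} {L : ConservationLaw n} {ε K ρ : ℝ} {Eh : State n × State n → Fin n → ℝ}

/-- The density `lᵢ(u)` is bounded and, by right continuity, measurable, hence integrable for the
finite variation of the continuous part. The strengths at the jumps are summable since they are at
most `K` times the jumps. -/
theorem exists_isProfile (R : L.RiemannEstimates ε Eh K ρ) {u : ℝ → State n}
    (hu : BoundedVariationOn u univ) (hrc : ∀ x, ContinuousWithinAt u (Ici x) x) {r : ℝ}
    (hr : r < ρ) (hur : ∀ x, ‖u x‖ ≤ r) :
    ∃ m : Fin n → SignedMeasure ℝ, ∀ i, (continuousPart hu).Integrable (fun x => L.l i (u x)) ∧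
      Summable (fun x : jumpSet u => L.strength ε u x i) ∧
      ∀ B : Set ℝ, MeasurableSet B → m i B =
        (∫ᵛ x in B, L.l i (u x) ∂[ContinuousLinearMap.id ℝ (State n →L[ℝ] ℝ);
          continuousPart hu]) + ∑' x : ↥(B ∩ jumpSet u), L.strength ε u x i := by
  have hlt : ∀ x, ‖u x‖ < ρ := fun x => (hur x).trans_lt hr
  have hltl : ∀ x, ‖Function.leftLim u x‖ < ρ := fun x =>
    (le_of_tendsto (hu.tendsto_leftLim x).norm (Eventually.of_forall hur)).trans_lt hr
  have hint : ∀ i, (continuousPart hu).Integrable (fun x => L.l i (u x)) := fun i => by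
    have h1 : StronglyMeasurable fun x => L.l i (u x) := by
      refine stronglyMeasurable_of_continuousWithinAt_Ici fun x => ?_
      have h2 : ContinuousAt (L.l i) (u x) := by
        refine continuousAt_of_locally_lipschitz (sub_pos.2 (hlt x)) K fun y hy => ?_
        rw [dist_eq_norm, dist_eq_norm] at *
        refine R.l_lipschitz _ _ ?_ (hlt x) i
        have := norm_le_norm_sub_add y (u x)
        linarith
      exact h2.comp_continuousWithinAt (hrc x)
    have : IsFiniteMeasure (continuousPart hu).variation := isFiniteMeasure_variation _
    exact Integrable.of_bound (μ := (continuousPart hu).variation) h1.aestronglyMeasurable K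
      (Eventually.of_forall fun x => R.l_bound _ (hlt x) i)
  have hsum : ∀ i, Summable (fun x : jumpSet u => L.strength ε u x i) := fun i => by
    set κ := hu.vectorMeasure.variation
    have hcount := countable_jumpSet hu hrc
    have : Countable (jumpSet u) := hcount.to_subtype
    have h2 : Summable (fun x : jumpSet u => κ.real {(x : ℝ)}) := by
      have := VectorMeasure.hasSum_of_disjoint_iUnion (v := κ.toSignedMeasure)
        (f := fun x : jumpSet u => ({(x : ℝ)} : Set ℝ)) (fun x => measurableSet_singleton _)
        fun x y hxy => by
          simp only [Function.onFun, Set.disjoint_singleton]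
          exact fun h => hxy (Subtype.ext h)
      simp only [Measure.toSignedMeasure_apply_measurable (measurableSet_singleton _)] at this
      exact this.summable
    refine Summable.of_norm_bounded (h2.mul_left K) fun x => ?_
    have h3 : L.strength ε u x i = Eh (Function.leftLim u x, u x) i := by
      rw [strength, R.E_eq _ _ (hltl x) (R.solvable _ _ (hltl x) (hlt x))]
    have h4 := R.abs_sub_le_right (hltl x) (hlt x) (hltl x) i
    rw [R.self _ (hltl x), Pi.zero_apply, sub_zero, ← vectorMeasure_singleton_eq hu hrc] at h4
    rw [h3, Real.norm_eq_abs]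
    exact h4.trans (mul_le_mul_of_nonneg_left (norm_le_variation _ _) R.K_nonneg)
  refine ⟨fun i => setIntegralMeasure (continuousPart hu) (fun x => L.l i (u x)) (hint i) +
    discreteSignedMeasure (fun x => L.strength ε u x i) (jumpSet u) (hsum i),
    fun i => ⟨hint i, hsum i, fun B hB => ?_⟩⟩
  rw [add_apply, setIntegralMeasure_apply, discreteSignedMeasure_apply _ _ _ hB]

theorem IsProfile.mk' {u : ℝ → State n} {hu : BoundedVariationOn u univ}
    (hrc : ∀ x, ContinuousWithinAt u (Ici x) x) {r : ℝ} (hr : r < ρ) (hur : ∀ x, ‖u x‖ ≤ r)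
    {m : Fin n → SignedMeasure ℝ}
    (hm : ∀ i, (continuousPart hu).Integrable (fun x => L.l i (u x)) ∧
      Summable (fun x : jumpSet u => L.strength ε u x i) ∧
      ∀ B : Set ℝ, MeasurableSet B → m i B =
        (∫ᵛ x in B, L.l i (u x) ∂[ContinuousLinearMap.id ℝ (State n →L[ℝ] ℝ);
          continuousPart hu]) + ∑' x : ↥(B ∩ jumpSet u), L.strength ε u x i) :
    L.IsProfile ε ρ u m (hu.vectorMeasure.variation + ∑ i, (m i).totalVariation) hu where
  right_cont := hrc
  bound := ⟨r, hr, hur⟩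
  integrable i := (hm i).1
  summable i := (hm i).2.1
  apply_eq i := (hm i).2.2
  finite := inferInstance
  variation_le := Measure.le_add_right le_rfl
  totalVariation_le i := by
    refine Measure.le_add_left (Measure.le_iff.2 fun s hs => ?_)
    rw [Measure.coe_finsetSum, Finset.sum_apply]
    exact Finset.single_le_sum (f := fun i => (m i).totalVariation s) (fun _ _ => bot_le)
      (Finset.mem_univ i)

end ConservationLaw

end

/-! ### Compactness: limits of step functions of bounded total strength. -/

section StepFun

variable {n : ℕ} {g : ℝ → State n}

theorem stepFun_eq_sum (F : Finset ℝ) (x : ℝ) :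
    stepFun F g x = ∑ z ∈ F, if z ≤ x then g z - leftState F g z else 0 := by
  induction F using Finset.induction_on_max with
  | empty => rw [stepFun_eq_zero (by simp), Finset.sum_empty]
  | insert M F hM ih =>
    rw [Finset.sum_insert fun h => lt_irrefl _ (hM M h), leftState_insert le_rfl,
      leftState_of_forall_lt hM, Finset.sum_congr rfl fun z hz => by
        rw [leftState_insert (hM z hz).le], ← ih]
    split_ifs with h
    · rw [stepFun_insert_of_le hM h, stepFun, Finset.filter_true_of_mem fun y hy =>
        (hM y hy).le.trans h, sub_add_cancel]
    · rw [stepFun_insert_of_lt (not_le.1 h), zero_add]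

theorem norm_stepFun_sub_stepFun_le (F : Finset ℝ) {x y : ℝ} (hxy : x ≤ y) :
    ‖stepFun F g y - stepFun F g x‖ ≤
      (∑ z ∈ F, if z ≤ y then ‖g z - leftState F g z‖ else 0) -
        ∑ z ∈ F, if z ≤ x then ‖g z - leftState F g z‖ else 0 := by
  rw [stepFun_eq_sum, stepFun_eq_sum, ← Finset.sum_sub_distrib, ← Finset.sum_sub_distrib]
  refine norm_sum_le_of_le _ fun z _ => ?_
  by_cases h1 : z ≤ x
  · simp [h1, h1.trans hxy]
  · by_cases h2 : z ≤ y <;> simp [h1, h2]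

/-- Increments of the step function are dominated by those of the monotone function that accumulates
the sizes of the jumps. -/
theorem eVariationOn_stepFun_le (F : Finset ℝ) :
    eVariationOn (stepFun F g) univ ≤
      ENNReal.ofReal (∑ z ∈ F, ‖g z - leftState F g z‖) := by
  set φ : ℝ → ℝ := fun x => ∑ z ∈ F, if z ≤ x then ‖g z - leftState F g z‖ else 0 with hφ
  have h0 : ∀ x, 0 ≤ φ x := fun x => Finset.sum_nonneg fun z _ => by
    split_ifs
    exacts [norm_nonneg _, le_rfl]
  have h1 : ∀ x, φ x ≤ ∑ z ∈ F, ‖g z - leftState F g z‖ := fun x =>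
    Finset.sum_le_sum fun z _ => by
      split_ifs
      exacts [le_rfl, norm_nonneg _]
  refine iSup_le fun ⟨N, w, hw, _⟩ => ?_
  calc ∑ i ∈ Finset.range N, edist (stepFun F g (w (i + 1))) (stepFun F g (w i))
      ≤ ∑ i ∈ Finset.range N, ENNReal.ofReal (φ (w (i + 1)) - φ (w i)) :=
        Finset.sum_le_sum fun i _ => by
          rw [edist_dist, dist_eq_norm]
          exact ENNReal.ofReal_le_ofReal (norm_stepFun_sub_stepFun_le F (hw (Nat.le_succ i)))
    _ = ENNReal.ofReal (φ (w N) - φ (w 0)) := by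
        rw [← ENNReal.ofReal_sum_of_nonneg fun i _ =>
          (norm_nonneg _).trans (norm_stepFun_sub_stepFun_le F (hw (Nat.le_succ i))),
          Finset.sum_range_sub fun i => φ (w i)]
    _ ≤ _ := ENNReal.ofReal_le_ofReal (by linarith [h0 (w 0), h1 (w N)])

end StepFun

/-- A class of functions which is an almost everywhere limit of bounded functions of equibounded
variation has a right continuous representative of bounded variation. -/
theorem exists_rightContinuous_ae_eq {n : ℕ} {w : ℕ → ℝ → State n} {U : ℝ → State n} {r : ℝ}
    {C : ℝ≥0∞} (hC : C ≠ ∞) (hw : ∀ k x, ‖w k x‖ ≤ r) (hv : ∀ k, eVariationOn (w k) univ ≤ C)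
    (hU : ∀ᵐ x, Tendsto (fun k => w k x) atTop (𝓝 (U x))) :
    ∃ u : ℝ → State n, U =ᵐ[volume] u ∧ (∀ x, ContinuousWithinAt u (Ici x) x) ∧
      BoundedVariationOn u univ := by
  -- Limits along a nonprincipal ultrafilter exist at every point by compactness, so no subsequence
  -- has to be selected. Lower semicontinuity bounds the variation of the limit, which agrees with
  -- `U` wherever the sequence converges to it.
  have h1 : ∀ x, ∃ y, Tendsto (fun k => w k x) (hyperfilter ℕ : Filter ℕ) (𝓝 y) := fun x => by
    obtain ⟨y, -, hy⟩ := (isCompact_closedBall (0 : State n) r).ultrafilter_le_nhds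
      ((hyperfilter ℕ).map fun k => w k x) (by
        rw [Ultrafilter.coe_map, le_principal_iff, mem_map]
        exact Eventually.of_forall fun k => by simpa using hw k x)
    exact ⟨y, hy⟩
  choose f hf using h1
  have hbv : BoundedVariationOn f univ := by
    refine ne_top_of_le_ne_top hC (not_lt.1 fun h => ?_)
    obtain ⟨k, hk⟩ := (eVariationOn.lowerSemicontinuous_aux (fun x _ => hf x) h).exists
    exact absurd hk (not_lt.2 (hv k))
  have hUf : U =ᵐ[volume] f := by
    filter_upwards [hU] with x hx
    exact tendsto_nhds_unique (hx.mono_left (Nat.hyperfilter_le_atTop)) (hf x)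
  -- Passing to right limits changes `f` only on a null set, because a function of bounded variation
  -- is differentiable, hence continuous, almost everywhere.
  refine ⟨f.rightLim, hUf.trans ?_, fun x => hbv.continuousWithinAt_rightLim, hbv.rightLim⟩
  filter_upwards [hbv.locallyBoundedVariationOn.ae_differentiableAt] with x hx
  exact (hx.continuousAt.continuousWithinAt.rightLim_eq).symm

theorem norm_le_of_dense {n : ℕ} {u : ℝ → State n} (hrc : ∀ x, ContinuousWithinAt u (Ici x) x)
    {D : Set ℝ} (hD : Dense D) {r : ℝ} (hr : ∀ x ∈ D, ‖u x‖ ≤ r) (x : ℝ) : ‖u x‖ ≤ r := by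
  by_contra h
  obtain ⟨y, hy, hyx⟩ := mem_nhdsGE_iff_exists_Ico_subset.1
    ((hrc x).norm.eventually_const_lt (not_le.1 h))
  obtain ⟨z, hzD, hz⟩ := hD.exists_between hy
  exact absurd (hr z hzD) (not_le.2 (hyx ⟨hz.1.le, hz.2⟩))

theorem eq_zero_of_tendsto_of_integrable {n : ℕ} {u : ℝ → State n} (hint : Integrable u)
    {f : Filter ℝ} {l : State n} (hl : Tendsto u f (𝓝 l)) (hf : ∀ s ∈ f, volume s = ∞) : l = 0 := by
  by_contra h
  have h0 : 0 < ‖l‖ / 2 := half_pos (norm_pos_iff.2 h)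
  have h1 := hf _ (hl.norm.eventually_const_le (half_lt_self (norm_pos_iff.2 h)))
  exact absurd h1 (hint.measure_norm_ge_lt_top h0).ne

theorem tendsto_atTop_zero_of_integrable {n : ℕ} {u : ℝ → State n} (hu : BoundedVariationOn u univ)
    (hint : Integrable u) : Tendsto u atTop (𝓝 0) := by
  have h := hu.tendsto_atTop_limUnder
  rwa [eq_zero_of_tendsto_of_integrable hint h fun s hs => ?_] at h
  obtain ⟨a, ha⟩ := mem_atTop_sets.1 hs
  exact top_unique (Real.volume_Ici.symm.le.trans (measure_mono ha))

theorem tendsto_atBot_zero_of_integrable {n : ℕ} {u : ℝ → State n} (hu : BoundedVariationOn u univ)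
    (hint : Integrable u) : Tendsto u atBot (𝓝 0) := by
  have h := hu.tendsto_atBot_limUnder
  rwa [eq_zero_of_tendsto_of_integrable hint h fun s hs => ?_] at h
  obtain ⟨a, ha⟩ := mem_atBot_sets.1 hs
  exact top_unique (Real.volume_Iic.symm.le.trans (measure_mono ha))

theorem lintegral_enorm_stepFun_sub_le {n : ℕ} {F : Finset ℝ} {g h : ℝ → State n} {A M c : ℝ}
    (hM : ∀ y ∈ F, y < M) (hA : ∀ y ∈ insert M F, A ≤ y) (hgM : g M = 0) (hhM : h M = 0)
    (hc : 0 ≤ c) (hgh : ∀ x ∈ insert M F, ‖g x - h x‖ ≤ c) :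
    ∫⁻ x, ‖stepFun (insert M F) g x - stepFun (insert M F) h x‖ₑ ≤
      ENNReal.ofReal (c * (M - A)) := by
  calc _ ≤ ∫⁻ x, (Icc A M).indicator (fun _ => ENNReal.ofReal c) x := by
        refine lintegral_mono fun x => ?_
        by_cases hx : x ∈ Icc A M
        · rw [indicator_of_mem hx, ← ofReal_norm]
          exact ENNReal.ofReal_le_ofReal (norm_stepFun_sub_le hc hgh x)
        · rw [indicator_of_notMem hx]
          rcases not_and_or.1 hx with h1 | h1
          · rw [stepFun_eq_zero fun y hy => (not_le.1 h1).trans_le (hA y hy),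
              stepFun_eq_zero fun y hy => (not_le.1 h1).trans_le (hA y hy)]
            simp
          · rw [stepFun_insert_of_le hM (not_le.1 h1).le, stepFun_insert_of_le hM (not_le.1 h1).le,
              hgM, hhM]
            simp
    _ = _ := by
        rw [lintegral_indicator measurableSet_Icc, setLIntegral_const, Real.volume_Icc,
          ENNReal.ofReal_mul hc]

/-! ### Approximating sequences and an abstract criterion for relaxations. -/

namespace ConservationLaw

variable {n : ℕ} {L : ConservationLaw n} {ε K ρ : ℝ} {Eh : State n × State n → Fin n → ℝ}

theorem RiemannEstimates.eVariationOn_le (R : L.RiemannEstimates ε Eh K ρ) {C₀ δ : ℝ} (hC : 0 ≤ C₀)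
    (hδ : K * δ < ρ) {v : ℝ → State n} (hv : v ∈ L.DStar ε C₀ δ) :
    eVariationOn v univ ≤ ENNReal.ofReal (K * δ) := by
  obtain ⟨hb, J, hJ, -⟩ := R.of_mem_DStar hC hδ hv
  have hlt : ∀ x ∈ J, ‖v x‖ < ρ := fun x _ => (hb x).trans_lt hδ
  have hvJ := hJ J Finset.Subset.rfl
  have hV : L.V ε v = stepV Eh J v := by
    conv_lhs => rw [hvJ]
    exact R.V_stepFun hlt
  have hΥ := hv.2.2.2.2
  rw [Upsilon, hV] at hΥ
  have hQ := mul_nonneg hC (Q_nonneg (L := L) (ε := ε) v)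
  rw [hvJ]
  refine (eVariationOn_stepFun_le J).trans (ENNReal.ofReal_le_ofReal ?_)
  calc ∑ z ∈ J, ‖v z - leftState J v z‖ ≤ ∑ z ∈ J, K * ∑ i, |fanAt Eh J v z i| := by
        refine Finset.sum_le_sum fun z hz => ?_
        have h1 := norm_leftState_lt R.ρ_pos hlt z
        refine (R.norm_sub_le _ _ h1 (R.solvable _ _ h1 (hlt z hz))).trans
          (mul_le_mul_of_nonneg_left ?_ R.K_nonneg)
        refine (pi_norm_le_iff_of_nonneg (Finset.sum_nonneg fun _ _ => abs_nonneg _)).2 fun i => ?_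
        exact Finset.single_le_sum (f := fun i => |fanAt Eh J v z i|) (fun _ _ => abs_nonneg _)
          (Finset.mem_univ i)
    _ = K * stepV Eh J v := by rw [stepV, Finset.mul_sum]
    _ ≤ K * δ := mul_le_mul_of_nonneg_left (by linarith) R.K_nonneg

theorem nbhd_nonempty {C₀ δ η : ℝ} {U : Lp (State n) 1 (volume : Measure ℝ)}
    (hU : U ∈ L.D ε C₀ δ) (hη : 0 < η) : (L.nbhd ε C₀ δ η U).Nonempty := by
  obtain ⟨W, ⟨v, hv, hWv⟩, hW⟩ := Metric.mem_closure_iff.1 hU η hη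
  refine ⟨v, hv, ?_⟩
  rw [dist_comm, Lp.dist_def] at hW
  rw [eLpNorm_congr_ae (g := ⇑W - ⇑U) (by
    filter_upwards [hWv] with x hx
    rw [Pi.sub_apply, hx])]
  rw [ENNReal.lt_ofReal_iff_toReal_lt]
  · exact hW
  · exact ((Lp.memLp W).sub (Lp.memLp U)).eLpNorm_ne_top

theorem exists_subseq_tendsto_ae {C₀ δ : ℝ} {U : Lp (State n) 1 (volume : Measure ℝ)}
    {w : ℕ → ℝ → State n} (hw : ∀ k : ℕ, w k ∈ L.nbhd ε C₀ δ (1 / ((k : ℝ) + 1)) U) :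
    ∃ ns : ℕ → ℕ, StrictMono ns ∧ ∀ᵐ x, Tendsto (fun k => w (ns k) x) atTop (𝓝 (U x)) := by
  refine TendstoInMeasure.exists_seq_tendsto_ae
    (tendstoInMeasure_of_tendsto_eLpNorm (p := 1) (f := w) one_ne_zero
      (fun k => (hw k).1.2.1.aestronglyMeasurable) (Lp.aestronglyMeasurable U) ?_)
  refine tendsto_of_tendsto_of_tendsto_of_le_of_le tendsto_const_nhds
    (h := fun k : ℕ => ENNReal.ofReal (1 / ((k : ℝ) + 1))) ?_ (fun _ => bot_le)
    fun k => (hw k).2.le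
  rw [← ENNReal.ofReal_zero]
  exact ENNReal.tendsto_ofReal tendsto_one_div_add_atTop_nhds_zero_nat

/-- For any approximating sequence, the competitors `v` near `U` with `F v` near `c` show that the
relaxation is at most `c`. Applied to a sequence whose values `F (w k)` stay below a number
exceeding the relaxation, `F v ≤ F (w k)` shows that it is at least `c`. -/
theorem relaxation_eq_ofReal {C₀ δ c : ℝ} {F : (ℝ → State n) → ℝ}
    {U : Lp (State n) 1 (volume : Measure ℝ)} (hU : U ∈ L.D ε C₀ δ)
    (H : ∀ w : ℕ → ℝ → State n, (∀ k : ℕ, w k ∈ L.nbhd ε C₀ δ (1 / ((k : ℝ) + 1)) U) → ∀ e > 0,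
      ∃ k, ∃ v ∈ L.DStar ε C₀ δ, eLpNorm (fun x => v x - U x) 1 volume ≤ ENNReal.ofReal e ∧
        |F v - c| ≤ e ∧ F v ≤ F (w k)) :
    L.relaxation ε C₀ δ F U = ENNReal.ofReal c := by
  have hlim : ∀ s : ℝ, Tendsto (fun e : ℝ => ENNReal.ofReal (c + s * e)) (𝓝[>] 0)
      (𝓝 (ENNReal.ofReal c)) := fun s => by
    have h1 : Continuous fun e : ℝ => c + s * e := by fun_prop
    have h2 := (ENNReal.tendsto_ofReal (h1.tendsto 0)).mono_left (nhdsWithin_le_nhds (s := Ioi 0))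
    simpa using h2
  apply le_antisymm
  · have h0 : ∀ k : ℕ, (L.nbhd ε C₀ δ (1 / ((k : ℝ) + 1)) U).Nonempty := fun k =>
      nbhd_nonempty hU (by positivity)
    choose w hw using h0
    refine iSup₂_le fun η hη => ge_of_tendsto (hlim 1) ?_
    filter_upwards [Ioo_mem_nhdsGT hη] with e he
    obtain ⟨k, v, hv, h1, h2, -⟩ := H w hw e he.1
    refine (iInf₂_le v ⟨hv, h1.trans_lt ((ENNReal.ofReal_lt_ofReal_iff hη).2 he.2)⟩).trans
      (ENNReal.ofReal_le_ofReal ?_)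
    linarith [(abs_le.1 h2).2]
  · refine le_of_forall_gt_imp_ge_of_dense fun a ha => ?_
    have h1 : ∀ k : ℕ, ∃ w ∈ L.nbhd ε C₀ δ (1 / ((k : ℝ) + 1)) U, ENNReal.ofReal (F w) < a := by
      intro k
      have := (le_iSup₂_of_le (f := fun (η : ℝ) (_ : 0 < η) =>
        ⨅ v ∈ L.nbhd ε C₀ δ η U, ENNReal.ofReal (F v)) (1 / ((k : ℝ) + 1)) (by positivity)
          le_rfl).trans_lt ha
      simpa only [iInf_lt_iff, exists_prop] using this
    choose w hw hwa using h1
    refine le_of_tendsto (hlim (-1)) ?_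
    filter_upwards [self_mem_nhdsWithin] with e he
    obtain ⟨k, v, -, -, h2, h3⟩ := H w hw e he
    refine (ENNReal.ofReal_le_ofReal ?_).trans (hwa k).le
    linarith [(abs_le.1 h2).1]

end ConservationLaw

/-! ### Recovery from approximating sequences, and conclusion. -/

namespace ConservationLaw

variable {n : ℕ} {L : ConservationLaw n} {ε K ρ C₀ δ : ℝ} {Eh : State n × State n → Fin n → ℝ}
  {U : Lp (State n) 1 (volume : Measure ℝ)}

/-- Almost everywhere convergence supplies a dense set of admissible grid points. Right continuity
extends the bound from this set to all points. -/
theorem RiemannEstimates.exists_dense_tendsto (R : L.RiemannEstimates ε Eh K ρ) (hC : 0 ≤ C₀)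
    (hδ : K * δ < ρ) {u : ℝ → State n} (hUu : U =ᵐ[volume] u)
    (hrc : ∀ x, ContinuousWithinAt u (Ici x) x) {w : ℕ → ℝ → State n}
    (hw : ∀ k : ℕ, w k ∈ L.nbhd ε C₀ δ (1 / ((k : ℝ) + 1)) U) :
    (∀ x, ‖u x‖ ≤ K * δ) ∧ ∃ (ns : ℕ → ℕ) (D : Set ℝ), Dense D ∧
      ∀ x ∈ D, Tendsto (fun k => w (ns k) x) atTop (𝓝 (u x)) := by
  obtain ⟨ns, -, hns⟩ := exists_subseq_tendsto_ae hw
  have h1 : ∀ᵐ x, Tendsto (fun k => w (ns k) x) atTop (𝓝 (u x)) := by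
    filter_upwards [hns, hUu] with x h1 h2
    rwa [← h2]
  have hD := Measure.dense_of_ae h1
  exact ⟨norm_le_of_dense hrc hD fun x hx => le_of_tendsto (Tendsto.norm hx)
    (Eventually.of_forall fun k => (R.of_mem_DStar hC hδ (hw (ns k)).1).1 x), ns, _, hD,
    fun x hx => hx⟩

theorem RiemannEstimates.exists_isWaveMeasures (R : L.RiemannEstimates ε Eh K ρ) (hC : 0 ≤ C₀)
    (hδ : K * δ < ρ) (hU : U ∈ L.D ε C₀ δ) :
    ∃ m : Fin n → SignedMeasure ℝ, L.IsWaveMeasures ε U m := by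
  have h0 : ∀ k : ℕ, (L.nbhd ε C₀ δ (1 / ((k : ℝ) + 1)) U).Nonempty := fun k =>
    nbhd_nonempty hU (by positivity)
  choose w hw using h0
  obtain ⟨ns, -, hns⟩ := exists_subseq_tendsto_ae hw
  obtain ⟨u, hUu, hrc, hu⟩ := exists_rightContinuous_ae_eq ENNReal.ofReal_ne_top
    (fun k => (R.of_mem_DStar hC hδ (hw (ns k)).1).1)
    (fun k => R.eVariationOn_le hC hδ (hw (ns k)).1) hns
  have hur := (R.exists_dense_tendsto hC hδ hUu hrc hw).1
  obtain ⟨m, hm⟩ := exists_isProfile R hu hrc hδ hur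
  refine ⟨m, u, hUu, hrc, hu, fun x _ => R.solvable _ _ ?_ ((hur x).trans_lt hδ), hm⟩
  exact (le_of_tendsto (hu.tendsto_leftLim x).norm (Eventually.of_forall hur)).trans_lt hδ

/-- The elements of a sequence in `D_δ^*` converging to `U` can be replaced by step functions
of smaller potentials, whose potentials are close to those of the wave measures of `U`. -/
theorem RiemannEstimates.exists_recovery (R : L.RiemannEstimates ε Eh K ρ)
    (hC : 2 * (n * K) ≤ C₀) (hδ : n * K * δ ≤ 1 / 2) (hδ' : K * δ < ρ)
    {m : Fin n → SignedMeasure ℝ} (hm : L.IsWaveMeasures ε U m) {w : ℕ → ℝ → State n}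
    (hw : ∀ k : ℕ, w k ∈ L.nbhd ε C₀ δ (1 / ((k : ℝ) + 1)) U) {e : ℝ} (he : 0 < e) :
    ∃ k, ∃ v ∈ L.DStar ε C₀ δ,
      eLpNorm (fun x => v x - U x) 1 volume ≤ ENNReal.ofReal e ∧
      |L.Q ε v - (L.rho m).real {p | p.1 < p.2}| ≤ e ∧
      |L.V ε v - ∑ i, (m i).totalVariation.real univ| ≤ e ∧
      L.Q ε v ≤ L.Q ε (w k) ∧ L.Upsilon ε C₀ v ≤ L.Upsilon ε C₀ (w k) := by
  have hC0 : 0 ≤ C₀ := le_trans (by have := R.K_nonneg; positivity) hC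
  obtain ⟨u, hUu, hrc, hu, -, hm⟩ := hm
  obtain ⟨hur, ns, D, hD, hDw⟩ := R.exists_dense_tendsto hC0 hδ' hUu hrc hw
  have hint : Integrable u := (L1.integrable_coeFn U).congr hUu
  obtain ⟨F, M, hFD, hM, a1, a2, a3⟩ := (IsProfile.mk' hrc hδ' hur hm).exists_stepFun_approx R
    (tendsto_atBot_zero_of_integrable hu hint) (tendsto_atTop_zero_of_integrable hu hint) hint hD
    (half_pos he)
  set g := Function.update u M 0 with hg
  -- The approximants are sampled rather than `u` itself: this gives the comparison with `w (ns k)`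
  -- and the strict inequality `Υ < δ`, while for large `k` the potentials are close to those of the
  -- samples of `u`.
  set G := fun k => Function.update (w (ns k)) M 0 with hG
  have hgρ : ∀ x ∈ insert M F, ‖g x‖ < ρ := fun x _ => by
    by_cases h : x = M
    · subst h; simpa [hg] using R.ρ_pos
    · rw [hg, Function.update_of_ne h]; exact (hur x).trans_lt hδ'
  have hGg : ∀ x ∈ insert M F, Tendsto (fun k => G k x) atTop (𝓝 (g x)) := fun x hx => by
    by_cases h : x = M
    · subst h; simp [hg, hG]
    · simp only [hg, hG, Function.update_of_ne h]
      exact hDw x (hFD ((Finset.mem_insert.1 hx).resolve_left h))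
  obtain ⟨A, hA⟩ := (insert M F).bddBelow
  have hAM : 0 ≤ M - A := sub_nonneg.2 (hA (by simp))
  have t1 := (R.tendsto_stepQ (L := L) hgρ hGg).sub_const (L.stepQ Eh (insert M F) g)
  have t2 := (R.tendsto_stepV hgρ hGg).sub_const (stepV Eh (insert M F) g)
  have t3 : Tendsto (fun k => (∑ x ∈ insert M F, ‖G k x - g x‖) * (M - A)) atTop (𝓝 0) := by
    have : Tendsto (fun k => ∑ x ∈ insert M F, ‖G k x - g x‖) atTop
        (𝓝 (∑ x ∈ insert M F, (0 : ℝ))) := tendsto_finsetSum _ fun x hx => by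
      simpa using ((hGg x hx).sub_const (g x)).norm
    simpa using this.mul_const (M - A)
  rw [sub_self] at t1 t2
  have he2 : 0 < e / 2 := half_pos he
  obtain ⟨k, b1, b2, b3⟩ := ((t1.abs.eventually_lt_const (u := e / 2) (by simpa using he2)).and
    ((t2.abs.eventually_lt_const (u := e / 2) (by simpa using he2)).and (t3.eventually_lt_const he2))).exists
  obtain ⟨s1, s2, s3, s4, s5⟩ := R.sample hC hδ hδ' (hw (ns k)).1 hM
  refine ⟨ns k, stepFun (insert M F) (G k), s1, ?_, ?_, ?_, ?_, ?_⟩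
  · have h1 := lintegral_enorm_stepFun_sub_le (g := G k) (h := g) hM (fun y hy => hA hy)
      (by simp [hG]) (by simp [hg]) (Finset.sum_nonneg fun _ _ => norm_nonneg _)
      fun x hx => Finset.single_le_sum (f := fun x => ‖G k x - g x‖) (fun _ _ => norm_nonneg _) hx
    rw [eLpNorm_one_eq_lintegral_enorm]
    calc ∫⁻ x, ‖stepFun (insert M F) (G k) x - U x‖ₑ
        ≤ ∫⁻ x, (‖stepFun (insert M F) (G k) x - stepFun (insert M F) g x‖ₑ +
            ‖stepFun (insert M F) g x - u x‖ₑ) := by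
          refine lintegral_mono_ae ?_
          filter_upwards [hUu] with x hx
          rw [hx, ← sub_add_sub_cancel _ (stepFun (insert M F) g x)]
          exact enorm_add_le _ _
      _ = (∫⁻ x, ‖stepFun (insert M F) (G k) x - stepFun (insert M F) g x‖ₑ) +
            ∫⁻ x, ‖stepFun (insert M F) g x - u x‖ₑ :=
          lintegral_add_left ((measurable_stepFun _ _).sub (measurable_stepFun _ _)).enorm _
      _ ≤ ENNReal.ofReal (e / 2) + ENNReal.ofReal (e / 2) :=
          add_le_add (h1.trans (ENNReal.ofReal_le_ofReal b3.le)) a3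
      _ = ENNReal.ofReal e := by rw [← ENNReal.ofReal_add he2.le he2.le, add_halves]
  · rw [show L.Q ε (stepFun (insert M F) (G k)) = L.stepQ Eh (insert M F) (G k) from s3]
    rw [abs_le] at a1 ⊢
    rw [abs_lt] at b1
    constructor <;> linarith [b1.1, b1.2, a1.1, a1.2]
  · rw [show L.V ε (stepFun (insert M F) (G k)) = stepV Eh (insert M F) (G k) from s2]
    rw [abs_le] at a2 ⊢
    rw [abs_lt] at b2
    constructor <;> linarith [b2.1, b2.2, a2.1, a2.2]
  · rwa [s3]
  · rwa [Upsilon, s2, s3]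

instance (m : Fin n → SignedMeasure ℝ) : IsFiniteMeasure (L.rho m) := by
  rw [rho_eq_sum]
  infer_instance

theorem QHat_eq (m : Fin n → SignedMeasure ℝ) :
    L.QHat m = ENNReal.ofReal ((L.rho m).real {p | p.1 < p.2}) := by
  rw [QHat, ofReal_measureReal]

theorem UpsilonHat_eq (hC : 0 ≤ C₀) (m : Fin n → SignedMeasure ℝ) :
    L.UpsilonHat C₀ m = ENNReal.ofReal (∑ i, (m i).totalVariation.real univ +
      C₀ * (L.rho m).real {p | p.1 < p.2}) := by
  rw [UpsilonHat, QHat_eq, ENNReal.ofReal_add (Finset.sum_nonneg fun _ _ => measureReal_nonneg)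
    (mul_nonneg hC measureReal_nonneg), ENNReal.ofReal_mul hC,
    ENNReal.ofReal_sum_of_nonneg fun _ _ => measureReal_nonneg]
  exact congrArg₂ _ (Finset.sum_congr rfl fun i _ => (ofReal_measureReal).symm) rfl

theorem RiemannEstimates.relaxation_eq (R : L.RiemannEstimates ε Eh K ρ)
    (hC : 2 * (n * K) ≤ C₀) (hδ : n * K * δ ≤ 1 / 2) (hδ' : K * δ < ρ) (hU : U ∈ L.D ε C₀ δ)
    {m : Fin n → SignedMeasure ℝ} (hm : L.IsWaveMeasures ε U m) :
    L.QBar ε C₀ δ U = L.QHat m ∧ L.UpsilonBar ε C₀ δ U = L.UpsilonHat C₀ m := by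
  have hC0 : 0 ≤ C₀ := le_trans (by have := R.K_nonneg; positivity) hC
  rw [QHat_eq, UpsilonHat_eq hC0]
  refine ⟨relaxation_eq_ofReal hU fun w hw e he => ?_, relaxation_eq_ofReal hU fun w hw e he => ?_⟩
  · obtain ⟨k, v, hv, h1, h2, -, h3, -⟩ := R.exists_recovery hC hδ hδ' hm hw he
    exact ⟨k, v, hv, h1, h2, h3⟩
  -- With precision `e / (1 + C₀)` the errors of `V` and of `C₀ Q` add up to `e`.
  · obtain ⟨k, v, hv, h1, h2, h3, -, h4⟩ := R.exists_recovery hC hδ hδ' hm hw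
      (e := e / (1 + C₀)) (by positivity)
    have he' : e / (1 + C₀) ≤ e := div_le_self he.le (by linarith)
    refine ⟨k, v, hv, h1.trans (ENNReal.ofReal_le_ofReal he'), ?_, h4⟩
    have h5 : e / (1 + C₀) + C₀ * (e / (1 + C₀)) = e := by field_simp
    rw [Upsilon, add_sub_add_comm, ← mul_sub]
    refine (abs_add_le _ _).trans ?_
    rw [abs_mul, abs_of_nonneg hC0, ← h5]
    exact add_le_add h3 (mul_le_mul_of_nonneg_left h2 hC0)

end ConservationLaw

theorem mainTheorem2 {n : ℕ} (L : ConservationLaw n) (hF : L.HypothesisF) (hr : L.IsNormalized) :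
    ∃ ε₀ > 0, ∃ Cstar > 0, ∀ ε, 0 < ε → ε < ε₀ → ∀ C₀, Cstar ≤ C₀ →
      ∃ δ₀ > 0, ∀ δ, 0 < δ → δ < δ₀ → ∀ U ∈ L.D ε C₀ δ,
        (∃ m : Fin n → SignedMeasure ℝ, L.IsWaveMeasures ε U m) ∧
        ∀ m : Fin n → SignedMeasure ℝ, L.IsWaveMeasures ε U m →
          L.QBar ε C₀ δ U = L.QHat m ∧ L.UpsilonBar ε C₀ δ U = L.UpsilonHat C₀ m := by
  obtain ⟨Eh, K, ε₀, hε₀, h⟩ := ConservationLaw.exists_riemannEstimates hF hr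
  -- The sign of `K` is part of the estimates for a given `ε`, hence the absolute value; the summand
  -- `1` makes the constant positive.
  refine ⟨ε₀, hε₀, 2 * (n * |K|) + 1, by positivity, fun ε hε hεε₀ C₀ hC => ?_⟩
  obtain ⟨ρ, R⟩ := h ε hε hεε₀
  have hK := R.K_nonneg
  have hρ := R.ρ_pos
  rw [abs_of_nonneg hK] at hC
  have hnK : 0 ≤ n * K := by positivity
  -- The first bound keeps all states in the ball of radius `ρ`, the second one lets interaction
  -- errors consume at most half of the lost potential. Adding `1` avoids vanishing denominators.
  refine ⟨min (ρ / (K + 1)) (1 / (2 * (n * K + 1))), by positivity, fun δ hδ hδ₀ U hU => ?_⟩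
  have h1 := (lt_div_iff₀ (by positivity)).1 (hδ₀.trans_le (min_le_left _ _))
  have h2 := (lt_div_iff₀ (by positivity)).1 (hδ₀.trans_le (min_le_right _ _))
  have hδ' : K * δ < ρ := by nlinarith
  have hC0 : 2 * (n * K) ≤ C₀ := by linarith
  exact ⟨R.exists_isWaveMeasures (by linarith) hδ' hU, fun m hm =>
    R.relaxation_eq hC0 (by nlinarith) hδ' hU hm⟩
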